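/- **High-frequency resolvent bound.** Let $n=m+r$ and let $d\ge 1$ be the space dimension. Consider a system of viscous conservation laws $$U_t+\sum_{j=1}^d F^j(U)_{x_j}=\sum_{j,k=1}^d\big(B^{jk}(U)U_{x_k}\big)_{x_j},\qquad U\in\mathbb R^n ,$$ and a stationary viscous shock profile $\bar U$, that is, a $C^1$ solution $\bar U:\mathbb R\to\mathbb R^n$ of $F^1(\bar U)'=(B^{11}(\bar U)\bar U')'$ with $\bar U(x_1)\to U_\pm$ as $x_1\to\pm\infty$. Write vectors and matrices in blocks of sizes $m$ and $r$. Let $\mathcal U$ be an open set containing $\bar U(\mathbb R)$, $U_-$ and $U_+$, and suppose that on $\mathcal U$ $$B^{jk}=\begin{pmatrix}0&0\\ b^{jk}_I&b^{jk}_{II}\end{pmatrix},\qquad \operatorname{Re}\,\sigma\Big(\sum_{j,k}\xi_j\xi_kb^{jk}_{II}\Big)\ge\theta_0|\xi|^2\quad(\xi\in\mathbb R^d)$$ for some $\theta_0>0$. Assume: * **(A1)** There are an invertible change of coordinates $U\mapsto W(U)$ on $\mathcal U$ and invertible lower block-triangular matrices $S(U)$ such that, with $\tilde A^0=S\,\frac{\partial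 U}{\partial W}$, $\tilde A^j=S\,dF^j\,\frac{\partial U}{\partial W}$, $\tilde B^{jk}=S\,B^{jk}\,\frac{\partial U}{\partial W}$, one has on $\mathcal U$: $\tilde A^0$ is symmetric positive definite and block-diagonal, the blocks $\tilde A^j_{11}$ are symmetric, and $\tilde B^{jk}=\text{block-diag}\{0,\tilde b^{jk}\}$ with $v\cdot\sum_{j,k}\xi_j\xi_k\tilde b^{jk}v\ge\theta_1|\xi|^2|v|^2$ for all $\xi\in\mathbb R^d$, $v\in\mathbb R^r$ and some $\theta_1>0$. (The equations then read $\tilde A^0W_t+\sum_j\tilde A^jW_{x_j}=\sum_{j,k}(\tilde B^{jk}W_{x_k})_{x_j}+(0,\tilde g)^t$, with $\tilde g$ quadratic in $\partial_xW$.) * **(A2)** At $U_-$ and at $U_+$, all $\tilde A^j$ are symmetric, and for no $\xi\in\mathbb R^d\setminus\{0\}$ does an eigenvector of $\sum_j\xi_j\,dF^j(U_\pm)$ lie in $\ker\sum_{j,k}\xi_j\xi_kB^{jk}(U_\pm)$. * **(H0)** $F^j,B^{jk},W(\cdot),\tilde A^0\in C^{q+1}(\mathcal U)$ for some integer $q\ge[d/2]+2$.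 * **(H1)** $\tilde A^1_{11}(\bar U(x_1))$ is definite, uniformly in $x_1$: for some $\theta_2>0$, either $\tilde A^1_{11}(\bar U(x_1))\ge\theta_2$ for all $x_1$, or $\tilde A^1_{11}(\bar U(x_1))\le-\theta_2$ for all $x_1$. With $x=(x_1,\tilde x)$, let $L_{\tilde\xi}$, $\tilde\xi=(\xi_2,\dots,\xi_d)\in\mathbb R^{d-1}$, be the Fourier transform in $\tilde x$ of the linearization about $\bar U$, $$L_{\tilde\xi}U=(B^{11}U')'-(A^1U)'-i\sum_{j\ne1}\xi_jA^jU+i\sum_{j\ne1}\xi_jB^{j1}U'+i\sum_{k\ne1}(\xi_kB^{1k}U)'-\sum_{j,k\ne1}\xi_j\xi_kB^{jk}U,$$ where $'=d/dx_1$, $B^{jk}=B^{jk}(\bar U(x_1))$ and $A^jv=dF^j(\bar U(x_1))v-(dB^{j1}(\bar U(x_1))v)\bar U'(x_1)$. It is considered, in the sense of distributions, as an operator on $H^1(\mathbb R;\mathbb C^n)$ with domain $\{U\in H^1: L_{\tilde\xi}U\in H^1\}$, where $H^1$ carries the norm $|f|_{\hat H^1}=\big|(1+|\partial_{x_1}|+|\tilde\xi|)f\big|_{L^2(\mathbb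 R)}$ and $|\partial_{x_1}|$ is the Fourier multiplier with symbol $|\xi_1|$. Then there are $R,C>0$ and $\theta>0$ such that, for all $\tilde\xi\in\mathbb R^{d-1}$ and $\lambda\in\mathbb C$ with $|(\tilde\xi,\lambda)|\ge R$ and $\operatorname{Re}\lambda\ge-\theta$, the operator $\lambda-L_{\tilde\xi}$ has a bounded inverse on $H^1$ and $$|(\lambda-L_{\tilde\xi})^{-1}|_{\hat H^1}\le C,$$ where $|\cdot|_{\hat H^1}$ now denotes the operator norm. No spectral stability of $\bar U$ is assumed. -/

import Mathlib

open MeasureTheory Filter Topology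
open scoped Matrix ENNReal FourierTransform ContDiff

noncomputable section

namespace ViscousShock

/-- Indices of the `n = m + r` components; the first block (of size `m = n - r`) is the
"hyperbolic" block `I`, the second block (of size `r`) is the "parabolic" block `II`. -/
abbrev Idx (m r : ℕ) := Fin m ⊕ Fin r

/-- Real state vectors in `ℝⁿ`, with `n = m + r`. -/
abbrev State (m r : ℕ) := Idx m r → ℝ

/-- Real `n × n` matrices. -/
abbrev Mat (m r : ℕ) := Matrix (Idx m r) (Idx m r) ℝ

/-- Complex state vectors, with the Euclidean norm. -/
abbrev CState (m r : ℕ) := EuclideanSpace ℂ (Idx m r)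

/-- `L²(ℝ; ℂⁿ)`. -/
abbrev L2 (m r : ℕ) := Lp (CState m r) 2 (volume : Measure ℝ)

/-- The fluxes `F^j` and viscosity matrices `B^{jk}` of a system of viscous conservation laws
`U_t + ∑_j F^j(U)_{x_j} = ∑_{j,k} (B^{jk}(U) U_{x_k})_{x_j}` in space dimension `d + 1`.
The space directions are indexed by `Fin (d + 1)`: index `0` is the direction `x_1` normal to the
front and `j.succ`, `j : Fin d`, are the `d` tangential directions. -/
structure System (d m r : ℕ) where
  F : Fin (d + 1) → State m r → State m r
  B : Fin (d + 1) → Fin (d + 1) → State m r → Mat m r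

/-- The Jacobian matrix of a map `ℝⁿ → ℝⁿ`. -/
def jac {m r : ℕ} (G : State m r → State m r) (U : State m r) : Mat m r :=
  LinearMap.toMatrix' (fderiv ℝ G U : State m r →ₗ[ℝ] State m r)

variable {d m r : ℕ}

namespace System

/-- Block structure of the viscosity on the set `𝒰`: the first block row of every `B^{jk}`
vanishes, and the spectrum of `∑ ξ_j ξ_k b^{jk}_{II}` (lower right block) has real part at least
`θ |ξ|²`. -/
structure HasViscousStructure (P : System d m r) (𝒰 : Set (State m r)) : Prop where
  upper_left : ∀ U ∈ 𝒰, ∀ j k, (P.B j k U).toBlocks₁₁ = 0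
  upper_right : ∀ U ∈ 𝒰, ∀ j k, (P.B j k U).toBlocks₁₂ = 0
  parabolic : ∃ θ : ℝ, 0 < θ ∧ ∀ U ∈ 𝒰, ∀ ξ : Fin (d + 1) → ℝ,
    ∀ μ ∈ spectrum ℂ
      ((∑ j, ∑ k, (ξ j * ξ k) • (P.B j k U).toBlocks₂₂).map (algebraMap ℝ ℂ)),
      θ * ∑ j, ξ j ^ 2 ≤ μ.re

/-- `Ubar` is a stationary viscous shock profile with end states `Um` (at `-∞`) and `Up`
(at `+∞`): a `C¹` solution of `F^1(Ubar)' = (B^{11}(Ubar) Ubar')'` with these limits. -/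
structure IsProfile (P : System d m r) (Ubar : ℝ → State m r) (Um Up : State m r) : Prop where
  smooth : ContDiff ℝ 1 Ubar
  ode : ∀ x, HasDerivAt (fun y => P.B 0 0 (Ubar y) *ᵥ deriv Ubar y)
    (deriv (fun y => P.F 0 (Ubar y)) x) x
  lim_left : Tendsto Ubar atBot (𝓝 Um)
  lim_right : Tendsto Ubar atTop (𝓝 Up)

/-! A change of coordinates `U ↦ W(U)` together with left multiplication by a matrix `S(U)` turns
the system into
`Ã⁰ W_t + ∑_j Ã^j W_{x_j} = ∑_{j,k} (B̃^{jk} W_{x_k})_{x_j} + G̃` with the coefficients `tA0`, `tA`,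
`tB` below (as functions of `U`) and `G̃ = - ∑_{j,k} (∂_{x_j} S(U)) B^{jk}(U) U_{x_k}`. -/

/-- `∂U/∂W`, the inverse of the Jacobian of `U ↦ W(U)`. -/
def dUdW (W : State m r → State m r) (U : State m r) : Mat m r := (jac W U)⁻¹

/-- `Ã⁰ = S ∂U/∂W`. -/
def tA0 (W : State m r → State m r) (S : State m r → Mat m r) (U : State m r) : Mat m r :=
  S U * dUdW W U

/-- `Ã^j = S dF^j ∂U/∂W`. -/
def tA (P : System d m r) (W : State m r → State m r) (S : State m r → Mat m r)
    (j : Fin (d + 1)) (U : State m r) : Mat m r :=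
  S U * jac (P.F j) U * dUdW W U

/-- `B̃^{jk} = S B^{jk} ∂U/∂W`. -/
def tB (P : System d m r) (W : State m r → State m r) (S : State m r → Mat m r)
    (j k : Fin (d + 1)) (U : State m r) : Mat m r :=
  S U * P.B j k U * dUdW W U

/-- Symmetric hyperbolic--parabolic form: on `𝒰`, the invertible change of coordinates `U ↦ W(U)` and left
multiplication by the invertible lower block-triangular matrix `S(U)` put the system in symmetric
hyperbolic--parabolic form. (As `S` is lower block-triangular and the first block row of `B^{jk}`
vanishes, the remainder `G̃` above has the form `(0, g̃)` with `g̃` quadratic in `∂_x W`; there is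
nothing to require about it.) -/
structure IsSymmHypParab (P : System d m r) (𝒰 : Set (State m r)) (W : State m r → State m r)
    (S : State m r → Mat m r) : Prop where
  W_injOn : Set.InjOn W 𝒰
  W_deriv_invertible : ∀ U ∈ 𝒰, IsUnit (jac W U).det
  S_invertible : ∀ U ∈ 𝒰, IsUnit (S U).det
  S_lower : ∀ U ∈ 𝒰, (S U).toBlocks₁₂ = 0
  tA0_posDef : ∀ U ∈ 𝒰, (tA0 W S U).PosDef
  tA0_blockDiag : ∀ U ∈ 𝒰, (tA0 W S U).toBlocks₁₂ = 0 ∧ (tA0 W S U).toBlocks₂₁ = 0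
  tA_symm : ∀ U ∈ 𝒰, ∀ j, (P.tA W S j U).toBlocks₁₁.IsSymm
  tB_blockDiag : ∀ U ∈ 𝒰, ∀ j k,
    P.tB W S j k U = Matrix.fromBlocks 0 0 0 (P.tB W S j k U).toBlocks₂₂
  tB_elliptic : ∃ θ : ℝ, 0 < θ ∧ ∀ U ∈ 𝒰, ∀ ξ : Fin (d + 1) → ℝ, ∀ v : Fin r → ℝ,
    θ * (∑ j, ξ j ^ 2) * (v ⬝ᵥ v) ≤
      v ⬝ᵥ ((∑ j, ∑ k, (ξ j * ξ k) • (P.tB W S j k U).toBlocks₂₂) *ᵥ v)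

/-- Constant-coefficient stability at one state `U`: the matrices `Ã^j` are symmetric, and genuine coupling
holds, that is, for `ξ ≠ 0` no eigenvector of `∑ ξ_j dF^j` lies in the kernel of
`∑ ξ_j ξ_k B^{jk}`. -/
structure IsStableEndState (P : System d m r) (W : State m r → State m r) (S : State m r → Mat m r)
    (U : State m r) : Prop where
  symm : ∀ j, (P.tA W S j U).IsSymm
  genuine_coupling : ∀ ξ : Fin (d + 1) → ℝ, ξ ≠ 0 → ∀ (μ : ℝ) (v : State m r), v ≠ 0 →
    (∑ j, ξ j • jac (P.F j) U) *ᵥ v = μ • v →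
    (∑ j, ∑ k, (ξ j * ξ k) • P.B j k U) *ᵥ v ≠ 0

/-- Regularity: the fluxes, the viscosity matrices, the coordinate change and `Ã⁰` are
`C^{q+1}` on `𝒰`, with `q ≥ [(d + 1) / 2] + 2`, where `d + 1` is the space dimension. -/
structure IsRegular (P : System d m r) (𝒰 : Set (State m r)) (W : State m r → State m r)
    (S : State m r → Mat m r) (q : ℕ) : Prop where
  q_ge : (d + 1) / 2 + 2 ≤ q
  F_smooth : ∀ j, ContDiffOn ℝ (q + 1 : ℕ) (P.F j) 𝒰
  B_smooth : ∀ j k a b, ContDiffOn ℝ (q + 1 : ℕ) (fun U => P.B j k U a b) 𝒰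
  W_smooth : ContDiffOn ℝ (q + 1 : ℕ) W 𝒰
  tA0_smooth : ∀ a b, ContDiffOn ℝ (q + 1 : ℕ) (fun U => tA0 W S U a b) 𝒰

/-- Uniform noncharacteristicity of the hyperbolic block: `Ã^1_{11}` is uniformly (positive or negative) definite along the
profile. -/
def IsUniformlyDefinite (P : System d m r) (W : State m r → State m r) (S : State m r → Mat m r)
    (Ubar : ℝ → State m r) : Prop :=
  ∃ θ : ℝ, 0 < θ ∧
    ((∀ x, ∀ v : Fin m → ℝ,
        θ * (v ⬝ᵥ v) ≤ v ⬝ᵥ ((P.tA W S 0 (Ubar x)).toBlocks₁₁ *ᵥ v)) ∨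
     (∀ x, ∀ v : Fin m → ℝ,
        v ⬝ᵥ ((P.tA W S 0 (Ubar x)).toBlocks₁₁ *ᵥ v) ≤ -(θ * (v ⬝ᵥ v))))

/-- The coefficient `B^{jk}(Ubar(x))` of the linearized equations. -/
def linB (P : System d m r) (Ubar : ℝ → State m r) (j k : Fin (d + 1)) (x : ℝ) : Mat m r :=
  P.B j k (Ubar x)

/-- The coefficient `A^j` of the linearized equations,
`A^j v = dF^j(Ubar) v - (dB^{j1}(Ubar) v) Ubar'`. -/
def linA (P : System d m r) (Ubar : ℝ → State m r) (j : Fin (d + 1)) (x : ℝ) : Mat m r :=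
  jac (P.F j) (Ubar x) -
    Matrix.of fun a c => ∑ b,
      fderiv ℝ (fun U => P.B j 0 U a b) (Ubar x) (Pi.single c 1) * deriv Ubar x b

end System

/-- Action of a real matrix on a complex vector. -/
def act (M : Mat m r) (v : CState m r) : CState m r :=
  WithLp.toLp 2 (M.map (algebraMap ℝ ℂ) *ᵥ v.ofLp)

/-- `g` is the weak (distributional) derivative of `f` on `ℝ`. -/
def HasWeakDeriv (f g : ℝ → CState m r) : Prop :=
  ∀ φ : ℝ → ℝ, ContDiff ℝ ∞ φ → HasCompactSupport φ →
    ∫ x, deriv φ x • f x = - ∫ x, φ x • g x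

/-- The norm `|(1 + |∂_{x_1}| + |ξ̃|) f|_{L²}`, where `|∂_{x_1}|` is the Fourier multiplier with
symbol `|ξ_1|`, that is `2 π |η|` in terms of the frequency `η` of Mathlib's Fourier transform.
It takes the value `∞` outside `H¹`. -/
def hatNorm (ξ : EuclideanSpace ℝ (Fin d)) (f : L2 m r) : ℝ≥0∞ :=
  eLpNorm (fun η : ℝ => (1 + 2 * Real.pi * |η| + ‖ξ‖) • (𝓕 f : L2 m r) η) 2 volume

namespace System

/-- `L_ξ̃ U = G` in the sense of distributions, where
`L_ξ̃ U = (B^{11} U')' - (A^1 U)' - i ∑_{j≠1} ξ_j A^j U + i ∑_{j≠1} ξ_j B^{j1} U'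
  + i ∑_{k≠1} (ξ_k B^{1k} U)' - ∑_{j,k≠1} ξ_j ξ_k B^{jk} U`
and `U` has a weak derivative `U'` in `L²`: the weak derivative of
`B^{11} U' - A^1 U + i ∑_{k≠1} ξ_k B^{1k} U` is `G` minus the terms that are not under `( )'`. -/
def LEq (P : System d m r) (Ubar : ℝ → State m r) (ξ : EuclideanSpace ℝ (Fin d))
    (U G : L2 m r) : Prop :=
  ∃ U' : L2 m r, HasWeakDeriv U U' ∧
    HasWeakDeriv
      (fun x => act (P.linB Ubar 0 0 x) (U' x) - act (P.linA Ubar 0 x) (U x)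
        + Complex.I • ∑ k : Fin d, ξ k • act (P.linB Ubar 0 k.succ x) (U x))
      (fun x => G x
        - (- Complex.I • ∑ j : Fin d, ξ j • act (P.linA Ubar j.succ x) (U x)
          + Complex.I • ∑ j : Fin d, ξ j • act (P.linB Ubar j.succ 0 x) (U' x)
          - ∑ j : Fin d, ∑ k : Fin d,
              (ξ j * ξ k) • act (P.linB Ubar j.succ k.succ x) (U x)))

/-- `lam` is in the resolvent set of `L_ξ̃`, as an operator on `Ĥ¹` with domain
`{U ∈ H¹ : L_ξ̃ U ∈ H¹}`, and `(lam - L_ξ̃)⁻¹` has `Ĥ¹` operator norm at most `C`: for every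
`f ∈ H¹` the equation `(lam - L_ξ̃) U = f` has exactly one solution `U ∈ H¹`, and
`|U|_{Ĥ¹} ≤ C |f|_{Ĥ¹}`. -/
def ResolventBound (P : System d m r) (Ubar : ℝ → State m r) (ξ : EuclideanSpace ℝ (Fin d))
    (lam : ℂ) (C : ℝ) : Prop :=
  ∀ f : L2 m r, hatNorm ξ f < ⊤ →
    ∃ U : L2 m r, hatNorm ξ U < ⊤ ∧ P.LEq Ubar ξ U (lam • U - f) ∧
      hatNorm ξ U ≤ ENNReal.ofReal C * hatNorm ξ f ∧
      ∀ V : L2 m r, hatNorm ξ V < ⊤ → P.LEq Ubar ξ V (lam • V - f) → V = U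

end System

end ViscousShock

end

set_option linter.unusedSectionVars false

noncomputable section

namespace ViscousShock

open scoped BoundedContinuousFunction InnerProductSpace SchwartzMap

section Multiplication

variable {E : Type*} [NormedAddCommGroup E] [InnerProductSpace ℂ E] [CompleteSpace E]

variable (E) in
/-- `L²(ℝ; E)`. -/
abbrev LL := Lp E 2 (volume : Measure ℝ)

variable (E) in
/-- Bounded continuous operator-valued coefficients. -/
abbrev Cf := ℝ →ᵇ (E →L[ℂ] E)

theorem memLp_mul (a : Cf E) (f : LL E) : MemLp (fun x => a x (f x)) 2 volume := by
  refine MemLp.of_le_mul (c := ‖a‖) (Lp.memLp f) ?_ (Eventually.of_forall fun x => ?_)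
  · exact (ContinuousLinearMap.id ℂ (E →L[ℂ] E)).aestronglyMeasurable_comp₂
      a.continuous.aestronglyMeasurable (Lp.aestronglyMeasurable f)
  · exact ((a x).le_opNorm _).trans (by gcongr; exact a.norm_coe_le_norm x)

/-- Multiplication by a bounded continuous coefficient. -/
def mulOp (a : Cf E) : LL E →L[ℂ] LL E :=
  LinearMap.mkContinuous
    { toFun := fun f => (memLp_mul a f).toLp _
      map_add' := fun f g => by
        rw [← MemLp.toLp_add]
        apply MemLp.toLp_congr
        filter_upwards [Lp.coeFn_add f g] with x hx
        change a x ((f + g : LL E) x) = a x (f x) + a x (g x)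
        rw [hx, Pi.add_apply, map_add]
      map_smul' := fun c f => by
        rw [RingHom.id_apply, ← MemLp.toLp_const_smul]
        apply MemLp.toLp_congr
        filter_upwards [Lp.coeFn_smul c f] with x hx
        change a x ((c • f : LL E) x) = c • a x (f x)
        rw [hx, Pi.smul_apply, map_smul] } ‖a‖ (fun f => by
      refine Lp.norm_le_mul_norm_of_ae_le_mul ?_
      filter_upwards [(memLp_mul a f).coeFn_toLp] with x hx
      simp only [LinearMap.coe_mk, AddHom.coe_mk, hx]
      exact ((a x).le_opNorm _).trans (by gcongr; exact a.norm_coe_le_norm x))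

theorem coeFn_mulOp (a : Cf E) (f : LL E) : mulOp a f =ᵐ[volume] fun x => a x (f x) :=
  (memLp_mul a f).coeFn_toLp

theorem norm_mulOp_le (a : Cf E) (f : LL E) : ‖mulOp a f‖ ≤ ‖a‖ * ‖f‖ :=
  (ContinuousLinearMap.le_opNorm _ f).trans
    (by gcongr; exact LinearMap.mkContinuous_norm_le _ (norm_nonneg a) _)

theorem mulOp_add (a b : Cf E) : mulOp (a + b) = mulOp a + mulOp b := by
  ext1 f
  apply Lp.ext
  filter_upwards [coeFn_mulOp (a + b) f, coeFn_mulOp a f, coeFn_mulOp b f,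
    Lp.coeFn_add (mulOp a f) (mulOp b f)] with x h1 h2 h3 h4
  rw [add_apply, h4, Pi.add_apply, h1, h2, h3]
  simp

theorem mulOp_mul (a b : Cf E) : mulOp (a * b) = mulOp a * mulOp b := by
  ext1 f
  apply Lp.ext
  filter_upwards [coeFn_mulOp (a * b) f, coeFn_mulOp a (mulOp b f), coeFn_mulOp b f] with x h1 h2 h3
  rw [mul_apply_eq_comp, h1, h2, h3]
  simp

theorem mulOp_smul (c : ℂ) (a : Cf E) : mulOp (c • a) = c • mulOp a := by
  ext1 f
  apply Lp.ext
  filter_upwards [coeFn_mulOp (c • a) f, coeFn_mulOp a f, Lp.coeFn_smul c (mulOp a f)]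
    with x h1 h2 h3
  rw [smul_apply, h3, Pi.smul_apply, h1, h2]
  simp

theorem mulOp_one : mulOp (1 : Cf E) = 1 := by
  ext1 f
  apply Lp.ext
  filter_upwards [coeFn_mulOp (1 : Cf E) f] with x h1
  rw [h1]
  simp

/-- Multiplication operators form a representation of the algebra of coefficients. -/
def mulHom : Cf E →ₐ[ℂ] (LL E →L[ℂ] LL E) :=
  AlgHom.ofLinearMap
    { toFun := mulOp, map_add' := mulOp_add, map_smul' := mulOp_smul } mulOp_one mulOp_mul

theorem mulOp_sub (a b : Cf E) : mulOp (a - b) = mulOp a - mulOp b := map_sub mulHom a b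

theorem mulOp_neg (a : Cf E) : mulOp (-a) = -mulOp a := map_neg mulHom a

theorem mulOp_sum {ι : Type*} (s : Finset ι) (a : ι → Cf E) :
    mulOp (∑ i ∈ s, a i) = ∑ i ∈ s, mulOp (a i) := map_sum mulHom a s

theorem inner_mulOp (a : Cf E) (f g : LL E) :
    ⟪f, mulOp a g⟫_ℂ = ∫ x, ⟪f x, a x (g x)⟫_ℂ := by
  rw [L2.inner_def]
  apply integral_congr_ae
  filter_upwards [coeFn_mulOp a g] with x hx
  rw [hx]

theorem mulOp_star (a : Cf E) (f g : LL E) : ⟪mulOp (star a) f, g⟫_ℂ = ⟪f, mulOp a g⟫_ℂ := by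
  rw [inner_mulOp, L2.inner_def]
  apply integral_congr_ae
  filter_upwards [coeFn_mulOp (star a) f] with x hx
  rw [hx]
  simp [ContinuousLinearMap.star_eq_adjoint, ContinuousLinearMap.adjoint_inner_left]

theorem norm_sq_eq_integral (f : LL E) : ‖f‖ ^ 2 = ∫ x, ‖f x‖ ^ 2 := by
  have h := L2.inner_def (𝕜 := ℂ) f f
  rw [inner_self_eq_norm_sq_to_K] at h
  simp_rw [inner_self_eq_norm_sq_to_K] at h
  have h2 : ((‖f‖ ^ 2 : ℝ) : ℂ) = ((∫ x, ‖f x‖ ^ 2 : ℝ) : ℂ) := by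
    rw [← integral_complex_ofReal]
    push_cast
    exact h
  exact_mod_cast h2

theorem integrable_norm_sq (f : LL E) : Integrable (fun x => ‖f x‖ ^ 2) :=
  (memLp_two_iff_integrable_sq_norm (Lp.aestronglyMeasurable f)).1 (Lp.memLp f)

/-- A pointwise smallness bound gives the same bound in `L²`. -/
theorem norm_mulOp_le_of_pointwise {a b : Cf E} {ε C : ℝ} (hε : 0 ≤ ε) (hC : 0 ≤ C)
    (h : ∀ x v, ‖a x v‖ ≤ ε * ‖v‖ + C * ‖b x v‖) (f : LL E) :
    ‖mulOp a f‖ ≤ ε * ‖f‖ + C * ‖mulOp b f‖ := by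
  have hm : MemLp (fun x => ε * ‖f x‖ + C * ‖mulOp b f x‖) 2 volume :=
    ((Lp.memLp f).norm.const_mul ε).add ((Lp.memLp (mulOp b f)).norm.const_mul C)
  have h1 : ‖mulOp a f‖ ≤ ‖hm.toLp _‖ := by
    apply Lp.norm_le_norm_of_ae_le
    filter_upwards [hm.coeFn_toLp, coeFn_mulOp a f, coeFn_mulOp b f] with x h1 h2 h3
    rw [h1, h2, h3, Real.norm_of_nonneg (by positivity)]
    exact h x _
  refine h1.trans ?_
  have h2 : hm.toLp _ = ε • ((Lp.memLp f).norm).toLp _ + C • ((Lp.memLp (mulOp b f)).norm).toLp _ := by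
    rw [← MemLp.toLp_const_smul, ← MemLp.toLp_const_smul, ← MemLp.toLp_add]
    rfl
  rw [h2]
  refine (norm_add_le _ _).trans ?_
  rw [norm_smul, norm_smul, Real.norm_of_nonneg hε, Real.norm_of_nonneg hC, Lp.norm_toLp,
    Lp.norm_toLp, eLpNorm_norm, eLpNorm_norm, ← Lp.norm_def, ← Lp.norm_def]

/-- A pointwise lower bound for quadratic forms gives the same bound in `L²`. -/
theorem re_inner_mulOp_ge {a b c : Cf E} {f : LL E} {p q : ℝ}
    (h : ∀ᵐ x, p * ‖b x (f x)‖ ^ 2 - q * ‖c x (f x)‖ ^ 2 ≤ (⟪f x, a x (f x)⟫_ℂ).re) :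
    p * ‖mulOp b f‖ ^ 2 - q * ‖mulOp c f‖ ^ 2 ≤ (⟪f, mulOp a f⟫_ℂ).re := by
  rw [norm_sq_eq_integral, norm_sq_eq_integral, ← integral_const_mul, ← integral_const_mul,
    ← integral_sub ((integrable_norm_sq _).const_mul _) ((integrable_norm_sq _).const_mul _),
    L2.inner_def]
  have hi := L2.integrable_inner (𝕜 := ℂ) f (mulOp a f)
  have := integral_re (𝕜 := ℂ) hi
  change _ ≤ RCLike.re (K := ℂ) _
  rw [← this]
  apply integral_mono_ae (((integrable_norm_sq _).const_mul _).sub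
    ((integrable_norm_sq _).const_mul _)) hi.re
  filter_upwards [h, coeFn_mulOp a f, coeFn_mulOp b f, coeFn_mulOp c f] with x h1 h2 h3 h4
  rw [h2, Pi.sub_apply]
  rw [h3, h4]
  exact h1

end Multiplication

section WeakDerivative

variable {E : Type*} [NormedAddCommGroup E] [InnerProductSpace ℂ E] [CompleteSpace E]

/-- `g` is the weak derivative of `f`. -/
def HD (f g : LL E) : Prop :=
  ∀ φ : ℝ → ℝ, ContDiff ℝ ∞ φ → HasCompactSupport φ →
    ∫ x, ((deriv φ x : ℝ) : ℂ) • f x = - ∫ x, ((φ x : ℝ) : ℂ) • g x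

theorem integrable_smul_LL {φ : ℝ → ℂ} (hφ : MemLp φ 2 volume) (f : LL E) :
    Integrable (fun x => φ x • f x) := by
  have := (Lp.memLp f).smul (r := 1) hφ
  exact memLp_one_iff_integrable.1 this

theorem memLp_schwartz (ψ : 𝓢(ℝ, ℂ)) : MemLp ψ 2 volume := ψ.memLp 2 volume

theorem memLp_deriv_schwartz (ψ : 𝓢(ℝ, ℂ)) : MemLp (deriv ψ) 2 volume :=
  (SchwartzMap.derivCLM ℂ ℂ ψ).memLp 2 volume

theorem HD.complex_test {f g : LL E} (h : HD f g) {φ : ℝ → ℂ} (hφ : ContDiff ℝ ∞ φ)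
    (hc : HasCompactSupport φ) : ∫ x, deriv φ x • f x = - ∫ x, φ x • g x := by
  have hre : ContDiff ℝ ∞ (fun x => (φ x).re) := Complex.reCLM.contDiff.comp hφ
  have him : ContDiff ℝ ∞ (fun x => (φ x).im) := Complex.imCLM.contDiff.comp hφ
  have cre : HasCompactSupport (fun x => (φ x).re) := hc.comp_left (g := Complex.re) rfl
  have cim : HasCompactSupport (fun x => (φ x).im) := hc.comp_left (g := Complex.im) rfl
  have hd : ∀ x, HasDerivAt φ (deriv φ x) x := fun x =>
    ((hφ.differentiable (by simp)) x).hasDerivAt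
  have dre : ∀ x, deriv (fun x => (φ x).re) x = (deriv φ x).re := fun x =>
    (Complex.reCLM.hasFDerivAt.comp_hasDerivAt x (hd x)).deriv
  have dim : ∀ x, deriv (fun x => (φ x).im) x = (deriv φ x).im := fun x =>
    (Complex.imCLM.hasFDerivAt.comp_hasDerivAt x (hd x)).deriv
  have h1 := h _ hre cre
  have h2 := h _ him cim
  have key : ∀ (u : ℝ → ℂ) (hu : MemLp u 2 volume) (F : LL E), ∫ x, u x • F x =
      (∫ x, (((u x).re : ℝ) : ℂ) • F x) + Complex.I • ∫ x, (((u x).im : ℝ) : ℂ) • F x := by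
    intro u hu F
    have e1 : Integrable (fun x => (((u x).re : ℝ) : ℂ) • F x) :=
      integrable_smul_LL (hu.re.ofReal) F
    have e2 : Integrable (fun x => (((u x).im : ℝ) : ℂ) • F x) :=
      integrable_smul_LL (hu.im.ofReal) F
    rw [← integral_smul]
    have := integral_add e1 (e2.smul Complex.I)
    simp only [Pi.smul_apply] at this
    rw [← this]
    congr 1
    ext x
    rw [smul_smul, ← add_smul]
    congr 1
    rw [mul_comm]
    exact (Complex.re_add_im _).symm
  have m1 : MemLp φ 2 volume := hφ.continuous.memLp_of_hasCompactSupport hc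
  have m2 : MemLp (deriv φ) 2 volume :=
    (hφ.continuous_deriv (by simp)).memLp_of_hasCompactSupport hc.deriv
  rw [key _ m1, key _ m2, neg_add, ← smul_neg, ← h1, ← h2]
  simp only [dre, dim]

theorem HD.schwartz_test {f g : LL E} (h : HD f g) (ψ : 𝓢(ℝ, ℂ)) :
    ∫ x, deriv ψ x • f x = - ∫ x, ψ x • g x := by
  let χ : ContDiffBump (0 : ℝ) := ⟨1, 2, by norm_num, by norm_num⟩
  have hχs : ContDiff ℝ ∞ (χ : ℝ → ℝ) := χ.contDiff
  obtain ⟨B, hB⟩ : ∃ B, ∀ x, ‖deriv (χ : ℝ → ℝ) x‖ ≤ B :=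
    χ.hasCompactSupport.deriv.exists_bound_of_continuous (hχs.continuous_deriv (by simp))
  have hB0 : 0 ≤ B := (norm_nonneg _).trans (hB 0)
  let c : ℕ → ℝ := fun n => ((n : ℝ) + 1)⁻¹
  have hc0 : ∀ n, 0 < c n := fun n => by positivity
  have hc1 : ∀ n, c n ≤ 1 := fun n => inv_le_one_of_one_le₀ (by
    have : (0 : ℝ) ≤ n := n.cast_nonneg
    linarith)
  have hct : Tendsto c atTop (𝓝 0) := by
    have := tendsto_one_div_add_atTop_nhds_zero_nat (𝕜 := ℝ)
    simpa [c, one_div] using this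
  let χn : ℕ → ℝ → ℝ := fun n x => χ (c n * x)
  have hdχ : ∀ n x, HasDerivAt (χn n) (deriv (χ : ℝ → ℝ) (c n * x) * c n) x := fun n x => by
    have h1 : HasDerivAt (fun x : ℝ => c n * x) (c n) x := by
      simpa using (hasDerivAt_id x).const_mul (c n)
    exact ((hχs.differentiable (by simp) _).hasDerivAt).comp x h1
  have hd : ∀ n x, HasDerivAt (fun x => ((χn n x : ℝ) : ℂ) * ψ x)
      (((deriv (χ : ℝ → ℝ) (c n * x) * c n : ℝ) : ℂ) * ψ x + ((χn n x : ℝ) : ℂ) * deriv ψ x) x :=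
    fun n x => (hdχ n x).ofReal_comp.mul (ψ.hasDerivAt x)
  have htest : ∀ n, ∫ x, (((deriv (χ : ℝ → ℝ) (c n * x) * c n : ℝ) : ℂ) * ψ x +
      ((χn n x : ℝ) : ℂ) * deriv ψ x) • f x = - ∫ x, (((χn n x : ℝ) : ℂ) * ψ x) • g x := by
    intro n
    have hs : ContDiff ℝ ∞ (fun x => ((χn n x : ℝ) : ℂ) * ψ x) := by
      refine ContDiff.mul ?_ (ψ.smooth ⊤)
      exact Complex.ofRealCLM.contDiff.comp (hχs.comp (contDiff_const.mul contDiff_id))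
    have hcs : HasCompactSupport (fun x => ((χn n x : ℝ) : ℂ) * ψ x) := by
      have h1 : HasCompactSupport (χn n) :=
        χ.hasCompactSupport.comp_homeomorph (Homeomorph.mulLeft₀ (c n) (hc0 n).ne')
      have h2 : HasCompactSupport (fun x => ((χn n x : ℝ) : ℂ)) :=
        h1.comp_left (g := fun r : ℝ => (r : ℂ)) (by simp)
      exact h2.mul_right
    rw [← h.complex_test hs hcs]
    congr 1
    ext x
    rw [(hd n x).deriv]
  have hχl : ∀ x, Tendsto (fun n => χn n x) atTop (𝓝 1) := by
    intro x
    have : Tendsto (fun n => c n * x) atTop (𝓝 0) := by simpa using hct.mul_const x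
    have h2 := (hχs.continuous.tendsto 0).comp this
    have h3 : (χ : ℝ → ℝ) 0 = 1 := χ.one_of_mem_closedBall (by simp [χ])
    rw [h3] at h2
    exact h2
  have hχb : ∀ n x, ‖((χn n x : ℝ) : ℂ)‖ ≤ 1 := fun n x => by
    rw [Complex.norm_real, Real.norm_of_nonneg χ.nonneg]
    exact χ.le_one
  have meas : ∀ (u : ℝ → ℂ), Continuous u → ∀ F : LL E,
      AEStronglyMeasurable (fun x => u x • F x) volume := fun u hu F =>
    hu.aestronglyMeasurable.smul (Lp.aestronglyMeasurable F)
  have hcont : ∀ n, Continuous (χn n) := fun n =>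
    hχs.continuous.comp (continuous_const.mul continuous_id)
  have hψ' : Continuous (deriv ψ) := (SchwartzMap.derivCLM ℂ ℂ ψ).continuous
  have R : Tendsto (fun n => ∫ x, (((χn n x : ℝ) : ℂ) * ψ x) • g x) atTop
      (𝓝 (∫ x, ψ x • g x)) := by
    refine tendsto_integral_of_dominated_convergence (fun x => ‖ψ x • g x‖) (fun n => ?_)
      (integrable_smul_LL (memLp_schwartz ψ) g).norm (fun n => ?_) ?_
    · exact meas _ ((Complex.continuous_ofReal.comp (hcont n)).mul ψ.continuous) g
    · refine Eventually.of_forall fun x => ?_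
      rw [mul_smul, norm_smul]
      exact mul_le_of_le_one_left (norm_nonneg _) (hχb n x)
    · refine Eventually.of_forall fun x => ?_
      have : Tendsto (fun n => ((χn n x : ℝ) : ℂ)) atTop (𝓝 1) := by
        have := (Complex.continuous_ofReal.tendsto 1).comp (hχl x)
        rw [Complex.ofReal_one] at this
        exact this
      simpa using (this.mul_const (ψ x)).smul_const (g x)
  have Lm : Tendsto (fun n => ∫ x, (((deriv (χ : ℝ → ℝ) (c n * x) * c n : ℝ) : ℂ) * ψ x +
      ((χn n x : ℝ) : ℂ) * deriv ψ x) • f x) atTop (𝓝 (∫ x, deriv ψ x • f x)) := by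
    refine tendsto_integral_of_dominated_convergence
      (fun x => B * ‖ψ x • f x‖ + ‖deriv ψ x • f x‖) (fun n => ?_)
      (((integrable_smul_LL (memLp_schwartz ψ) f).norm.const_mul B).add
        (integrable_smul_LL (memLp_deriv_schwartz ψ) f).norm) (fun n => ?_) ?_
    · refine meas _ ?_ f
      refine Continuous.add (Continuous.mul ?_ ψ.continuous)
        ((Complex.continuous_ofReal.comp (hcont n)).mul hψ')
      refine Complex.continuous_ofReal.comp (Continuous.mul ?_ continuous_const)
      exact (hχs.continuous_deriv (by simp)).comp (continuous_const.mul continuous_id)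
    · refine Eventually.of_forall fun x => ?_
      rw [add_smul, mul_smul, mul_smul]
      refine (norm_add_le _ _).trans (add_le_add ?_ ?_)
      · rw [norm_smul, Complex.norm_real, norm_mul, Real.norm_of_nonneg (hc0 n).le]
        have : ‖deriv (χ : ℝ → ℝ) (c n * x)‖ * c n ≤ B * 1 :=
          mul_le_mul (hB _) (hc1 n) (hc0 n).le hB0
        rw [mul_one] at this
        exact mul_le_mul_of_nonneg_right this (norm_nonneg _)
      · rw [norm_smul]
        exact mul_le_of_le_one_left (norm_nonneg _) (hχb n x)
    · refine Eventually.of_forall fun x => ?_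
      have t1 : Tendsto (fun n => ((χn n x : ℝ) : ℂ)) atTop (𝓝 1) := by
        have := (Complex.continuous_ofReal.tendsto 1).comp (hχl x)
        rw [Complex.ofReal_one] at this
        exact this
      have t0 : Tendsto (fun n => deriv (χ : ℝ → ℝ) (c n * x) * c n) atTop (𝓝 0) := by
        refine squeeze_zero_norm (a := fun n => B * c n) (fun n => ?_) (by simpa using hct.const_mul B)
        rw [norm_mul, Real.norm_of_nonneg (hc0 n).le]
        exact mul_le_mul_of_nonneg_right (hB _) (hc0 n).le
      have t2 : Tendsto (fun n => ((deriv (χ : ℝ → ℝ) (c n * x) * c n : ℝ) : ℂ)) atTop (𝓝 0) := by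
        have := (Complex.continuous_ofReal.tendsto 0).comp t0
        rw [Complex.ofReal_zero] at this
        exact this
      simpa using ((t2.mul_const (ψ x)).add (t1.mul_const (deriv ψ x))).smul_const (f x)
  simp only [htest] at Lm
  exact tendsto_nhds_unique Lm R.neg

theorem hD_of_schwartz_test {f g : LL E}
    (h : ∀ ψ : 𝓢(ℝ, ℂ), ∫ x, deriv ψ x • f x = - ∫ x, ψ x • g x) : HD f g := by
  intro φ hφ hc
  have h1 : HasCompactSupport (fun x => ((φ x : ℝ) : ℂ)) :=
    hc.comp_left (g := fun r : ℝ => (r : ℂ)) (by simp)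
  have h2 : ContDiff ℝ ∞ (fun x => ((φ x : ℝ) : ℂ)) := Complex.ofRealCLM.contDiff.comp hφ
  have := h (h1.toSchwartzMap h2)
  refine Eq.trans (integral_congr_ae (Eventually.of_forall fun x => ?_)) this
  dsimp only
  congr 1
  exact ((hφ.differentiable (by simp) x).hasDerivAt.ofReal_comp).deriv.symm

theorem integral_fourier_smul_LL (ρ : 𝓢(ℝ, ℂ)) (f : LL E) :
    ∫ x, (𝓕 ρ : 𝓢(ℝ, ℂ)) x • f x = ∫ x, ρ x • (𝓕 f : LL E) x := by
  have h := congrArg (fun T => T ρ) (Lp.fourier_toTemperedDistribution_eq f)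
  simpa using h

theorem deriv_fourier_schwartz (ρ : 𝓢(ℝ, ℂ)) :
    ∃ ρ' : 𝓢(ℝ, ℂ), (∀ x, ρ' x = -(2 * Real.pi * x * Complex.I) * ρ x) ∧
      ∀ x, deriv (𝓕 ρ : 𝓢(ℝ, ℂ)) x = (𝓕 ρ' : 𝓢(ℝ, ℂ)) x := by
  have ht : (fun y : ℝ => inner ℝ y (1 : ℝ)).HasTemperateGrowth := by fun_prop
  refine ⟨-(2 * Real.pi * Complex.I) • SchwartzMap.smulLeftCLM ℂ (inner ℝ · (1 : ℝ)) ρ, ?_, ?_⟩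
  · intro x
    change (-(2 * Real.pi * Complex.I)) • (SchwartzMap.smulLeftCLM ℂ (inner ℝ · (1 : ℝ)) ρ x) = _
    rw [SchwartzMap.smulLeftCLM_apply_apply ht]
    simp
    ring
  · intro x
    rw [← SchwartzMap.lineDerivOp_fourier_eq ρ (1 : ℝ)]
    rw [SchwartzMap.lineDerivOp_apply_eq_fderiv]
    simp

theorem hD_iff_fourier {f g : LL E} : HD f g ↔
    ∀ᵐ η : ℝ, (𝓕 g : LL E) η = (2 * Real.pi * η * Complex.I : ℂ) • (𝓕 f : LL E) η := by
  have key : ∀ ρ : 𝓢(ℝ, ℂ), ((∫ x, deriv (𝓕 ρ : 𝓢(ℝ, ℂ)) x • f x) = -∫ x, ρ x • ((2 * Real.pi * x * Complex.I : ℂ) • (𝓕 f : LL E) x)) ∧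
      Integrable (fun x => ρ x • ((2 * Real.pi * x * Complex.I : ℂ) • (𝓕 f : LL E) x)) := by
    intro ρ
    obtain ⟨ρ', h1, h2⟩ := deriv_fourier_schwartz ρ
    have e : ∀ x, ρ' x • (𝓕 f : LL E) x =
        -(ρ x • ((2 * Real.pi * x * Complex.I : ℂ) • (𝓕 f : LL E) x)) := by
      intro x
      rw [h1, smul_smul, ← neg_smul]
      ring_nf
    constructor
    · simp_rw [h2]
      rw [integral_fourier_smul_LL, ← integral_neg]
      simp_rw [e]
    · have := (integrable_smul_LL (memLp_schwartz ρ') (𝓕 f)).neg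
      refine this.congr (Eventually.of_forall fun x => ?_)
      simp [e]
  constructor
  · intro h
    have hloc : LocallyIntegrable
        (fun x : ℝ => (2 * Real.pi * x * Complex.I : ℂ) • (𝓕 f : LL E) x) := by
      refine LocallyIntegrable.continuous_smul ?_ ?_
      · fun_prop
      · exact (Lp.memLp (𝓕 f : LL E)).locallyIntegrable (by norm_num)
    refine ae_eq_of_integral_contDiff_smul_eq
      ((Lp.memLp (𝓕 g : LL E)).locallyIntegrable (by norm_num)) hloc ?_
    intro φ hφ hc
    have h1 : HasCompactSupport (fun x => ((φ x : ℝ) : ℂ)) :=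
      hc.comp_left (g := fun r : ℝ => (r : ℂ)) (by simp)
    have h2 : ContDiff ℝ ∞ (fun x => ((φ x : ℝ) : ℂ)) := Complex.ofRealCLM.contDiff.comp hφ
    have h3 := h.schwartz_test (𝓕 (h1.toSchwartzMap h2))
    rw [(key _).1, integral_fourier_smul_LL, neg_inj] at h3
    exact h3.symm
  · intro h
    apply hD_of_schwartz_test
    intro ψ
    obtain ⟨ρ, rfl⟩ : ∃ ρ : 𝓢(ℝ, ℂ), 𝓕 ρ = ψ := ⟨𝓕⁻ ψ, by simp⟩
    rw [(key ρ).1, integral_fourier_smul_LL, neg_inj]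
    apply integral_congr_ae
    filter_upwards [h] with x hx
    rw [hx]

end WeakDerivative

section WeakDerivativeCalculus

variable {E : Type*} [NormedAddCommGroup E] [InnerProductSpace ℂ E] [CompleteSpace E]

/-- The coefficient given by a bounded continuous scalar function. -/
def scal (m : ℝ → ℂ) (hm : Continuous m) (C : ℝ) (hC : ∀ x, ‖m x‖ ≤ C) : Cf E :=
  BoundedContinuousFunction.ofNormedAddCommGroup (fun x => m x • (1 : E →L[ℂ] E))
    (hm.smul continuous_const) C (fun x => by
      rw [norm_smul]
      calc ‖m x‖ * ‖(1 : E →L[ℂ] E)‖ ≤ ‖m x‖ * 1 := by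
            gcongr
            exact ContinuousLinearMap.norm_id_le
        _ ≤ C := by rw [mul_one]; exact hC x)

theorem scal_apply (m : ℝ → ℂ) (hm : Continuous m) (C : ℝ) (hC : ∀ x, ‖m x‖ ≤ C) (x : ℝ) (v : E) :
    scal m hm C hC x v = m x • v := rfl

/-- The constant coefficient. -/
def cst (T : E →L[ℂ] E) : Cf E := BoundedContinuousFunction.const ℝ T

theorem cst_apply (T : E →L[ℂ] E) (x : ℝ) (v : E) : cst T x v = T v := rfl

/-- The weak derivative relation as a linear relation. -/
def hDGraph : Submodule ℂ (LL E × LL E) where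
  carrier := {p | HD p.1 p.2}
  add_mem' := by
    rintro ⟨f, f'⟩ ⟨g, g'⟩ hf hg
    simp only [Set.mem_ofPred_eq, Prod.mk_add_mk, hD_iff_fourier,
      FourierTransform.fourier_add] at *
    filter_upwards [hf, hg, Lp.coeFn_add (𝓕 f : LL E) (𝓕 g), Lp.coeFn_add (𝓕 f' : LL E) (𝓕 g')]
      with x h1 h2 h3 h4
    rw [h3, h4, Pi.add_apply, Pi.add_apply, h1, h2, smul_add]
  zero_mem' := by
    intro φ _ _
    have h0 : ∀ᵐ x : ℝ, (0 : LL E) x = 0 := Lp.coeFn_zero _ _ _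
    have e : ∀ u : ℝ → ℂ, ∫ x, u x • (0 : LL E) x = 0 := fun u => by
      rw [integral_congr_ae (g := fun _ => (0 : E)), integral_zero]
      filter_upwards [h0] with x hx
      rw [hx, smul_zero]
    exact (e _).trans (neg_eq_zero.2 (e _)).symm
  smul_mem' := by
    rintro c ⟨f, f'⟩ hf
    simp only [Set.mem_ofPred_eq, Prod.smul_mk, hD_iff_fourier, FourierTransform.fourier_smul] at *
    filter_upwards [hf, Lp.coeFn_smul c (𝓕 f : LL E), Lp.coeFn_smul c (𝓕 f' : LL E)] with x h1 h2 h3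
    rw [h2, h3, Pi.smul_apply, Pi.smul_apply, h1, smul_comm]

theorem mem_hDGraph {f g : LL E} : (f, g) ∈ hDGraph ↔ HD f g := Iff.rfl

theorem HD.add {f f' g g' : LL E} (hf : HD f f') (hg : HD g g') : HD (f + g) (f' + g') :=
  hDGraph.add_mem (mem_hDGraph.2 hf) (mem_hDGraph.2 hg)

theorem HD.sub {f f' g g' : LL E} (hf : HD f f') (hg : HD g g') : HD (f - g) (f' - g') :=
  hDGraph.sub_mem (mem_hDGraph.2 hf) (mem_hDGraph.2 hg)

theorem HD.smul {f f' : LL E} (c : ℂ) (hf : HD f f') : HD (c • f) (c • f') :=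
  hDGraph.smul_mem c (mem_hDGraph.2 hf)

theorem HD.unique {f g g' : LL E} (h : HD f g) (h' : HD f g') : g = g' := by
  rw [hD_iff_fourier] at h h'
  have : (𝓕 g : LL E) = 𝓕 g' := by
    apply Lp.ext
    filter_upwards [h, h'] with x h1 h2
    rw [h1, h2]
  simpa using congrArg (fun u : LL E => (𝓕⁻ u : LL E)) this

theorem HD.skew {f f' g g' : LL E} (hf : HD f f') (hg : HD g g') :
    ⟪f', g⟫_ℂ = -⟪f, g'⟫_ℂ := by
  rw [hD_iff_fourier] at hf hg
  rw [← Lp.inner_fourier_eq, ← Lp.inner_fourier_eq f, L2.inner_def, L2.inner_def, ← integral_neg]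
  apply integral_congr_ae
  filter_upwards [hf, hg] with x h1 h2
  rw [h1, h2, inner_smul_left, inner_smul_right, ← neg_mul]
  congr 1
  simp only [map_mul, Complex.conj_ofReal, Complex.conj_I, map_ofNat]
  ring

theorem LL.integral_smul_eq {φ : ℝ → ℂ} (hφ : MemLp φ 2 volume) :
    ∃ T : LL E →L[ℂ] E, ∀ f, T f = ∫ x, φ x • f x := by
  refine ⟨(ContinuousLinearMap.lsmul ℂ ℂ).lpPairing volume 2 2 (hφ.toLp φ), fun f => ?_⟩
  rw [ContinuousLinearMap.lpPairing_eq_integral]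
  apply integral_congr_ae
  filter_upwards [hφ.coeFn_toLp] with x hx
  simp [hx]

theorem isClosed_HD : IsClosed {p : LL E × LL E | HD p.1 p.2} := by
  have : {p : LL E × LL E | HD p.1 p.2} = ⋂ ψ : 𝓢(ℝ, ℂ),
      {p | ∫ x, deriv ψ x • p.1 x = - ∫ x, ψ x • p.2 x} := by
    ext p
    simp only [Set.mem_iInter, Set.mem_ofPred_eq]
    exact ⟨fun h => h.schwartz_test, hD_of_schwartz_test⟩
  rw [this]
  refine isClosed_iInter fun ψ => ?_
  obtain ⟨T1, h1⟩ := LL.integral_smul_eq (E := E) (memLp_deriv_schwartz ψ)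
  obtain ⟨T2, h2⟩ := LL.integral_smul_eq (E := E) (memLp_schwartz ψ)
  simp only [← h1, ← h2]
  exact isClosed_eq (T1.continuous.comp continuous_fst) (T2.continuous.comp continuous_snd).neg

theorem fourier_cst (T : E →L[ℂ] E) (f : LL E) :
    (𝓕 (mulOp (cst T) f) : LL E) = mulOp (cst T) (𝓕 f : LL E) := by
  apply Lp.ext
  refine ae_eq_of_integral_contDiff_smul_eq ((Lp.memLp _).locallyIntegrable (by norm_num))
    ((Lp.memLp _).locallyIntegrable (by norm_num)) ?_
  intro φ hφ hc
  have h1 : HasCompactSupport (fun x => ((φ x : ℝ) : ℂ)) :=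
    hc.comp_left (g := fun r : ℝ => (r : ℂ)) (by simp)
  have h2 : ContDiff ℝ ∞ (fun x => ((φ x : ℝ) : ℂ)) := Complex.ofRealCLM.contDiff.comp hφ
  have key : ∀ (ρ : 𝓢(ℝ, ℂ)) (F : LL E), ∫ x, ρ x • mulOp (cst T) F x = T (∫ x, ρ x • F x) := by
    intro ρ F
    rw [← ContinuousLinearMap.integral_comp_comm _ (integrable_smul_LL (memLp_schwartz ρ) F)]
    apply integral_congr_ae
    filter_upwards [coeFn_mulOp (cst T) F] with x hx
    rw [hx, cst_apply, map_smul]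
  have h3 := integral_fourier_smul_LL (h1.toSchwartzMap h2) (mulOp (cst T) f)
  rw [key, integral_fourier_smul_LL, ← key] at h3
  exact h3.symm

theorem HD.cst {f f' : LL E} (h : HD f f') (T : E →L[ℂ] E) :
    HD (mulOp (cst T) f) (mulOp (cst T) f') := by
  rw [hD_iff_fourier] at *
  rw [fourier_cst, fourier_cst]
  filter_upwards [h, coeFn_mulOp (ViscousShock.cst T) (𝓕 f : LL E),
    coeFn_mulOp (ViscousShock.cst T) (𝓕 f' : LL E)] with x h1 h2 h3
  rw [h3, h2, h1, cst_apply, cst_apply, map_smul]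

/-- `a'` is the derivative of the coefficient `a`. -/
def CfDeriv (a a' : Cf E) : Prop := ∀ x, HasDerivAt (fun y => a y) (a' x) x

theorem CfDeriv.hasDerivAt_apply {a a' : Cf E} (h : CfDeriv a a') {v : ℝ → E} {v' : E} {x : ℝ}
    (hv : HasDerivAt v v' x) : HasDerivAt (fun y => a y (v y)) (a' x (v x) + a x v') x := by
  have h1 := (ContinuousLinearMap.restrictScalarsL ℂ E E ℝ ℝ).hasFDerivAt.comp_hasDerivAt x (h x)
  exact h1.clm_apply hv

/-- A classical derivative in `L²` is a weak derivative. -/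
theorem hD_of_hasDerivAt {F F' : LL E} {v v' : ℝ → E} (hF : F =ᵐ[volume] v)
    (hF' : F' =ᵐ[volume] v') (hd : ∀ x, HasDerivAt v (v' x) x) : HD F F' := by
  intro ψ hψ hc
  have m1 : MemLp (fun x => ((ψ x : ℝ) : ℂ)) 2 volume :=
    (Complex.continuous_ofReal.comp hψ.continuous).memLp_of_hasCompactSupport
      (hc.comp_left (g := fun r : ℝ => (r : ℂ)) (by simp))
  have m2 : MemLp (fun x => ((deriv ψ x : ℝ) : ℂ)) 2 volume :=
    (Complex.continuous_ofReal.comp (hψ.continuous_deriv (by simp))).memLp_of_hasCompactSupport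
      (hc.deriv.comp_left (g := fun r : ℝ => (r : ℂ)) (by simp))
  have c1 : ∀ u : ℝ → ℝ, (fun x => ((u x : ℝ) : ℂ) • F x) =ᵐ[volume] fun x => u x • v x := by
    intro u
    filter_upwards [hF] with x hx
    rw [hx, Complex.coe_smul]
  have c2 : ∀ u : ℝ → ℝ, (fun x => ((u x : ℝ) : ℂ) • F' x) =ᵐ[volume] fun x => u x • v' x := by
    intro u
    filter_upwards [hF'] with x hx
    rw [hx, Complex.coe_smul]
  have key := integral_bilinear_hasDerivAt_right_eq_neg_left_of_integrable
    (L := ContinuousLinearMap.lsmul ℝ ℝ (E := E)) (u := ψ) (u' := deriv ψ)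
    (v := v) (v' := v')
    (fun x _ => (hψ.differentiable (by simp) x).hasDerivAt)
    (fun x _ => hd x) ((integrable_smul_LL m1 F').congr (c2 ψ))
    ((integrable_smul_LL m2 F).congr (c1 _)) ((integrable_smul_LL m1 F).congr (c1 ψ))
  simp only [ContinuousLinearMap.lsmul_apply] at key
  rw [integral_congr_ae (c1 _), integral_congr_ae (c2 _), key, neg_neg]

theorem hD_mulOp_schwartz {a a' : Cf E} (h : CfDeriv a a') (φ : 𝓢(ℝ, E)) :
    HD (mulOp a (φ.toLp 2 : LL E))
      (mulOp a' (φ.toLp 2 : LL E) + mulOp a ((SchwartzMap.derivCLM ℂ E φ).toLp 2 : LL E)) := by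
  have e5 : (φ.toLp 2 : LL E) =ᵐ[volume] φ := φ.coeFn_toLp 2 volume
  have e6 : ((SchwartzMap.derivCLM ℂ E φ).toLp 2 : LL E) =ᵐ[volume] SchwartzMap.derivCLM ℂ E φ :=
    SchwartzMap.coeFn_toLp _ 2 volume
  generalize (φ.toLp 2 : LL E) = f at *
  generalize ((SchwartzMap.derivCLM ℂ E φ).toLp 2 : LL E) = g at *
  refine hD_of_hasDerivAt (v := fun x => a x (φ x))
    (v' := fun x => a' x (φ x) + a x (deriv φ x)) ?_ ?_
    (fun x => h.hasDerivAt_apply (φ.hasDerivAt x))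
  · filter_upwards [coeFn_mulOp a f, e5] with x h1 h2
    rw [h1, h2]
  · filter_upwards [coeFn_mulOp a' f, coeFn_mulOp a g, Lp.coeFn_add (mulOp a' f) (mulOp a g), e5, e6]
      with x h2 h3 h4 h5 h6
    rw [h4, Pi.add_apply, h2, h3, h5, h6]
    rfl

theorem hD_schwartz (φ : 𝓢(ℝ, E)) :
    HD (φ.toLp 2 : LL E) ((SchwartzMap.derivCLM ℂ E φ).toLp 2) := by
  have h : CfDeriv (1 : Cf E) 0 := fun x => hasDerivAt_const x (1 : E →L[ℂ] E)
  have := hD_mulOp_schwartz h φ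
  have h0 : mulOp (0 : Cf E) = 0 := map_zero mulHom
  simpa [mulOp_one, h0] using this

/-- Functions with weak derivative in `L²` are obtained from `L²` by continuous maps `F`, `G`
(the function and its derivative) that send Schwartz functions to Schwartz functions. -/
theorem exists_sobolev_param : ∃ F G : LL E →L[ℂ] LL E,
    (∀ y, HD (F y) (G y)) ∧ (∀ f g, HD f g → ∃ y, F y = f ∧ G y = g) ∧
    ∀ y : 𝓢(ℝ, E), ∃ φ : 𝓢(ℝ, E), F (y.toLp 2) = φ.toLp 2 := by
  let wt : ℝ → ℝ := fun x => (1 + ‖x‖ ^ 2) ^ (-(1 / 2) : ℝ)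
  have hpos : ∀ x : ℝ, 0 < 1 + ‖x‖ ^ 2 := fun x => by positivity
  have hwtc : Continuous wt :=
    (continuous_const.add (continuous_norm.pow 2)).rpow_const fun x => Or.inl (hpos x).ne'
  have hwt0 : ∀ x, 0 < wt x := fun x => Real.rpow_pos_of_pos (hpos x) _
  have hwt2 : ∀ x, wt x ^ 2 * (1 + x ^ 2) = 1 := fun x => by
    have h := hpos x
    have : x ^ 2 = ‖x‖ ^ 2 := by simp
    rw [this]
    simp only [wt]
    rw [← Real.rpow_natCast, ← Real.rpow_mul h.le]
    norm_num
    rw [Real.rpow_neg_one]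
    simp only [Real.norm_eq_abs, sq_abs] at h
    field_simp
  have hwt1 : ∀ x, wt x ≤ 1 := fun x => by
    have := hwt2 x
    have := hwt0 x
    nlinarith [sq_nonneg x, mul_nonneg (sq_nonneg (wt x)) (sq_nonneg x)]
  have hwtx : ∀ x, wt x * |x| ≤ 1 := fun x => by
    have h := hwt2 x
    have h1 : (wt x * |x|) ^ 2 ≤ 1 := by
      rw [mul_pow, sq_abs]
      nlinarith [sq_nonneg (wt x)]
    exact (sq_le_one_iff₀ (mul_nonneg (hwt0 x).le (abs_nonneg x))).1 h1
  have hwtxc : Continuous fun x : ℝ => wt x * x := hwtc.mul continuous_id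
  let m1 : Cf E := scal (fun x => ((wt x : ℝ) : ℂ)) (Complex.continuous_ofReal.comp hwtc) 1 (fun x => by
    rw [Complex.norm_real, Real.norm_of_nonneg (hwt0 x).le]; exact hwt1 x)
  let m2 : Cf E := scal (fun x => ((wt x * x : ℝ) : ℂ)) (Complex.continuous_ofReal.comp hwtxc) 1
    (fun x => by
      rw [Complex.norm_real, norm_mul, Real.norm_of_nonneg (hwt0 x).le]; exact hwtx x)
  let Fo : LL E →L[ℂ] LL E := (Lp.fourierTransformₗᵢ ℝ E : LL E →L[ℂ] LL E)
  let Fi : LL E →L[ℂ] LL E := ((Lp.fourierTransformₗᵢ ℝ E).symm : LL E →L[ℂ] LL E)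
  have hFi : ∀ u : LL E, (𝓕 (Fi u) : LL E) = u := fun u => (Lp.fourierTransformₗᵢ ℝ E).apply_symm_apply u
  let c : ℂ := 2 * Real.pi * Complex.I
  have hc : c ≠ 0 := by simp [c, Real.pi_ne_zero]
  have hFG : ∀ y, HD (Fi (mulOp m1 y)) (Fi (mulOp (c • m2) y)) := by
    intro y
    rw [hD_iff_fourier, hFi, hFi]
    filter_upwards [coeFn_mulOp m1 y, coeFn_mulOp (c • m2) y] with x h1 h2
    rw [h1, h2]
    simp only [m1, m2, BoundedContinuousFunction.coe_smul, smul_apply, scal_apply,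
      smul_smul, c]
    congr 1
    push_cast
    ring
  refine ⟨Fi ∘L mulOp m1, Fi ∘L mulOp (c • m2), hFG, fun f g h => ?_, fun y => ?_⟩
  · have hF : Fi (mulOp m1 (mulOp m1 (𝓕 f : LL E) + mulOp (c⁻¹ • m2) (𝓕 g : LL E))) = f := by
      have : (mulOp m1 (mulOp m1 (𝓕 f : LL E) + mulOp (c⁻¹ • m2) (𝓕 g : LL E))) = (𝓕 f : LL E) := by
        apply Lp.ext
        filter_upwards [coeFn_mulOp m1 (mulOp m1 (𝓕 f : LL E) + mulOp (c⁻¹ • m2) (𝓕 g : LL E)),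
          coeFn_mulOp m1 (𝓕 f : LL E), coeFn_mulOp (c⁻¹ • m2) (𝓕 g : LL E), hD_iff_fourier.1 h,
          Lp.coeFn_add (mulOp m1 (𝓕 f : LL E)) (mulOp (c⁻¹ • m2) (𝓕 g : LL E))] with x h1 h2 h3 h4 h5
        rw [h1, h5, Pi.add_apply, h2, h3, h4]
        simp only [m1, m2, BoundedContinuousFunction.coe_smul, smul_apply, scal_apply,
          smul_smul, ← add_smul]
        convert one_smul ℂ _ using 2
        have h6 : ((wt x : ℝ) : ℂ) ^ 2 * (1 + (x : ℂ) ^ 2) = 1 := by exact_mod_cast hwt2 x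
        rw [← h6]
        have h7 : (2 * Real.pi * x * Complex.I : ℂ) = c * x := by simp only [c]; ring
        rw [h7]
        push_cast
        field_simp
      rw [this]
      exact (Lp.fourierTransformₗᵢ ℝ E).symm_apply_apply f
    refine ⟨_, hF, ?_⟩
    have := hFG (mulOp m1 (𝓕 f : LL E) + mulOp (c⁻¹ • m2) (𝓕 g : LL E))
    rw [hF] at this
    exact this.unique h
  · have ht : wt.HasTemperateGrowth := Function.hasTemperateGrowth_one_add_norm_sq_rpow ℝ _
    refine ⟨𝓕⁻ (SchwartzMap.smulLeftCLM E wt y), ?_⟩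
    rw [← SchwartzMap.toLp_fourierInv_eq]
    change (𝓕⁻ (mulOp m1 (y.toLp 2)) : LL E) = _
    congr 1
    apply Lp.ext
    filter_upwards [coeFn_mulOp m1 (y.toLp 2), y.coeFn_toLp 2 volume,
      (SchwartzMap.smulLeftCLM E wt y).coeFn_toLp 2 volume] with x h1 h2 h3
    rw [h1, h2, h3, SchwartzMap.smulLeftCLM_apply_apply ht]
    simp only [m1, scal_apply]
    rw [Complex.coe_smul]

/-- Product rule. -/
theorem HD.mulOp {a a' : Cf E} (h : CfDeriv a a') {f f' : LL E} (hf : HD f f') :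
    HD (mulOp a f) (mulOp a' f + mulOp a f') := by
  obtain ⟨F, G, hFG, hs, hφ⟩ := exists_sobolev_param (E := E)
  obtain ⟨y, rfl, rfl⟩ := hs f f' hf
  have hd : DenseRange (SchwartzMap.toLpCLM ℂ (E := ℝ) E 2 volume) :=
    SchwartzMap.denseRange_toLpCLM ENNReal.ofNat_ne_top
  refine hd.induction_on (p := fun y => HD (ViscousShock.mulOp a (F y))
    (ViscousShock.mulOp a' (F y) + ViscousShock.mulOp a (G y))) y ?_ ?_
  · exact isClosed_HD.preimage (f := fun y : LL E => ((ViscousShock.mulOp a (F y),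
      ViscousShock.mulOp a' (F y) + ViscousShock.mulOp a (G y)) : LL E × LL E)) (by fun_prop)
  · intro y
    obtain ⟨φ, e⟩ := hφ y
    change HD (ViscousShock.mulOp a (F (y.toLp 2)))
      (ViscousShock.mulOp a' (F (y.toLp 2)) + ViscousShock.mulOp a (G (y.toLp 2)))
    have hG : G (y.toLp 2) = (SchwartzMap.derivCLM ℂ E φ).toLp 2 :=
      HD.unique (e ▸ hFG (y.toLp 2)) (hD_schwartz φ)
    rw [e, hG]
    exact hD_mulOp_schwartz h φ

end WeakDerivativeCalculus

section Energy

variable {H : Type*} [NormedAddCommGroup H] [InnerProductSpace ℂ H]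

variable (H) in
/-- A skew-symmetric linear relation, playing the role of `d/dx`. -/
structure SkewRel where
  graph : Submodule ℂ (H × H)
  skew : ∀ {f f' g g'}, (f, f') ∈ graph → (g, g') ∈ graph → ⟪f', g⟫_ℂ = -⟪f, g'⟫_ℂ

/-- `f'` is a derivative of `f`. -/
def SkewRel.D (Δ : SkewRel H) (f f' : H) : Prop := (f, f') ∈ Δ.graph

/-- `a'` is the derivative of the coefficient `a`. -/
def SkewRel.Comm (Δ : SkewRel H) (a a' : H →L[ℂ] H) : Prop :=
  ∀ f f', Δ.D f f' → Δ.D (a f) (a' f + a f')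

/-- The real part of the inner product. -/
def rI (x y : H) : ℝ := (⟪x, y⟫_ℂ).re

theorem rI_comm (x y : H) : rI x y = rI y x := by
  unfold rI
  rw [← inner_conj_symm, Complex.conj_re]

theorem rI_add_right (x y z : H) : rI x (y + z) = rI x y + rI x z := by
  simp [rI]

theorem rI_add_left (x y z : H) : rI (x + y) z = rI x z + rI y z := by
  simp [rI]

theorem rI_sub_right (x y z : H) : rI x (y - z) = rI x y - rI x z := by
  simp [rI]

theorem rI_sub_left (x y z : H) : rI (x - y) z = rI x z - rI y z := by
  simp [rI]

theorem rI_neg_right (x y : H) : rI x (-y) = -rI x y := by simp [rI]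

theorem rI_neg_left (x y : H) : rI (-x) y = -rI x y := by simp [rI]

theorem rI_self (x : H) : rI x x = ‖x‖ ^ 2 := by
  unfold rI
  rw [inner_self_eq_norm_sq_to_K]
  norm_cast

theorem abs_rI_le (x y : H) : |rI x y| ≤ ‖x‖ * ‖y‖ :=
  (Complex.abs_re_le_norm _).trans (norm_inner_le_norm x y)

theorem rI_le (x y : H) : rI x y ≤ ‖x‖ * ‖y‖ := (le_abs_self _).trans (abs_rI_le x y)

theorem neg_le_rI (x y : H) : -(‖x‖ * ‖y‖) ≤ rI x y := neg_le_of_abs_le (abs_rI_le x y)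

theorem rI_I_smul_right (x y : H) : rI x (Complex.I • y) = -rI (Complex.I • x) y := by
  simp [rI]

theorem norm_I_smul (x : H) : ‖Complex.I • x‖ = ‖x‖ := by simp [norm_smul]

theorem SkewRel.rI_skew {Δ : SkewRel H} {f f' g g' : H} (hf : Δ.D f f') (hg : Δ.D g g') :
    rI f' g = -rI f g' := by
  unfold rI
  rw [Δ.skew hf hg, Complex.neg_re]

/-- Symmetry of an operator. -/
def SA (A : H →L[ℂ] H) : Prop := ∀ f g, ⟪A f, g⟫_ℂ = ⟪f, A g⟫_ℂ

theorem SA.rI {A : H →L[ℂ] H} (h : SA A) (f g : H) : rI (A f) g = rI f (A g) := by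
  unfold ViscousShock.rI
  rw [h]

theorem SA.rI_I {A : H →L[ℂ] H} (h : SA A) (f : H) : ViscousShock.rI f (Complex.I • A f) = 0 := by
  have h1 : ViscousShock.rI (Complex.I • f) (A f) = ViscousShock.rI f (Complex.I • A f) := by
    rw [← h.rI, map_smul, rI_comm]
  have h2 := rI_I_smul_right f (A f)
  linarith

theorem SA.inner_self_im {A : H →L[ℂ] H} (h : SA A) (f : H) : (⟪A f, f⟫_ℂ).im = 0 := by
  have h1 : (starRingEnd ℂ) ⟪A f, f⟫_ℂ = ⟪A f, f⟫_ℂ := by rw [inner_conj_symm, h]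
  exact Complex.conj_eq_iff_im.1 h1

variable (H) in
/-- Coefficients of a linear hyperbolic-parabolic system on the line at a fixed tangential
frequency. -/
structure Coefs where
  (a0 a0i a0' A A' X X' e e' pr b b' b1 b1' b2 b2' b3 b3' del delx sg : H →L[ℂ] H)

/-- Structural bounds; `k` is the size of the tangential frequency. -/
structure Coefs.Bounds (q : Coefs H) (Δ : SkewRel H) (k c C ε : ℝ) : Prop where
  pr_sa : SA q.pr
  pr_pr : ∀ f, q.pr (q.pr f) = q.pr f
  pr_D : ∀ f f', Δ.D f f' → Δ.D (q.pr f) (q.pr f')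
  a0_sa : SA q.a0
  a0_pos : ∀ f, c * ‖f‖ ^ 2 ≤ rI f (q.a0 f)
  a0_le : ∀ f, ‖q.a0 f‖ ≤ C * ‖f‖
  a0i_le : ∀ f, ‖q.a0i f‖ ≤ C * ‖f‖
  a0_a0i : ∀ f, q.a0 (q.a0i f) = f
  a0i_a0 : ∀ f, q.a0i (q.a0 f) = f
  a0_comm : Δ.Comm q.a0 q.a0'
  a0'_le : ∀ f, ‖q.a0' f‖ ≤ ε * ‖f‖ + C * ‖q.sg f‖
  pr_a0i : ∀ f, q.pr (q.a0i f) = q.a0i (q.pr f)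
  pr_a0' : ∀ f, q.pr (q.a0' f) = q.a0' (q.pr f)
  A_sa : SA q.A
  A_le : ∀ f, ‖q.A f‖ ≤ C * ‖f‖
  A_comm : Δ.Comm q.A q.A'
  A'_le : ∀ f, ‖q.A' f‖ ≤ ε * ‖f‖ + C * ‖q.sg f‖
  X_sa : SA q.X
  X_le : ∀ f, ‖q.X f‖ ≤ C * k * ‖f‖
  X_comm : Δ.Comm q.X q.X'
  X'_le : ∀ f, ‖q.X' f‖ ≤ k * (ε * ‖f‖ + C * ‖q.sg f‖)
  pr_b : ∀ f, q.pr (q.b f) = q.b f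
  pr_b1 : ∀ f, q.pr (q.b1 f) = q.b1 f
  pr_b2 : ∀ f, q.pr (q.b2 f) = q.b2 f
  pr_b3 : ∀ f, q.pr (q.b3 f) = q.b3 f
  b_le : ∀ f, ‖q.b f‖ ≤ C * ‖q.pr f‖
  b1_le : ∀ f, ‖q.b1 f‖ ≤ C * k * ‖q.pr f‖
  b2_le : ∀ f, ‖q.b2 f‖ ≤ C * k * ‖q.pr f‖
  b3_le : ∀ f, ‖q.b3 f‖ ≤ C * k ^ 2 * ‖q.pr f‖
  b_comm : Δ.Comm q.b q.b'
  b1_comm : Δ.Comm q.b1 q.b1'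
  b2_comm : Δ.Comm q.b2 q.b2'
  b3_comm : Δ.Comm q.b3 q.b3'
  pr_b' : ∀ f, q.pr (q.b' f) = q.b' f
  pr_b1' : ∀ f, q.pr (q.b1' f) = q.b1' f
  pr_b2' : ∀ f, q.pr (q.b2' f) = q.b2' f
  pr_b3' : ∀ f, q.pr (q.b3' f) = q.b3' f
  b'_le : ∀ f, ‖q.b' f‖ ≤ C * ‖q.pr f‖
  b1'_le : ∀ f, ‖q.b1' f‖ ≤ C * k * ‖q.pr f‖
  b2'_le : ∀ f, ‖q.b2' f‖ ≤ C * k * ‖q.pr f‖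
  b3'_le : ∀ f, ‖q.b3' f‖ ≤ C * k ^ 2 * ‖q.pr f‖
  pr_del : ∀ f, q.pr (q.del f) = q.del f
  pr_delx : ∀ f, q.pr (q.delx f) = q.delx f
  del_le : ∀ f, ‖q.del f‖ ≤ ε * ‖f‖ + C * ‖q.sg f‖ + C * ‖q.pr f‖
  delx_le : ∀ f, ‖q.delx f‖ ≤ k * (ε * ‖f‖ + C * ‖q.sg f‖ + C * ‖q.pr f‖)
  sg_le : ∀ f, ‖q.sg f‖ ≤ ‖f‖
  garding : ∀ y y1, Δ.D y y1 → c * (‖q.pr y1‖ ^ 2 + k ^ 2 * ‖q.pr y‖ ^ 2) - C * ‖q.pr y‖ ^ 2 ≤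
    rI y1 (q.b y1) + rI y1 (Complex.I • q.b1 y) - rI y (Complex.I • q.b2 y1) + rI y (q.b3 y)

/-- Bounds on the zero order coefficient, including damping of strength `K` of the hyperbolic modes
where the cutoff is active, and the coupling estimate. -/
structure Coefs.Damped (q : Coefs H) (Δ : SkewRel H) (k C ε K M : ℝ) : Prop where
  pr_e : ∀ f, q.pr (q.e f) = 0
  e_le : ∀ f, ‖q.e f‖ ≤ M * ‖f‖
  e_comm : Δ.Comm q.e q.e'
  e'_le : ∀ f, ‖q.e' f‖ ≤ M * ‖f‖
  damping : ∀ f, q.pr f = 0 → K * ‖q.sg f‖ ^ 2 - ε * ‖f‖ ^ 2 ≤ rI f (q.e f)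
  coupling : ∀ (w w1 : H) (τ : ℝ), Δ.D w w1 → ‖w1‖ + k * ‖w‖ ≤
    C * (‖(Complex.I * τ) • q.a0 w + q.A w1 + Complex.I • q.X w‖ + ‖q.pr w1‖ + k * ‖q.pr w‖ +
      ε * (‖w1‖ + k * ‖w‖ + |τ| * ‖w‖) + ‖q.sg w1‖ + k * ‖q.sg w‖) + M * ‖w‖

/-- The second order part of the equation. -/
def Coefs.par (q : Coefs H) (w w1 w2 : H) : H :=
  -(q.b w2) - Complex.I • (q.b1 w1 + q.b2 w1) + q.b3 w

/-- The equation `λ a⁰ w + A w' + i X w + e w + par + δ w' + i δ_ξ w + r = g`. -/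
def Coefs.Eqn (q : Coefs H) (lam : ℂ) (w w1 w2 r g : H) : Prop :=
  lam • q.a0 w + q.A w1 + Complex.I • q.X w + q.e w +
    (q.par w w1 w2 + q.del w1 + Complex.I • q.delx w + r) = g

variable {Δ : SkewRel H} {q : Coefs H} {k c C ε K M : ℝ}

theorem Coefs.Bounds.rI_pr (h : q.Bounds Δ k c C ε) (f g : H) : rI (q.pr f) g = rI f (q.pr g) :=
  h.pr_sa.rI f g

theorem Coefs.Bounds.norm_pr_le (h : q.Bounds Δ k c C ε) (f : H) : ‖q.pr f‖ ≤ ‖f‖ := by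
  have h1 : ‖q.pr f‖ ^ 2 ≤ ‖q.pr f‖ * ‖f‖ := by
    rw [← rI_self, h.rI_pr, h.pr_pr, rI_comm]
    exact rI_le _ _
  by_contra hlt
  push Not at hlt
  nlinarith [norm_nonneg f, norm_nonneg (q.pr f)]

theorem Coefs.Bounds.norm_compl_le (h : q.Bounds Δ k c C ε) (f : H) : ‖f - q.pr f‖ ≤ ‖f‖ := by
  have h1 : ‖f - q.pr f‖ ^ 2 ≤ ‖f - q.pr f‖ * ‖f‖ := by
    have : rI (f - q.pr f) (f - q.pr f) = rI (f - q.pr f) f := by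
      rw [rI_sub_right, rI_sub_left _ _ (q.pr f), h.rI_pr, h.pr_pr, sub_self, sub_zero]
    rw [← rI_self, this]
    exact rI_le _ _
  by_contra hlt
  push Not at hlt
  nlinarith [norm_nonneg f, norm_nonneg (f - q.pr f)]

theorem Coefs.Bounds.rI_of_pr (h : q.Bounds Δ k c C ε) {f g : H} (hg : q.pr g = g) :
    rI f g = rI (q.pr f) g := by
  rw [h.rI_pr, hg]

theorem Coefs.Bounds.abs_rI_of_pr (h : q.Bounds Δ k c C ε) {f g : H} (hg : q.pr g = g) :
    |rI f g| ≤ ‖q.pr f‖ * ‖g‖ := by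
  rw [h.rI_of_pr hg]
  exact abs_rI_le _ _

/-- Gårding's inequality at the level of second derivatives. -/
theorem Coefs.Bounds.garding_two (h : q.Bounds Δ k c C ε) (hk : 0 ≤ k) (hC : 1 ≤ C)
    {w w1 w2 : H} (hw : Δ.D w w1) (hw1 : Δ.D w1 w2) :
    c * (‖q.pr w2‖ ^ 2 + 2 * k ^ 2 * ‖q.pr w1‖ ^ 2 + k ^ 4 * ‖q.pr w‖ ^ 2) -
      4 * C * (‖q.pr w1‖ + k * ‖q.pr w‖) * ((‖q.pr w1‖ + k * ‖q.pr w‖) +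
        (‖q.pr w2‖ + k * ‖q.pr w1‖ + k ^ 2 * ‖q.pr w‖)) ≤
    rI (-w2) (q.par w w1 w2) + k ^ 2 * rI w (q.par w w1 w2) := by
  have G1 := h.garding w1 w2 hw1
  have G0 := h.garding w w1 hw
  have s3 := Δ.rI_skew hw1 (h.b3_comm w w1 hw)
  have s2 := Δ.rI_skew hw1 (Submodule.smul_mem _ Complex.I (h.b2_comm w1 w2 hw1) :
    Δ.D (Complex.I • q.b2 w1) (Complex.I • (q.b2' w1 + q.b2 w2)))
  have t0 := Δ.rI_skew hw (h.b_comm w1 w2 hw1)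
  have t1 := Δ.rI_skew hw (Submodule.smul_mem _ Complex.I (h.b1_comm w w1 hw) :
    Δ.D (Complex.I • q.b1 w) (Complex.I • (q.b1' w + q.b1 w1)))
  simp only [smul_add, rI_add_right] at s3 s2 t0 t1
  have e1 := h.abs_rI_of_pr (f := w1) (h.pr_b3' w)
  have e2 : |rI w1 (Complex.I • q.b2' w1)| ≤ ‖q.pr w1‖ * ‖q.b2' w1‖ := by
    refine (h.abs_rI_of_pr (by rw [map_smul, h.pr_b2'])).trans_eq ?_
    rw [norm_I_smul]
  have e3 := h.abs_rI_of_pr (f := w) (h.pr_b' w1)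
  have e4 : |rI w (Complex.I • q.b1' w)| ≤ ‖q.pr w‖ * ‖q.b1' w‖ := by
    refine (h.abs_rI_of_pr (by rw [map_smul, h.pr_b1'])).trans_eq ?_
    rw [norm_I_smul]
  have f1 := h.b3'_le w
  have f2 := h.b2'_le w1
  have f3 := h.b'_le w1
  have f4 := h.b1'_le w
  simp only [Coefs.par, smul_add, rI_add_right, rI_sub_right, rI_neg_right, rI_neg_left]
  have p2 := norm_nonneg (q.pr w2)
  have p1 := norm_nonneg (q.pr w1)
  have p0 := norm_nonneg (q.pr w)
  generalize ‖q.pr w2‖ = P2 at *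
  generalize ‖q.pr w1‖ = P1 at *
  generalize ‖q.pr w‖ = P0 at *
  have E1 : |rI w1 (q.b3' w)| ≤ C * P1 * (k ^ 2 * P0) :=
    e1.trans ((mul_le_mul_of_nonneg_left f1 p1).trans_eq (by ring))
  have E2 : |rI w1 (Complex.I • q.b2' w1)| ≤ C * P1 * (k * P1) :=
    e2.trans ((mul_le_mul_of_nonneg_left f2 p1).trans_eq (by ring))
  have E3 : k ^ 2 * |rI w (q.b' w1)| ≤ C * P1 * (k ^ 2 * P0) := by
    have := e3.trans (mul_le_mul_of_nonneg_left f3 p0)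
    exact (mul_le_mul_of_nonneg_left this (sq_nonneg k)).trans_eq (by ring)
  have E4 : k ^ 2 * |rI w (Complex.I • q.b1' w)| ≤ C * (k * P0) * (k ^ 2 * P0) := by
    have := e4.trans (mul_le_mul_of_nonneg_left f4 p0)
    exact (mul_le_mul_of_nonneg_left this (sq_nonneg k)).trans_eq (by ring)
  have A1 := abs_le.1 E1
  have A2 := abs_le.1 E2
  have A3 : -(C * P1 * (k ^ 2 * P0)) ≤ k ^ 2 * rI w (q.b' w1) := by
    have := mul_le_mul_of_nonneg_left (neg_abs_le (rI w (q.b' w1))) (sq_nonneg k)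
    linarith
  have A4 : -(C * (k * P0) * (k ^ 2 * P0)) ≤ k ^ 2 * rI w (Complex.I • q.b1' w) := by
    have := mul_le_mul_of_nonneg_left (neg_abs_le (rI w (Complex.I • q.b1' w))) (sq_nonneg k)
    linarith
  have G0' := mul_le_mul_of_nonneg_left G0 (sq_nonneg k)
  have q1 : 0 ≤ C * P1 * (k ^ 2 * P0) := by positivity
  have q2 : 0 ≤ C * P1 * (k * P1) := by positivity
  have q3 : 0 ≤ C * (k * P0) * (k ^ 2 * P0) := by positivity
  have q4 : 0 ≤ C * P1 * P2 := by positivity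
  have q5 : 0 ≤ C * (k * P0) * P2 := by positivity
  have q6 : 0 ≤ C * P1 * (k * P0) := by positivity
  have q7 : 0 ≤ C * P1 * P1 := by positivity
  have q8 : 0 ≤ C * (k * P0) * (k * P0) := by positivity
  have t0' : k ^ 2 * rI w1 (q.b w1) = k ^ 2 * -(rI w (q.b' w1) + rI w (q.b w2)) := by rw [t0]
  have t1' : k ^ 2 * rI w1 (Complex.I • q.b1 w) =
      k ^ 2 * -(rI w (Complex.I • q.b1' w) + rI w (Complex.I • q.b1 w1)) := by rw [t1]
  linarith [G0', G1, s3, s2, t0', t1', A1.1, A1.2, A2.1, A2.2, A3, A4]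

end Energy

section EnergyTests

variable {H : Type*} [NormedAddCommGroup H] [InnerProductSpace ℂ H]
variable {Δ : SkewRel H} {q : Coefs H} {k c C ε K M : ℝ}

theorem rI_smul_of_im_zero {z x : H} (lam : ℂ) (h : (⟪z, x⟫_ℂ).im = 0) :
    rI z (lam • x) = lam.re * rI z x := by
  unfold rI
  rw [inner_smul_right, Complex.mul_re, h, mul_zero, sub_zero]

theorem Coefs.Bounds.pr_par (h : q.Bounds Δ k c C ε) (w w1 w2 : H) :
    q.pr (q.par w w1 w2) = q.par w w1 w2 := by
  simp only [Coefs.par, map_add, map_sub, map_neg, map_smul, h.pr_b, h.pr_b1, h.pr_b2, h.pr_b3]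

theorem Coefs.Bounds.norm_par_le (h : q.Bounds Δ k c C ε) (w w1 w2 : H) :
    ‖q.par w w1 w2‖ ≤ C * ‖q.pr w2‖ + 2 * (C * k * ‖q.pr w1‖) + C * k ^ 2 * ‖q.pr w‖ := by
  unfold Coefs.par
  refine (norm_add_le _ _).trans (add_le_add ((norm_sub_le _ _).trans (add_le_add ?_ ?_))
    (h.b3_le w))
  · rw [norm_neg]
    exact h.b_le w2
  · rw [norm_I_smul]
    refine (norm_add_le _ _).trans ?_
    have := h.b1_le w1
    have := h.b2_le w1
    linarith

/-- The lower order part of the second block of equations. -/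
def Coefs.low (q : Coefs H) (w w1 r : H) : H := q.del w1 + Complex.I • q.delx w + r

theorem Coefs.Bounds.pr_low (h : q.Bounds Δ k c C ε) {w w1 r : H} (hr : q.pr r = r) :
    q.pr (q.low w w1 r) = q.low w w1 r := by
  simp only [Coefs.low, map_add, map_smul, h.pr_del, h.pr_delx, hr]

theorem Coefs.Bounds.norm_low_le (h : q.Bounds Δ k c C ε) (w w1 r : H) :
    ‖q.low w w1 r‖ ≤ (ε * ‖w1‖ + C * ‖q.sg w1‖ + C * ‖q.pr w1‖) +
      k * (ε * ‖w‖ + C * ‖q.sg w‖ + C * ‖q.pr w‖) + ‖r‖ := by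
  unfold Coefs.low
  refine (norm_add_le _ _).trans (add_le_add ((norm_add_le _ _).trans (add_le_add (h.del_le w1) ?_))
    le_rfl)
  rw [norm_I_smul]
  exact h.delx_le w

theorem Coefs.Eqn.rI {lam : ℂ} {w w1 w2 r g : H} (h : q.Eqn lam w w1 w2 r g) (z : H) :
    rI z (lam • q.a0 w) + rI z (q.A w1) + rI z (Complex.I • q.X w) + rI z (q.e w) +
      (rI z (q.par w w1 w2) + rI z (q.low w w1 r)) = rI z g := by
  rw [← h]
  simp only [rI_add_right, Coefs.low]
  ring

/-- Damping of the zero order coefficient. -/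
theorem Coefs.Damped.rI_e_ge (h : q.Bounds Δ k c C ε) (hd : q.Damped Δ k C ε K M) (hε : 0 ≤ ε) (f : H) :
    K * ‖q.sg (f - q.pr f)‖ ^ 2 - ε * ‖f‖ ^ 2 - M * ‖f‖ * ‖q.pr f‖ ≤ rI f (q.e f) := by
  have hu : q.pr (f - q.pr f) = 0 := by rw [map_sub, h.pr_pr, sub_self]
  have h1 := hd.damping _ hu
  have h2 : rI f (q.e f) = rI (f - q.pr f) (q.e f) := by
    rw [rI_sub_left, h.rI_pr, hd.pr_e]
    simp [ViscousShock.rI]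
  have h3 : rI (f - q.pr f) (q.e f) =
      rI (f - q.pr f) (q.e (f - q.pr f)) + rI (f - q.pr f) (q.e (q.pr f)) := by
    rw [← rI_add_right, ← map_add, sub_add_cancel]
  have h4 := neg_le_rI (f - q.pr f) (q.e (q.pr f))
  have h5 := hd.e_le (q.pr f)
  have h6 := h.norm_compl_le f
  have h7 : ‖f - q.pr f‖ * ‖q.e (q.pr f)‖ ≤ ‖f‖ * (M * ‖q.pr f‖) := by gcongr
  have h8 : ε * ‖f - q.pr f‖ ^ 2 ≤ ε * ‖f‖ ^ 2 := by gcongr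
  rw [h2, h3]
  linarith

/-- The equation tested against `w`. -/
theorem Coefs.Bounds.test_zero (h : q.Bounds Δ k c C ε) (hd : q.Damped Δ k C ε K M) (hε : 0 ≤ ε)
    {lam : ℂ} {w w1 w2 r g : H} (hw : Δ.D w w1) (hr : q.pr r = r) (he : q.Eqn lam w w1 w2 r g) :
    lam.re * rI w (q.a0 w) + rI w (q.par w w1 w2) + K * ‖q.sg (w - q.pr w)‖ ^ 2 ≤
      (ε * ‖w‖ + C * ‖q.sg w‖) * ‖w‖ + ε * ‖w‖ ^ 2 + M * ‖w‖ * ‖q.pr w‖ +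
        ‖q.pr w‖ * ‖q.low w w1 r‖ + ‖w‖ * ‖g‖ := by
  have e := he.rI w
  have e1 : rI w (lam • q.a0 w) = lam.re * rI w (q.a0 w) :=
    rI_smul_of_im_zero lam (by rw [← h.a0_sa]; exact h.a0_sa.inner_self_im w)
  have e2 : rI w (q.A w1) = -(1 / 2) * rI w (q.A' w) := by
    have := Δ.rI_skew hw (h.A_comm w w1 hw)
    rw [rI_add_right, ← h.A_sa.rI w w1, rI_comm (q.A w)] at this
    have h2 := h.A_sa.rI w w1
    rw [rI_comm (q.A w)] at h2
    linarith
  have e3 : rI w (Complex.I • q.X w) = 0 := h.X_sa.rI_I w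
  have e4 := Coefs.Damped.rI_e_ge h hd hε w
  have e5 : |rI w (q.low w w1 r)| ≤ ‖q.pr w‖ * ‖q.low w w1 r‖ := h.abs_rI_of_pr (h.pr_low hr)
  have e6 := rI_le w g
  have e7 := rI_le w (q.A' w)
  have e8 := mul_le_mul_of_nonneg_left (h.A'_le w) (norm_nonneg w)
  have e9 := (abs_le.1 e5).1
  have e10 : 0 ≤ ‖w‖ * ‖q.A' w‖ := by positivity
  rw [e1, e2, e3] at e
  linarith

/-- The equation tested against `-w'' - (a⁰)⁻¹ (a⁰)' w'`. -/
theorem Coefs.Bounds.test_one (h : q.Bounds Δ k c C ε) (hd : q.Damped Δ k C ε K M) (hε : 0 ≤ ε)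
    (hC : 1 ≤ C) {lam : ℂ} {w w1 w2 r g g1 : H} (hw : Δ.D w w1) (hw1 : Δ.D w1 w2) (hg : Δ.D g g1)
    (hr : q.pr r = r) (he : q.Eqn lam w w1 w2 r g) :
    lam.re * rI w1 (q.a0 w1) + rI (-w2) (q.par w w1 w2) + K * ‖q.sg (w1 - q.pr w1)‖ ^ 2 ≤
      (ε * ‖w1‖ + C * ‖q.sg w1‖) * ‖w1‖ + ε * ‖w1‖ ^ 2 + M * ‖w1‖ * ‖q.pr w1‖ + M * ‖w1‖ * ‖w‖ +
        k * (ε * ‖w‖ + C * ‖q.sg w‖) * ‖w1‖ + ‖q.pr w2‖ * ‖q.low w w1 r‖ + ‖w1‖ * ‖g1‖ +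
        C * (ε * ‖w1‖ + C * ‖q.sg w1‖) * (C * ‖w1‖ + C * k * ‖w‖ + M * ‖w‖ + ‖g‖) +
        C * ((ε + C) * ‖q.pr w1‖) * (‖q.par w w1 w2‖ + ‖q.low w w1 r‖) := by
  set cw := q.a0i (q.a0' w1) with hcw
  have e := he.rI (-w2 - cw)
  have hz : ⟪-w2 - cw, q.a0 w⟫_ℂ = ⟪q.a0 w1, w1⟫_ℂ := by
    rw [← h.a0_sa]
    have : q.a0 (-w2 - cw) = -(q.a0' w1 + q.a0 w2) := by
      rw [map_sub, map_neg, hcw, h.a0_a0i]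
      abel
    rw [this, inner_neg_left, Δ.skew (h.a0_comm w1 w2 hw1) hw, neg_neg]
  have e1 : rI (-w2 - cw) (lam • q.a0 w) = lam.re * rI w1 (q.a0 w1) := by
    rw [rI_smul_of_im_zero lam (by rw [hz]; exact h.a0_sa.inner_self_im w1), rI_comm w1]
    unfold rI
    rw [hz]
  have e2 : rI (-w2 - cw) (q.A w1) = 1 / 2 * rI w1 (q.A' w1) - rI cw (q.A w1) := by
    have := Δ.rI_skew hw1 (h.A_comm w1 w2 hw1)
    rw [rI_add_right] at this
    have h2 := h.A_sa.rI w1 w2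
    rw [rI_comm (q.A w1)] at h2
    rw [rI_sub_left, rI_neg_left]
    linarith
  have e3 : rI (-w2 - cw) (Complex.I • q.X w) =
      rI w1 (Complex.I • q.X' w) - rI cw (Complex.I • q.X w) := by
    have := Δ.rI_skew hw1 (Submodule.smul_mem _ Complex.I (h.X_comm w w1 hw) :
      Δ.D (Complex.I • q.X w) (Complex.I • (q.X' w + q.X w1)))
    rw [smul_add, rI_add_right, h.X_sa.rI_I w1] at this
    rw [rI_sub_left, rI_neg_left]
    linarith
  have e4 : rI (-w2 - cw) (q.e w) = rI w1 (q.e' w) + rI w1 (q.e w1) - rI cw (q.e w) := by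
    have := Δ.rI_skew hw1 (hd.e_comm w w1 hw)
    rw [rI_add_right] at this
    rw [rI_sub_left, rI_neg_left]
    linarith
  have e6 : rI (-w2 - cw) g = rI w1 g1 - rI cw g := by
    have := Δ.rI_skew hw1 hg
    rw [rI_sub_left, rI_neg_left]
    linarith
  have e5 : rI (-w2 - cw) (q.par w w1 w2) = rI (-w2) (q.par w w1 w2) - rI cw (q.par w w1 w2) :=
    rI_sub_left _ _ _
  have e5' : rI (-w2 - cw) (q.low w w1 r) = -rI w2 (q.low w w1 r) - rI cw (q.low w w1 r) := by
    rw [rI_sub_left, rI_neg_left]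
  rw [e1, e2, e3, e4, e5, e5', e6] at e
  have D1 := Coefs.Damped.rI_e_ge h hd hε w1
  have ncw : ‖cw‖ ≤ C * (ε * ‖w1‖ + C * ‖q.sg w1‖) :=
    (h.a0i_le _).trans (by gcongr; exact h.a0'_le w1)
  have npcw : ‖q.pr cw‖ ≤ C * ((ε + C) * ‖q.pr w1‖) := by
    rw [hcw, h.pr_a0i, h.pr_a0']
    refine (h.a0i_le _).trans ?_
    gcongr
    refine (h.a0'_le _).trans ?_
    have := h.sg_le (q.pr w1)
    linarith only [mul_le_mul_of_nonneg_left this (zero_le_one.trans hC)]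
  have R1 : |rI w1 (q.A' w1)| ≤ ‖w1‖ * (ε * ‖w1‖ + C * ‖q.sg w1‖) :=
    (abs_rI_le _ _).trans (by gcongr; exact h.A'_le w1)
  have R2 : |rI cw (q.A w1)| ≤ C * (ε * ‖w1‖ + C * ‖q.sg w1‖) * (C * ‖w1‖) :=
    (abs_rI_le _ _).trans (by gcongr; exact h.A_le w1)
  have R3 : |rI w1 (Complex.I • q.X' w)| ≤ ‖w1‖ * (k * (ε * ‖w‖ + C * ‖q.sg w‖)) :=
    (abs_rI_le _ _).trans (by rw [norm_I_smul]; gcongr; exact h.X'_le w)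
  have R4 : |rI cw (Complex.I • q.X w)| ≤ C * (ε * ‖w1‖ + C * ‖q.sg w1‖) * (C * k * ‖w‖) :=
    (abs_rI_le _ _).trans (by rw [norm_I_smul]; gcongr; exact h.X_le w)
  have R5 : |rI w1 (q.e' w)| ≤ ‖w1‖ * (M * ‖w‖) :=
    (abs_rI_le _ _).trans (by gcongr; exact hd.e'_le w)
  have R6 : |rI cw (q.e w)| ≤ C * (ε * ‖w1‖ + C * ‖q.sg w1‖) * (M * ‖w‖) :=
    (abs_rI_le _ _).trans (by gcongr; exact hd.e_le w)
  have R7 : |rI cw (q.par w w1 w2)| ≤ C * ((ε + C) * ‖q.pr w1‖) * ‖q.par w w1 w2‖ :=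
    (h.abs_rI_of_pr (h.pr_par w w1 w2)).trans (by gcongr)
  have R8 : |rI cw (q.low w w1 r)| ≤ C * ((ε + C) * ‖q.pr w1‖) * ‖q.low w w1 r‖ :=
    (h.abs_rI_of_pr (h.pr_low hr)).trans (by gcongr)
  have R9 : |rI w2 (q.low w w1 r)| ≤ ‖q.pr w2‖ * ‖q.low w w1 r‖ := h.abs_rI_of_pr (h.pr_low hr)
  have R10 := rI_le w1 g1
  have R11 : |rI cw g| ≤ C * (ε * ‖w1‖ + C * ‖q.sg w1‖) * ‖g‖ :=
    (abs_rI_le _ _).trans (by gcongr)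
  have R0 : 0 ≤ ‖w1‖ * (ε * ‖w1‖ + C * ‖q.sg w1‖) := by positivity
  have := abs_le.1 R1
  have := abs_le.1 R2
  have := abs_le.1 R3
  have := abs_le.1 R4
  have := abs_le.1 R5
  have := abs_le.1 R6
  have := abs_le.1 R7
  have := abs_le.1 R8
  have := abs_le.1 R9
  have := abs_le.1 R11
  linarith

/-- The `λ`-part is controlled by the other terms of the equation. -/
theorem Coefs.Bounds.lam_le (h : q.Bounds Δ k c C ε) (hd : q.Damped Δ k C ε K M)
    (hC : 1 ≤ C) {lam : ℂ} {w w1 w2 r g : H} (he : q.Eqn lam w w1 w2 r g) :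
    ‖lam‖ * ‖w‖ ≤ C * (‖g‖ + C * ‖w1‖ + C * k * ‖w‖ + M * ‖w‖ + ‖q.par w w1 w2‖ +
      ‖q.low w w1 r‖) := by
  have h1 : lam • q.a0 w = g - q.A w1 - Complex.I • q.X w - q.e w - q.par w w1 w2 -
      q.low w w1 r := by
    rw [← he, Coefs.low]
    abel
  have h2 : lam • w = q.a0i (lam • q.a0 w) := by rw [map_smul, h.a0i_a0]
  rw [← norm_smul, h2]
  refine (h.a0i_le _).trans ?_
  gcongr
  rw [h1]
  refine (norm_sub_le _ _).trans (add_le_add ((norm_sub_le _ _).trans (add_le_add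
    ((norm_sub_le _ _).trans (add_le_add ((norm_sub_le _ _).trans (add_le_add
    ((norm_sub_le _ _).trans (add_le_add le_rfl (h.A_le _))) ?_)) (hd.e_le _))) le_rfl)) le_rfl)
  rw [norm_I_smul]
  exact h.X_le w

theorem Coefs.Eqn.norm_hyp_le (h : q.Bounds Δ k c C ε) (hd : q.Damped Δ k C ε K M)
    {lam : ℂ} {w w1 w2 r g : H} (he : q.Eqn lam w w1 w2 r g) :
    ‖(Complex.I * lam.im) • q.a0 w + q.A w1 + Complex.I • q.X w‖ ≤
      ‖g‖ + |lam.re| * (C * ‖w‖) + M * ‖w‖ + ‖q.par w w1 w2‖ + ‖q.low w w1 r‖ := by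
  have h1 : (Complex.I * lam.im) • q.a0 w + q.A w1 + Complex.I • q.X w =
      g - (lam.re : ℂ) • q.a0 w - q.e w - q.par w w1 w2 - q.low w w1 r := by
    rw [← he, Coefs.low]
    nth_rw 2 [← Complex.re_add_im lam]
    rw [add_smul, mul_comm Complex.I]
    abel
  rw [h1]
  refine (norm_sub_le _ _).trans (add_le_add ((norm_sub_le _ _).trans (add_le_add
    ((norm_sub_le _ _).trans (add_le_add ((norm_sub_le _ _).trans (add_le_add le_rfl ?_))
    (hd.e_le _))) le_rfl)) le_rfl)
  rw [norm_smul, Complex.norm_real, Real.norm_eq_abs]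
  gcongr
  exact h.a0_le w

end EnergyTests

section Absorption

/-- At high frequency the lower order quantities are small. -/
theorem small_of_high_frequency {C M ρ R L N V V1 G : ℝ} (hC : 1 ≤ C) (hρ : 0 < ρ)
    (hρ1 : ρ ≤ 1) (hR : M + C + 8 * C / ρ ^ 2 ≤ R) (hL : 0 ≤ L) (hN : 0 ≤ N) (hV : 0 ≤ V)
    (hG : 0 ≤ G) (hint : V1 ^ 2 ≤ 4 * (L * V))
    (h : R * L ≤ C * (N + V + V1 + G) + M * L) :
    L ≤ ρ * (N + V + G) ∧ V1 ≤ ρ * (N + V + G) := by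
  have h1 : V1 ≤ V + L := abs_le_of_sq_le_sq' (by nlinarith [sq_nonneg (V - L)]) (by positivity) |>.2
  have h2 : (8 * C / ρ ^ 2) * L ≤ 2 * C * (N + V + G) := by
    have := mul_le_mul_of_nonneg_right hR hL
    nlinarith
  have h3 : 4 * L ≤ ρ ^ 2 * (N + V + G) := by
    rw [div_mul_eq_mul_div, div_le_iff₀ (by positivity)] at h2
    have : 2 * C * (4 * L) ≤ 2 * C * (ρ ^ 2 * (N + V + G)) := by linarith
    exact le_of_mul_le_mul_left this (by positivity)
  constructor
  · have : ρ ^ 2 * (N + V + G) ≤ ρ * (N + V + G) := by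
      gcongr
      nlinarith
    linarith
  · refine (abs_le_of_sq_le_sq' ?_ (by positivity)).2
    calc V1 ^ 2 ≤ (4 * L) * V := by linarith
      _ ≤ (ρ ^ 2 * (N + V + G)) * (N + V + G) := by gcongr; linarith
      _ = _ := by ring

set_option maxHeartbeats 1000000 in
/-- Absorption of the errors in the energy estimate. -/
theorem absorb {C c ε K M ρ Λ lamL L N V V1 G S Su En : ℝ} (hC : 1 ≤ C) (hc : 0 < c) (hc1 : c ≤ 1)
    (hε : ε = c / (40000 * C ^ 4)) (hK : K = 4 * C ^ 2 / ε)
    (hM : 0 ≤ M) (hρ : ρ = ε / (10 * (C + M + 1)))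
    (hL : 0 ≤ L) (hN : 0 ≤ N) (hV : 0 ≤ V) (hV1 : 0 ≤ V1) (hG : 0 ≤ G) (hSu : 0 ≤ Su)
    (hEn1 : c / 2 * N ^ 2 ≤ En) (hEn2 : En ≤ C * N ^ 2) (hSS : S ≤ Su + V1)
    (hLY : L ≤ ρ * (N + V + G)) (hVY : V1 ≤ ρ * (N + V + G))
    (hE : Λ * En + c / 3 * V ^ 2 + K / 2 * Su ^ 2 ≤
      C * ((ε * N + S) * (N + V) + V1 * (V1 + V + N) + N * G) + M * (L + V1) * (N + V + V1))
    (hlam : lamL ≤ C * (N + V + V1 + G) + M * L)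
    (hco : N ≤ C * (G + |Λ| * L + V + V1 + ε * N + S + ε * lamL) + M * (L + V1))
    (hΛ : -ε ≤ Λ) : N ≤ 40000 * C ^ 4 / c * G ∧ V ≤ (40000 * C ^ 4 / c) ^ 2 * G := by
  have hε0 : 0 < ε := by rw [hε]; positivity
  have hC4 : 1 ≤ C ^ 4 := one_le_pow₀ hC
  have hεc : ε * (40000 * C ^ 4) = c := by rw [hε]; field_simp
  have hεC : ε * C ≤ c / 40000 := by
    have := mul_le_mul_of_nonneg_left (le_self_pow₀ hC (by norm_num) : C ≤ C ^ 4) hε0.le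
    linarith
  have hεC2 : ε * C ^ 2 ≤ c / 40000 := by
    have := mul_le_mul_of_nonneg_left (pow_le_pow_right₀ hC (by norm_num) : C ^ 2 ≤ C ^ 4) hε0.le
    linarith
  have hεC3 : ε * C ^ 3 ≤ c / 40000 := by
    have := mul_le_mul_of_nonneg_left (pow_le_pow_right₀ hC (by norm_num) : C ^ 3 ≤ C ^ 4) hε0.le
    linarith
  have hε1 : ε ≤ 1 / 40000 := by
    have := mul_le_mul_of_nonneg_left hC4 hε0.le
    linarith
  have hρ0 : 0 < ρ := by rw [hρ]; positivity
  have hρe : ρ * (C + M + 1) = ε / 10 := by rw [hρ]; field_simp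
  have hρC0 : 0 ≤ ρ * C := by positivity
  have hρM0 : 0 ≤ ρ * M := by positivity
  have hρC : ρ * C ≤ ε / 10 := by linarith
  have hρM : ρ * M ≤ ε / 10 := by linarith
  have hρ1 : ρ ≤ ε / 10 := by linarith
  obtain ⟨Y, hY⟩ : ∃ Y, Y = N + V + G := ⟨_, rfl⟩
  rw [← hY] at hLY hVY
  have hY0 : 0 ≤ Y := by rw [hY]; positivity
  have hNY : N ≤ Y := by linarith
  have hVYY : V ≤ Y := by linarith
  have hGY : G ≤ Y := by linarith
  have hρY : ∀ {a x : ℝ}, 0 ≤ a → ρ * a ≤ ε / 10 → x ≤ ρ * Y → a * x ≤ ε / 10 * Y := by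
    intro a x ha h1 h2
    calc a * x ≤ a * (ρ * Y) := by gcongr
      _ = ρ * a * Y := by ring
      _ ≤ _ := by gcongr
  have k1 : C * V1 ≤ ε / 10 * Y := hρY (by linarith) hρC hVY
  have k2 : M * L ≤ ε / 10 * Y := hρY hM hρM hLY
  have k3 : M * V1 ≤ ε / 10 * Y := hρY hM hρM hVY
  have k4 : C * L ≤ ε / 10 * Y := hρY (by linarith) hρC hLY
  have hV1Y : V1 ≤ Y := hVY.trans (by
    have : ρ * Y ≤ 1 * Y := by gcongr; linarith only [hρ1, hε1]
    linarith)
  -- the energy inequality with all errors collected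
  have E1 : C * ((ε * N + S) * (N + V) + V1 * (V1 + V + N) + N * G) + M * (L + V1) * (N + V + V1) ≤
      C * Su * (N + V) + C * (N * G) + 4 * (C * ε) * Y ^ 2 := by
    have a1 : C * V1 * (N + V) ≤ ε / 10 * Y * (2 * Y) := by gcongr; linarith only [hNY, hVYY]
    have a2 : C * V1 * (V1 + V + N) ≤ ε / 10 * Y * (3 * Y) := by gcongr; linarith only [hNY, hVYY, hV1Y]
    have a3 : (M * L + M * V1) * (N + V + V1) ≤ (ε / 10 * Y + ε / 10 * Y) * (3 * Y) := by
      gcongr; linarith only [hNY, hVYY, hV1Y]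
    have a4 : C * ε * (N * (N + V)) ≤ C * ε * (Y * (2 * Y)) := by gcongr; linarith only [hNY, hVYY]
    have a5 : C * (S * (N + V)) ≤ C * ((Su + V1) * (N + V)) := by gcongr
    have a6 : 1 * (ε * Y ^ 2) ≤ C * (ε * Y ^ 2) := by gcongr
    have a7 : 0 ≤ ε * Y ^ 2 := by positivity
    linarith only [a1, a2, a3, a4, a5, a6, a7]
  have E2 : C * Su * (N + V) ≤ K / 4 * Su ^ 2 + ε * Y ^ 2 := by
    have b1 : K / 4 = C ^ 2 / ε := by rw [hK]; ring
    have b2 : C * Su * (N + V) ≤ C * Su * Y := by gcongr; linarith only [hY, hG]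
    have b3 : C * Su * Y ≤ C ^ 2 / ε * Su ^ 2 + ε * Y ^ 2 := by
      have : C ^ 2 / ε * Su ^ 2 + ε * Y ^ 2 - C * Su * Y =
          ((C * Su - ε * Y) ^ 2 + C * Su * (ε * Y)) / ε := by
        field_simp
        ring
      have h0 : 0 ≤ ((C * Su - ε * Y) ^ 2 + C * Su * (ε * Y)) / ε := by positivity
      linarith only [this, h0]
    rw [b1]; linarith only [b2, b3]
  have hYY : Y ^ 2 ≤ 3 * (N ^ 2 + V ^ 2 + G ^ 2) := by
    rw [hY]
    linarith only [sq_nonneg (N - V), sq_nonneg (N - G), sq_nonneg (V - G)]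
  have hC0 : 0 ≤ C := le_trans zero_le_one hC
  have E3 : Λ * En + c / 6 * V ^ 2 + K / 4 * Su ^ 2 ≤
      C * (N * G) + 15 * (C * ε) * (N ^ 2 + G ^ 2) := by
    have a6 : 1 * (ε * Y ^ 2) ≤ C * (ε * Y ^ 2) := by gcongr
    have a7 : 5 * (C * ε) * Y ^ 2 ≤ 5 * (C * ε) * (3 * (N ^ 2 + V ^ 2 + G ^ 2)) := by gcongr
    have a8 : 15 * (C * ε) * V ^ 2 ≤ c / 6 * V ^ 2 := by
      gcongr
      linarith only [hεC, hc]
    linarith only [a6, a7, a8, E1, E2, hE]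
  have hK4 : c / 6 ≤ K / 4 := by
    have : K / 4 = C ^ 2 / ε := by rw [hK]; ring
    have hC2 : 1 ≤ C ^ 2 := one_le_pow₀ hC
    have : c * ε ≤ 1 * 1 := by gcongr; linarith only [hε1]
    rw [‹K / 4 = C ^ 2 / ε›, le_div_iff₀ hε0]
    linarith only [this, hC2]
  obtain ⟨Q, hQ⟩ : ∃ Q, Q = 40000 * C ^ 4 / c := ⟨_, rfl⟩
  rw [← hQ]
  have hQc : Q * c = 40000 * C ^ 4 := by rw [hQ]; field_simp
  have hQ1 : 40000 ≤ Q := by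
    rw [hQ, le_div_iff₀ hc]
    linarith only [hC4, hc1]
  have hCQ : C * 40000 ≤ c * Q := by
    have : C ≤ C ^ 4 := le_self_pow₀ hC (by norm_num)
    linarith
  -- main claim
  have main : N ≤ Q * G := by
    by_contra hlt
    push Not at hlt
    have hN0 : 0 < N := lt_of_le_of_lt (by positivity) hlt
    have hGN : G * 40000 ≤ N := by
      have : 40000 * G ≤ Q * G := by gcongr
      linarith only [this, hlt]
    have hG2 : G ^ 2 ≤ N ^ 2 := by gcongr; linarith only [hGN, hG]
    have hNN : 0 < N ^ 2 := by positivity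
    have g1 : C * (N * G) * 40000 ≤ c * N ^ 2 := by
      calc C * (N * G) * 40000 = (C * 40000) * (N * G) := by ring
        _ ≤ (c * Q) * (N * G) := by gcongr
        _ = c * N * (Q * G) := by ring
        _ ≤ c * N * N := by gcongr
        _ = _ := by ring
    have g2 : 15 * (C * ε) * (N ^ 2 + G ^ 2) ≤ 30 * (c / 40000) * N ^ 2 := by
      have : C * ε * (N ^ 2 + G ^ 2) ≤ (c / 40000) * (2 * N ^ 2) := by
        exact mul_le_mul (by linarith only [hεC]) (by linarith only [hG2]) (by positivity)
          (by positivity)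
      linarith only [this]
    by_cases h1 : 1 ≤ Λ
    · have : c / 2 * N ^ 2 ≤ Λ * En := by
        have : 0 ≤ En := le_trans (by positivity) hEn1
        have : 1 * En ≤ Λ * En := by gcongr
        linarith only [this, hEn1]
      have v : 0 ≤ c / 6 * V ^ 2 := by positivity
      have s : 0 ≤ K / 4 * Su ^ 2 := mul_nonneg (by linarith) (sq_nonneg _)
      have : 0 < c * N ^ 2 := by positivity
      linarith only [‹c / 2 * N ^ 2 ≤ Λ * En›, v, s, this, g1, g2, E3]
    · push Not at h1
      have hΛ1 : |Λ| ≤ 1 := abs_le.2 ⟨by linarith, h1.le⟩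
      have e1 : -(c / 40000 * N ^ 2) ≤ Λ * En := by
        have hEn0 : 0 ≤ En := le_trans (by positivity) hEn1
        have : -ε * En ≤ Λ * En := by gcongr
        have h2 : ε * En ≤ ε * (C * N ^ 2) := by gcongr
        have h3 : (ε * C) * N ^ 2 ≤ c / 40000 * N ^ 2 := by gcongr
        linarith only [this, h2, h3]
      have e2 : c / 6 * (V ^ 2 + Su ^ 2) ≤ C * (N * G) + 16 * (C * ε) * (N ^ 2 + G ^ 2) := by
        have hEn0 : 0 ≤ En := le_trans (by positivity) hEn1
        have t1 : -ε * En ≤ Λ * En := by gcongr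
        have t2 : ε * En ≤ ε * (C * N ^ 2) := by gcongr
        have t3 : c / 6 * Su ^ 2 ≤ K / 4 * Su ^ 2 := by gcongr
        have t4 : 0 ≤ C * ε * G ^ 2 := by positivity
        linarith only [t1, t2, t3, t4, E3]
      have e3 : N ≤ C * (G + V + Su) + 5 * (C ^ 2 * ε) * Y := by
        have hee : 1 * ε ≤ C * ε := by gcongr
        have hCC : 1 * (C * ε) ≤ C * (C * ε) := by gcongr
        have c1 : C * (|Λ| * L) ≤ ε / 10 * Y := by
          have : |Λ| * L ≤ 1 * L := by gcongr
          have : C * (|Λ| * L) ≤ C * (1 * L) := by gcongr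
          linarith only [this, k4]
        have c2 : C * S ≤ C * Su + ε / 10 * Y := by
          have : C * S ≤ C * (Su + V1) := by gcongr
          linarith only [this, k1]
        have c3 : C * (ε * N) ≤ C * ε * Y := by
          rw [← mul_assoc]; gcongr
        have c4 : lamL ≤ C * Y + ε / 5 * Y := by
          have : C * (N + V + V1 + G) = C * Y + C * V1 := by rw [hY]; ring
          have : C * V1 + M * L ≤ ε / 5 * Y := by linarith only [k1, k2]
          linarith only [this, hlam, ‹C * (N + V + V1 + G) = C * Y + C * V1›]
        have c5 : C * (ε * lamL) ≤ C ^ 2 * ε * Y + C * ε * Y := by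
          have h1 : C * (ε * lamL) ≤ C * ε * (C * Y + ε / 5 * Y) := by
            rw [← mul_assoc]; gcongr
          have h2 : C * ε * (ε / 5 * Y) ≤ C * ε * (1 * Y) := by gcongr; linarith only [hε1, hε0]
          linarith only [h1, h2]
        have c6 : C * ε * Y ≤ C ^ 2 * ε * Y := by
          linarith only [mul_le_mul_of_nonneg_right hCC hY0]
        have c7 : ε * Y ≤ C ^ 2 * ε * Y := by
          linarith only [c6, mul_le_mul_of_nonneg_right hee hY0]
        have c8 : 0 ≤ C ^ 2 * ε * Y := by positivity
        linarith only [hco, c1, c2, c3, c5, c6, c7, c8, k1, k2, k3]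
      have e4 : N ≤ 2 * C * (G + V + Su) := by
        have d1 : 5 * (C ^ 2 * ε) * Y ≤ 5 * (1 / 40000) * Y := by
          gcongr
          linarith only [hεC2, hc1]
        have d2 : 1 * (G + V) ≤ C * (G + V) := by gcongr
        have d3 : 0 ≤ C * Su := by positivity
        rw [hY] at d1 e3
        linarith only [d1, d2, d3, e3, hG, hV, hN]
      have e5 : N ^ 2 ≤ 12 * C ^ 2 * (G ^ 2 + (V ^ 2 + Su ^ 2)) := by
        calc N ^ 2 ≤ (2 * C * (G + V + Su)) ^ 2 := by gcongr
          _ = 4 * C ^ 2 * (G + V + Su) ^ 2 := by ring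
          _ ≤ 4 * C ^ 2 * (3 * (G ^ 2 + (V ^ 2 + Su ^ 2))) := by
            gcongr
            linarith only [sq_nonneg (G - V), sq_nonneg (G - Su), sq_nonneg (V - Su)]
          _ = _ := by ring
      have e6 : c * N ^ 2 ≤ 12 * C ^ 2 * (c * G ^ 2) +
          72 * C ^ 2 * (C * (N * G) + 16 * (C * ε) * (N ^ 2 + G ^ 2)) := by
        have t1 := mul_le_mul_of_nonneg_left e5 hc.le
        have t2 := mul_le_mul_of_nonneg_left e2 (by positivity : 0 ≤ 72 * C ^ 2)
        linarith only [t1, t2]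
      have f1 : 12 * C ^ 2 * (c * G ^ 2) ≤ c * N ^ 2 / 100 := by
        have h1 : C ^ 2 * G ^ 2 * 40000 ≤ N * N := by
          have : C ^ 2 ≤ C ^ 4 := pow_le_pow_right₀ hC (by norm_num)
          have h2 : C ^ 2 * 40000 ≤ Q := by
            have : Q * c ≤ Q * 1 := by gcongr
            linarith only [this, hQc, ‹C ^ 2 ≤ C ^ 4›]
          have h3 : C ^ 2 * 40000 * G ≤ Q * G := by gcongr
          have h3 : C ^ 2 * 40000 * G ≤ N := h3.trans hlt.le
          have h4 : G ≤ N := by linarith only [hGN, hG]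
          calc C ^ 2 * G ^ 2 * 40000 = (C ^ 2 * 40000 * G) * G := by ring
            _ ≤ N * N := by gcongr
        have := mul_le_mul_of_nonneg_left h1 hc.le
        linarith only [this, mul_nonneg hc.le (sq_nonneg N)]
      have f2 : 72 * C ^ 2 * (C * (N * G)) ≤ c * N ^ 2 / 100 := by
        have : C ^ 3 ≤ C ^ 4 := pow_le_pow_right₀ hC (by norm_num)
        calc 72 * C ^ 2 * (C * (N * G)) = 72 * C ^ 3 * (N * G) := by ring
          _ ≤ (c * Q / 100) * (N * G) := by
            gcongr
            linarith only [this, hQc, hC4]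
          _ = c * N / 100 * (Q * G) := by ring
          _ ≤ c * N / 100 * N := by gcongr
          _ = _ := by ring
      have f3 : 72 * C ^ 2 * (16 * (C * ε) * (N ^ 2 + G ^ 2)) ≤ c * N ^ 2 / 10 := by
        have h1 : C ^ 3 * ε * (N ^ 2 + G ^ 2) ≤ (c / 40000) * (1.1 * N ^ 2) := by
          refine mul_le_mul (by linarith only [hεC3]) ?_ (by positivity) (by positivity)
          have : G ^ 2 ≤ (N / 40000) ^ 2 := by gcongr; linarith only [hGN]
          linarith only [this, sq_nonneg N]
        linarith only [h1, mul_nonneg hc.le (sq_nonneg N)]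
      have : 0 < c * N ^ 2 := by positivity
      linarith only [this, e6, f1, f2, f3]
  refine ⟨main, ?_⟩
  by_contra hlt
  push Not at hlt
  have hQ0 : 0 < Q := by linarith only [hQ1]
  have hV0 : 0 < V := lt_of_le_of_lt (by positivity) hlt
  have hNV : N * Q ≤ V := by
    have : N * Q ≤ Q * G * Q := by gcongr
    linarith only [this, hlt]
  have hGV : G * Q ^ 2 ≤ V := by linarith only [hlt]
  have hN2 : N * 40000 ≤ V := by
    have : N * 40000 ≤ N * Q := by gcongr
    linarith only [this, hNV]
  have hG2 : G * 40000 ≤ V := by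
    have : G * 40000 ≤ G * Q ^ 2 := by
      gcongr
      have : Q ^ 1 ≤ Q ^ 2 := pow_le_pow_right₀ (by linarith only [hQ1]) (by norm_num)
      linarith only [this, hQ1]
    linarith only [this, hGV]
  have s : 0 ≤ K / 4 * Su ^ 2 := mul_nonneg (by linarith) (sq_nonneg _)
  have t1 : -(ε * C) * V ^ 2 ≤ Λ * En := by
    have hEn0 : 0 ≤ En := le_trans (by positivity) hEn1
    have t1 : -ε * En ≤ Λ * En := by gcongr
    have t2 : ε * En ≤ ε * (C * N ^ 2) := by gcongr
    have : ε * (C * N ^ 2) ≤ ε * (C * V ^ 2) := by gcongr; linarith only [hN2, hN]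
    linarith only [this, t1, t2]
  have t2 : C * (N * G) * 40000 ≤ c * V ^ 2 := by
    calc C * (N * G) * 40000 = (C * 40000) * (N * G) := by ring
        _ ≤ (c * Q) * (N * G) := by gcongr
        _ = c * (N * Q) * G := by ring
        _ ≤ c * V * V := by gcongr; linarith only [hG2, hG]
        _ = _ := by ring
  have t3 : 15 * (C * ε) * (N ^ 2 + G ^ 2) ≤ 30 * (c / 40000) * V ^ 2 := by
    have : C * ε * (N ^ 2 + G ^ 2) ≤ (c / 40000) * (2 * V ^ 2) := by
      refine mul_le_mul (by linarith only [hεC]) ?_ (by positivity) (by positivity)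
      have h1 : G ^ 2 ≤ V ^ 2 := by gcongr; linarith only [hG2, hG]
      have h2 : N ^ 2 ≤ V ^ 2 := by gcongr; linarith only [hN2, hN]
      linarith only [h1, h2]
    linarith only [this]
  have t4 : ε * C * V ^ 2 ≤ c / 40000 * V ^ 2 := by gcongr
  have : 0 < c * V ^ 2 := by positivity
  linarith only [this, t1, t2, t3, t4, s, E3]

end Absorption

section EnergyEstimate

theorem energy_sum_le {C ε k M n1 n0 p2 p1 p0 s1 s0 N V V1 S L G g g1 par low : ℝ} (hC : 1 ≤ C)
    (hε : 0 ≤ ε) (hε1 : ε ≤ 1) (hk : 0 ≤ k) (hM : 0 ≤ M)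
    (hn1 : 0 ≤ n1) (hn0 : 0 ≤ n0) (hp2 : 0 ≤ p2) (hp1 : 0 ≤ p1) (hp0 : 0 ≤ p0) (hs1 : 0 ≤ s1)
    (hs0 : 0 ≤ s0) (hg : 0 ≤ g) (hg1 : 0 ≤ g1) (hlow0 : 0 ≤ low)
    (hsn1 : s1 ≤ n1) (hsn0 : s0 ≤ n0) (hN : N = n1 + k * n0) (hV : V = p2 + k * p1 + k ^ 2 * p0)
    (hV1 : V1 = p1 + k * p0) (hS : S = s1 + k * s0) (hL : L = n0) (hG : G = g1 + (1 + k) * g)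
    (hpar : par ≤ 2 * C * V) (hlow : low ≤ C * (ε * N + S) + C * V1 + M * (L + V1)) :
    ((ε * n1 + C * s1) * n1 + ε * n1 ^ 2 + M * n1 * p1 + M * n1 * n0 +
        k * (ε * n0 + C * s0) * n1 + p2 * low + n1 * g1 +
        C * (ε * n1 + C * s1) * (C * n1 + C * k * n0 + M * n0 + g) +
        C * ((ε + C) * p1) * (par + low)) +
      k ^ 2 * ((ε * n0 + C * s0) * n0 + ε * n0 ^ 2 + M * n0 * p0 + p0 * low + n0 * g) +
      4 * C * (p1 + k * p0) * ((p1 + k * p0) + (p2 + k * p1 + k ^ 2 * p0)) ≤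
    10 * C ^ 4 * ((ε * N + S) * (N + V) + V1 * (V1 + V + N) + N * G) +
      10 * C ^ 4 * M * (L + V1) * (N + V + V1) := by
  have hC0 : 0 ≤ C := le_trans zero_le_one hC
  have kn0 : 0 ≤ k * n0 := by positivity
  have kp0 : 0 ≤ k * p0 := by positivity
  have kp1 : 0 ≤ k * p1 := by positivity
  have kkp0 : 0 ≤ k ^ 2 * p0 := by positivity
  have ks0 : 0 ≤ k * s0 := by positivity
  have N0 : 0 ≤ N := by rw [hN]; positivity
  have V0 : 0 ≤ V := by rw [hV]; positivity
  have V10 : 0 ≤ V1 := by rw [hV1]; positivity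
  have S0 : 0 ≤ S := by rw [hS]; positivity
  have L0 : 0 ≤ L := by rw [hL]; positivity
  have G0 : 0 ≤ G := by rw [hG]; positivity
  have hSN : S ≤ N := by rw [hS, hN]; gcongr
  obtain ⟨X, hX⟩ : ∃ X, X = ε * N + S := ⟨_, rfl⟩
  have X0 : 0 ≤ X := by rw [hX]; positivity
  have hXN : X ≤ 2 * N := by
    have : ε * N ≤ 1 * N := by gcongr
    linarith only [this, hSN, hX]
  have n1N : n1 ≤ N := by linarith only [hN, kn0]
  have n0N : k * n0 ≤ N := by linarith only [hN, hn1]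
  have p1V : p1 ≤ V1 := by linarith only [hV1, kp0]
  have p0V : k * p0 ≤ V1 := by linarith only [hV1, hp1]
  have h1X : ε * n1 + C * s1 + k * (ε * n0 + C * s0) ≤ C * X := by
    have : 1 * (ε * N) ≤ C * (ε * N) := by gcongr
    rw [hX, mul_add]
    rw [hN] at this ⊢
    rw [hS]
    linarith only [this]
  have x1 : 0 ≤ ε * n1 + C * s1 := by positivity
  have x0 : 0 ≤ k * (ε * n0 + C * s0) := by positivity
  have h2X : ε * n1 + C * s1 ≤ C * X := by linarith only [h1X, x0]
  have h3X : k * (ε * n0 + C * s0) ≤ C * X := by linarith only [h1X, x1]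
  have hεN : ε * N ≤ X := by linarith only [hX, S0]
  rw [← hX] at hlow ⊢
  obtain ⟨B, hB⟩ : ∃ B, B = C * X + C * V1 + M * (L + V1) := ⟨_, rfl⟩
  rw [← hB] at hlow
  have B0 : 0 ≤ B := hlow0.trans hlow
  have a : (ε * n1 + C * s1) * n1 + k ^ 2 * ((ε * n0 + C * s0) * n0) ≤ C * X * N := by
    calc _ = (ε * n1 + C * s1) * n1 + (k * (ε * n0 + C * s0)) * (k * n0) := by ring
      _ ≤ (ε * n1 + C * s1) * N + (k * (ε * n0 + C * s0)) * N := by gcongr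
      _ = (ε * n1 + C * s1 + k * (ε * n0 + C * s0)) * N := by ring
      _ ≤ _ := by gcongr
  have b : ε * n1 ^ 2 + k ^ 2 * (ε * n0 ^ 2) ≤ X * N := by
    calc _ = ε * n1 * n1 + ε * (k * n0) * (k * n0) := by ring
      _ ≤ ε * n1 * N + ε * (k * n0) * N := by gcongr
      _ = ε * N * N := by rw [hN]; ring
      _ ≤ _ := by gcongr
  have c : M * n1 * p1 + k ^ 2 * (M * n0 * p0) ≤ M * N * V1 := by
    calc _ = M * n1 * p1 + M * (k * n0) * (k * p0) := by ring
      _ ≤ M * n1 * V1 + M * (k * n0) * V1 := by gcongr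
      _ = _ := by rw [hN]; ring
  have d : M * n1 * n0 ≤ M * N * L := by rw [hL]; gcongr
  have e : k * (ε * n0 + C * s0) * n1 ≤ C * X * N := by gcongr
  have f : p2 * low + k ^ 2 * (p0 * low) ≤ V * B := by
    calc _ = (p2 + k ^ 2 * p0) * low := by ring
      _ ≤ V * B := by gcongr; linarith only [hV, kp1]
  have gg : n1 * g1 + k ^ 2 * (n0 * g) ≤ N * G := by
    have h1 : 0 ≤ k * g := by positivity
    calc _ = n1 * g1 + (k * n0) * (k * g) := by ring
      _ ≤ N * g1 + N * (k * g) := by gcongr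
      _ = N * (g1 + k * g) := by ring
      _ ≤ N * G := by gcongr; linarith only [hG, hg]
  have h : C * (ε * n1 + C * s1) * (C * n1 + C * k * n0 + M * n0 + g) ≤
      C ^ 2 * (C * (X * N) + 2 * N * (M * L) + 2 * N * G) := by
    have h1 : 0 ≤ k * g := by positivity
    have h2 : C * n1 + C * k * n0 + M * n0 + g ≤ C * N + M * L + G := by
      rw [hN, hL, hG]
      linarith only [h1, hg1]
    calc _ ≤ C * (C * X) * (C * N + M * L + G) := by gcongr
      _ = C ^ 2 * (C * (X * N) + X * (M * L) + X * G) := by ring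
      _ ≤ _ := by gcongr
  have i : C * ((ε + C) * p1) * (par + low) ≤ 2 * C ^ 2 * V1 * (2 * C * V + B) := by
    calc _ ≤ C * ((ε + C) * p1) * (2 * C * V + B) := by gcongr
      _ ≤ C * ((C + C) * V1) * (2 * C * V + B) := by gcongr; exact hε1.trans hC
      _ = _ := by ring
  have hi : 2 * C ^ 2 * V1 * (2 * C * V + B) ≤ 2 * C ^ 2 * V1 * (2 * C * V +
      (C * (2 * N) + C * V1 + M * (L + V1))) := by rw [hB]; gcongr
  rw [hB] at f
  rw [← hV1, ← hV]
  have D1 : C ≤ C ^ 4 := le_self_pow₀ hC (by norm_num)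
  have D2 : C ^ 2 ≤ C ^ 4 := pow_le_pow_right₀ hC (by norm_num)
  have D3 : C ^ 3 ≤ C ^ 4 := pow_le_pow_right₀ hC (by norm_num)
  have D4 : 1 ≤ C ^ 4 := one_le_pow₀ hC
  have m1 := mul_le_mul_of_nonneg_right (by linarith only [D1, D3, D4] :
    2 * C + 1 + C ^ 3 ≤ 10 * C ^ 4) (by positivity : 0 ≤ X * N)
  have m2 := mul_le_mul_of_nonneg_right (by linarith only [D1, D3, D4] :
    C ≤ 10 * C ^ 4) (by positivity : 0 ≤ X * V)
  have m3 := mul_le_mul_of_nonneg_right (by linarith only [D1, D3, D4] :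
    5 * C + 4 * C ^ 3 ≤ 10 * C ^ 4) (by positivity : 0 ≤ V1 * V)
  have m4 := mul_le_mul_of_nonneg_right (by linarith only [D1, D3, D4] :
    4 * C ^ 3 ≤ 10 * C ^ 4) (by positivity : 0 ≤ V1 * N)
  have m5 := mul_le_mul_of_nonneg_right (by linarith only [D1, D3, D4] :
    4 * C + 2 * C ^ 3 ≤ 10 * C ^ 4) (by positivity : 0 ≤ V1 * V1)
  have m6 := mul_le_mul_of_nonneg_right (by linarith only [D2, D4] :
    1 + 2 * C ^ 2 ≤ 10 * C ^ 4) (by positivity : 0 ≤ N * G)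
  have m7 := mul_le_mul_of_nonneg_right (by linarith only [D2, D4] :
    1 ≤ 10 * C ^ 4) (by positivity : 0 ≤ M * (N * V1))
  have m8 := mul_le_mul_of_nonneg_right (by linarith only [D2, D4] :
    1 + 2 * C ^ 2 ≤ 10 * C ^ 4) (by positivity : 0 ≤ M * (N * L))
  have m9 := mul_le_mul_of_nonneg_right (by linarith only [D2, D4] :
    1 ≤ 10 * C ^ 4) (by positivity : 0 ≤ M * (V * (L + V1)))
  have m10 := mul_le_mul_of_nonneg_right (by linarith only [D2, D4] :
    2 * C ^ 2 ≤ 10 * C ^ 4) (by positivity : 0 ≤ M * (V1 * (L + V1)))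
  linarith only [a, b, c, d, e, f, gg, h, i, hi, m1, m2, m3, m4, m5, m6, m7, m8, m9, m10]

variable {H : Type*} [NormedAddCommGroup H] [InnerProductSpace ℂ H]

theorem Coefs.Bounds.norm_pr_sq_le {Δ : SkewRel H} {q : Coefs H} {k c C ε : ℝ}
    (h : q.Bounds Δ k c C ε) {w w1 w2 : H} (hw : Δ.D w w1) (hw1 : Δ.D w1 w2) :
    ‖q.pr w1‖ ^ 2 ≤ ‖q.pr w‖ * ‖q.pr w2‖ := by
  have := Δ.rI_skew (h.pr_D _ _ hw) (h.pr_D _ _ hw1)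
  rw [rI_self] at this
  rw [this]
  linarith [neg_le_rI (q.pr w) (q.pr w2)]

variable (H) in
/-- The uniform a priori estimate at high frequency. -/
theorem energy_estimate {C c : ℝ} (hC : 1 ≤ C) (hc : 0 < c) :
    ∃ ε K : ℝ, 0 < ε ∧ ε ≤ 1 ∧ 0 < K ∧ ∀ M : ℝ, 0 ≤ M → ∃ R C' : ℝ, 0 < R ∧ 0 < C' ∧
      ∀ (Δ : SkewRel H) (q : Coefs H) (k : ℝ), 0 ≤ k → q.Bounds Δ k c C ε →
        q.Damped Δ k C ε K M → ∀ (lam : ℂ) (w w1 w2 r g g1 : H), Δ.D w w1 → Δ.D w1 w2 → Δ.D g g1 →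
          q.pr r = r → ‖r‖ ≤ M * (‖w‖ + ‖q.pr w1‖ + k * ‖q.pr w‖) → q.Eqn lam w w1 w2 r g →
          -ε ≤ lam.re → R ≤ max k ‖lam‖ →
          ‖w1‖ + (1 + k) * ‖w‖ ≤ C' * (‖g1‖ + (1 + k) * ‖g‖) := by
  obtain ⟨D, hD⟩ : ∃ D, D = 10 * C ^ 4 := ⟨_, rfl⟩
  obtain ⟨c', hc'⟩ : ∃ c', c' = min c 1 := ⟨_, rfl⟩
  have hC4 : 1 ≤ C ^ 4 := one_le_pow₀ hC
  have hC0 : 0 ≤ C := le_trans zero_le_one hC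
  have hD10 : 10 ≤ D := by linarith only [hD, hC4]
  have hD1 : 1 ≤ D := by linarith only [hD10]
  have hD0 : 0 < D := by linarith only [hD1]
  have hc0' : 0 < c' := by rw [hc']; positivity
  have hc1' : c' ≤ 1 := by rw [hc']; exact min_le_right _ _
  have hcc' : c' ≤ c := by rw [hc']; exact min_le_left _ _
  obtain ⟨ε, hε⟩ : ∃ ε, ε = c' / (40000 * D ^ 4) := ⟨_, rfl⟩
  obtain ⟨K, hK⟩ : ∃ K, K = 4 * D ^ 2 / ε := ⟨_, rfl⟩
  have hε0 : 0 < ε := by rw [hε]; positivity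
  have hε1 : ε ≤ 1 := by
    rw [hε, div_le_one (by positivity)]
    have : 1 ≤ D ^ 4 := one_le_pow₀ hD1
    linarith only [this, hc1']
  have hK0 : 0 < K := by rw [hK]; positivity
  refine ⟨ε, K, hε0, hε1, hK0, fun M hM => ?_⟩
  obtain ⟨M', hM'⟩ : ∃ M', M' = D * (M + 1) ^ 2 := ⟨_, rfl⟩
  have hM0' : 0 ≤ M' := by rw [hM']; positivity
  have hMM2 : 1 ≤ (M + 1) ^ 2 := one_le_pow₀ (by linarith only [hM])
  have hDM' : D * M ≤ M' := by rw [hM']; gcongr; nlinarith only [hM]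
  obtain ⟨ρ, hρ⟩ : ∃ ρ, ρ = ε / (10 * (D + M' + 1)) := ⟨_, rfl⟩
  have hρ0 : 0 < ρ := by rw [hρ]; positivity
  have hρ1 : ρ ≤ 1 := by
    rw [hρ, div_le_one (by positivity)]
    linarith only [hM0', hε1, hD0]
  obtain ⟨Q, hQ⟩ : ∃ Q, Q = 40000 * D ^ 4 / c' := ⟨_, rfl⟩
  have hQ0 : 0 < Q := by rw [hQ]; positivity
  refine ⟨M' + D + 8 * D / ρ ^ 2, Q + ρ * (Q + Q ^ 2 + 1), by positivity, by positivity, ?_⟩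
  intro Δ q k hk hB hd lam w w1 w2 r g g1 hw hw1 hg hr hrle he hlam hR
  obtain ⟨N, hN⟩ : ∃ N, N = ‖w1‖ + k * ‖w‖ := ⟨_, rfl⟩
  obtain ⟨V, hV⟩ : ∃ V, V = ‖q.pr w2‖ + k * ‖q.pr w1‖ + k ^ 2 * ‖q.pr w‖ := ⟨_, rfl⟩
  obtain ⟨V1, hV1⟩ : ∃ V1, V1 = ‖q.pr w1‖ + k * ‖q.pr w‖ := ⟨_, rfl⟩
  obtain ⟨S, hS⟩ : ∃ S, S = ‖q.sg w1‖ + k * ‖q.sg w‖ := ⟨_, rfl⟩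
  obtain ⟨Su, hSu⟩ : ∃ Su, Su = ‖q.sg (w1 - q.pr w1)‖ + k * ‖q.sg (w - q.pr w)‖ := ⟨_, rfl⟩
  obtain ⟨L, hL⟩ : ∃ L, L = ‖w‖ := ⟨_, rfl⟩
  obtain ⟨G, hG⟩ : ∃ G, G = ‖g1‖ + (1 + k) * ‖g‖ := ⟨_, rfl⟩
  obtain ⟨En, hEn⟩ : ∃ En, En = rI w1 (q.a0 w1) + k ^ 2 * rI w (q.a0 w) := ⟨_, rfl⟩
  have N0 : 0 ≤ N := by rw [hN]; positivity
  have V0 : 0 ≤ V := by rw [hV]; positivity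
  have V10 : 0 ≤ V1 := by rw [hV1]; positivity
  have S0 : 0 ≤ S := by rw [hS]; positivity
  have L0 : 0 ≤ L := by rw [hL]; positivity
  have G0 : 0 ≤ G := by rw [hG]; positivity
  have Su0 : 0 ≤ Su := by rw [hSu]; positivity
  have hX0 : 0 ≤ ε * N + S := by positivity
  have hSN : S ≤ N := by
    rw [hS, hN]
    gcongr
    · exact hB.sg_le w1
    · exact hB.sg_le w
  have hεN : ε * N ≤ 1 * N := by gcongr
  have hgG : ‖g‖ ≤ G := by
    have : 0 ≤ k * ‖g‖ := by positivity
    rw [hG]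
    linarith only [this, norm_nonneg g1]
  have hint : V1 ^ 2 ≤ 4 * (L * V) := by
    have h1 := hB.norm_pr_sq_le hw hw1
    have h2 := hB.norm_pr_le w
    have h3 : ‖q.pr w1‖ ^ 2 ≤ L * V := by
      refine h1.trans ?_
      rw [hL, hV]
      have : 0 ≤ k * ‖q.pr w1‖ + k ^ 2 * ‖q.pr w‖ := by positivity
      gcongr
      linarith only [this]
    have h4 : (k * ‖q.pr w‖) ^ 2 ≤ L * V := by
      calc (k * ‖q.pr w‖) ^ 2 = ‖q.pr w‖ * (k ^ 2 * ‖q.pr w‖) := by ring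
        _ ≤ L * V := by
          rw [hL, hV]
          have : 0 ≤ ‖q.pr w2‖ + k * ‖q.pr w1‖ := by positivity
          gcongr
          linarith only [this]
    rw [hV1]
    linarith only [h3, h4, sq_nonneg (‖q.pr w1‖ - k * ‖q.pr w‖)]
  have hpar : ‖q.par w w1 w2‖ ≤ 2 * C * V := by
    refine (hB.norm_par_le w w1 w2).trans ?_
    rw [hV]
    have h1 : 0 ≤ C * ‖q.pr w2‖ := by positivity
    have h2 : 0 ≤ C * (k ^ 2 * ‖q.pr w‖) := by positivity
    linarith only [h1, h2]
  have hlow : ‖q.low w w1 r‖ ≤ C * (ε * N + S) + C * V1 + M * (L + V1) := by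
    refine (hB.norm_low_le w w1 r).trans ?_
    have h0 : 0 ≤ ε * N := by positivity
    have h1 : 1 * (ε * N) ≤ C * (ε * N) := by gcongr
    rw [hN] at h1
    rw [hN, hS, hV1, hL]
    linarith only [h1, hrle]
  have hEnergy : lam.re * En + c' / 3 * V ^ 2 + K / 2 * Su ^ 2 ≤
      D * ((ε * N + S) * (N + V) + V1 * (V1 + V + N) + N * G) + M' * (L + V1) * (N + V + V1) := by
    have t1 := hB.test_one hd hε0.le hC hw hw1 hg hr he
    have t0 := mul_le_mul_of_nonneg_left (hB.test_zero hd hε0.le hw hr he) (sq_nonneg k)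
    have t2 := hB.garding_two hk hC hw hw1
    have t3 := energy_sum_le hC hε0.le hε1 hk hM (norm_nonneg w1) (norm_nonneg w)
      (norm_nonneg (q.pr w2)) (norm_nonneg (q.pr w1)) (norm_nonneg (q.pr w)) (norm_nonneg (q.sg w1))
      (norm_nonneg (q.sg w)) (norm_nonneg g) (norm_nonneg g1) (norm_nonneg (q.low w w1 r))
      (hB.sg_le w1) (hB.sg_le w) hN hV hV1 hS hL hG hpar hlow
    have t4 : c' / 3 * V ^ 2 ≤
        c * (‖q.pr w2‖ ^ 2 + 2 * k ^ 2 * ‖q.pr w1‖ ^ 2 + k ^ 4 * ‖q.pr w‖ ^ 2) := by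
      have : V ^ 2 ≤ 3 * (‖q.pr w2‖ ^ 2 + 2 * k ^ 2 * ‖q.pr w1‖ ^ 2 + k ^ 4 * ‖q.pr w‖ ^ 2) := by
        rw [hV]
        linarith only [sq_nonneg (‖q.pr w2‖ - k * ‖q.pr w1‖),
          sq_nonneg (‖q.pr w2‖ - k ^ 2 * ‖q.pr w‖),
          sq_nonneg (k * ‖q.pr w1‖ - k ^ 2 * ‖q.pr w‖), sq_nonneg (k * ‖q.pr w1‖)]
      calc c' / 3 * V ^ 2 ≤ c / 3 * (3 * (‖q.pr w2‖ ^ 2 + 2 * k ^ 2 * ‖q.pr w1‖ ^ 2 +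
            k ^ 4 * ‖q.pr w‖ ^ 2)) := by gcongr
        _ = _ := by ring
    have t5 : K / 2 * Su ^ 2 ≤ K * ‖q.sg (w1 - q.pr w1)‖ ^ 2 +
        k ^ 2 * (K * ‖q.sg (w - q.pr w)‖ ^ 2) := by
      have : Su ^ 2 ≤ 2 * (‖q.sg (w1 - q.pr w1)‖ ^ 2 + (k * ‖q.sg (w - q.pr w)‖) ^ 2) := by
        rw [hSu]
        linarith only [sq_nonneg (‖q.sg (w1 - q.pr w1)‖ - k * ‖q.sg (w - q.pr w)‖)]
      have := mul_le_mul_of_nonneg_left this (by positivity : 0 ≤ K / 2)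
      linarith only [this]
    have t6 : D * M * (L + V1) * (N + V + V1) ≤ M' * (L + V1) * (N + V + V1) := by gcongr
    rw [hD] at t6 ⊢
    rw [hEn]
    linarith only [t0, t1, t2, t3, t4, t5, t6]
  have hEn1 : c' / 2 * N ^ 2 ≤ En := by
    have h1 := hB.a0_pos w1
    have h2 := mul_le_mul_of_nonneg_left (hB.a0_pos w) (sq_nonneg k)
    have h3 : N ^ 2 ≤ 2 * (‖w1‖ ^ 2 + k ^ 2 * ‖w‖ ^ 2) := by
      rw [hN]
      linarith only [sq_nonneg (‖w1‖ - k * ‖w‖)]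
    have h4 : c' / 2 * N ^ 2 ≤ c / 2 * (2 * (‖w1‖ ^ 2 + k ^ 2 * ‖w‖ ^ 2)) := by gcongr
    rw [hEn]
    linarith only [h1, h2, h4]
  have hDC : C ≤ D := by
    have := le_self_pow₀ hC (by norm_num : 4 ≠ 0)
    linarith only [this, hD, hC4]
  have hDC2 : 10 * C ^ 2 ≤ D := by
    have : C ^ 2 ≤ C ^ 4 := pow_le_pow_right₀ hC (by norm_num)
    linarith only [this, hD]
  have hDC1 : 10 * C ≤ D := by
    have := le_self_pow₀ hC (by norm_num : 4 ≠ 0)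
    linarith only [this, hD, hC4]
  have hEn2 : En ≤ D * N ^ 2 := by
    have h1 : rI w1 (q.a0 w1) ≤ ‖w1‖ * (C * ‖w1‖) :=
      (rI_le _ _).trans (by gcongr; exact hB.a0_le w1)
    have h2 : k ^ 2 * rI w (q.a0 w) ≤ k ^ 2 * (‖w‖ * (C * ‖w‖)) := by
      gcongr
      exact (rI_le _ _).trans (by gcongr; exact hB.a0_le w)
    have h3 : C * N ^ 2 ≤ D * N ^ 2 := by gcongr
    have h4 : 0 ≤ C * ‖w1‖ * (k * ‖w‖) := by positivity
    rw [hEn]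
    rw [hN] at h3 ⊢
    linarith only [h1, h2, h3, h4]
  have hSS : S ≤ Su + V1 := by
    have : ∀ f, ‖q.sg f‖ ≤ ‖q.sg (f - q.pr f)‖ + ‖q.pr f‖ := fun f => by
      have h1 : q.sg f = q.sg (f - q.pr f) + q.sg (q.pr f) := by rw [← map_add, sub_add_cancel]
      rw [h1]
      exact (norm_add_le _ _).trans (by gcongr; exact hB.sg_le _)
    have h0 := mul_le_mul_of_nonneg_left (this w) hk
    rw [hS, hSu, hV1]
    linarith only [this w1, h0]
  have hMV : M * V1 ≤ V + M ^ 2 * L := by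
    refine (abs_le_of_sq_le_sq' ?_ (by positivity)).2
    have := mul_le_mul_of_nonneg_left hint (sq_nonneg M)
    linarith only [this, sq_nonneg (V - M ^ 2 * L)]
  have hlamL : ‖lam‖ * L ≤ D * (N + V + V1 + G) + M' * L := by
    have h1 := hB.lam_le hd hC he
    have h2 : ‖g‖ + C * ‖w1‖ + C * k * ‖w‖ + M * ‖w‖ + ‖q.par w w1 w2‖ + ‖q.low w w1 r‖ ≤
        G + C * N + M * L + 2 * C * V + (C * (N + N) + C * V1 + M * L + (V + M ^ 2 * L)) := by
      have : C * (ε * N + S) ≤ C * (N + N) := by gcongr; linarith only [hεN]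
      rw [hN] at this hlow ⊢
      rw [hL] at hlow hMV ⊢
      linarith only [this, hlow, hMV, hgG, hpar]
    have h3 : C * (G + C * N + M * L + 2 * C * V + (C * (N + N) + C * V1 + M * L + (V + M ^ 2 * L)))
        = C * G + 3 * C ^ 2 * N + (2 * C ^ 2 + C) * V + C ^ 2 * V1 + C * (2 * M + M ^ 2) * L := by
      ring
    have h4 : C * (2 * M + M ^ 2) * L ≤ M' * L := by
      rw [hM']
      gcongr
      linarith only
    have m1 := mul_le_mul_of_nonneg_right (by linarith only [hDC1, hC0] : C ≤ D) G0
    have m2 := mul_le_mul_of_nonneg_right (by linarith only [hDC2, sq_nonneg C] : 3 * C ^ 2 ≤ D) N0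
    have m3 := mul_le_mul_of_nonneg_right (by linarith only [hDC2, hDC1, hC0] : 2 * C ^ 2 + C ≤ D) V0
    have m4 := mul_le_mul_of_nonneg_right (by linarith only [hDC2, sq_nonneg C] : C ^ 2 ≤ D) V10
    have h5 := mul_le_mul_of_nonneg_left h2 hC0
    rw [h3] at h5
    rw [hL] at *
    linarith only [h1, h5, h4, m1, m2, m3, m4]
  have hco : N ≤ D * (G + |lam.re| * L + V + V1 + ε * N + S + ε * (‖lam‖ * L)) +
      M' * (L + V1) := by
    have h1 := hd.coupling w w1 lam.im hw
    have h2 := Coefs.Eqn.norm_hyp_le hB hd he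
    have hP : 0 ≤ |lam.re| * L := by positivity
    have h3 : ‖w1‖ + k * ‖w‖ ≤ C * ((‖g‖ + |lam.re| * (C * ‖w‖) + M * ‖w‖ + ‖q.par w w1 w2‖ +
        ‖q.low w w1 r‖) + ‖q.pr w1‖ + k * ‖q.pr w‖ +
      ε * (‖w1‖ + k * ‖w‖ + ‖lam‖ * ‖w‖) + ‖q.sg w1‖ + k * ‖q.sg w‖) + M * ‖w‖ := by
      refine h1.trans ?_
      have : |lam.im| ≤ ‖lam‖ := Complex.abs_im_le_norm lam
      gcongr
    have h4 : (‖g‖ + |lam.re| * (C * ‖w‖) + M * ‖w‖ + ‖q.par w w1 w2‖ +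
        ‖q.low w w1 r‖) + ‖q.pr w1‖ + k * ‖q.pr w‖ +
      ε * (‖w1‖ + k * ‖w‖ + ‖lam‖ * ‖w‖) + ‖q.sg w1‖ + k * ‖q.sg w‖ ≤
      G + C * (|lam.re| * L) + M * L + 2 * C * V + (C * (ε * N + S) + C * V1 + M * (L + V1)) + V1 +
        ε * (N + ‖lam‖ * L) + S := by
      rw [hV1, hN, hL, hS] at *
      linarith only [hgG, hpar, hlow]
    have h5 := mul_le_mul_of_nonneg_left h4 hC0
    rw [← hN] at h3
    have e1 : 0 ≤ ε * N := by positivity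
    have e2 : 0 ≤ ε * (‖lam‖ * L) := by positivity
    have hCC := sq_nonneg C
    have m1 := mul_le_mul_of_nonneg_right (by linarith only [hDC1, hC0] : C ≤ D) G0
    have m2 := mul_le_mul_of_nonneg_right (by linarith only [hDC2, hCC] : C ^ 2 ≤ D) hP
    have m3 := mul_le_mul_of_nonneg_right (by linarith only [hDC2, hCC] : 2 * C ^ 2 ≤ D) V0
    have m4 := mul_le_mul_of_nonneg_right (by linarith only [hDC2, hDC1, hC0] : C ^ 2 + C ≤ D) V10
    have m5 := mul_le_mul_of_nonneg_right (by linarith only [hDC2, hDC1, hC0] : C ^ 2 + C ≤ D) e1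
    have m6 := mul_le_mul_of_nonneg_right (by linarith only [hDC2, hDC1, hC0] : C ^ 2 + C ≤ D) S0
    have m7 := mul_le_mul_of_nonneg_right (by linarith only [hDC1, hC0] : C ≤ D) e2
    have m8 : (2 * C * M + M) * (L + V1) ≤ M' * (L + V1) := by
      gcongr
      have h6 := mul_le_mul_of_nonneg_right (by linarith only [hDC1, hC] : 2 * C + 1 ≤ D) hM
      linarith only [h6, hDM']
    have m9 : 0 ≤ C * M * L := by positivity
    have m10 : 0 ≤ C * M * V1 := by positivity
    have m11 : 0 ≤ M * V1 := by positivity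
    rw [← hN, ← hL] at h5
    rw [← hL] at h3
    linarith only [h3, h5, m1, m2, m3, m4, m5, m6, m7, m8, m9, m10, m11]
  have hsmall : L ≤ ρ * (N + V + G) ∧ V1 ≤ ρ * (N + V + G) := by
    refine small_of_high_frequency hD1 hρ0 hρ1 hR L0 N0 V0 G0 hint ?_
    rcases max_choice k ‖lam‖ with h | h
    · rw [h]
      have h1 : k * L ≤ N := by rw [hN, hL]; linarith only [norm_nonneg w1]
      have h2 : 1 * N ≤ D * N := by gcongr
      have h3 : 0 ≤ D * (V + V1 + G) := by positivity
      have h4 : 0 ≤ M' * L := by positivity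
      linarith only [h1, h2, h3, h4]
    · rw [h]
      exact hlamL
  have hfin := absorb hD1 hc0' hc1' hε hK hM0' hρ L0 N0 V0 V10 G0 Su0 hEn1 hEn2 hSS hsmall.1
    hsmall.2 hEnergy hlamL hco hlam
  rw [← hQ] at hfin
  have h1 : L ≤ ρ * (Q + Q ^ 2 + 1) * G := by
    refine hsmall.1.trans ?_
    rw [mul_assoc]
    gcongr
    linarith only [hfin.1, hfin.2]
  calc ‖w1‖ + (1 + k) * ‖w‖ = N + L := by rw [hN, hL]; ring
    _ ≤ (Q + ρ * (Q + Q ^ 2 + 1)) * G := by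
      linarith only [h1, hfin.1]
    _ = _ := by rw [hG]

end EnergyEstimate

section Partition

variable {V : Type*} [NormedAddCommGroup V] [NormedSpace ℝ V] [FiniteDimensional ℝ V]

/-- A finite quadratic partition of unity on the line along which a bounded function with bounded
derivative has small oscillation. -/
theorem exists_partition {f f' : ℝ → V} (hf : ∀ x, HasDerivAt f (f' x) x) (hf' : Continuous f')
    {C C' : ℝ} (hC : ∀ x, ‖f x‖ ≤ C) (hC' : ∀ x, ‖f' x‖ ≤ C') {δ : ℝ} (hδ : 0 < δ) :
    ∃ (t : Finset ℝ) (φ φ' : ℝ → ℝ → ℝ) (B : ℝ → ℝ), (∀ p x, HasDerivAt (φ p) (φ' p x) x) ∧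
      (∀ p, Continuous (φ' p)) ∧ (∀ p x, |φ p x| ≤ B p) ∧ (∀ p x, |φ' p x| ≤ B p) ∧
      (∀ x, ∑ p ∈ t, φ p x ^ 2 = 1) ∧
      ∀ p x, φ p x ≠ 0 ∨ φ' p x ≠ 0 → ‖f x - f p‖ ≤ δ := by
  have htb : TotallyBounded (Set.range f) := by
    refine (isCompact_closedBall (0 : V) C).totallyBounded.subset ?_
    rintro _ ⟨x, rfl⟩
    simpa using hC x
  obtain ⟨T, hTs, hTf, hcov⟩ := Metric.finite_approx_of_totallyBounded htb (δ / 2) (by positivity)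
  obtain ⟨t, ht⟩ : ∃ t : Finset ℝ, T ⊆ f '' t := by
    classical
    choose! g hg using fun (y : V) (hy : y ∈ T) => hTs hy
    refine ⟨hTf.toFinset.image g, fun y hy => ⟨g y, ?_, hg y hy⟩⟩
    simp only [Finset.coe_image, Set.Finite.coe_toFinset]
    exact ⟨y, hy, rfl⟩
  let b : (p : ℝ) → ContDiffBump (f p) := fun p =>
    { rIn := δ / 2, rOut := δ, rIn_pos := by positivity, rIn_lt_rOut := by linarith }
  have hb0 : ∀ p y, 0 ≤ b p y := fun p y => (b p).nonneg
  have hb1 : ∀ p y, b p y ≤ 1 := fun p y => (b p).le_one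
  let β : ℝ → ℝ → ℝ := fun p x => b p (f x)
  let β' : ℝ → ℝ → ℝ := fun p x => fderiv ℝ (b p) (f x) (f' x)
  have hbd : ∀ p, ContDiff ℝ 1 (b p) := fun p => (b p).contDiff
  have hβ : ∀ p x, HasDerivAt (β p) (β' p x) x := fun p x =>
    (((hbd p).differentiable (by norm_num)) (f x)).hasFDerivAt.comp_hasDerivAt x (hf x)
  have hfc : Continuous f := continuous_iff_continuousAt.2 fun x => (hf x).continuousAt
  have hβ'c : ∀ p, Continuous (β' p) := fun p =>
    (((hbd p).continuous_fderiv (by norm_num)).comp hfc).clm_apply hf'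
  have hβc : ∀ p, Continuous (β p) := fun p =>
    continuous_iff_continuousAt.2 fun x => (hβ p x).continuousAt
  have hβ'b : ∀ p, ∃ D, 0 ≤ D ∧ ∀ x, |β' p x| ≤ D := fun p => by
    obtain ⟨D, hD⟩ := ((b p).hasCompactSupport.fderiv (𝕜 := ℝ)).exists_bound_of_continuous
      ((hbd p).continuous_fderiv (by norm_num))
    have hD0 : 0 ≤ D := (norm_nonneg _).trans (hD (f p))
    refine ⟨D * C', mul_nonneg hD0 ((norm_nonneg _).trans (hC' 0)), fun x => ?_⟩
    exact ((fderiv ℝ (b p) (f x)).le_opNorm _).trans (by gcongr; exacts [hD _, hC' _])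
  choose D hD0 hD using hβ'b
  let sq : ℝ → ℝ := fun x => ∑ q ∈ t, β q x ^ 2
  let sd : ℝ → ℝ := fun x => ∑ q ∈ t, 2 * β q x * β' q x
  have hSd : ∀ x, HasDerivAt sq (sd x) x := fun x => by
    have := HasDerivAt.fun_sum (u := t) fun q _ => (hβ q x).pow 2
    simpa using this
  have hS1 : ∀ x, 1 ≤ sq x := fun x => by
    obtain ⟨y, hyT, hy⟩ := Set.mem_iUnion₂.1 (hcov ⟨x, rfl⟩)
    obtain ⟨p, hp, rfl⟩ := ht hyT
    have h1 : β p x = 1 := (b p).one_of_mem_closedBall (Metric.ball_subset_closedBall hy)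
    have h2 : β p x ^ 2 ≤ sq x :=
      Finset.single_le_sum (f := fun q => β q x ^ 2) (fun q _ => sq_nonneg _) hp
    rw [h1] at h2
    simpa using h2
  have hSs : ∀ x, 1 ≤ √(sq x) := fun x => Real.one_le_sqrt.2 (hS1 x)
  have hsdc : Continuous sd := continuous_finset_sum _ fun q _ =>
    (continuous_const.mul (hβc q)).mul (hβ'c q)
  have hSc : Continuous sq := continuous_finset_sum _ fun q _ => (hβc q).pow 2
  let φ : ℝ → ℝ → ℝ := fun p x => β p x / √(sq x)
  let φ' : ℝ → ℝ → ℝ := fun p x =>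
    (β' p x * √(sq x) - β p x * (sd x / (2 * √(sq x)))) / √(sq x) ^ 2
  refine ⟨t, φ, φ', fun p => D p + ∑ q ∈ t, D q + 1, ?_, ?_, ?_, ?_, ?_, ?_⟩
  · intro p x
    exact (hβ p x).div ((hSd x).sqrt (by linarith [hS1 x])) (by linarith [hSs x])
  · intro p
    refine Continuous.div ?_ ((hSc.sqrt).pow 2) fun x => by have := hSs x; positivity
    refine ((hβ'c p).mul hSc.sqrt).sub ((hβc p).mul ?_)
    exact hsdc.div (continuous_const.mul hSc.sqrt) fun x => by have := hSs x; positivity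
  · intro p x
    have h1 : |φ p x| ≤ 1 := by
      rw [abs_div, abs_of_nonneg (Real.sqrt_nonneg _), div_le_one (by linarith [hSs x]),
        abs_of_nonneg (hb0 p _)]
      exact (hb1 p _).trans (hSs x)
    have h2 : 0 ≤ ∑ q ∈ t, D q := Finset.sum_nonneg fun q _ => hD0 q
    have := hD0 p
    linarith
  · intro p x
    have hs := hSs x
    have h3 : |sd x| ≤ 2 * ∑ q ∈ t, D q := by
      rw [Finset.mul_sum]
      refine (Finset.abs_sum_le_sum_abs _ _).trans (Finset.sum_le_sum fun q _ => ?_)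
      rw [abs_mul, abs_mul, abs_two, abs_of_nonneg (hb0 q _)]
      have := hb1 q (f x)
      have := hD q x
      have := hb0 q (f x)
      have h5 : b q (f x) * |β' q x| ≤ 1 * D q := by gcongr
      linarith
    have h4 : |β' p x * √(sq x) - β p x * (sd x / (2 * √(sq x)))| ≤
        D p * √(sq x) + 1 * (∑ q ∈ t, D q) := by
      refine (abs_sub _ _).trans ?_
      rw [abs_mul, abs_mul, abs_of_nonneg (Real.sqrt_nonneg _), abs_of_nonneg (hb0 p _), abs_div,
        abs_of_pos (by positivity : 0 < 2 * √(sq x))]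
      gcongr
      · exact hD p x
      · exact hb1 p _
      · rw [div_le_iff₀ (by positivity)]
        have : 0 ≤ ∑ q ∈ t, D q := Finset.sum_nonneg fun q _ => hD0 q
        nlinarith
    have h5 : 0 ≤ ∑ q ∈ t, D q := Finset.sum_nonneg fun q _ => hD0 q
    rw [abs_div, abs_of_pos (by positivity : 0 < √(sq x) ^ 2), div_le_iff₀ (by positivity)]
    refine h4.trans ?_
    have h6 : √(sq x) ≤ √(sq x) ^ 2 := by nlinarith
    have h7 : 1 ≤ √(sq x) ^ 2 := by nlinarith
    nlinarith [hD0 p]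
  · intro x
    have hs := hS1 x
    have : ∀ p, φ p x ^ 2 = β p x ^ 2 / sq x := fun p => by
      rw [div_pow, Real.sq_sqrt (by linarith)]
    simp_rw [this]
    rw [← Finset.sum_div]
    exact div_self (by linarith : sq x ≠ 0)
  · intro p x h
    by_contra hlt
    push Not at hlt
    have hn : f x ∉ tsupport (b p) := by
      rw [(b p).tsupport_eq]
      simp only [Metric.mem_closedBall, not_le, dist_eq_norm]
      exact hlt
    have h1 : β p x = 0 := image_eq_zero_of_notMem_tsupport (f := b p) hn
    have h2 : fderiv ℝ (b p) (f x) = 0 := by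
      by_contra h0
      exact hn (support_fderiv_subset ℝ h0)
    have h3 : β' p x = 0 := by simp only [β', h2]; rfl
    rcases h with h | h
    · exact h (by simp only [φ, h1, zero_div])
    · exact h (by simp only [φ', h1, h3, zero_mul, sub_self, zero_div])

end Partition

section Garding

variable {E : Type*} [NormedAddCommGroup E] [InnerProductSpace ℂ E] [FiniteDimensional ℂ E]
variable {d : ℕ}

theorem rI_integrable (f g : LL E) : Integrable (fun x => rI (f x) (g x)) :=
  (L2.integrable_inner (𝕜 := ℂ) f g).re

theorem rI_eq_integral (f g : LL E) : rI f g = ∫ x, rI (f x) (g x) := by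
  unfold rI
  rw [L2.inner_def]
  exact (integral_re (L2.integrable_inner (𝕜 := ℂ) f g)).symm

theorem rI_fourier (f g : LL E) : rI (𝓕 f : LL E) (𝓕 g : LL E) = rI f g := by
  unfold rI
  rw [Lp.inner_fourier_eq]

/-- The gradient at tangential frequency `ξ`, given `y` and its normal derivative `y1`. -/
def grad (ξ : Fin d → ℝ) (y y1 : LL E) : Fin (d + 1) → LL E :=
  Fin.cons y1 fun j => (Complex.I * ξ j) • y

/-- The quadratic form with coefficients `B`. -/
def quad (B : Fin (d + 1) → Fin (d + 1) → Cf E) (Y : Fin (d + 1) → LL E) : ℝ :=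
  ∑ j, ∑ k, rI (Y j) (mulOp (B j k) (Y k))

theorem fourier_smul_LL (c : ℂ) (f : LL E) : (𝓕 (c • f) : LL E) = c • (𝓕 f : LL E) :=
  map_smul (Lp.fourierTransformₗᵢ ℝ E) c f

theorem fourier_grad {y y1 : LL E} (h : HD y y1) (ξ : Fin d → ℝ) (j : Fin (d + 1)) :
    ∀ᵐ η, (𝓕 (grad ξ y y1 j) : LL E) η =
      (Complex.I * ((Fin.cons (2 * Real.pi * η) ξ : Fin (d + 1) → ℝ) j : ℝ)) • (𝓕 y : LL E) η := by
  refine Fin.cases ?_ (fun j => ?_) j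
  · filter_upwards [hD_iff_fourier.1 h] with η hη
    simp only [grad, Fin.cons_zero]
    rw [hη]
    congr 1
    push_cast
    ring
  · simp only [grad, Fin.cons_succ]
    rw [fourier_smul_LL]
    filter_upwards [Lp.coeFn_smul (Complex.I * ξ j) (𝓕 y : LL E)] with η hη
    rw [hη]
    rfl

theorem quad_const_nonneg {M : Fin (d + 1) → Fin (d + 1) → E →L[ℂ] E}
    (hM : ∀ (ζ : Fin (d + 1) → ℝ) (v : E), 0 ≤ ∑ j, ∑ k, ζ j * ζ k * rI v (M j k v))
    (ξ : Fin d → ℝ) {y y1 : LL E} (h : HD y y1) :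
    0 ≤ quad (fun j k => cst (M j k)) (grad ξ y y1) := by
  have h1 : quad (fun j k => cst (M j k)) (grad ξ y y1) =
      ∫ η, ∑ j, ∑ k, rI ((𝓕 (grad ξ y y1 j) : LL E) η)
        ((mulOp (cst (M j k)) (𝓕 (grad ξ y y1 k) : LL E) : LL E) η) := by
    rw [integral_finset_sum _ fun j _ => integrable_finset_sum _ fun k _ => rI_integrable _ _]
    unfold quad
    congr 1 with j
    rw [integral_finset_sum _ fun k _ => rI_integrable _ _]
    congr 1 with k
    rw [← rI_eq_integral, ← fourier_cst, rI_fourier]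
  rw [h1]
  refine integral_nonneg_of_ae ?_
  have a1 := ae_all_iff.2 fun j => fourier_grad h ξ j
  have a2 := ae_all_iff.2 fun j => ae_all_iff.2 fun k =>
    coeFn_mulOp (cst (M j k)) (𝓕 (grad ξ y y1 k) : LL E)
  filter_upwards [a1, a2] with η e1 e2
  refine (hM (Fin.cons (2 * Real.pi * η) ξ) ((𝓕 y : LL E) η)).trans_eq ?_
  refine Finset.sum_congr rfl fun j _ => Finset.sum_congr rfl fun k _ => ?_
  rw [e2, e1, e1, cst_apply, map_smul]
  generalize (Fin.cons (2 * Real.pi * η) ξ : Fin (d + 1) → ℝ) = z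
  unfold rI
  rw [inner_smul_left, inner_smul_right, map_mul, Complex.conj_I, Complex.conj_ofReal, ← mul_assoc,
    show -Complex.I * (z j : ℂ) * (Complex.I * z k) = ((z j * z k : ℝ) : ℂ) by
      push_cast
      linear_combination -(z j : ℂ) * z k * Complex.I_sq]
  rw [Complex.re_ofReal_mul]

theorem norm_le_of_ae {f g : LL E} {c : ℝ} (hc : 0 ≤ c) (h : ∀ᵐ x, ‖f x‖ ≤ c * ‖g x‖) :
    ‖f‖ ≤ c * ‖g‖ := by
  have : ‖f‖ ≤ ‖(c : ℂ) • g‖ := by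
    refine Lp.norm_le_norm_of_ae_le ?_
    filter_upwards [h, Lp.coeFn_smul (c : ℂ) g] with x h1 h2
    rw [h2]
    simpa [norm_smul, abs_of_nonneg hc] using h1
  rwa [norm_smul, Complex.norm_real, Real.norm_eq_abs, abs_of_nonneg hc] at this

/-- Multiplication by a bounded continuous real function. -/
def rscal (φ : ℝ → ℝ) (h : Continuous φ) (C : ℝ) (hC : ∀ x, |φ x| ≤ C) : Cf E :=
  scal (fun x => (φ x : ℂ)) (Complex.continuous_ofReal.comp h) C (fun x => by simpa using hC x)

theorem rscal_apply (φ : ℝ → ℝ) (h : Continuous φ) (C : ℝ) (hC : ∀ x, |φ x| ≤ C) (x : ℝ) (v : E) :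
    rscal φ h C hC x v = (φ x : ℂ) • v := rfl

theorem Cf.ext' {a b : Cf E} (h : ∀ x v, a x v = b x v) : a = b :=
  BoundedContinuousFunction.ext fun x => ContinuousLinearMap.ext (h x)

theorem Cf.mul_apply' (a b : Cf E) (x : ℝ) (v : E) : (a * b) x v = a x (b x v) := rfl

theorem rscal_comm (φ : ℝ → ℝ) (h : Continuous φ) (C : ℝ) (hC : ∀ x, |φ x| ≤ C) (a : Cf E) :
    rscal φ h C hC * a = a * rscal φ h C hC :=
  Cf.ext' fun x v => by simp only [Cf.mul_apply', rscal_apply, map_smul]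

theorem SA_of_star {a : Cf E} (h : star a = a) : SA (mulOp a) := fun f g => by
  conv_lhs => rw [← h]
  exact mulOp_star a f g

theorem SA_of_pointwise {a : Cf E} (h : ∀ x v w, ⟪a x v, w⟫_ℂ = ⟪v, a x w⟫_ℂ) : SA (mulOp a) := by
  refine SA_of_star (BoundedContinuousFunction.ext fun x => ?_)
  exact ((ContinuousLinearMap.eq_adjoint_iff _ _).2 (h x)).symm

theorem SA_rscal (φ : ℝ → ℝ) (h : Continuous φ) (C : ℝ) (hC : ∀ x, |φ x| ≤ C) :
    SA (mulOp (rscal φ h C hC : Cf E)) :=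
  SA_of_pointwise fun x v w => by
    rw [rscal_apply, rscal_apply, inner_smul_left, inner_smul_right, Complex.conj_ofReal]

theorem mulOp_comm_apply {a b : Cf E} (h : a * b = b * a) (f : LL E) :
    mulOp a (mulOp b f) = mulOp b (mulOp a f) := by
  have := congrArg (fun c => mulOp c f) h
  simpa only [mulOp_mul, mul_apply_eq_comp] using this

theorem sum_rI_localize {ι : Type*} (t : Finset ι) {P Q : ι → Cf E} {R : Cf E} (hP : ∀ i, SA (mulOp (P i)))
    (a : Cf E) (hc : ∀ i, P i * a = a * P i) (hR : ∑ i ∈ t, P i * Q i = R) (f g : LL E) :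
    ∑ i ∈ t, rI (mulOp (P i) f) (mulOp a (mulOp (Q i) g)) = rI f (mulOp a (mulOp R g)) := by
  have h1 : ∀ i, rI (mulOp (P i) f) (mulOp a (mulOp (Q i) g)) =
      rI f (mulOp a (mulOp (P i * Q i) g)) := fun i => by
    rw [(hP i).rI, mulOp_comm_apply (hc i), mulOp_mul, mul_apply_eq_comp]
  simp_rw [h1]
  rw [← hR, mulOp_sum, ContinuousLinearMap.sum_apply, map_sum]
  simp only [rI, inner_sum, Complex.re_sum]

/-- Gårding's inequality, uniformly in the tangential frequency. -/
theorem garding {B B' : Fin (d + 1) → Fin (d + 1) → Cf E} {pr : E →L[ℂ] E} {θ : ℝ} (hθ : 0 < θ)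
    (hsa : ∀ v w, ⟪pr v, w⟫_ℂ = ⟪v, pr w⟫_ℂ) (hpp : ∀ v, pr (pr v) = pr v)
    (hB : ∀ j k x v, pr (B j k x v) = B j k x v) (hB2 : ∀ j k x v, B j k x (pr v) = B j k x v)
    (hd : ∀ j k, CfDeriv (B j k) (B' j k))
    (hell : ∀ (x : ℝ) (ξ : Fin (d + 1) → ℝ) (v : E),
      θ * (∑ j, ξ j ^ 2) * ‖pr v‖ ^ 2 ≤ ∑ j, ∑ k, ξ j * ξ k * rI v (B j k x v)) :
    ∃ C, 0 ≤ C ∧ ∀ (ξ : Fin d → ℝ) (y y1 : LL E), HD y y1 →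
      θ / 2 * (∑ j, ‖mulOp (cst pr) (grad ξ y y1 j)‖ ^ 2) - C * ‖mulOp (cst pr) y‖ ^ 2 ≤
        quad B (grad ξ y y1) := by
  set pL : LL E →L[ℂ] LL E := mulOp (cst pr) with hpL
  have hrp : ∀ f : LL E, rI f (pL f) = ‖pL f‖ ^ 2 := fun f => by
    have h1 : SA pL := SA_of_pointwise fun x v w => hsa v w
    have h2 : pL (pL f) = pL f := by
      rw [hpL, ← mul_apply_eq_comp, ← mulOp_mul]
      congr 2
      exact Cf.ext' fun x v => hpp v
    rw [← rI_self, h1.rI, h2]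
  have hdiag : ∀ (Z : Fin (d + 1) → LL E) (j : Fin (d + 1)), θ / 2 * ‖pL (Z j)‖ ^ 2 =
      ∑ k, rI (Z j) (mulOp ((if j = k then ((θ / 2 : ℝ) : ℂ) else 0) • cst pr) (Z k)) := by
    intro Z j
    rw [Finset.sum_eq_single j]
    · rw [if_pos rfl, mulOp_smul, _root_.smul_apply, ← hrp]
      simp only [rI, inner_smul_right, Complex.re_ofReal_mul, pL]
    · intro k _ hk
      rw [if_neg (Ne.symm hk), mulOp_smul, zero_smul]
      simp [rI]
    · simp
  obtain ⟨D, hD⟩ : ∃ D : Fin (d + 1) → Fin (d + 1) → Cf E,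
      D = fun j k => B j k - (if j = k then ((θ / 2 : ℝ) : ℂ) else 0) • cst pr := ⟨_, rfl⟩
  let f : ℝ → Fin (d + 1) → Fin (d + 1) → E →L[ℂ] E := fun x j k => B j k x
  let f' : ℝ → Fin (d + 1) → Fin (d + 1) → E →L[ℂ] E := fun x j k => B' j k x
  have bd : ∀ A : Fin (d + 1) → Fin (d + 1) → Cf E, ∀ x, ‖fun j k => A j k x‖ ≤ ∑ j, ∑ k, ‖A j k‖ := by
    intro A x
    have h0 : ∀ j, 0 ≤ ∑ k, ‖A j k‖ := fun j => Finset.sum_nonneg fun k _ => norm_nonneg (A j k)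
    refine (pi_norm_le_iff_of_nonneg (Finset.sum_nonneg fun j _ => h0 j)).2 fun j => ?_
    refine (pi_norm_le_iff_of_nonneg (Finset.sum_nonneg fun j _ => h0 j)).2 fun k => ?_
    refine ((A j k).norm_coe_le_norm x).trans ?_
    refine le_trans ?_ (Finset.single_le_sum (fun j _ => h0 j) (Finset.mem_univ j))
    exact Finset.single_le_sum (f := fun k => ‖A j k‖) (fun k _ => norm_nonneg (A j k)) (Finset.mem_univ k)
  obtain ⟨t, φ, φ', b, hφ, hφ'c, hb, hb', hsum, hosc⟩ := exists_partition (f := f) (f' := f')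
    (fun x => hasDerivAt_pi.2 fun j => hasDerivAt_pi.2 fun k => hd j k x)
    (continuous_pi fun j => continuous_pi fun k => (B' j k).continuous) (bd B) (bd B')
    (δ := θ / (2 * (d + 1))) (by positivity)
  have hφc : ∀ p, Continuous (φ p) := fun p =>
    continuous_iff_continuousAt.2 fun x => (hφ p x).continuousAt
  let P : ℝ → Cf E := fun p => rscal (φ p) (hφc p) (b p) (hb p)
  let P' : ℝ → Cf E := fun p => rscal (φ' p) (hφ'c p) (b p) (hb' p)
  let T : Cf E := ∑ p ∈ t, P' p * P' p
  have hPP : ∑ p ∈ t, P p * P p = 1 := Cf.ext' fun x v => by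
    have : (∑ p ∈ t, P p * P p) x v = ∑ p ∈ t, ((φ p x ^ 2 : ℝ) : ℂ) • v := by
      rw [BoundedContinuousFunction.sum_apply, ContinuousLinearMap.sum_apply]
      refine Finset.sum_congr rfl fun p _ => ?_
      simp only [Cf.mul_apply', P, rscal_apply, smul_smul]
      push_cast
      ring_nf
    rw [this, ← Finset.sum_smul, ← Complex.ofReal_sum, hsum]
    simp
  have hzero : ∀ x, ∑ p ∈ t, φ p x * φ' p x = 0 := fun x => by
    have h1 : HasDerivAt (fun x => ∑ p ∈ t, φ p x ^ 2) (∑ p ∈ t, 2 * φ p x * φ' p x) x := by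
      simpa using HasDerivAt.fun_sum (u := t) fun q _ => (hφ q x).pow 2
    have h2 : (fun x => ∑ p ∈ t, φ p x ^ 2) = fun _ => (1 : ℝ) := funext hsum
    rw [h2] at h1
    have h3 := h1.unique (hasDerivAt_const x (1 : ℝ))
    simp only [mul_assoc] at h3
    rw [← Finset.mul_sum] at h3
    linarith
  have hPP' : ∑ p ∈ t, P p * P' p = 0 := Cf.ext' fun x v => by
    have : (∑ p ∈ t, P p * P' p) x v = ∑ p ∈ t, ((φ p x * φ' p x : ℝ) : ℂ) • v := by
      rw [BoundedContinuousFunction.sum_apply, ContinuousLinearMap.sum_apply]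
      refine Finset.sum_congr rfl fun p _ => ?_
      simp only [Cf.mul_apply', P, P', rscal_apply, smul_smul]
      push_cast
      ring_nf
    rw [this, ← Finset.sum_smul, ← Complex.ofReal_sum, hzero]
    simp
  have hP'P : ∑ p ∈ t, P' p * P p = 0 := by
    rw [← hPP']
    exact Finset.sum_congr rfl fun p _ => rscal_comm _ _ _ _ _
  refine ⟨‖D 0 0‖ * ‖T‖, by positivity, fun ξ y y1 hy => ?_⟩
  obtain ⟨Y, hY⟩ : ∃ Y, Y = grad ξ y y1 := ⟨_, rfl⟩
  let e : Fin (d + 1) → LL E := Fin.cons y fun _ => 0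
  let Yp : ℝ → Fin (d + 1) → LL E := fun p j => mulOp (P p) (Y j) + mulOp (P' p) (e j)
  have hYp : ∀ p, Yp p = grad ξ (mulOp (P p) y) (mulOp (P' p) y + mulOp (P p) y1) := fun p => by
    funext j
    refine Fin.cases ?_ (fun j => ?_) j
    · simp only [Yp, hY, grad, Fin.cons_zero, e]
      abel
    · simp only [Yp, hY, grad, Fin.cons_succ, e, map_zero, add_zero, map_smul]
  have hder : ∀ p, HD (mulOp (P p) y) (mulOp (P' p) y + mulOp (P p) y1) := fun p => by
    refine HD.mulOp (fun x => ?_) hy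
    exact ((hφ p x).ofReal_comp).smul_const (1 : E →L[ℂ] E)
  -- each localized piece is nonnegative
  have hpiece : ∀ p, 0 ≤ quad D (Yp p) := by
    intro p
    have h1 : quad D (Yp p) =
        quad (fun j k => cst (B j k p - (if j = k then ((θ : ℝ) : ℂ) else 0) • pr)) (Yp p) +
        quad (fun j k => B j k - cst (B j k p)) (Yp p) + θ / 2 * ∑ j, ‖pL (Yp p j)‖ ^ 2 := by
      have h2 : θ / 2 * ∑ j, ‖pL (Yp p j)‖ ^ 2 =
          quad (fun j k => (if j = k then ((θ / 2 : ℝ) : ℂ) else 0) • cst pr) (Yp p) := by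
        unfold quad
        rw [Finset.mul_sum]
        refine Finset.sum_congr rfl fun j _ => ?_
        exact hdiag _ _
      rw [h2]
      unfold quad
      rw [← Finset.sum_add_distrib, ← Finset.sum_add_distrib]
      refine Finset.sum_congr rfl fun j _ => ?_
      rw [← Finset.sum_add_distrib, ← Finset.sum_add_distrib]
      refine Finset.sum_congr rfl fun k _ => ?_
      rw [← rI_add_right, ← rI_add_right, ← _root_.add_apply, ← _root_.add_apply, ← mulOp_add,
        ← mulOp_add]
      congr 3
      refine Cf.ext' fun x v => ?_
      rw [hD]
      have : (if j = k then ((θ : ℝ) : ℂ) else 0) =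
          (if j = k then ((θ / 2 : ℝ) : ℂ) else 0) + (if j = k then ((θ / 2 : ℝ) : ℂ) else 0) := by
        split_ifs
        · push_cast
          ring
        · simp
      beta_reduce
      rw [this]
      simp only [BoundedContinuousFunction.coe_sub, BoundedContinuousFunction.coe_add,
        BoundedContinuousFunction.coe_smul, Pi.sub_apply, Pi.add_apply, _root_.sub_apply,
        _root_.add_apply, _root_.smul_apply, cst_apply, add_smul]
      abel
    have h3 : 0 ≤ quad (fun j k => cst (B j k p - (if j = k then ((θ : ℝ) : ℂ) else 0) • pr))
        (Yp p) := by
      rw [hYp]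
      refine quad_const_nonneg (fun ζ v => ?_) ξ (hder p)
      have h4 := hell p ζ v
      have h5 : ∑ j, ∑ k, ζ j * ζ k * rI v ((B j k p - (if j = k then ((θ : ℝ) : ℂ) else 0) • pr) v)
          = ∑ j, ∑ k, ζ j * ζ k * rI v (B j k p v) - θ * (∑ j, ζ j ^ 2) * ‖pr v‖ ^ 2 := by
        rw [mul_assoc, Finset.sum_mul, Finset.mul_sum, ← Finset.sum_sub_distrib]
        refine Finset.sum_congr rfl fun j _ => ?_
        have h6 : θ * (ζ j ^ 2 * ‖pr v‖ ^ 2) =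
            ∑ k, ζ j * ζ k * rI v (((if j = k then ((θ : ℝ) : ℂ) else 0) • pr) v) := by
          rw [Finset.sum_eq_single j]
          · have : ‖pr v‖ ^ 2 = rI v (pr v) := by
              rw [← rI_self]
              unfold rI
              rw [hsa, hpp]
            rw [if_pos rfl, _root_.smul_apply, this]
            simp only [rI, inner_smul_right, Complex.re_ofReal_mul]
            ring
          · intro k _ hk
            simp [if_neg (Ne.symm hk), rI]
          · simp
        rw [h6, ← Finset.sum_sub_distrib]
        refine Finset.sum_congr rfl fun k _ => ?_
        rw [_root_.sub_apply, rI_sub_right, mul_sub]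
      rw [h5]
      linarith
    have h7 : |quad (fun j k => B j k - cst (B j k p)) (Yp p)| ≤
        θ / 2 * ∑ j, ‖pL (Yp p j)‖ ^ 2 := by
      have h8 : ∀ j k, |rI (Yp p j) (mulOp (B j k - cst (B j k p)) (Yp p k))| ≤
          θ / (2 * (d + 1)) * ((‖pL (Yp p j)‖ ^ 2 + ‖pL (Yp p k)‖ ^ 2) / 2) := by
        intro j k
        have h9 : mulOp (B j k - cst (B j k p)) (Yp p k) =
            pL (mulOp (B j k - cst (B j k p)) (Yp p k)) := by
          rw [hpL, ← mul_apply_eq_comp, ← mulOp_mul]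
          congr 2
          refine Cf.ext' fun x v => ?_
          rw [Cf.mul_apply', cst_apply]
          simp only [BoundedContinuousFunction.coe_sub, Pi.sub_apply, _root_.sub_apply, map_sub, hB,
            cst_apply]
        have h10 : ‖mulOp (B j k - cst (B j k p)) (Yp p k)‖ ≤ θ / (2 * (d + 1)) * ‖pL (Yp p k)‖ := by
          refine norm_le_of_ae (by positivity) ?_
          filter_upwards [coeFn_mulOp (B j k - cst (B j k p)) (Yp p k), coeFn_mulOp (cst pr) (Yp p k),
            Lp.coeFn_add (mulOp (P p) (Y k)) (mulOp (P' p) (e k)), coeFn_mulOp (P p) (Y k),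
            coeFn_mulOp (P' p) (e k)] with x e1 e2 e3 e4 e5
          rw [e1, hpL, e2, cst_apply]
          by_cases hx : φ p x ≠ 0 ∨ φ' p x ≠ 0
          · have h11 : (B j k - cst (B j k p)) x (Yp p k x) =
                (B j k x - B j k p) (pr (Yp p k x)) := by
              simp only [BoundedContinuousFunction.coe_sub, Pi.sub_apply, _root_.sub_apply, hB2,
                cst_apply]
            rw [h11]
            refine ((B j k x - B j k p).le_opNorm _).trans ?_
            gcongr
            refine le_trans ?_ (hosc p x hx)
            exact (norm_le_pi_norm ((f x - f p) j) k).trans (norm_le_pi_norm (f x - f p) j)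
          · push Not at hx
            have : Yp p k x = 0 := by
              simp only [Yp]
              rw [e3, Pi.add_apply, e4, e5]
              simp only [P, P', rscal_apply, hx.1, hx.2, Complex.ofReal_zero, zero_smul, add_zero]
            rw [this]
            simp
        rw [h9, ← (SA_of_pointwise fun x v w => hsa v w : SA pL).rI]
        refine (abs_rI_le _ _).trans ?_
        calc ‖pL (Yp p j)‖ * ‖mulOp (B j k - cst (B j k p)) (Yp p k)‖
            ≤ ‖pL (Yp p j)‖ * (θ / (2 * (d + 1)) * ‖pL (Yp p k)‖) := by gcongr
          _ = θ / (2 * (d + 1)) * (‖pL (Yp p j)‖ * ‖pL (Yp p k)‖) := by ring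
          _ ≤ _ := by
            gcongr
            linarith [sq_nonneg (‖pL (Yp p j)‖ - ‖pL (Yp p k)‖)]
      unfold quad
      refine (Finset.abs_sum_le_sum_abs _ _).trans ?_
      refine (Finset.sum_le_sum fun j _ => (Finset.abs_sum_le_sum_abs _ _).trans
        (Finset.sum_le_sum fun k _ => h8 j k)).trans_eq ?_
      simp_rw [← Finset.mul_sum, ← Finset.sum_div, Finset.sum_add_distrib]
      simp only [Finset.sum_const, Finset.card_univ, Fintype.card_fin, nsmul_eq_mul]
      rw [← Finset.mul_sum]
      push_cast
      field_simp
      ring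
    have := (abs_le.1 h7).1
    linarith
  have htotal : ∑ p ∈ t, quad D (Yp p) = quad D Y + rI y (mulOp (D 0 0) (mulOp T y)) := by
    unfold quad
    rw [Finset.sum_comm]
    have hSA : ∀ p, SA (mulOp (P p)) := fun p => SA_rscal _ _ _ _
    have hSA' : ∀ p, SA (mulOp (P' p)) := fun p => SA_rscal _ _ _ _
    have h1 : ∀ j k, ∑ p ∈ t, rI (Yp p j) (mulOp (D j k) (Yp p k)) =
        rI (Y j) (mulOp (D j k) (Y k)) + rI (e j) (mulOp (D j k) (mulOp T (e k))) := by
      intro j k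
      have c1 := fun p => rscal_comm (φ p) (hφc p) (b p) (hb p) (D j k)
      have c2 := fun p => rscal_comm (φ' p) (hφ'c p) (b p) (hb' p) (D j k)
      have s1 := sum_rI_localize t hSA (D j k) c1 hPP (Y j) (Y k)
      have s2 := sum_rI_localize t hSA (D j k) c1 hPP' (Y j) (e k)
      have s3 := sum_rI_localize t hSA' (D j k) c2 hP'P (e j) (Y k)
      have s4 := sum_rI_localize t hSA' (D j k) c2 (rfl : _ = T) (e j) (e k)
      simp only [Yp, map_add, rI_add_left, rI_add_right, Finset.sum_add_distrib, s1, s2, s3, s4]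
      have z : mulOp (0 : Cf E) = 0 := map_zero mulHom
      simp [z, mulOp_one, rI]
    have h2 : ∀ j, ∑ p ∈ t, ∑ k, rI (Yp p j) (mulOp (D j k) (Yp p k)) =
        ∑ k, (rI (Y j) (mulOp (D j k) (Y k)) + rI (e j) (mulOp (D j k) (mulOp T (e k)))) := fun j => by
      rw [Finset.sum_comm]
      exact Finset.sum_congr rfl fun k _ => h1 j k
    simp_rw [h2, Finset.sum_add_distrib]
    congr 1
    rw [Finset.sum_eq_single 0, Finset.sum_eq_single 0]
    · rfl
    · intro k _ hk
      obtain ⟨k, rfl⟩ := Fin.exists_succ_eq.2 hk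
      simp [e, rI]
    · simp
    · intro j _ hj
      obtain ⟨j, rfl⟩ := Fin.exists_succ_eq.2 hj
      simp [e, rI]
    · simp
  have h0 : 0 ≤ quad D Y + rI y (mulOp (D 0 0) (mulOp T y)) := by
    rw [← htotal]
    exact Finset.sum_nonneg fun p _ => hpiece p
  have hDY : quad D Y = quad B Y - θ / 2 * ∑ j, ‖pL (Y j)‖ ^ 2 := by
    unfold quad
    rw [Finset.mul_sum, ← Finset.sum_sub_distrib]
    refine Finset.sum_congr rfl fun j _ => ?_
    rw [hdiag Y j, ← Finset.sum_sub_distrib]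
    refine Finset.sum_congr rfl fun k _ => ?_
    rw [← rI_sub_right, ← _root_.sub_apply, ← mulOp_sub, hD]
  have hrest : |rI y (mulOp (D 0 0) (mulOp T y))| ≤ ‖D 0 0‖ * ‖T‖ * ‖pL y‖ ^ 2 := by
    have hDpr : ∀ x v, pr (D 0 0 x v) = D 0 0 x v ∧ D 0 0 x (pr v) = D 0 0 x v := fun x v => by
      rw [hD]
      simp only [BoundedContinuousFunction.coe_sub, BoundedContinuousFunction.coe_smul,
        Pi.sub_apply, _root_.sub_apply, _root_.smul_apply, cst_apply, map_sub, map_smul, hpp, hB, hB2,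
        and_self]
    have h1 : mulOp (D 0 0) (mulOp T y) = pL (mulOp (D 0 0) (mulOp T (pL y))) := by
      have hT : T * cst pr = cst pr * T := by
        refine Cf.ext' fun x v => ?_
        rw [Cf.mul_apply', Cf.mul_apply', cst_apply, cst_apply, BoundedContinuousFunction.sum_apply,
          ContinuousLinearMap.sum_apply, ContinuousLinearMap.sum_apply, map_sum]
        refine Finset.sum_congr rfl fun p _ => ?_
        simp only [Cf.mul_apply', P', rscal_apply, map_smul]
      rw [mulOp_comm_apply hT, hpL]
      simp only [← mul_apply_eq_comp, ← mulOp_mul]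
      congr 2
      refine Cf.ext' fun x v => ?_
      simp only [Cf.mul_apply', cst_apply, (hDpr _ _).1, (hDpr _ _).2]
    rw [h1, ← (SA_of_pointwise fun x v w => hsa v w : SA pL).rI]
    refine (abs_rI_le _ _).trans ?_
    have h2 : ‖mulOp (D 0 0) (mulOp T (pL y))‖ ≤ ‖D 0 0‖ * (‖T‖ * ‖pL y‖) :=
      (norm_mulOp_le _ _).trans (by gcongr; exact norm_mulOp_le _ _)
    calc _ ≤ ‖pL y‖ * (‖D 0 0‖ * (‖T‖ * ‖pL y‖)) := by gcongr
      _ = _ := by ring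
  have := (abs_le.1 hrest).2
  rw [← hY]
  linarith

end Garding

section Coupling

variable {E : Type*} [NormedAddCommGroup E] [InnerProductSpace ℂ E] [FiniteDimensional ℂ E]
variable {d : ℕ}

theorem norm_le_of_ae_sum {ι : Type*} (s : Finset ι) {f : LL E} {g : ι → LL E} {c : ℝ} (hc : 0 ≤ c)
    (h : ∀ᵐ x, ‖f x‖ ≤ c * ∑ i ∈ s, ‖g i x‖) : ‖f‖ ≤ c * ∑ i ∈ s, ‖g i‖ := by
  have hm : ∀ i ∈ s, AEStronglyMeasurable (fun x => ‖g i x‖) volume := fun i _ =>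
    (Lp.aestronglyMeasurable (g i)).norm
  have h1 : eLpNorm f 2 volume ≤ ENNReal.ofReal c * ∑ i ∈ s, eLpNorm (g i) 2 volume := by
    calc eLpNorm f 2 volume ≤ eLpNorm (c • ∑ i ∈ s, fun x => ‖g i x‖) 2 volume := by
          refine eLpNorm_mono_ae ?_
          filter_upwards [h] with x hx
          refine hx.trans ((le_abs_self _).trans_eq ?_)
          simp [Finset.sum_apply]
      _ = ENNReal.ofReal c * eLpNorm (∑ i ∈ s, fun x => ‖g i x‖) 2 volume := by
          rw [eLpNorm_const_smul, Real.enorm_eq_ofReal hc]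
      _ ≤ ENNReal.ofReal c * ∑ i ∈ s, eLpNorm (fun x => ‖g i x‖) 2 volume := by
          gcongr
          exact eLpNorm_sum_le hm (by norm_num)
      _ = _ := by simp_rw [eLpNorm_norm]
  have h2 : ∑ i ∈ s, eLpNorm (g i) 2 volume ≠ ⊤ :=
    ENNReal.sum_ne_top.2 fun i _ => Lp.eLpNorm_ne_top (g i)
  have h3 := ENNReal.toReal_mono (ENNReal.mul_ne_top ENNReal.ofReal_ne_top h2) h1
  rw [ENNReal.toReal_mul, ENNReal.toReal_ofReal hc,
    ENNReal.toReal_sum fun i _ => Lp.eLpNorm_ne_top (g i)] at h3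
  exact h3

/-- Uniform positivity by compactness and homogeneity. -/
theorem exists_symbol_bound {a0 : E →L[ℂ] E} {A : Fin (d + 1) → E →L[ℂ] E} {pr : E →L[ℂ] E}
    (h0 : ∀ v, a0 v = 0 → v = 0)
    (hk : ∀ (τ : ℝ) (ζ : Fin (d + 1) → ℝ), ζ ≠ 0 → ∀ v, (τ : ℂ) • a0 v + ∑ j, (ζ j : ℂ) • A j v = 0 →
      pr v = 0 → v = 0) :
    ∃ c, 0 < c ∧ ∀ (τ : ℝ) (ζ : Fin (d + 1) → ℝ) (v : E),
      c * ‖ζ‖ * ‖v‖ ≤ ‖(τ : ℂ) • a0 v + ∑ j, (ζ j : ℂ) • A j v‖ + ‖ζ‖ * ‖pr v‖ := by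
  let F : (ℝ × (Fin (d + 1) → ℝ)) × E → ℝ := fun p =>
    ‖(p.1.1 : ℂ) • a0 p.2 + ∑ j, (p.1.2 j : ℂ) • A j p.2‖ + ‖p.1.2‖ * ‖pr p.2‖
  have hF : Continuous F := by
    refine Continuous.add (Continuous.norm (Continuous.add ?_ (continuous_finset_sum _ fun j _ => ?_)))
      ?_
    · exact (Complex.continuous_ofReal.comp (by fun_prop)).smul (a0.continuous.comp (by fun_prop))
    · exact (Complex.continuous_ofReal.comp (by fun_prop)).smul ((A j).continuous.comp (by fun_prop))
    · exact (by fun_prop : Continuous fun p : (ℝ × (Fin (d + 1) → ℝ)) × E => ‖p.1.2‖).mul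
        (pr.continuous.comp (by fun_prop)).norm
  have hproper : ProperSpace E := FiniteDimensional.proper ℂ E
  let K : Set ((ℝ × (Fin (d + 1) → ℝ)) × E) := Metric.sphere 0 1 ×ˢ Metric.sphere 0 1
  have hK : IsCompact K := (isCompact_sphere _ _).prod (isCompact_sphere _ _)
  have hpos : ∀ p ∈ K, 0 < F p := by
    rintro ⟨⟨τ, ζ⟩, v⟩ ⟨h1, h2⟩
    simp only [mem_sphere_zero_iff_norm] at h1 h2
    have hv : v ≠ 0 := by
      rintro rfl
      simp at h2
    have hnn : 0 ≤ F ((τ, ζ), v) := by positivity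
    refine lt_of_le_of_ne hnn fun heq => hv ?_
    have e1 : ‖(τ : ℂ) • a0 v + ∑ j, (ζ j : ℂ) • A j v‖ = 0 := by
      have : 0 ≤ ‖ζ‖ * ‖pr v‖ := by positivity
      have := norm_nonneg ((τ : ℂ) • a0 v + ∑ j, (ζ j : ℂ) • A j v)
      simp only [F] at heq
      linarith
    have e2 : ‖ζ‖ * ‖pr v‖ = 0 := by
      simp only [F] at heq
      linarith
    rw [norm_eq_zero] at e1
    by_cases hζ : ζ = 0
    · subst hζ
      have hτ : τ ≠ 0 := by
        rintro rfl
        simp at h1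
      simp only [Pi.zero_apply, Complex.ofReal_zero, zero_smul, Finset.sum_const_zero, add_zero,
        smul_eq_zero, Complex.ofReal_eq_zero, hτ, false_or] at e1
      exact h0 v e1
    · refine hk τ ζ hζ v e1 ?_
      simpa [hζ] using e2
  obtain ⟨c, hc, hcK⟩ : ∃ c, 0 < c ∧ ∀ p ∈ K, c ≤ F p := by
    rcases K.eq_empty_or_nonempty with he | hne
    · exact ⟨1, one_pos, by simp [he]⟩
    · obtain ⟨p, hp, hmin⟩ := hK.exists_isMinOn hne hF.continuousOn
      exact ⟨F p, hpos p hp, fun q hq => hmin hq⟩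
  refine ⟨c, hc, fun τ ζ v => ?_⟩
  by_cases hv : v = 0
  · subst hv; simp
  by_cases hp : (τ, ζ) = 0
  · obtain ⟨rfl, rfl⟩ := Prod.mk_eq_zero.1 hp
    simp
  have hn : 0 < ‖(τ, ζ)‖ := norm_pos_iff.2 hp
  have hvn : 0 < ‖v‖ := norm_pos_iff.2 hv
  obtain ⟨ρ, hρ⟩ : ∃ ρ, ρ = ‖(τ, ζ)‖ := ⟨_, rfl⟩
  obtain ⟨ν, hν⟩ : ∃ ν, ν = ‖v‖ := ⟨_, rfl⟩
  rw [← hρ] at hn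
  rw [← hν] at hvn
  have h1 := hcK (ρ⁻¹ • (τ, ζ), (ν⁻¹ : ℂ) • v) (by
    constructor
    · simp only [mem_sphere_zero_iff_norm, norm_smul, norm_inv, Real.norm_eq_abs, abs_of_pos hn, ← hρ]
      field_simp
    · simp only [mem_sphere_zero_iff_norm, norm_smul, norm_inv, Complex.norm_real, Real.norm_eq_abs,
        abs_of_pos hvn, ← hν]
      field_simp)
  have h2 : F (ρ⁻¹ • (τ, ζ), (ν⁻¹ : ℂ) • v) = ρ⁻¹ * ν⁻¹ * F ((τ, ζ), v) := by
    simp only [F, Prod.smul_mk, Prod.fst, Pi.smul_apply, smul_eq_mul, map_smul, norm_smul, norm_inv,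
      Complex.norm_real, Real.norm_eq_abs, abs_of_pos hn, abs_of_pos hvn, Complex.ofReal_mul,
      Complex.ofReal_inv]
    have : ((ρ : ℂ)⁻¹ * τ) • (ν : ℂ)⁻¹ • a0 v + ∑ j, ((ρ : ℂ)⁻¹ * ζ j) • (ν : ℂ)⁻¹ • A j v =
        ((ρ : ℂ)⁻¹ * (ν : ℂ)⁻¹) • ((τ : ℂ) • a0 v + ∑ j, (ζ j : ℂ) • A j v) := by
      rw [smul_add, Finset.smul_sum]
      simp only [smul_smul]
      congr 1
      · congr 1; ring
      · refine Finset.sum_congr rfl fun j _ => ?_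
        congr 1; ring
    rw [this, norm_smul, norm_mul, norm_inv, norm_inv, Complex.norm_real, Complex.norm_real,
      Real.norm_eq_abs, Real.norm_eq_abs, abs_of_pos hn, abs_of_pos hvn]
    ring
  rw [h2] at h1
  have h3 : c * ρ * ν ≤ F ((τ, ζ), v) := by
    have h4 := mul_le_mul_of_nonneg_right h1 (by positivity : 0 ≤ ρ * ν)
    have h5 : ρ⁻¹ * ν⁻¹ * F ((τ, ζ), v) * (ρ * ν) = F ((τ, ζ), v) := by field_simp
    rw [h5] at h4
    linarith
  refine le_trans ?_ h3
  rw [hν]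
  gcongr
  rw [hρ]
  exact norm_snd_le (τ, ζ)

/-- The coupling estimate for constant coefficients. -/
theorem coupling_const {a0 : E →L[ℂ] E} {A : Fin (d + 1) → E →L[ℂ] E} {pr : E →L[ℂ] E}
    (h0 : ∀ v, a0 v = 0 → v = 0)
    (hk : ∀ (τ : ℝ) (ζ : Fin (d + 1) → ℝ), ζ ≠ 0 → ∀ v, (τ : ℂ) • a0 v + ∑ j, (ζ j : ℂ) • A j v = 0 →
      pr v = 0 → v = 0) :
    ∃ C, 0 < C ∧ ∀ (ξ : Fin d → ℝ) (τ : ℝ) (w w1 : LL E), HD w w1 → ∀ j,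
      ‖grad ξ w w1 j‖ ≤ C * (‖(Complex.I * τ) • mulOp (cst a0) w +
        ∑ j, mulOp (cst (A j)) (grad ξ w w1 j)‖ + ∑ j, ‖mulOp (cst pr) (grad ξ w w1 j)‖) := by
  obtain ⟨c, hc, hb⟩ := exists_symbol_bound h0 hk
  refine ⟨c⁻¹, by positivity, fun ξ τ w w1 hw j => ?_⟩
  set Y := grad ξ w w1 with hY
  set z := (Complex.I * τ) • mulOp (cst a0) w + ∑ j, mulOp (cst (A j)) (Y j) with hz
  let g : Option (Fin (d + 1)) → LL E := fun o => o.elim (𝓕 z : LL E)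
    fun j => mulOp (cst pr) (𝓕 (Y j) : LL E)
  have hF : ∀ f : LL E, ‖(𝓕 f : LL E)‖ = ‖f‖ := Lp.norm_fourier_eq
  have hz' : (𝓕 z : LL E) = (Complex.I * τ) • mulOp (cst a0) (𝓕 w : LL E) +
      ∑ j, mulOp (cst (A j)) (𝓕 (Y j) : LL E) := by
    have h1 := map_add (Lp.fourierTransformₗᵢ ℝ E) ((Complex.I * τ) • mulOp (cst a0) w)
      (∑ j, mulOp (cst (A j)) (Y j))
    rw [map_sum, map_smul] at h1
    refine h1.trans ?_
    have h2 := fourier_cst a0 w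
    have h3 := fun j => fourier_cst (A j) (Y j)
    rw [← h2]
    simp_rw [← h3]
    rfl
  have hae : ∀ᵐ η, ‖(𝓕 (Y j) : LL E) η‖ ≤ c⁻¹ * ∑ o ∈ Finset.univ, ‖g o η‖ := by
    have a1 := ae_all_iff.2 fun j => fourier_grad hw ξ j
    have a2 := ae_all_iff.2 fun j => coeFn_mulOp (cst (A j)) (𝓕 (Y j) : LL E)
    have a3 := ae_all_iff.2 fun j => coeFn_mulOp (cst pr) (𝓕 (Y j) : LL E)
    have a4 := coeFn_mulOp (cst a0) (𝓕 w : LL E)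
    have a5 := Lp.coeFn_add ((Complex.I * τ) • mulOp (cst a0) (𝓕 w : LL E))
      (∑ j, mulOp (cst (A j)) (𝓕 (Y j) : LL E))
    have a6 := Lp.coeFn_smul (Complex.I * τ) (mulOp (cst a0) (𝓕 w : LL E))
    have a7 := Lp.coeFn_fun_finsetSum Finset.univ fun j => mulOp (cst (A j)) (𝓕 (Y j) : LL E)
    filter_upwards [a1, a2, a3, a4, a5, a6, a7] with η e1 e2 e3 e4 e5 e6 e7
    rw [Fintype.sum_option]
    simp only [g, Option.elim_none, Option.elim_some]
    rw [hz', e5, Pi.add_apply, e6, e7, Pi.smul_apply, e4]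
    simp_rw [e2, e3, hY, e1, cst_apply, map_smul]
    obtain ⟨ζ, hζ⟩ : ∃ ζ, ζ = (Fin.cons (2 * Real.pi * η) ξ : Fin (d + 1) → ℝ) := ⟨_, rfl⟩
    obtain ⟨v, hv⟩ : ∃ v, v = (𝓕 w : LL E) η := ⟨_, rfl⟩
    simp only [← hζ, ← hv]
    have h1 := hb τ ζ v
    have h2 : (Complex.I * (τ : ℂ)) • a0 v + ∑ j, (Complex.I * (ζ j : ℂ)) • A j v =
        Complex.I • ((τ : ℂ) • a0 v + ∑ j, (ζ j : ℂ) • A j v) := by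
      rw [smul_add, Finset.smul_sum]
      simp only [smul_smul]
    rw [h2, norm_I_smul]
    simp only [norm_smul, norm_mul, Complex.norm_I, one_mul, Complex.norm_real]
    have h3 : ‖ζ‖ * ‖pr v‖ ≤ ∑ j, ‖ζ j‖ * ‖pr v‖ := by
      rw [← Finset.sum_mul]
      gcongr
      refine (pi_norm_le_iff_of_nonneg (Finset.sum_nonneg fun j _ => norm_nonneg _)).2 fun j => ?_
      exact Finset.single_le_sum (f := fun j => ‖ζ j‖) (fun j _ => norm_nonneg _) (Finset.mem_univ j)
    have h4 : ‖ζ j‖ ≤ ‖ζ‖ := norm_le_pi_norm ζ j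
    rw [inv_mul_eq_div, le_div_iff₀ hc]
    have h5 : c * ‖ζ j‖ * ‖v‖ ≤ c * ‖ζ‖ * ‖v‖ := by gcongr
    linarith
  have := norm_le_of_ae_sum Finset.univ (by positivity) hae
  rw [hF, Fintype.sum_option] at this
  simp only [g, Option.elim_none, Option.elim_some, hF, ← fourier_cst] at this
  exact this

end Coupling

section LinData

variable {E : Type*} [NormedAddCommGroup E] [InnerProductSpace ℂ E] [FiniteDimensional ℂ E]
variable {d : ℕ}

theorem CfDeriv.sum {ι : Type*} (s : Finset ι) {a a' : ι → Cf E} (h : ∀ i, CfDeriv (a i) (a' i)) :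
    CfDeriv (∑ i ∈ s, a i) (∑ i ∈ s, a' i) := fun x => by
  have := HasDerivAt.fun_sum (u := s) fun i _ => h i x
  simpa [BoundedContinuousFunction.sum_apply] using this

theorem CfDeriv.smul {a a' : Cf E} (h : CfDeriv a a') (c : ℂ) : CfDeriv (c • a) (c • a') :=
  fun x => (h x).const_smul c

theorem CfDeriv.mul {a a' b b' : Cf E} (h : CfDeriv a a') (h' : CfDeriv b b') :
    CfDeriv (a * b) (a' * b + a * b') := fun x => (h x).mul (h' x)

/-- Linear combinations of coefficients with real weights. -/
def lcomb {n : ℕ} (ξ : Fin n → ℝ) (F : Fin n → Cf E) : Cf E := ∑ j, (ξ j : ℂ) • F j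

theorem lcomb_apply {n : ℕ} (ξ : Fin n → ℝ) (F : Fin n → Cf E) (x : ℝ) (v : E) :
    lcomb ξ F x v = ∑ j, (ξ j : ℂ) • F j x v := by
  rw [lcomb, BoundedContinuousFunction.sum_apply, ContinuousLinearMap.sum_apply]
  rfl

theorem CfDeriv.lcomb {n : ℕ} (ξ : Fin n → ℝ) {F F' : Fin n → Cf E}
    (h : ∀ j, CfDeriv (F j) (F' j)) : CfDeriv (lcomb ξ F) (lcomb ξ F') :=
  CfDeriv.sum _ fun j => (h j).smul _

theorem mulOp_lcomb {n : ℕ} (ξ : Fin n → ℝ) (F : Fin n → Cf E) (f : LL E) :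
    mulOp (lcomb ξ F) f = ∑ j, (ξ j : ℂ) • mulOp (F j) f := by
  rw [lcomb, mulOp_sum, ContinuousLinearMap.sum_apply]
  simp only [mulOp_smul, _root_.smul_apply]

theorem norm_le_sum_abs (ξ : EuclideanSpace ℝ (Fin d)) : ‖ξ‖ ≤ ∑ j, |ξ j| := by
  have h0 : 0 ≤ ∑ j, |ξ j| := Finset.sum_nonneg fun j _ => abs_nonneg _
  refine (abs_le_of_sq_le_sq' ?_ h0).2
  rw [EuclideanSpace.norm_sq_eq, sq (∑ j, |ξ j|), Finset.sum_mul]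
  refine Finset.sum_le_sum fun j _ => ?_
  rw [sq, Real.norm_eq_abs]
  gcongr
  exact Finset.single_le_sum (f := fun j => |ξ j|) (fun j _ => abs_nonneg _) (Finset.mem_univ j)

theorem abs_coord_le (ξ : EuclideanSpace ℝ (Fin d)) (j : Fin d) : |ξ j| ≤ ‖ξ‖ :=
  PiLp.norm_apply_le ξ j

variable (E d) in
/-- Coefficients of a linear hyperbolic-parabolic system on the line, depending polynomially on the
tangential frequency. Primes denote derivatives. -/
structure LinData where
  (a0 a0i a0' e e' r0 : Cf E)
  (A A' del r : Fin (d + 1) → Cf E)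
  (B B' : Fin (d + 1) → Fin (d + 1) → Cf E)
  pr : E →L[ℂ] E

/-- The structural hypotheses on the symmetrized system; `s = ± 1` is the sign of the hyperbolic
block of the normal coefficient. -/
structure LinData.Good (L : LinData E d) (s : ℝ) : Prop where
  pr_sa : ∀ v w, ⟪L.pr v, w⟫_ℂ = ⟪v, L.pr w⟫_ℂ
  pr_pr : ∀ v, L.pr (L.pr v) = L.pr v
  a0_sa : ∀ x v w, ⟪L.a0 x v, w⟫_ℂ = ⟪v, L.a0 x w⟫_ℂ
  a0_pos : ∃ c, 0 < c ∧ ∀ x v, c * ‖v‖ ^ 2 ≤ rI v (L.a0 x v)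
  a0_a0i : ∀ x v, L.a0 x (L.a0i x v) = v
  a0i_a0 : ∀ x v, L.a0i x (L.a0 x v) = v
  a0_d : CfDeriv L.a0 L.a0'
  a0_pr : ∀ x v, L.pr (L.a0 x v) = L.a0 x (L.pr v)
  A_sa : ∀ j x v w, ⟪L.A j x v, w⟫_ℂ = ⟪v, L.A j x w⟫_ℂ
  A_d : ∀ j, CfDeriv (L.A j) (L.A' j)
  pr_B : ∀ j k x v, L.pr (L.B j k x v) = L.B j k x v
  B_pr : ∀ j k x v, L.B j k x (L.pr v) = L.B j k x v
  B_d : ∀ j k, CfDeriv (L.B j k) (L.B' j k)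
  ell : ∃ θ, 0 < θ ∧ ∀ (x : ℝ) (ξ : Fin (d + 1) → ℝ) (v : E),
    θ * (∑ j, ξ j ^ 2) * ‖L.pr v‖ ^ 2 ≤ ∑ j, ∑ k, ξ j * ξ k * rI v (L.B j k x v)
  pr_del : ∀ j x v, L.pr (L.del j x v) = L.del j x v
  pr_r : ∀ j x v, L.pr (L.r j x v) = L.r j x v
  r_pr : ∀ j x v, L.r j x (L.pr v) = L.r j x v
  pr_r0 : ∀ x v, L.pr (L.r0 x v) = L.r0 x v
  pr_e : ∀ x v, L.pr (L.e x v) = 0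
  e_d : CfDeriv L.e L.e'
  s_sq : s = 1 ∨ s = -1
  definite : ∃ θ, 0 < θ ∧ ∀ x v, L.pr v = 0 → θ * ‖v‖ ^ 2 ≤ s * rI v (L.A 0 x v)

/-- Behaviour of the coefficients at an end of the line: convergence and genuine coupling. -/
structure LinData.AtEnd (L : LinData E d) (l : Filter ℝ) (α : E →L[ℂ] E)
    (𝒜 : Fin (d + 1) → E →L[ℂ] E) : Prop where
  a0 : Tendsto L.a0 l (𝓝 α)
  A : ∀ j, Tendsto (L.A j) l (𝓝 (𝒜 j))
  a0' : Tendsto L.a0' l (𝓝 0)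
  A' : ∀ j, Tendsto (L.A' j) l (𝓝 0)
  e : Tendsto L.e l (𝓝 0)
  del : ∀ j, Tendsto (fun x => L.del j x * (1 - L.pr)) l (𝓝 0)
  inj : ∀ v, α v = 0 → v = 0
  coupling : ∀ (τ : ℝ) (ζ : Fin (d + 1) → ℝ), ζ ≠ 0 → ∀ v,
    (τ : ℂ) • α v + ∑ j, (ζ j : ℂ) • 𝒜 j v = 0 → L.pr v = 0 → v = 0

/-- All coefficients that vanish at the ends are at most `ε` at `x`. -/
structure LinData.Small (L : LinData E d) (ε x : ℝ) : Prop where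
  a0' : ‖L.a0' x‖ ≤ ε
  A' : ∀ j, ‖L.A' j x‖ ≤ ε
  e : ‖L.e x‖ ≤ ε
  del : ∀ j, ‖L.del j x * (1 - L.pr)‖ ≤ ε

theorem LinData.AtEnd.eventually_small {L : LinData E d} {l : Filter ℝ} {α : E →L[ℂ] E}
    {𝒜 : Fin (d + 1) → E →L[ℂ] E} (h : L.AtEnd l α 𝒜) {ε : ℝ} (hε : 0 < ε) :
    ∀ᶠ x in l, L.Small ε x ∧ ‖L.a0 x - α‖ ≤ ε ∧ ∀ j, ‖L.A j x - 𝒜 j‖ ≤ ε := by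
  have key : ∀ {f : ℝ → E →L[ℂ] E} {y : E →L[ℂ] E}, Tendsto f l (𝓝 y) →
      ∀ᶠ x in l, ‖f x - y‖ ≤ ε := fun hf => by
    filter_upwards [hf.eventually (Metric.closedBall_mem_nhds _ hε)] with x hx
    simpa [dist_eq_norm] using hx
  filter_upwards [key h.a0, eventually_all.2 fun j => key (h.A j), key h.a0',
    eventually_all.2 fun j => key (h.A' j), key h.e, eventually_all.2 fun j => key (h.del j)]
    with x h1 h2 h3 h4 h5 h6
  simp only [sub_zero] at h3 h4 h5 h6
  exact ⟨⟨h3, h4, h5, h6⟩, h1, h2⟩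

/-- Tangential part of a family indexed by all directions. -/
def tang {n : ℕ} {α : Type*} (F : Fin (n + 1) → α) : Fin n → α := fun j => F j.succ

/-- The abstract coefficients at a fixed tangential frequency. -/
def LinData.coefs (L : LinData E d) (ξ : Fin d → ℝ) (sg : Cf E) : Coefs (LL E) where
  a0 := mulOp L.a0
  a0i := mulOp L.a0i
  a0' := mulOp L.a0'
  A := mulOp (L.A 0)
  A' := mulOp (L.A' 0)
  X := mulOp (lcomb ξ (tang L.A))
  X' := mulOp (lcomb ξ (tang L.A'))
  e := mulOp L.e
  e' := mulOp L.e'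
  pr := mulOp (cst L.pr)
  b := mulOp (L.B 0 0)
  b' := mulOp (L.B' 0 0)
  b1 := mulOp (lcomb ξ fun k => L.B 0 k.succ)
  b1' := mulOp (lcomb ξ fun k => L.B' 0 k.succ)
  b2 := mulOp (lcomb ξ fun j => L.B j.succ 0)
  b2' := mulOp (lcomb ξ fun j => L.B' j.succ 0)
  b3 := mulOp (lcomb ξ fun j => lcomb ξ fun k => L.B j.succ k.succ)
  b3' := mulOp (lcomb ξ fun j => lcomb ξ fun k => L.B' j.succ k.succ)
  del := mulOp (L.del 0)
  delx := mulOp (lcomb ξ (tang L.del))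
  sg := mulOp sg

variable (E) in
/-- The derivative as a skew relation. -/
def dRel : SkewRel (LL E) where
  graph := hDGraph
  skew := fun hf hg => HD.skew hf hg

theorem norm_lcomb_apply_le {n : ℕ} (ξ : EuclideanSpace ℝ (Fin n)) {F : Fin n → Cf E} {x : ℝ} {v : E}
    {c : ℝ} (h : ∀ j, ‖F j x v‖ ≤ c) : ‖lcomb ξ F x v‖ ≤ n * ‖ξ‖ * c := by
  rw [lcomb_apply]
  refine (norm_sum_le _ _).trans ?_
  have : ∀ j ∈ Finset.univ, ‖(ξ j : ℂ) • F j x v‖ ≤ ‖ξ‖ * c := fun j _ => by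
    rw [norm_smul, Complex.norm_real, Real.norm_eq_abs]
    exact mul_le_mul (abs_coord_le ξ j) (h j) (norm_nonneg _) (norm_nonneg _)
  refine (Finset.sum_le_sum this).trans_eq ?_
  simp only [Finset.sum_const, Finset.card_univ, Fintype.card_fin, nsmul_eq_mul]
  ring

theorem comm_of_cfDeriv {a a' : Cf E} (h : CfDeriv a a') : (dRel E).Comm (mulOp a) (mulOp a') :=
  fun _ _ hf => HD.mulOp h hf

/-- Identities between coefficients pass to their derivatives. -/
theorem CfDeriv.comp_eq {a a' b b' : Cf E} (ha : CfDeriv a a') (hb : CfDeriv b b') {S T : E →L[ℂ] E}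
    (h : ∀ x v, S (a x v) = b x (T v)) (x : ℝ) (v : E) : S (a' x v) = b' x (T v) := by
  have h1 : CfDeriv (cst S * a) (cst S * a') := by
    have : CfDeriv (cst S) 0 := fun x => hasDerivAt_const x S
    have e : 0 * a + cst S * a' = cst S * a' := Cf.ext' fun x v => by simp [Cf.mul_apply']
    rw [← e]
    exact this.mul ha
  have h2 : CfDeriv (b * cst T) (b' * cst T) := by
    have : CfDeriv (cst T) 0 := fun x => hasDerivAt_const x T
    have e : b' * cst T + b * 0 = b' * cst T := Cf.ext' fun x v => by simp [Cf.mul_apply']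
    rw [← e]
    exact hb.mul this
  have h3 : cst S * a = b * cst T := Cf.ext' h
  rw [h3] at h1
  have := (h1 x).unique (h2 x)
  exact congrArg (fun T : E →L[ℂ] E => T v) this

theorem norm_mulOp_le_pr {a : Cf E} {pr : E →L[ℂ] E} {c : ℝ} (hc : 0 ≤ c)
    (h : ∀ x v, ‖a x v‖ ≤ c * ‖pr v‖) (f : LL E) : ‖mulOp a f‖ ≤ c * ‖mulOp (cst pr) f‖ := by
  have := norm_mulOp_le_of_pointwise (a := a) (b := cst pr) le_rfl hc
    (fun x v => by rw [zero_mul, zero_add]; exact h x v) f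
  simpa using this

theorem mulOp_cst_apply_eq {a b : Cf E} {T : E →L[ℂ] E} (h : ∀ x v, T (a x v) = b x v) (f : LL E) :
    mulOp (cst T) (mulOp a f) = mulOp b f := by
  rw [← mul_apply_eq_comp, ← mulOp_mul]
  congr 2
  exact Cf.ext' h

theorem rI_mulOp_ge {a : Cf E} {c : ℝ} (h : ∀ x v, c * ‖v‖ ^ 2 ≤ rI v (a x v)) (f : LL E) :
    c * ‖f‖ ^ 2 ≤ rI f (mulOp a f) := by
  have := re_inner_mulOp_ge (a := a) (b := 1) (c := 0) (f := f) (p := c) (q := 0)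
    (Eventually.of_forall fun x => by simpa [rI] using h x (f x))
  simpa [mulOp_one, rI] using this

theorem sum_grad (A : Fin (d + 1) → Cf E) (ξ : Fin d → ℝ) (w w1 : LL E) :
    ∑ j, mulOp (A j) (grad ξ w w1 j) =
      mulOp (A 0) w1 + Complex.I • mulOp (lcomb ξ (tang A)) w := by
  rw [Fin.sum_univ_succ, mulOp_lcomb, Finset.smul_sum]
  simp only [grad, Fin.cons_zero, Fin.cons_succ, map_smul, smul_smul, tang]

theorem quad_grad (B : Fin (d + 1) → Fin (d + 1) → Cf E) (ξ : Fin d → ℝ) (y y1 : LL E) :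
    quad B (grad ξ y y1) = rI y1 (mulOp (B 0 0) y1) +
      rI y1 (Complex.I • mulOp (lcomb ξ fun k => B 0 k.succ) y) -
      rI y (Complex.I • mulOp (lcomb ξ fun j => B j.succ 0) y1) +
      rI y (mulOp (lcomb ξ fun j => lcomb ξ fun k => B j.succ k.succ) y) := by
  have hs : ∀ (c : ℝ) (f g : LL E), rI f ((c : ℂ) • g) = c * rI f g := fun c f g => by
    simp only [rI, inner_smul_right, Complex.re_ofReal_mul]
  have hsum : ∀ (n : ℕ) (f : LL E) (g : Fin n → LL E), rI f (∑ j, g j) = ∑ j, rI f (g j) :=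
    fun n f g => by simp only [rI, inner_sum, Complex.re_sum]
  have hl : ∀ (c : ℝ) (f g : LL E), rI ((Complex.I * c) • f) g = -(c * rI f (Complex.I • g)) := by
    intro c f g
    rw [mul_comm, ← smul_smul, rI_comm, hs, rI_comm, rI_I_smul_right]
    ring
  unfold quad
  rw [Fin.sum_univ_succ, Fin.sum_univ_succ]
  simp_rw [Fin.sum_univ_succ]
  simp only [grad, Fin.cons_zero, Fin.cons_succ, map_smul, hl, mulOp_lcomb, Finset.smul_sum, hsum]
  have e1 : ∀ (c : ℝ) (f g : LL E), rI f ((Complex.I * c) • g) = rI f (Complex.I • (c : ℂ) • g) :=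
    fun c f g => by rw [smul_smul]
  have e2 : ∀ (c c' : ℝ) (f g : LL E), -(c * rI f (Complex.I • (Complex.I * c') • g)) =
      rI f ((c : ℂ) • (c' : ℂ) • g) := fun c c' f g => by
    rw [smul_smul, ← mul_assoc, Complex.I_mul_I, hs, hs, neg_one_mul, neg_smul, rI_neg_right, hs]
    ring
  simp only [e1, e2, Finset.sum_add_distrib, Finset.sum_neg_distrib]
  have e3 : ∀ (c : ℝ) (f g : LL E), rI f (Complex.I • (c : ℂ) • g) = c * rI f (Complex.I • g) :=
    fun c f g => by rw [smul_comm, hs]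
  simp only [e3]
  ring

end LinData

section LinDataBounds

variable {E : Type*} [NormedAddCommGroup E] [InnerProductSpace ℂ E] [FiniteDimensional ℂ E]
variable {d : ℕ} {L : LinData E d} {s : ℝ}

/-- A common bound for the principal coefficients. -/
structure LinData.Bdd (L : LinData E d) (N : ℝ) : Prop where
  nonneg : 0 ≤ N
  a0 : ∀ x v, ‖L.a0 x v‖ ≤ N * ‖v‖
  a0i : ∀ x v, ‖L.a0i x v‖ ≤ N * ‖v‖
  a0' : ∀ x v, ‖L.a0' x v‖ ≤ N * ‖v‖
  A : ∀ j x v, ‖L.A j x v‖ ≤ N * ‖v‖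
  A' : ∀ j x v, ‖L.A' j x v‖ ≤ N * ‖v‖
  del : ∀ j x v, ‖L.del j x v‖ ≤ N * ‖v‖
  del' : ∀ j x v, ‖(L.del j x * (1 - L.pr)) v‖ ≤ N * ‖v‖
  B : ∀ j k x v, ‖L.B j k x v‖ ≤ N * ‖v‖
  B' : ∀ j k x v, ‖L.B' j k x v‖ ≤ N * ‖v‖

theorem LinData.exists_bdd (L : LinData E d) : ∃ N, L.Bdd N := by
  have hb : ∀ (a : Cf E) x v, ‖a x v‖ ≤ ‖a‖ * ‖v‖ := fun a x v =>
    ((a x).le_opNorm v).trans (by gcongr; exact a.norm_coe_le_norm x)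
  have key : ∀ (a : Cf E), ∀ᶠ N in atTop, ∀ x v, ‖a x v‖ ≤ N * ‖v‖ := fun a => by
    filter_upwards [eventually_ge_atTop ‖a‖] with N hN x v
    exact (hb a x v).trans (by gcongr)
  have h1 := eventually_all.2 fun j => key (L.A j)
  have h2 := eventually_all.2 fun j => key (L.A' j)
  have h3 := eventually_all.2 fun j => key (L.del j)
  have h4 := eventually_all.2 fun j => eventually_all.2 fun k => key (L.B j k)
  have h5 := eventually_all.2 fun j => eventually_all.2 fun k => key (L.B' j k)
  have h6 := eventually_all.2 fun j => key (L.del j * (1 - cst L.pr))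
  obtain ⟨N, h0, g1, g2, g3, g4, g5, g6, g7, g8, g9⟩ := (eventually_ge_atTop (0 : ℝ)).and
    ((key L.a0).and ((key L.a0i).and ((key L.a0').and (h1.and (h2.and (h3.and (h6.and
      (h4.and h5)))))))) |>.exists
  exact ⟨N, h0, g1, g2, g3, g4, g5, g6, g7, g8, g9⟩

theorem norm_cutoff_le {a : Cf E} {σ : ℝ → ℝ} (hσ : Continuous σ) {Cσ : ℝ} (hCσ : ∀ x, |σ x| ≤ Cσ)
    {ε N : ℝ} (hε : 0 ≤ ε) (hN : 0 ≤ N) (h1 : ∀ x v, ‖a x v‖ ≤ N * ‖v‖)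
    (h2 : ∀ x, σ x = 1 ∨ ∀ v, ‖a x v‖ ≤ ε * ‖v‖) (f : LL E) :
    ‖mulOp a f‖ ≤ ε * ‖f‖ + N * ‖mulOp (rscal σ hσ Cσ hCσ) f‖ := by
  refine norm_mulOp_le_of_pointwise hε hN (fun x v => ?_) f
  rw [rscal_apply, norm_smul, Complex.norm_real, Real.norm_eq_abs]
  rcases h2 x with h | h
  · have := h1 x v
    rw [h]
    simp only [abs_one, one_mul]
    have : 0 ≤ ε * ‖v‖ := by positivity
    linarith [h1 x v]
  · have : 0 ≤ N * (|σ x| * ‖v‖) := by positivity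
    linarith [h v]

theorem norm_mulOp_le' {a : Cf E} {c : ℝ} (hc : 0 ≤ c) (h : ∀ x v, ‖a x v‖ ≤ c * ‖v‖) (f : LL E) :
    ‖mulOp a f‖ ≤ c * ‖f‖ := by
  refine norm_le_of_ae hc ?_
  filter_upwards [coeFn_mulOp a f] with x hx
  rw [hx]
  exact h x _

theorem sum_sq_grad (T : LL E →L[ℂ] LL E) (ξ : EuclideanSpace ℝ (Fin d)) (y y1 : LL E) :
    ∑ j, ‖T (grad ξ y y1 j)‖ ^ 2 = ‖T y1‖ ^ 2 + ‖ξ‖ ^ 2 * ‖T y‖ ^ 2 := by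
  rw [Fin.sum_univ_succ, EuclideanSpace.norm_sq_eq, Finset.sum_mul]
  simp only [grad, Fin.cons_zero, Fin.cons_succ, map_smul, norm_smul, norm_mul, Complex.norm_I,
    one_mul, Complex.norm_real, mul_pow]

/-- The structural bounds hold, uniformly with respect to the smallness parameter. -/
theorem LinData.Good.bounds (h : L.Good s) : ∃ C c : ℝ, 1 ≤ C ∧ 0 < c ∧ ∀ C', C ≤ C' →
    ∀ (ε : ℝ), 0 ≤ ε → ∀ (σ : ℝ → ℝ) (hσ : Continuous σ) (hσ1 : ∀ x, |σ x| ≤ 1),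
      (∀ x, σ x = 1 ∨ L.Small (ε / (d + 1)) x) → ∀ ξ : EuclideanSpace ℝ (Fin d),
      (L.coefs ξ (rscal σ hσ 1 hσ1)).Bounds (dRel E) ‖ξ‖ c C' ε := by
  obtain ⟨c0, hc0, ha0⟩ := h.a0_pos
  obtain ⟨θ, hθ, hell⟩ := h.ell
  obtain ⟨Cg, hCg, hgar⟩ := garding hθ h.pr_sa h.pr_pr h.pr_B h.B_pr h.B_d hell
  obtain ⟨N, hN⟩ := L.exists_bdd
  have hN0 := hN.nonneg
  have hd1 : (1 : ℝ) ≤ d + 1 := by linarith [(Nat.cast_nonneg d : (0 : ℝ) ≤ d)]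
  have hd0 : (0 : ℝ) ≤ d := Nat.cast_nonneg d
  refine ⟨1 + (d + 1) ^ 2 * N + Cg, min c0 (θ / 2), by
    have : 0 ≤ (d + 1 : ℝ) ^ 2 * N := by positivity
    linarith, by positivity, ?_⟩
  intro C hC ε hε σ hσ hσ1 hsm ξ
  have hN2 : 0 ≤ (d + 1 : ℝ) ^ 2 * N := by positivity
  have hC0 : 0 ≤ C := by linarith
  have hdN : 0 ≤ d * N := by positivity
  have hddN : 0 ≤ d * (d * N) := by positivity
  have hCN : N ≤ C := by linarith
  have hCdN : d * N ≤ C := by linarith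
  have hCddN : d * (d * N) ≤ C := by linarith
  have hεd : ε / (d + 1) ≤ ε := div_le_self hε hd1
  have hεd0 : 0 ≤ ε / (d + 1) := by positivity
  have hdε : d * (ε / (d + 1)) ≤ ε := by
    rw [← mul_div_assoc, div_le_iff₀ (by positivity)]
    nlinarith
  set σo : Cf E := rscal σ hσ 1 hσ1 with hσo
  have hB' : ∀ j k x v, L.pr (L.B' j k x v) = L.B' j k x v := fun j k x v => by
    simpa using (h.B_d j k).comp_eq (h.B_d j k) (S := L.pr) (T := 1)
      (fun x v => by simpa using h.pr_B j k x v) x v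
  have hB'2 : ∀ j k x v, L.B' j k x (L.pr v) = L.B' j k x v := fun j k x v => by
    simpa using ((h.B_d j k).comp_eq (h.B_d j k) (S := 1) (T := L.pr)
      (fun x v => by simpa using (h.B_pr j k x v).symm) x v).symm
  have bB : ∀ j k x v, ‖L.B j k x v‖ ≤ N * ‖L.pr v‖ := fun j k x v => by
    rw [← h.B_pr]; exact hN.B j k x _
  have bB' : ∀ j k x v, ‖L.B' j k x v‖ ≤ N * ‖L.pr v‖ := fun j k x v => by
    rw [← hB'2]; exact hN.B' j k x _
  have cpr : CfDeriv (cst L.pr) 0 := fun x => hasDerivAt_const x L.pr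
  have hprl : ∀ (F : Fin d → Cf E), (∀ j x v, L.pr (F j x v) = F j x v) → ∀ x v,
      L.pr (lcomb ξ F x v) = lcomb ξ F x v := fun F hF x v => by
    rw [lcomb_apply, map_sum]
    simp only [map_smul, hF]
  have l1 : ∀ (F : Fin d → Cf E), (∀ j x v, ‖F j x v‖ ≤ N * ‖L.pr v‖) → ∀ x v,
      ‖lcomb ξ F x v‖ ≤ C * ‖ξ‖ * ‖L.pr v‖ := fun F hF x v => by
    refine (norm_lcomb_apply_le ξ (fun j => hF j x v)).trans ?_
    have : d * N * (‖ξ‖ * ‖L.pr v‖) ≤ C * (‖ξ‖ * ‖L.pr v‖) := by gcongr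
    linarith
  have l2 : ∀ (F : Fin d → Fin d → Cf E), (∀ j k x v, ‖F j k x v‖ ≤ N * ‖L.pr v‖) → ∀ x v,
      ‖lcomb ξ (fun j => lcomb ξ fun k => F j k) x v‖ ≤ C * ‖ξ‖ ^ 2 * ‖L.pr v‖ := fun F hF x v => by
    refine (norm_lcomb_apply_le ξ fun j => norm_lcomb_apply_le ξ fun k => hF j k x v).trans ?_
    have : d * (d * N) * (‖ξ‖ ^ 2 * ‖L.pr v‖) ≤ C * (‖ξ‖ ^ 2 * ‖L.pr v‖) := by gcongr
    linarith
  have t1 : ∀ (F : Fin d → Cf E), (∀ j x v, ‖F j x v‖ ≤ N * ‖v‖) → ∀ x v,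
      ‖lcomb ξ F x v‖ ≤ C * ‖ξ‖ * ‖v‖ := fun F hF x v => by
    refine (norm_lcomb_apply_le ξ (fun j => hF j x v)).trans ?_
    have : d * N * (‖ξ‖ * ‖v‖) ≤ C * (‖ξ‖ * ‖v‖) := by gcongr
    linarith
  have t2 : ∀ (F : Fin d → Cf E) x, (∀ j v, ‖F j x v‖ ≤ ε / (d + 1) * ‖v‖) → ∀ v,
      ‖lcomb ξ F x v‖ ≤ ‖ξ‖ * ε * ‖v‖ := fun F x hF v => by
    refine (norm_lcomb_apply_le ξ (fun j => hF j v)).trans ?_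
    have : d * (ε / (d + 1)) * (‖ξ‖ * ‖v‖) ≤ ε * (‖ξ‖ * ‖v‖) := by gcongr
    linarith
  have ptw : ∀ {T : E →L[ℂ] E} {η : ℝ}, ‖T‖ ≤ η → ∀ v, ‖T v‖ ≤ η * ‖v‖ := fun hT v =>
    (ContinuousLinearMap.le_opNorm _ v).trans (by gcongr)
  have cut1 : ∀ {a : Cf E}, (∀ x v, ‖a x v‖ ≤ N * ‖v‖) → (∀ x, L.Small (ε / (d + 1)) x →
      ‖a x‖ ≤ ε / (d + 1)) → ∀ f, ‖mulOp a f‖ ≤ ε * ‖f‖ + C * ‖mulOp σo f‖ := fun h1 h2 f => by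
    refine (norm_cutoff_le hσ hσ1 hε hN0 h1 (fun x => (hsm x).imp_right fun hx v => ?_) f).trans
      (by gcongr)
    exact (ptw (h2 x hx) v).trans (by gcongr)
  have cutx : ∀ {F : Fin d → Cf E}, (∀ j x v, ‖F j x v‖ ≤ N * ‖v‖) → (∀ j x,
      L.Small (ε / (d + 1)) x → ‖F j x‖ ≤ ε / (d + 1)) → ∀ f,
      ‖mulOp (lcomb ξ F) f‖ ≤ ‖ξ‖ * (ε * ‖f‖ + C * ‖mulOp σo f‖) := fun h1 h2 f => by
    refine (norm_cutoff_le (N := C * ‖ξ‖) (ε := ‖ξ‖ * ε) hσ hσ1 (by positivity) (by positivity)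
      (t1 _ h1) (fun x => (hsm x).imp_right fun hx => ?_) f).trans_eq (by ring)
    exact t2 _ x fun j v => ptw (h2 j x hx) v
  have small' : ∀ j x, L.Small (ε / (d + 1)) x → ‖(L.del j * (1 - cst L.pr)) x‖ ≤ ε / (d + 1) :=
    fun j x hx => hx.del j
  have npr : ∀ v, ‖L.pr v‖ ≤ ‖v‖ := fun v => by
    have h1 : ‖L.pr v‖ ^ 2 ≤ ‖v‖ * ‖L.pr v‖ := by
      have : ‖L.pr v‖ ^ 2 = rI v (L.pr v) := by
        rw [← rI_self]; unfold rI; rw [h.pr_sa, h.pr_pr]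
      rw [this]
      exact rI_le _ _
    by_contra hlt
    push Not at hlt
    nlinarith [norm_nonneg v]
  have lsplit : ∀ f, mulOp (lcomb ξ (tang L.del)) f =
      mulOp (lcomb ξ fun j => L.del j.succ * (1 - cst L.pr)) f +
        mulOp (lcomb ξ (tang L.del)) (mulOp (cst L.pr) f) := fun f => by
    rw [← mul_apply_eq_comp, ← mulOp_mul, ← _root_.add_apply, ← mulOp_add]
    congr 2
    refine Cf.ext' fun x v => ?_
    rw [BoundedContinuousFunction.add_apply, _root_.add_apply, Cf.mul_apply', lcomb_apply, lcomb_apply,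
      lcomb_apply, ← Finset.sum_add_distrib]
    refine Finset.sum_congr rfl fun j _ => ?_
    rw [← smul_add]
    simp [tang, Cf.mul_apply', cst_apply]
  exact
  { pr_sa := SA_of_pointwise fun x v w => h.pr_sa v w
    pr_pr := fun f => mulOp_cst_apply_eq (fun x v => h.pr_pr v) f
    pr_D := fun f f' hf => HD.cst hf L.pr
    a0_sa := SA_of_pointwise h.a0_sa
    a0_pos := fun f => le_trans (by gcongr; exact min_le_left _ _) (rI_mulOp_ge ha0 f)
    a0_le := fun f => (norm_mulOp_le' hN0 hN.a0 f).trans (by gcongr)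
    a0i_le := fun f => (norm_mulOp_le' hN0 hN.a0i f).trans (by gcongr)
    a0_a0i := fun f => by
      have : L.a0 * L.a0i = 1 := Cf.ext' h.a0_a0i
      rw [← mul_apply_eq_comp]
      simp only [LinData.coefs, ← mulOp_mul, this, mulOp_one]
      rfl
    a0i_a0 := fun f => by
      have : L.a0i * L.a0 = 1 := Cf.ext' h.a0i_a0
      rw [← mul_apply_eq_comp]
      simp only [LinData.coefs, ← mulOp_mul, this, mulOp_one]
      rfl
    a0_comm := comm_of_cfDeriv h.a0_d
    a0'_le := cut1 hN.a0' fun x hx => hx.a0'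
    pr_a0i := fun f => mulOp_comm_apply (Cf.ext' fun x v => by
      rw [Cf.mul_apply', Cf.mul_apply', cst_apply, cst_apply]
      conv_lhs => rw [← h.a0i_a0 x (L.pr (L.a0i x v)), ← h.a0_pr, h.a0_a0i]) f
    pr_a0' := fun f => mulOp_comm_apply (Cf.ext' fun x v =>
      h.a0_d.comp_eq h.a0_d h.a0_pr x v) f
    A_sa := SA_of_pointwise (h.A_sa 0)
    A_le := fun f => (norm_mulOp_le' hN0 (hN.A 0) f).trans (by gcongr)
    A_comm := comm_of_cfDeriv (h.A_d 0)
    A'_le := cut1 (hN.A' 0) fun x hx => hx.A' 0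
    X_sa := SA_of_pointwise fun x v w => by
      rw [lcomb_apply, lcomb_apply, sum_inner, inner_sum]
      refine Finset.sum_congr rfl fun j _ => ?_
      rw [inner_smul_left, inner_smul_right, Complex.conj_ofReal]
      simp only [tang, h.A_sa]
    X_le := fun f => norm_mulOp_le' (by positivity) (t1 _ fun j => hN.A j.succ) f
    X_comm := comm_of_cfDeriv (CfDeriv.lcomb ξ fun j => h.A_d j.succ)
    X'_le := cutx (fun j => hN.A' j.succ) fun j x hx => hx.A' j.succ
    pr_b := fun f => mulOp_cst_apply_eq (h.pr_B 0 0) f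
    pr_b1 := fun f => mulOp_cst_apply_eq (hprl _ fun j => h.pr_B 0 j.succ) f
    pr_b2 := fun f => mulOp_cst_apply_eq (hprl _ fun j => h.pr_B j.succ 0) f
    pr_b3 := fun f => mulOp_cst_apply_eq (hprl _ fun j => hprl _ fun k => h.pr_B j.succ k.succ) f
    b_le := fun f => norm_mulOp_le_pr hC0 (fun x v => (bB 0 0 x v).trans (by gcongr)) f
    b1_le := fun f => norm_mulOp_le_pr (by positivity) (l1 _ fun k => bB 0 k.succ) f
    b2_le := fun f => norm_mulOp_le_pr (by positivity) (l1 _ fun j => bB j.succ 0) f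
    b3_le := fun f => norm_mulOp_le_pr (by positivity) (l2 _ fun j k => bB j.succ k.succ) f
    b_comm := comm_of_cfDeriv (h.B_d 0 0)
    b1_comm := comm_of_cfDeriv (CfDeriv.lcomb ξ fun k => h.B_d 0 k.succ)
    b2_comm := comm_of_cfDeriv (CfDeriv.lcomb ξ fun j => h.B_d j.succ 0)
    b3_comm := comm_of_cfDeriv (CfDeriv.lcomb ξ fun j => CfDeriv.lcomb ξ fun k =>
      h.B_d j.succ k.succ)
    pr_b' := fun f => mulOp_cst_apply_eq (hB' 0 0) f
    pr_b1' := fun f => mulOp_cst_apply_eq (hprl _ fun j => hB' 0 j.succ) f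
    pr_b2' := fun f => mulOp_cst_apply_eq (hprl _ fun j => hB' j.succ 0) f
    pr_b3' := fun f => mulOp_cst_apply_eq (hprl _ fun j => hprl _ fun k => hB' j.succ k.succ) f
    b'_le := fun f => norm_mulOp_le_pr hC0 (fun x v => (bB' 0 0 x v).trans (by gcongr)) f
    b1'_le := fun f => norm_mulOp_le_pr (by positivity) (l1 _ fun k => bB' 0 k.succ) f
    b2'_le := fun f => norm_mulOp_le_pr (by positivity) (l1 _ fun j => bB' j.succ 0) f
    b3'_le := fun f => norm_mulOp_le_pr (by positivity) (l2 _ fun j k => bB' j.succ k.succ) f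
    pr_del := fun f => mulOp_cst_apply_eq (h.pr_del 0) f
    pr_delx := fun f => mulOp_cst_apply_eq (hprl _ fun j => h.pr_del j.succ) f
    del_le := fun f => by
      have e : mulOp (L.del 0) f = mulOp (L.del 0 * (1 - cst L.pr)) f +
          mulOp (L.del 0) (mulOp (cst L.pr) f) := by
        rw [← mul_apply_eq_comp, ← mulOp_mul, ← _root_.add_apply, ← mulOp_add]
        congr 2
        refine Cf.ext' fun x v => ?_
        simp [Cf.mul_apply', cst_apply]
      change ‖mulOp (L.del 0) f‖ ≤ _
      rw [e]
      refine (norm_add_le _ _).trans (add_le_add (cut1 (hN.del' 0) (fun x hx => small' 0 x hx) f) ?_)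
      exact (norm_mulOp_le' hN0 (hN.del 0) _).trans
        (mul_le_mul_of_nonneg_right hCN (norm_nonneg (mulOp (cst L.pr) f)))
    delx_le := fun f => by
      change ‖mulOp (lcomb ξ (tang L.del)) f‖ ≤ _
      rw [lsplit f]
      refine (norm_add_le _ _).trans ?_
      rw [mul_add]
      refine add_le_add (cutx (fun j => hN.del' j.succ) (fun j x hx => small' j.succ x hx) f) ?_
      refine (norm_mulOp_le' (by positivity) (t1 _ fun j => hN.del j.succ) _).trans_eq ?_
      simp only [LinData.coefs]
      ring
    sg_le := fun f => by
      refine (norm_mulOp_le' (c := 1) zero_le_one (fun x v => ?_) f).trans_eq (one_mul _)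
      rw [rscal_apply, norm_smul, Complex.norm_real, Real.norm_eq_abs]
      gcongr
      exact hσ1 x
    garding := fun y y1 hy => by
      have h1 := hgar ξ y y1 hy
      rw [quad_grad, sum_sq_grad] at h1
      refine le_trans ?_ h1
      have h2 : min c0 (θ / 2) ≤ θ / 2 := min_le_right _ _
      have h3 : Cg ≤ C := by linarith
      gcongr <;> exact le_rfl }

end LinDataBounds

section LinDataCoupling

variable {E : Type*} [NormedAddCommGroup E] [InnerProductSpace ℂ E] [FiniteDimensional ℂ E]
variable {d : ℕ} {L : LinData E d} {s : ℝ}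

theorem le_sum_norm_grad (T : LL E →L[ℂ] LL E) (ξ : EuclideanSpace ℝ (Fin d)) (w w1 : LL E) :
    ‖T w1‖ + ‖ξ‖ * ‖T w‖ ≤ ∑ j, ‖T (grad ξ w w1 j)‖ := by
  rw [Fin.sum_univ_succ]
  simp only [grad, Fin.cons_zero, Fin.cons_succ, map_smul, norm_smul, norm_mul, Complex.norm_I,
    one_mul, Complex.norm_real]
  rw [← Finset.sum_mul]
  gcongr
  exact norm_le_sum_abs ξ

theorem sum_norm_grad_le (T : LL E →L[ℂ] LL E) (ξ : EuclideanSpace ℝ (Fin d)) (w w1 : LL E) :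
    ∑ j, ‖T (grad ξ w w1 j)‖ ≤ (d + 1) * (‖T w1‖ + ‖ξ‖ * ‖T w‖) := by
  rw [Fin.sum_univ_succ]
  simp only [grad, Fin.cons_zero, Fin.cons_succ, map_smul, norm_smul, norm_mul, Complex.norm_I,
    one_mul, Complex.norm_real]
  rw [← Finset.sum_mul]
  have h1 : ∑ j, ‖ξ j‖ ≤ d * ‖ξ‖ := by
    refine (Finset.sum_le_sum fun j _ => abs_coord_le ξ j).trans_eq ?_
    simp
  have h2 : (∑ j, ‖ξ j‖) * ‖T w‖ ≤ d * ‖ξ‖ * ‖T w‖ := by gcongr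
  have h3 : 0 ≤ d * ‖T w1‖ := by positivity
  have h4 : 0 ≤ ‖ξ‖ * ‖T w‖ := by positivity
  linarith

theorem norm_rscal_le {φ : ℝ → ℝ} {h : Continuous φ} {C : ℝ} (hC : ∀ x, |φ x| ≤ C) (f : LL E) :
    ‖mulOp (rscal φ h C hC) f‖ ≤ C * ‖f‖ := by
  have hC0 : 0 ≤ C := (abs_nonneg _).trans (hC 0)
  refine norm_mulOp_le' hC0 (fun x v => ?_) f
  rw [rscal_apply, norm_smul, Complex.norm_real, Real.norm_eq_abs]
  gcongr
  exact hC x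

theorem cfDeriv_rscal {φ φ' : ℝ → ℝ} {h : Continuous φ} {h' : Continuous φ'} {C C' : ℝ}
    {hC : ∀ x, |φ x| ≤ C} {hC' : ∀ x, |φ' x| ≤ C'} (hd : ∀ x, HasDerivAt φ (φ' x) x) :
    CfDeriv (rscal φ h C hC : Cf E) (rscal φ' h' C' hC') := fun x =>
  ((hd x).ofReal_comp).smul_const (1 : E →L[ℂ] E)

theorem exists_smoothTransition_deriv : ∃ (f' : ℝ → ℝ) (D : ℝ),
    (∀ x, HasDerivAt Real.smoothTransition (f' x) x) ∧ Continuous f' ∧ ∀ x, |f' x| ≤ D := by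
  have hsm : ContDiff ℝ 1 Real.smoothTransition := Real.smoothTransition.contDiff
  have hc : Continuous (deriv Real.smoothTransition) := hsm.continuous_deriv le_rfl
  have hcs : HasCompactSupport (deriv Real.smoothTransition) := by
    refine HasCompactSupport.intro (isCompact_Icc (a := (0 : ℝ)) (b := 1)) fun x hx => ?_
    rw [Set.mem_Icc, not_and_or, not_le, not_le] at hx
    rcases hx with hx | hx
    · have : Real.smoothTransition =ᶠ[𝓝 x] fun _ => 0 := by
        filter_upwards [gt_mem_nhds hx] with y hy
        exact Real.smoothTransition.zero_of_nonpos hy.le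
      rw [this.deriv_eq, deriv_const]
    · have : Real.smoothTransition =ᶠ[𝓝 x] fun _ => 1 := by
        filter_upwards [lt_mem_nhds hx] with y hy
        exact Real.smoothTransition.one_of_one_le hy.le
      rw [this.deriv_eq, deriv_const]
  obtain ⟨D, hD⟩ := hcs.exists_bound_of_continuous hc
  exact ⟨deriv Real.smoothTransition, D,
    fun x => ((hsm.differentiable (by norm_num)) x).hasDerivAt, hc, hD⟩

/-- The coupling estimate localized where the coefficients are almost constant. -/
theorem coupling_localized {α : E →L[ℂ] E} {𝒜 : Fin (d + 1) → E →L[ℂ] E} {pr : E →L[ℂ] E} {C0 : ℝ}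
    (hC0 : 0 ≤ C0) (hpr : ∀ v, ‖pr v‖ ≤ ‖v‖)
    (hcp : ∀ (ξ : Fin d → ℝ) (τ : ℝ) (w w1 : LL E), HD w w1 → ∀ j,
      ‖grad ξ w w1 j‖ ≤ C0 * (‖(Complex.I * τ) • mulOp (cst α) w +
        ∑ j, mulOp (cst (𝒜 j)) (grad ξ w w1 j)‖ + ∑ j, ‖mulOp (cst pr) (grad ξ w w1 j)‖))
    {χ χ' : ℝ → ℝ} {D : ℝ} (hχ : Continuous χ) (hχ' : Continuous χ') (h1 : ∀ x, |χ x| ≤ 1)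
    (hD : ∀ x, |χ' x| ≤ D) (hd : ∀ x, HasDerivAt χ (χ' x) x) {ε : ℝ} (hε : 0 ≤ ε)
    {a0 : Cf E} {A : Fin (d + 1) → Cf E}
    (hs : ∀ x, χ x = 0 ∨ (‖a0 x - α‖ ≤ ε ∧ ∀ j, ‖A j x - 𝒜 j‖ ≤ ε))
    (ξ : Fin d → ℝ) (τ : ℝ) {w w1 : LL E} (hw : HD w w1) :
    ∑ j, ‖mulOp (rscal χ hχ 1 h1) (grad ξ w w1 j)‖ ≤
      (d + 1) * C0 * (‖(Complex.I * τ) • mulOp a0 w + ∑ j, mulOp (A j) (grad ξ w w1 j)‖ +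
        ∑ j, ‖mulOp (cst pr) (grad ξ w w1 j)‖ + ε * (|τ| * ‖w‖ + ∑ j, ‖grad ξ w w1 j‖)) +
      ((d + 1) * C0 * (‖𝒜 0‖ + 1) * D + D) * ‖w‖ := by
  set P : Cf E := rscal χ hχ 1 h1 with hP
  set P' : Cf E := rscal χ' hχ' D hD with hP'
  set Y := grad ξ w w1 with hY
  set z := (Complex.I * τ) • mulOp a0 w + ∑ j, mulOp (A j) (Y j) with hz
  let e : Fin (d + 1) → LL E := Fin.cons w fun _ => 0
  have hu : HD (mulOp P w) (mulOp P' w + mulOp P w1) := HD.mulOp (cfDeriv_rscal hd) hw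
  have hYu : ∀ j, grad ξ (mulOp P w) (mulOp P' w + mulOp P w1) j =
      mulOp P (Y j) + mulOp P' (e j) := fun j => by
    refine Fin.cases ?_ (fun j => ?_) j
    · simp only [hY, grad, Fin.cons_zero, e]
      abel
    · simp only [hY, grad, Fin.cons_succ, e, map_zero, add_zero, map_smul]
  have hc := hcp ξ τ _ _ hu
  simp only [hYu] at hc
  have bP : ∀ f, ‖mulOp P f‖ ≤ ‖f‖ := fun f => (norm_rscal_le h1 f).trans_eq (one_mul _)
  have bP' : ∀ f, ‖mulOp P' f‖ ≤ D * ‖f‖ := norm_rscal_le hD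
  have hD0 : 0 ≤ D := (abs_nonneg _).trans (hD 0)
  have bpr : ∀ f, ‖mulOp (cst pr) f‖ ≤ ‖f‖ := fun f =>
    (norm_mulOp_le' (c := 1) zero_le_one (fun x v => by simpa [cst_apply] using hpr v) f).trans_eq
      (one_mul _)
  have bdiff : ∀ {T : E →L[ℂ] E} {a : Cf E}, (∀ x, χ x = 0 ∨ ‖a x - T‖ ≤ ε) → ∀ f,
      ‖mulOp (cst T) (mulOp P f) - mulOp P (mulOp a f)‖ ≤ ε * ‖f‖ := fun {T a} hT f => by
    rw [← mul_apply_eq_comp, ← mul_apply_eq_comp, ← mulOp_mul, ← mulOp_mul, ← _root_.sub_apply,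
      ← mulOp_sub]
    refine norm_mulOp_le' hε (fun x v => ?_) f
    have : (cst T * P - P * a) x v = -((χ x : ℂ) • (a x - T) v) := by
      rw [BoundedContinuousFunction.sub_apply, _root_.sub_apply, Cf.mul_apply', Cf.mul_apply',
        rscal_apply, rscal_apply, cst_apply, map_smul, _root_.sub_apply, smul_sub]
      abel
    rw [this, norm_neg, norm_smul, Complex.norm_real, Real.norm_eq_abs]
    rcases hT x with h | h
    · rw [h]
      simp only [abs_zero, zero_mul]
      positivity
    · calc |χ x| * ‖(a x - T) v‖ ≤ 1 * (ε * ‖v‖) := by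
            gcongr
            · exact h1 x
            · exact ((a x - T).le_opNorm v).trans (by gcongr)
        _ = _ := one_mul _
  have hz' : ‖(Complex.I * τ) • mulOp (cst α) (mulOp P w) +
      ∑ j, mulOp (cst (𝒜 j)) (mulOp P (Y j) + mulOp P' (e j))‖ ≤
      ‖z‖ + ε * (|τ| * ‖w‖ + ∑ j, ‖Y j‖) + ‖𝒜 0‖ * (D * ‖w‖) := by
    have e1 : (Complex.I * τ) • mulOp (cst α) (mulOp P w) +
        ∑ j, mulOp (cst (𝒜 j)) (mulOp P (Y j) + mulOp P' (e j)) =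
        mulOp P z + ((Complex.I * τ) • (mulOp (cst α) (mulOp P w) - mulOp P (mulOp a0 w)) +
        ∑ j, (mulOp (cst (𝒜 j)) (mulOp P (Y j)) - mulOp P (mulOp (A j) (Y j)))) +
        mulOp (cst (𝒜 0)) (mulOp P' w) := by
      have e2 : ∑ j, mulOp (cst (𝒜 j)) (mulOp P' (e j)) = mulOp (cst (𝒜 0)) (mulOp P' w) := by
        rw [Finset.sum_eq_single 0]
        · rfl
        · intro j _ hj
          obtain ⟨j, rfl⟩ := Fin.exists_succ_eq.2 hj
          simp [e]
        · simp
      rw [hz, map_add, map_smul, map_sum, Finset.sum_sub_distrib, smul_sub, ← e2]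
      simp_rw [map_add]
      rw [Finset.sum_add_distrib]
      abel
    rw [e1]
    refine (norm_add_le _ _).trans (add_le_add ((norm_add_le _ _).trans (add_le_add (bP z) ?_)) ?_)
    · refine (norm_add_le _ _).trans ?_
      rw [mul_add, Finset.mul_sum]
      refine add_le_add ?_ ((norm_sum_le _ _).trans (Finset.sum_le_sum fun j _ => ?_))
      · rw [norm_smul, norm_mul, Complex.norm_I, one_mul, Complex.norm_real, Real.norm_eq_abs]
        have := bdiff (T := α) (a := a0) (fun x => (hs x).imp_right fun h => h.1) w
        calc _ ≤ |τ| * (ε * ‖w‖) := by gcongr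
          _ = _ := by ring
      · exact bdiff (fun x => (hs x).imp_right fun h => h.2 j) (Y j)
    · refine (norm_mulOp_le' (norm_nonneg (𝒜 0)) (fun x v => (𝒜 0).le_opNorm v) _).trans ?_
      gcongr
      exact bP' w
  have hprY : ∑ j, ‖mulOp (cst pr) (mulOp P (Y j) + mulOp P' (e j))‖ ≤
      ∑ j, ‖mulOp (cst pr) (Y j)‖ + D * ‖w‖ := by
    have : ∀ j, ‖mulOp (cst pr) (mulOp P (Y j) + mulOp P' (e j))‖ ≤
        ‖mulOp (cst pr) (Y j)‖ + D * ‖e j‖ := fun j => by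
      rw [map_add]
      refine (norm_add_le _ _).trans (add_le_add ?_ ((bpr _).trans (bP' _)))
      rw [mulOp_comm_apply (rscal_comm χ hχ 1 h1 (cst pr)).symm]
      exact bP _
    refine (Finset.sum_le_sum fun j _ => this j).trans_eq ?_
    rw [Finset.sum_add_distrib, Fin.sum_univ_succ (fun j => D * ‖e j‖)]
    simp [e]
  have hfin : ∀ j, ‖mulOp P (Y j)‖ ≤ C0 * ((‖z‖ + ε * (|τ| * ‖w‖ + ∑ j, ‖Y j‖) +
      ‖𝒜 0‖ * (D * ‖w‖)) + (∑ j, ‖mulOp (cst pr) (Y j)‖ + D * ‖w‖)) + D * ‖e j‖ := fun j => by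
    have h3 : mulOp P (Y j) = (mulOp P (Y j) + mulOp P' (e j)) - mulOp P' (e j) := by abel
    rw [h3]
    refine (norm_sub_le _ _).trans (add_le_add ((hc j).trans ?_) (bP' _))
    gcongr
  refine (Finset.sum_le_sum fun j _ => hfin j).trans_eq ?_
  rw [Finset.sum_add_distrib, Fin.sum_univ_succ (fun j => D * ‖e j‖), Finset.sum_const]
  simp only [Finset.card_univ, Fintype.card_fin, nsmul_eq_mul, e, Fin.cons_zero, Fin.cons_succ,
    norm_zero, mul_zero, Finset.sum_const_zero, add_zero]
  push_cast
  ring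

/-- Cutoff to a bounded part of the line. -/
def cutoff (T : ℝ) (x : ℝ) : ℝ := 1 - Real.smoothTransition (x - T) - Real.smoothTransition (-x - T)

theorem smoothTransition_abs_le (x : ℝ) : |Real.smoothTransition x| ≤ 1 := by
  rw [abs_of_nonneg (Real.smoothTransition.nonneg x)]
  exact Real.smoothTransition.le_one x

theorem continuous_cutoff (T : ℝ) : Continuous (cutoff T) := by
  unfold cutoff
  have := Real.smoothTransition.continuous
  fun_prop

theorem cutoff_eq_one {T x : ℝ} (h1 : x ≤ T) (h2 : -T ≤ x) : cutoff T x = 1 := by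
  unfold cutoff
  rw [Real.smoothTransition.zero_of_nonpos (by linarith),
    Real.smoothTransition.zero_of_nonpos (by linarith)]
  simp

theorem cutoff_eq_zero {T x : ℝ} (hT : 0 ≤ T) (h : x ∉ Set.Icc (-(T + 1)) (T + 1)) :
    cutoff T x = 0 := by
  unfold cutoff
  rw [Set.mem_Icc, not_and_or, not_le, not_le] at h
  rcases h with h | h
  · rw [Real.smoothTransition.zero_of_nonpos (by linarith),
      Real.smoothTransition.one_of_one_le (by linarith)]
    simp
  · rw [Real.smoothTransition.one_of_one_le (by linarith),
      Real.smoothTransition.zero_of_nonpos (by linarith)]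
    simp

theorem abs_cutoff_le {T : ℝ} (hT : 0 ≤ T) (x : ℝ) : |cutoff T x| ≤ 1 := by
  unfold cutoff
  have h1 := Real.smoothTransition.nonneg (x - T)
  have h2 := Real.smoothTransition.nonneg (-x - T)
  have h3 := Real.smoothTransition.le_one (x - T)
  have h4 := Real.smoothTransition.le_one (-x - T)
  rcases le_total x 0 with hx | hx
  · rw [Real.smoothTransition.zero_of_nonpos (by linarith : x - T ≤ 0)] at *
    rw [abs_le]
    constructor <;> linarith
  · rw [Real.smoothTransition.zero_of_nonpos (by linarith : -x - T ≤ 0)] at *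
    rw [abs_le]
    constructor <;> linarith

/-- The coupling estimate for variable coefficients converging at both ends. -/
theorem LinData.coupling (hpr : ∀ v, ‖L.pr v‖ ≤ ‖v‖) {αp αm : E →L[ℂ] E}
    {𝒜p 𝒜m : Fin (d + 1) → E →L[ℂ] E} (hp : L.AtEnd atTop αp 𝒜p) (hm : L.AtEnd atBot αm 𝒜m) :
    ∃ C M : ℝ, 0 < C ∧ 0 ≤ M ∧ ∀ (ε : ℝ), 0 ≤ ε → ∀ (T : ℝ) (hT : 0 ≤ T),
      (∀ x, T < x → ‖L.a0 x - αp‖ ≤ ε ∧ ∀ j, ‖L.A j x - 𝒜p j‖ ≤ ε) →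
      (∀ x, x < -T → ‖L.a0 x - αm‖ ≤ ε ∧ ∀ j, ‖L.A j x - 𝒜m j‖ ≤ ε) →
      ∀ (ξ : EuclideanSpace ℝ (Fin d)) (w w1 : LL E) (τ : ℝ), HD w w1 →
        ‖w1‖ + ‖ξ‖ * ‖w‖ ≤ C * (‖(Complex.I * τ) • mulOp L.a0 w + mulOp (L.A 0) w1 +
          Complex.I • mulOp (lcomb ξ (tang L.A)) w‖ + ‖mulOp (cst L.pr) w1‖ +
          ‖ξ‖ * ‖mulOp (cst L.pr) w‖ + ε * (‖w1‖ + ‖ξ‖ * ‖w‖ + |τ| * ‖w‖) +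
          ‖mulOp (rscal _ (continuous_cutoff T) 1 (abs_cutoff_le hT)) w1‖ +
          ‖ξ‖ * ‖mulOp (rscal _ (continuous_cutoff T) 1 (abs_cutoff_le hT)) w‖) + M * ‖w‖ := by
  obtain ⟨Cp, hCp, hp2⟩ := coupling_const hp.inj hp.coupling
  obtain ⟨Cm, hCm, hm2⟩ := coupling_const hm.inj hm.coupling
  obtain ⟨f', D, hf', hf'c, hD⟩ := exists_smoothTransition_deriv
  have hD0 : 0 ≤ D := (abs_nonneg _).trans (hD 0)
  have hd1 : (1 : ℝ) ≤ d + 1 := by linarith [(Nat.cast_nonneg d : (0 : ℝ) ≤ d)]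
  refine ⟨(d + 1) ^ 2 * (Cp + Cm) + (d + 1),
    ((d + 1) * Cp * (‖𝒜p 0‖ + 1) * D + D) + ((d + 1) * Cm * (‖𝒜m 0‖ + 1) * D + D),
    by positivity, by positivity, ?_⟩
  intro ε hε T hT hap ham ξ w w1 τ hw
  have hst := Real.smoothTransition.continuous
  have c1 : Continuous fun x : ℝ => Real.smoothTransition (x - T) := by fun_prop
  have c2 : Continuous fun x : ℝ => Real.smoothTransition (-x - T) := by fun_prop
  have kp := coupling_localized hCp.le hpr hp2 c1 (χ' := fun x => f' (x - T)) (by fun_prop)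
    (fun x => smoothTransition_abs_le _) (fun x => hD (x - T))
    (fun x => by
      have := (hf' (x - T)).comp x ((hasDerivAt_id x).sub_const T)
      rw [mul_one] at this
      exact this) hε
    (a0 := L.a0) (A := L.A) (fun x => by
      by_cases hx : T < x
      · exact Or.inr (hap x hx)
      · exact Or.inl (Real.smoothTransition.zero_of_nonpos (by linarith))) ξ τ hw
  have km := coupling_localized hCm.le hpr hm2 c2 (χ' := fun x => -f' (-x - T)) (by fun_prop)
    (fun x => smoothTransition_abs_le _) (fun x => by rw [abs_neg]; exact hD (-x - T))
    (fun x => by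
      have := (hf' (-x - T)).comp x ((hasDerivAt_neg x).sub_const T)
      rw [mul_neg, mul_one] at this
      exact this) hε
    (a0 := L.a0) (A := L.A) (fun x => by
      by_cases hx : x < -T
      · exact Or.inr (ham x hx)
      · exact Or.inl (Real.smoothTransition.zero_of_nonpos (by linarith))) ξ τ hw
  rw [sum_grad, ← add_assoc] at kp km
  set Z := ‖(Complex.I * τ) • mulOp L.a0 w + mulOp (L.A 0) w1 +
          Complex.I • mulOp (lcomb ξ (tang L.A)) w‖ with hZ
  set σ : Cf E := rscal _ (continuous_cutoff T) 1 (abs_cutoff_le hT) with hσ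
  have hsplit : ∀ f : LL E, ‖f‖ ≤ ‖mulOp (rscal _ c1 1 fun x => smoothTransition_abs_le _) f‖ +
      ‖mulOp (rscal _ c2 1 fun x => smoothTransition_abs_le _) f‖ + ‖mulOp σ f‖ := fun f => by
    have e1 : (rscal _ c1 1 fun x => smoothTransition_abs_le _) +
        (rscal _ c2 1 fun x => smoothTransition_abs_le _) + σ = (1 : Cf E) :=
      Cf.ext' fun x v => by
        rw [BoundedContinuousFunction.add_apply, BoundedContinuousFunction.add_apply,
          _root_.add_apply, _root_.add_apply, rscal_apply, rscal_apply, rscal_apply, ← add_smul,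
          ← add_smul]
        have : ((Real.smoothTransition (x - T) : ℝ) : ℂ) + (Real.smoothTransition (-x - T) : ℝ) +
            (cutoff T x : ℝ) = 1 := by
          unfold cutoff
          push_cast
          ring
        rw [this, one_smul]
        rfl
    have e2 : f = mulOp (rscal _ c1 1 fun x => smoothTransition_abs_le _) f +
        mulOp (rscal _ c2 1 fun x => smoothTransition_abs_le _) f + mulOp σ f := by
      rw [← _root_.add_apply, ← _root_.add_apply, ← mulOp_add, ← mulOp_add, e1, mulOp_one]
      rfl
    calc ‖f‖ = ‖_‖ := by conv_lhs => rw [e2]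
      _ ≤ _ := (norm_add_le _ _).trans (by gcongr; exact norm_add_le _ _)
  have h0 := le_sum_norm_grad (1 : LL E →L[ℂ] LL E) ξ w w1
  simp only [one_apply_eq_self] at h0
  have h0' := sum_norm_grad_le (1 : LL E →L[ℂ] LL E) ξ w w1
  simp only [one_apply_eq_self] at h0'
  have h1 := sum_norm_grad_le (mulOp (cst L.pr)) ξ w w1
  have h2 := sum_norm_grad_le (mulOp σ) ξ w w1
  have h3 := Finset.sum_le_sum fun j (_ : j ∈ Finset.univ) => hsplit (grad ξ w w1 j)
  rw [Finset.sum_add_distrib, Finset.sum_add_distrib] at h3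
  have hZ0 : 0 ≤ Z := norm_nonneg _
  have key : ∀ {Y G c a m : ℝ}, 0 ≤ c →
      Y ≤ (d + 1) * c * (Z + G + ε * (|τ| * ‖w‖ + a)) + m →
      G ≤ (d + 1) * (‖mulOp (cst L.pr) w1‖ + ‖ξ‖ * ‖mulOp (cst L.pr) w‖) →
      a ≤ (d + 1) * (‖w1‖ + ‖ξ‖ * ‖w‖) →
      Y ≤ (d + 1) ^ 2 * c * (Z + ‖mulOp (cst L.pr) w1‖ + ‖ξ‖ * ‖mulOp (cst L.pr) w‖ +
        ε * (‖w1‖ + ‖ξ‖ * ‖w‖ + |τ| * ‖w‖)) + m := fun {Y G c a m} hc h hG ha => by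
    have t1 : |τ| * ‖w‖ ≤ (d + 1) * (|τ| * ‖w‖) :=
      le_mul_of_one_le_left (by positivity) hd1
    have t2 : Z ≤ (d + 1) * Z := le_mul_of_one_le_left hZ0 hd1
    have t3 : ε * (|τ| * ‖w‖ + a) ≤
        ε * ((d + 1) * (|τ| * ‖w‖) + (d + 1) * (‖w1‖ + ‖ξ‖ * ‖w‖)) := by gcongr
    calc Y ≤ _ := h
      _ ≤ (d + 1) * c * ((d + 1) * Z +
          (d + 1) * (‖mulOp (cst L.pr) w1‖ + ‖ξ‖ * ‖mulOp (cst L.pr) w‖) +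
          ε * ((d + 1) * (|τ| * ‖w‖) + (d + 1) * (‖w1‖ + ‖ξ‖ * ‖w‖))) + m := by gcongr
      _ = _ := by ring
  have k1 := key hCp.le kp h1 h0'
  have k2 := key hCm.le km h1 h0'
  set Q := Z + ‖mulOp (cst L.pr) w1‖ + ‖ξ‖ * ‖mulOp (cst L.pr) w‖ +
        ε * (‖w1‖ + ‖ξ‖ * ‖w‖ + |τ| * ‖w‖) with hQ
  have hQ0 : 0 ≤ Q := by positivity
  have t1 : 0 ≤ (d + 1) ^ 2 * (Cp + Cm) * (‖mulOp σ w1‖ + ‖ξ‖ * ‖mulOp σ w‖) := by positivity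
  have t2 : 0 ≤ (d + 1) * Q := by positivity
  linarith only [h0, h3, k1, k2, h2, t1, t2]

end LinDataCoupling

section Weight

variable {E : Type*} [NormedAddCommGroup E] [InnerProductSpace ℂ E] [FiniteDimensional ℂ E]
variable {d : ℕ} {L : LinData E d} {s : ℝ}

/-- The lower order terms. -/
def LinData.rem (L : LinData E d) (ξ : Fin d → ℝ) (w w1 : LL E) : LL E :=
  ∑ j, mulOp (L.r j) (grad ξ w w1 j) + mulOp L.r0 w

/-- The resolvent equation for the symmetrized system. -/
def LinData.Eq (L : LinData E d) (lam : ℂ) (ξ : Fin d → ℝ) (w w1 w2 g : LL E) : Prop :=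
  (L.coefs ξ 0).Eqn lam w w1 w2 (L.rem ξ w w1) g

/-- Zero order coefficient after conjugation by a weight with logarithmic derivative `κ`. -/
def LinData.ew (L : LinData E d) (κ : Cf E) : Cf E :=
  L.e - (κ * L.A 0 - cst L.pr * (κ * L.A 0))

/-- The derivative of `LinData.ew`. -/
def LinData.ew' (L : LinData E d) (κ κ' : Cf E) : Cf E :=
  L.e' - ((κ' * L.A 0 + κ * L.A' 0) - cst L.pr * (κ' * L.A 0 + κ * L.A' 0))

/-- The coefficients after conjugation by a weight. -/
def LinData.wcoefs (L : LinData E d) (ξ : Fin d → ℝ) (sg κ κ' : Cf E) : Coefs (LL E) :=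
  { L.coefs ξ sg with e := mulOp (L.ew κ), e' := mulOp (L.ew' κ κ') }

/-- The lower order terms after conjugation by a weight. -/
def LinData.wrem (L : LinData E d) (ξ : Fin d → ℝ) (κ κ' : Cf E) (w w1 : LL E) : LL E :=
  L.rem ξ w w1 - mulOp (L.r 0) (mulOp κ w) - mulOp (L.del 0) (mulOp κ w) -
    mulOp (cst L.pr) (mulOp (L.A 0) (mulOp κ w)) +
    (2 : ℂ) • mulOp (L.B 0 0) (mulOp κ w1) -
    mulOp (L.B 0 0) (mulOp κ (mulOp κ w) - mulOp κ' w) +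
    Complex.I • (mulOp (lcomb ξ fun k => L.B 0 k.succ) (mulOp κ w) +
      mulOp (lcomb ξ fun j => L.B j.succ 0) (mulOp κ w))

theorem Coefs.Bounds.congr_e {H : Type*} [NormedAddCommGroup H] [InnerProductSpace ℂ H]
    {Δ : SkewRel H} {q : Coefs H} {k c C ε : ℝ} (h : q.Bounds Δ k c C ε) (e e' : H →L[ℂ] H) :
    ({ q with e := e, e' := e' } : Coefs H).Bounds Δ k c C ε := by
  cases h
  constructor <;> assumption

theorem mulOp_sub_apply (a b : Cf E) (f : LL E) : mulOp (a - b) f = mulOp a f - mulOp b f := by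
  rw [mulOp_sub]; rfl

theorem mulOp_add_apply (a b : Cf E) (f : LL E) : mulOp (a + b) f = mulOp a f + mulOp b f := by
  rw [mulOp_add]; rfl

theorem mulOp_mul_apply (a b : Cf E) (f : LL E) : mulOp (a * b) f = mulOp a (mulOp b f) := by
  rw [mulOp_mul]; rfl

theorem LinData.ew_apply (κ : Cf E) (f : LL E) : mulOp (L.ew κ) f = mulOp L.e f -
    (mulOp κ (mulOp (L.A 0) f) - mulOp (cst L.pr) (mulOp κ (mulOp (L.A 0) f))) := by
  simp only [LinData.ew, mulOp_sub_apply, mulOp_mul_apply]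

theorem LinData.Eq.weight {lam : ℂ} {ξ : Fin d → ℝ} {w w1 w2 g : LL E}
    (h : L.Eq lam ξ w w1 w2 g) (hw : HD w w1) (hw1 : HD w1 w2) {γ κ κ' : Cf E}
    (hγ : ∀ a : Cf E, γ * a = a * γ) (hκ : ∀ a : Cf E, κ * a = a * κ)
    (hγd : CfDeriv γ (κ * γ)) (hκd : CfDeriv κ κ') (sg : Cf E) :
    ∃ u1 u2, u1 = mulOp γ w1 + mulOp κ (mulOp γ w) ∧
      HD (mulOp γ w) u1 ∧ HD u1 u2 ∧
      (L.wcoefs ξ sg κ κ').Eqn lam (mulOp γ w) u1 u2 (L.wrem ξ κ κ' (mulOp γ w) u1)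
        (mulOp γ g) := by
  have hG : ∀ a f, mulOp γ (mulOp a f) = mulOp a (mulOp γ f) :=
    fun a f => mulOp_comm_apply (hγ a) f
  have hK : ∀ a f, mulOp κ (mulOp a f) = mulOp a (mulOp κ f) :=
    fun a f => mulOp_comm_apply (hκ a) f
  have d1 := HD.mulOp hγd hw
  rw [mulOp_mul_apply, add_comm] at d1
  have d2 := (HD.mulOp hγd hw1).add (HD.mulOp hκd d1)
  refine ⟨_, _, rfl, d1, d2, ?_⟩
  have h' : mulOp γ _ = mulOp γ g := congrArg (mulOp γ) h
  rw [← h']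
  simp only [Coefs.Eqn, LinData.wcoefs, LinData.coefs, LinData.ew_apply, LinData.wrem, Coefs.par,
    LinData.rem, Fin.sum_univ_succ, grad, Fin.cons_zero, Fin.cons_succ, mulOp_mul_apply]
  have hs : ∀ f : Fin d → LL E, mulOp γ (∑ j, f j) = ∑ j, mulOp γ (f j) := fun f => map_sum _ _ _
  have hK2 : ∀ f, mulOp γ (mulOp κ f) = mulOp κ (mulOp γ f) := fun f => hG κ f
  generalize mulOp γ = G at *
  generalize mulOp κ = Kp at *
  simp only [map_add, map_sub, map_neg, map_smul, hs, hK, hG, hK2]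
  simp only [smul_add, smul_sub, smul_neg, two_smul]
  abel

end Weight

section Apriori

variable {E : Type*} [NormedAddCommGroup E] [InnerProductSpace ℂ E] [FiniteDimensional ℂ E]
variable {d : ℕ} {L : LinData E d} {s : ℝ}

theorem norm_mulOp_lcomb_le (ξ : EuclideanSpace ℝ (Fin d)) (F : Fin d → Cf E) (f : LL E) :
    ‖mulOp (lcomb ξ F) f‖ ≤ (∑ j, ‖F j‖) * (‖ξ‖ * ‖f‖) := by
  rw [mulOp_lcomb, Finset.sum_mul]
  refine (norm_sum_le _ _).trans (Finset.sum_le_sum fun j _ => ?_)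
  rw [norm_smul, Complex.norm_real, Real.norm_eq_abs]
  calc |ξ j| * ‖mulOp (F j) f‖ ≤ ‖ξ‖ * (‖F j‖ * ‖f‖) :=
        mul_le_mul (abs_coord_le ξ j) (norm_mulOp_le _ _) (norm_nonneg _) (norm_nonneg _)
    _ = _ := by ring

theorem LinData.Good.pr_wrem (h : L.Good s) (ξ : Fin d → ℝ) {κ κ' : Cf E} (w w1 : LL E) :
    mulOp (cst L.pr) (L.wrem ξ κ κ' w w1) = L.wrem ξ κ κ' w w1 := by
  have hB : ∀ j k f, mulOp (cst L.pr) (mulOp (L.B j k) f) = mulOp (L.B j k) f :=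
    fun j k f => mulOp_cst_apply_eq (h.pr_B j k) f
  have hr : ∀ j f, mulOp (cst L.pr) (mulOp (L.r j) f) = mulOp (L.r j) f :=
    fun j f => mulOp_cst_apply_eq (h.pr_r j) f
  have hr0 : ∀ f, mulOp (cst L.pr) (mulOp L.r0 f) = mulOp L.r0 f :=
    fun f => mulOp_cst_apply_eq h.pr_r0 f
  have hd : ∀ j f, mulOp (cst L.pr) (mulOp (L.del j) f) = mulOp (L.del j) f :=
    fun j f => mulOp_cst_apply_eq (h.pr_del j) f
  have hp : ∀ f, mulOp (cst L.pr) (mulOp (cst L.pr) f) = mulOp (cst L.pr) f :=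
    fun f => mulOp_cst_apply_eq (a := cst L.pr) (fun _ v => h.pr_pr v) f
  simp only [LinData.wrem, LinData.rem, map_add, map_sub, map_smul, map_sum, mulOp_lcomb, hB, hr,
    hr0, hd, hp]

theorem LinData.Good.norm_wrem_le (h : L.Good s) {κ κ' : Cf E} (hκ : ∀ a : Cf E, κ * a = a * κ) :
    ∃ M : ℝ, 0 ≤ M ∧ ∀ (ξ : EuclideanSpace ℝ (Fin d)) (w w1 : LL E), ‖L.wrem ξ κ κ' w w1‖ ≤
      M * (‖w‖ + ‖mulOp (cst L.pr) w1‖ + ‖ξ‖ * ‖mulOp (cst L.pr) w‖) := by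
  set P := mulOp (cst L.pr) with hP
  have hK : ∀ a f, mulOp κ (mulOp a f) = mulOp a (mulOp κ f) :=
    fun a f => mulOp_comm_apply (hκ a) f
  have hB : ∀ j k f, mulOp (L.B j k) f = mulOp (L.B j k) (P f) := fun j k f => by
    rw [hP, ← mulOp_mul_apply]
    congr 2
    exact Cf.ext' fun x v => (h.B_pr j k x v).symm
  have hr : ∀ j f, mulOp (L.r j) f = mulOp (L.r j) (P f) := fun j f => by
    rw [hP, ← mulOp_mul_apply]
    congr 2
    exact Cf.ext' fun x v => (h.r_pr j x v).symm
  refine ⟨(∑ j, ‖L.r j‖) * (d + 1) + ‖L.r0‖ + ‖L.r 0‖ * ‖κ‖ + ‖L.del 0‖ * ‖κ‖ +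
    ‖cst L.pr‖ * (‖L.A 0‖ * ‖κ‖) + 2 * (‖L.B 0 0‖ * ‖κ‖) +
    ‖L.B 0 0‖ * (‖κ‖ * ‖κ‖ + ‖κ'‖) +
    ((∑ k : Fin d, ‖L.B 0 k.succ‖) * ‖κ‖ + (∑ j : Fin d, ‖L.B j.succ 0‖) * ‖κ‖), by positivity, ?_⟩
  intro ξ w w1
  set Q := ‖w‖ + ‖P w1‖ + ‖ξ‖ * ‖P w‖ with hQ
  have q0 : ‖w‖ ≤ Q := by
    have : 0 ≤ ‖ξ‖ * ‖P w‖ := by positivity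
    linarith [norm_nonneg (P w1)]
  have q1 : ‖P w1‖ ≤ Q := by
    have : 0 ≤ ‖ξ‖ * ‖P w‖ := by positivity
    linarith [norm_nonneg w]
  have q2 : ‖P w1‖ + ‖ξ‖ * ‖P w‖ ≤ Q := by linarith [norm_nonneg w]
  have q3 : ‖ξ‖ * ‖P w‖ ≤ Q := by linarith [norm_nonneg w, norm_nonneg (P w1)]
  have m2 : ∀ (a b : Cf E) f, ‖mulOp a (mulOp b f)‖ ≤ ‖a‖ * ‖b‖ * ‖f‖ := fun a b f =>
    (norm_mulOp_le _ _).trans (by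
      rw [mul_assoc]
      exact mul_le_mul_of_nonneg_left (norm_mulOp_le _ _) (by positivity))
  have m3 : ∀ {x c f : ℝ}, 0 ≤ c → x ≤ c * f → f ≤ Q → x ≤ c * Q := fun hc hx hf =>
    hx.trans (mul_le_mul_of_nonneg_left hf hc)
  have t1 : ‖∑ j, mulOp (L.r j) (grad ξ w w1 j)‖ ≤ (∑ j, ‖L.r j‖) * (d + 1) * Q := by
    refine m3 (by positivity) ?_ q2
    refine (norm_sum_le _ _).trans ?_
    calc ∑ j, ‖mulOp (L.r j) (grad ξ w w1 j)‖ ≤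
          ∑ j, (∑ i, ‖L.r i‖) * ‖P (grad ξ w w1 j)‖ := by
          refine Finset.sum_le_sum fun j _ => ?_
          rw [hr]
          refine (norm_mulOp_le _ _).trans ?_
          gcongr
          exact Finset.single_le_sum (f := fun i => ‖L.r i‖) (fun i _ => by positivity)
            (Finset.mem_univ j)
      _ ≤ _ := by
          rw [← Finset.mul_sum, mul_assoc]
          gcongr
          exact sum_norm_grad_le P ξ w w1
  have t2 : ‖mulOp L.r0 w‖ ≤ ‖L.r0‖ * Q := m3 (by positivity) (norm_mulOp_le _ _) q0
  have t3 : ‖mulOp (L.r 0) (mulOp κ w)‖ ≤ ‖L.r 0‖ * ‖κ‖ * Q := m3 (by positivity) (m2 _ _ _) q0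
  have t4 : ‖mulOp (L.del 0) (mulOp κ w)‖ ≤ ‖L.del 0‖ * ‖κ‖ * Q := m3 (by positivity) (m2 _ _ _) q0
  have t5 : ‖P (mulOp (L.A 0) (mulOp κ w))‖ ≤ ‖cst (L.pr)‖ * (‖L.A 0‖ * ‖κ‖) * Q := by
    refine m3 (by positivity) ((norm_mulOp_le _ _).trans ?_) q0
    rw [mul_assoc]
    exact mul_le_mul_of_nonneg_left (m2 _ _ _) (by positivity)
  have t6 : ‖(2 : ℂ) • mulOp (L.B 0 0) (mulOp κ w1)‖ ≤ 2 * (‖L.B 0 0‖ * ‖κ‖) * Q := by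
    rw [norm_smul, Complex.norm_ofNat, mul_assoc]
    refine mul_le_mul_of_nonneg_left (m3 (by positivity) ?_ q1) zero_le_two
    rw [hB, hP, ← hK]
    exact m2 _ _ _
  have t7 : ‖mulOp (L.B 0 0) (mulOp κ (mulOp κ w) - mulOp κ' w)‖ ≤
      ‖L.B 0 0‖ * (‖κ‖ * ‖κ‖ + ‖κ'‖) * Q := by
    refine m3 (by positivity) ((norm_mulOp_le _ _).trans ?_) q0
    rw [mul_assoc]
    refine mul_le_mul_of_nonneg_left ?_ (by positivity)
    rw [add_mul]
    exact (norm_sub_le _ _).trans (add_le_add (m2 _ _ _) (norm_mulOp_le _ _))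
  have t8 : ∀ F : Fin d → Cf E, (∀ j f, mulOp (F j) f = mulOp (F j) (P f)) →
      ‖mulOp (lcomb ξ F) (mulOp κ w)‖ ≤ (∑ j, ‖F j‖) * ‖κ‖ * Q := fun F hF => by
    refine m3 (by positivity) ?_ q3
    have e : mulOp (lcomb ξ F) (mulOp κ w) = mulOp (lcomb ξ F) (mulOp κ (P w)) := by
      simp only [mulOp_lcomb]
      refine Finset.sum_congr rfl fun j _ => ?_
      rw [hF, hP, ← hK]
    rw [e]
    refine (norm_mulOp_lcomb_le ξ F _).trans ?_
    rw [mul_assoc]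
    refine mul_le_mul_of_nonneg_left ?_ (by positivity)
    calc ‖ξ‖ * ‖mulOp κ (P w)‖ ≤ ‖ξ‖ * (‖κ‖ * ‖P w‖) := by
          gcongr
          exact norm_mulOp_le _ _
      _ = _ := by ring
  have t9 := t8 (fun k => L.B 0 k.succ) fun j f => hB _ _ _
  have t10 := t8 (fun j => L.B j.succ 0) fun j f => hB _ _ _
  simp only [add_mul _ _ Q]
  unfold LinData.wrem LinData.rem
  refine norm_add_le_of_le (norm_sub_le_of_le (norm_add_le_of_le (norm_sub_le_of_le
    (norm_sub_le_of_le (norm_sub_le_of_le (norm_add_le_of_le t1 t2) t3) t4) t5) t6) t7) ?_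
  rw [norm_I_smul]
  exact norm_add_le_of_le t9 t10

/-- Damping of the hyperbolic modes by a weight whose logarithmic derivative is large where the
cutoff is active. -/
theorem LinData.Good.damping (h : L.Good s) {σ φ : ℝ → ℝ} {hσ : Continuous σ}
    {hσ1 : ∀ x, |σ x| ≤ 1} {hφ : Continuous φ} {N : ℝ} {hN : ∀ x, |φ x| ≤ N} {θ K ε Ne : ℝ}
    (hK : 0 ≤ K) (hε : 0 ≤ ε) (hNe : 0 ≤ Ne)
    (hθ : ∀ x v, L.pr v = 0 → θ * ‖v‖ ^ 2 ≤ s * rI v (L.A 0 x v)) (hθ0 : 0 < θ)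
    (he : ∀ x v, ‖L.e x v‖ ≤ Ne * ‖v‖) (hsm : ∀ x, σ x = 1 ∨ ∀ v, ‖L.e x v‖ ≤ ε * ‖v‖)
    (hs : ∀ x, (K + Ne) / θ * σ x ^ 2 ≤ -(s * φ x)) (hs1 : s * s = 1) (f : LL E)
    (hf : mulOp (cst L.pr) f = 0) :
    K * ‖mulOp (rscal σ hσ 1 hσ1) f‖ ^ 2 - ε * ‖f‖ ^ 2 ≤ rI f (mulOp (L.ew (rscal φ hφ N hN)) f) := by
  have key := re_inner_mulOp_ge (a := L.ew (rscal φ hφ N hN)) (b := rscal σ hσ 1 hσ1) (c := 1)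
    (f := f) (p := K) (q := ε) ?_
  · simpa [mulOp_one, rI] using key
  have h0 : ∀ᵐ x, L.pr (f x) = 0 := by
    have h1 := coeFn_mulOp (cst L.pr) f
    rw [hf] at h1
    filter_upwards [h1, Lp.coeFn_zero E 2 (volume : Measure ℝ)] with x hx hx0
    rw [cst_apply] at hx
    rw [← hx, hx0]
    rfl
  filter_upwards [h0] with x hx
  have e1 : (⟪f x, L.ew (rscal φ hφ N hN) x (f x)⟫_ℂ).re =
      rI (f x) (L.e x (f x)) - φ x * rI (f x) (L.A 0 x (f x)) := by
    have e2 : L.ew (rscal φ hφ N hN) x (f x) = L.e x (f x) -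
        ((φ x : ℂ) • L.A 0 x (f x) - L.pr ((φ x : ℂ) • L.A 0 x (f x))) := rfl
    have e3 : ∀ v, ⟪f x, L.pr v⟫_ℂ = 0 := fun v => by rw [← h.pr_sa, hx, inner_zero_left]
    rw [e2, inner_sub_right, inner_sub_right, e3, sub_zero, inner_smul_right, Complex.sub_re,
      Complex.re_ofReal_mul]
    rfl
  rw [e1, rscal_apply, norm_smul, Complex.norm_real, Real.norm_eq_abs, mul_pow, sq_abs]
  have e4 : ‖(1 : Cf E) x (f x)‖ = ‖f x‖ := rfl
  rw [e4]
  have g1 := hθ x (f x) hx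
  have g2 : -(‖f x‖ * ‖L.e x (f x)‖) ≤ rI (f x) (L.e x (f x)) := neg_le_rI _ _
  have g3 : ‖L.e x (f x)‖ ≤ (ε + Ne * σ x ^ 2) * ‖f x‖ := by
    rcases hsm x with h1 | h1
    · have := he x (f x)
      rw [h1]
      have := norm_nonneg (f x)
      nlinarith
    · have := h1 (f x)
      have : 0 ≤ Ne * σ x ^ 2 * ‖f x‖ := by positivity
      linarith
  have g4 : 0 ≤ ‖f x‖ := norm_nonneg _
  have g5 : ‖f x‖ * ‖L.e x (f x)‖ ≤ (ε + Ne * σ x ^ 2) * ‖f x‖ ^ 2 :=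
    (mul_le_mul_of_nonneg_left g3 g4).trans_eq (by ring)
  have g0 : 0 ≤ -(s * φ x) := le_trans (by positivity) (hs x)
  have g6 : -(s * φ x) * (θ * ‖f x‖ ^ 2) ≤ -(φ x * rI (f x) (L.A 0 x (f x))) := by
    refine (mul_le_mul_of_nonneg_left g1 g0).trans_eq ?_
    linear_combination (-(φ x * rI (f x) (L.A 0 x (f x)))) * hs1
  have g7 : (K + Ne) * σ x ^ 2 * ‖f x‖ ^ 2 ≤ -(s * φ x) * (θ * ‖f x‖ ^ 2) := by
    have := mul_le_mul_of_nonneg_right (hs x) (by positivity : 0 ≤ θ * ‖f x‖ ^ 2)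
    refine le_trans (le_of_eq ?_) this
    field_simp
  linarith

end Apriori

section AprioriEstimate

variable {E : Type*} [NormedAddCommGroup E] [InnerProductSpace ℂ E] [FiniteDimensional ℂ E]
variable {d : ℕ} {L : LinData E d} {s : ℝ}

theorem LinData.Good.norm_pr_le (h : L.Good s) (v : E) : ‖L.pr v‖ ≤ ‖v‖ := by
  have h1 : rI (L.pr v) (L.pr v) = rI v (L.pr v) := by
    unfold rI
    rw [h.pr_sa, h.pr_pr]
  rw [rI_self] at h1
  have h2 := rI_le v (L.pr v)
  by_contra hlt
  push Not at hlt
  nlinarith [norm_nonneg v, norm_nonneg (L.pr v)]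

/-- A bounded increasing weight exponent with prescribed lower bound on its derivative where the
cutoff is active. -/
theorem exists_weight (s Λ T : ℝ) (hs : s = 1 ∨ s = -1) (hΛ : 0 ≤ Λ) (hT : 0 ≤ T) :
    ∃ (φ φ' γ δ : ℝ → ℝ) (N : ℝ), Continuous φ ∧ Continuous φ' ∧ Continuous γ ∧ Continuous δ ∧
      (∀ x, HasDerivAt φ (φ' x) x) ∧ (∀ x, HasDerivAt γ (φ x * γ x) x) ∧ (∀ x, δ x * γ x = 1) ∧
      (∀ x, |φ x| ≤ N) ∧ (∀ x, |φ' x| ≤ N) ∧ (∀ x, |γ x| ≤ N) ∧ (∀ x, |δ x| ≤ N) ∧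
      ∀ x, Λ * cutoff T x ^ 2 ≤ -(s * φ x) := by
  have hs1 : s * s = 1 := by rcases hs with h | h <;> rw [h] <;> norm_num
  have hsa : |s| = 1 := by rcases hs with h | h <;> rw [h] <;> norm_num
  obtain ⟨Λ', hΛ'⟩ : ∃ Λ', Λ' = Λ * (1 + (T + 1) ^ 2) := ⟨_, rfl⟩
  have hΛ0 : 0 ≤ Λ' := by rw [hΛ']; positivity
  have hx : ∀ x : ℝ, 0 < 1 + x ^ 2 := fun x => by positivity
  have hexp : ∀ x, ∀ t : ℝ, |t| = 1 → |Real.exp (t * Λ' * Real.arctan x)| ≤ Real.exp (2 * Λ') := by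
    intro x t ht
    rw [abs_of_pos (Real.exp_pos _)]
    refine Real.exp_le_exp.2 ((le_abs_self _).trans ?_)
    rw [abs_mul, abs_mul, ht, one_mul, abs_of_nonneg hΛ0, mul_comm]
    refine mul_le_mul_of_nonneg_right ?_ hΛ0
    have h1 := Real.arctan_lt_pi_div_two x
    have h2 := Real.neg_pi_div_two_lt_arctan x
    have h3 := Real.pi_le_four
    rw [abs_le]
    constructor <;> linarith
  have hN1 : Λ' ≤ Real.exp (2 * Λ') := by
    have := Real.add_one_le_exp (2 * Λ')
    linarith
  have hcq : Continuous fun x : ℝ => (1 + x ^ 2)⁻¹ :=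
    Continuous.inv₀ (by fun_prop) fun x => (hx x).ne'
  refine ⟨fun x => -s * Λ' * (1 + x ^ 2)⁻¹, fun x => -s * Λ' * -(2 * x * ((1 + x ^ 2)⁻¹) ^ 2),
    fun x => Real.exp (-s * Λ' * Real.arctan x), fun x => Real.exp (s * Λ' * Real.arctan x),
    Real.exp (2 * Λ'), by fun_prop, by fun_prop, by fun_prop, by fun_prop, fun x => ?_, fun x => ?_,
    fun x => ?_, fun x => ?_, fun x => ?_, fun x => hexp x _ (by rwa [abs_neg]),
    fun x => hexp x _ hsa, fun x => ?_⟩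
  · have h1 : HasDerivAt (fun x : ℝ => 1 + x ^ 2) (2 * x) x := by
      simpa using (hasDerivAt_pow 2 x).const_add 1
    have h2 := (h1.inv (hx x).ne').const_mul (-s * Λ')
    refine h2.congr_deriv ?_
    simp only [inv_pow]
    ring
  · have h1 := (((Real.hasDerivAt_arctan x).const_mul (-s * Λ'))).exp
    refine h1.congr_deriv ?_
    rw [one_div]
    ring
  · rw [← Real.exp_add, Real.exp_eq_one_iff]
    ring
  · refine le_trans ?_ hN1
    rw [abs_mul, abs_mul, abs_neg, hsa, abs_of_nonneg hΛ0, one_mul, abs_of_pos (inv_pos.2 (hx x))]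
    refine mul_le_of_le_one_right hΛ0 (inv_le_one_of_one_le₀ ?_)
    nlinarith [sq_nonneg x]
  · refine le_trans ?_ hN1
    rw [abs_mul, abs_mul, abs_neg, hsa, abs_of_nonneg hΛ0, one_mul]
    refine mul_le_of_le_one_right hΛ0 ?_
    rw [abs_neg, abs_mul, abs_of_pos (pow_pos (inv_pos.2 (hx x)) 2), inv_pow, ← div_eq_mul_inv,
      div_le_one (by positivity), abs_le]
    have h1 := hx x
    constructor <;> nlinarith [sq_nonneg (x - 1), sq_nonneg (x + 1), sq_nonneg x, sq_nonneg (x ^ 2)]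
  · have e : -(s * (-s * Λ' * (1 + x ^ 2)⁻¹)) = Λ' * (1 + x ^ 2)⁻¹ := by
      linear_combination Λ' * (1 + x ^ 2)⁻¹ * hs1
    rw [e]
    by_cases hxT : x ∈ Set.Icc (-(T + 1)) (T + 1)
    · have h1 : cutoff T x ^ 2 ≤ 1 := by
        rw [← sq_abs]
        exact pow_le_one₀ (abs_nonneg _) (abs_cutoff_le hT x)
      have h2 : 1 ≤ (1 + (T + 1) ^ 2) * (1 + x ^ 2)⁻¹ := by
        rw [← div_eq_mul_inv, one_le_div (hx x)]
        have := sq_le_sq' hxT.1 hxT.2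
        linarith
      calc Λ * cutoff T x ^ 2 ≤ Λ * 1 := by gcongr
        _ ≤ Λ * ((1 + (T + 1) ^ 2) * (1 + x ^ 2)⁻¹) := by gcongr
        _ = _ := by rw [hΛ']; ring
    · rw [cutoff_eq_zero hT hxT]
      have := hx x
      simp only [ne_eq, OfNat.ofNat_ne_zero, not_false_eq_true, zero_pow, mul_zero]
      positivity

/-- The a priori estimate at high frequencies. -/
theorem LinData.Good.apriori (h : L.Good s) {αp αm : E →L[ℂ] E}
    {𝒜p 𝒜m : Fin (d + 1) → E →L[ℂ] E} (hp : L.AtEnd atTop αp 𝒜p) (hm : L.AtEnd atBot αm 𝒜m) :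
    ∃ R C θ : ℝ, 0 < R ∧ 0 < C ∧ 0 < θ ∧ ∀ (ξ : EuclideanSpace ℝ (Fin d)) (lam : ℂ)
      (w w1 w2 g g1 : LL E), HD w w1 → HD w1 w2 → HD g g1 → L.Eq lam ξ w w1 w2 g →
      -θ ≤ lam.re → R ≤ max ‖ξ‖ ‖lam‖ →
      ‖w1‖ + (1 + ‖ξ‖) * ‖w‖ ≤ C * (‖g1‖ + (1 + ‖ξ‖) * ‖g‖) := by
  obtain ⟨C, c, hC, hc, hbd⟩ := h.bounds
  obtain ⟨C2, M2, hC2, hM2, hcoup⟩ := LinData.coupling (L := L) h.norm_pr_le hp hm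
  obtain ⟨ε, K, hε, hε1, hK, hen⟩ :=
    energy_estimate (H := LL E) (C := max C C2) (hC.trans (le_max_left _ _)) hc
  obtain ⟨θ, hθ, hdef⟩ := h.definite
  have hd1 : (0 : ℝ) < d + 1 := by positivity
  have hε' : 0 < ε / (d + 1) := by positivity
  have hε'1 : ε / (d + 1) ≤ ε := div_le_self hε.le (by linarith [(Nat.cast_nonneg d : (0 : ℝ) ≤ d)])
  obtain ⟨T1, hT1⟩ := eventually_atTop.1 (hp.eventually_small hε')
  obtain ⟨T2, hT2⟩ := eventually_atBot.1 (hm.eventually_small hε')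
  obtain ⟨T, hT⟩ : ∃ T, T = max (max T1 (-T2)) 0 := ⟨_, rfl⟩
  have hT0 : 0 ≤ T := hT ▸ le_max_right _ _
  have hTp : ∀ x, T < x → T1 ≤ x := fun x hx =>
    ((le_max_left _ _).trans (le_max_left _ _)).trans ((hT ▸ hx.le))
  have hTm : ∀ x, x < -T → x ≤ T2 := fun x hx => by
    have : -T2 ≤ T := hT ▸ ((le_max_right _ _).trans (le_max_left _ _))
    linarith
  have hsmall : ∀ x, cutoff T x = 1 ∨ L.Small (ε / (d + 1)) x := fun x => by
    by_cases h1 : T < x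
    · exact Or.inr (hT1 x (hTp x h1)).1
    by_cases h2 : x < -T
    · exact Or.inr (hT2 x (hTm x h2)).1
    exact Or.inl (cutoff_eq_one (not_lt.1 h1) (not_lt.1 h2))
  have hs1 : s * s = 1 := by rcases h.s_sq with h | h <;> rw [h] <;> norm_num
  obtain ⟨φ, φ', γ, δ, N, hφ, hφ', hγ, hδ, hφd, hγd, hδγ, hφN, hφ'N, hγN, hδN, hwt⟩ :=
    exists_weight s ((K + ‖L.e‖) / θ) T h.s_sq (by positivity) hT0
  have hN0 : 0 ≤ N := (abs_nonneg _).trans (hφN 0)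
  set κ : Cf E := rscal φ hφ N hφN with hκ
  set κ' : Cf E := rscal φ' hφ' N hφ'N with hκ'
  set Γ : Cf E := rscal γ hγ N hγN with hΓ
  set Δ : Cf E := rscal δ hδ N hδN with hΔ
  have hκd : CfDeriv κ κ' := cfDeriv_rscal hφd
  have hφγ : ∀ x, |φ x * γ x| ≤ N * N := fun x => by
    rw [abs_mul]
    exact mul_le_mul (hφN x) (hγN x) (abs_nonneg _) hN0
  have hΓd : CfDeriv Γ (κ * Γ) := by
    have h1 : CfDeriv Γ (rscal (fun x => φ x * γ x) (hφ.mul hγ) (N * N) hφγ) := cfDeriv_rscal hγd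
    have h2 : κ * Γ = rscal (fun x => φ x * γ x) (hφ.mul hγ) (N * N) hφγ :=
      Cf.ext' fun x v => by
        rw [Cf.mul_apply', rscal_apply, rscal_apply, rscal_apply, smul_smul]
        push_cast
        rfl
    rwa [h2]
  have hΔΓ : ∀ f : LL E, mulOp Δ (mulOp Γ f) = f := fun f => by
    rw [← mulOp_mul_apply]
    have : Δ * Γ = 1 := Cf.ext' fun x v => by
      rw [Cf.mul_apply', rscal_apply, rscal_apply, smul_smul, ← Complex.ofReal_mul, hδγ]
      simp
    rw [this, mulOp_one]
    rfl
  obtain ⟨Mr, hMr, hrem⟩ := h.norm_wrem_le (κ := κ) (κ' := κ') (rscal_comm _ _ _ _)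
  obtain ⟨M, hM⟩ : ∃ M, M = Mr + M2 + ‖L.ew κ‖ + ‖L.ew' κ κ'‖ := ⟨_, rfl⟩
  have n1 : 0 ≤ ‖L.ew κ‖ := by positivity
  have n2 : 0 ≤ ‖L.ew' κ κ'‖ := by positivity
  obtain ⟨R, C', hR, hC', hest⟩ := hen M (by rw [hM]; positivity)
  refine ⟨R, N * (1 + N) * C' * (N * (1 + N)) + 1, ε, hR, by positivity, hε, ?_⟩
  intro ξ lam w w1 w2 g g1 hw hw1 hg heq hre hbig
  obtain ⟨u1, u2, hu1, du, du1, hequ⟩ := heq.weight hw hw1 (γ := Γ) (κ := κ) (κ' := κ')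
    (rscal_comm _ _ _ _) (rscal_comm _ _ _ _) hΓd hκd
    (rscal _ (continuous_cutoff T) 1 (abs_cutoff_le hT0))
  have hb := (hbd (max C C2) (le_max_left _ _) ε hε.le _ (continuous_cutoff T) (abs_cutoff_le hT0)
    hsmall ξ).congr_e (mulOp (L.ew κ)) (mulOp (L.ew' κ κ'))
  have hpr2 : ∀ f, mulOp (cst L.pr) (mulOp (cst L.pr) f) = mulOp (cst L.pr) f :=
    fun f => mulOp_cst_apply_eq (a := cst L.pr) (fun _ v => h.pr_pr v) f
  have hdm : (L.wcoefs ξ (rscal _ (continuous_cutoff T) 1 (abs_cutoff_le hT0)) κ κ').Damped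
      (dRel E) ‖ξ‖ (max C C2) ε K M := by
    refine ⟨fun f => ?_, fun f => ?_, ?_, fun f => ?_, fun f hf => ?_, fun v v1 τ hv => ?_⟩
    · change mulOp (cst L.pr) (mulOp (L.ew κ) f) = 0
      have he : mulOp (cst L.pr) (mulOp L.e f) = 0 := by
        rw [mulOp_cst_apply_eq (b := 0) h.pr_e f]
        rw [show mulOp (0 : Cf E) = 0 from map_zero mulHom]
        rfl
      rw [LinData.ew_apply, map_sub, map_sub, hpr2, sub_self, sub_zero, he]
    · exact (norm_mulOp_le _ _).trans (by gcongr; rw [hM]; linarith)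
    · refine comm_of_cfDeriv (a := L.ew κ) (a' := L.ew' κ κ') fun x => ?_
      have k1 := hκd.mul (h.A_d 0)
      have k2 : CfDeriv (cst L.pr) 0 := fun x => hasDerivAt_const x L.pr
      have k3 := (h.e_d x).sub ((k1 x).sub ((k2.mul k1) x))
      refine k3.congr_deriv ?_
      ext v
      simp [LinData.ew', Cf.mul_apply']
    · exact (norm_mulOp_le _ _).trans (by gcongr; rw [hM]; linarith)
    · refine h.damping hK.le hε.le (by positivity) hdef hθ (fun x v => ?_) (fun x => ?_) hwt hs1 f hf
      · exact ((L.e x).le_opNorm v).trans (by gcongr; exact L.e.norm_coe_le_norm x)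
      · refine (hsmall x).imp_right fun hx v => ((L.e x).le_opNorm v).trans ?_
        gcongr
        exact hx.e.trans hε'1
    · have hc := hcoup ε hε.le T hT0
        (fun x hx => by
          obtain ⟨-, h1, h2⟩ := hT1 x (hTp x hx)
          exact ⟨h1.trans hε'1, fun j => (h2 j).trans hε'1⟩)
        (fun x hx => by
          obtain ⟨-, h1, h2⟩ := hT2 x (hTm x hx)
          exact ⟨h1.trans hε'1, fun j => (h2 j).trans hε'1⟩) ξ v v1 τ hv
      refine hc.trans ?_
      have : M2 ≤ M := by rw [hM]; linarith
      exact add_le_add (mul_le_mul_of_nonneg_right (le_max_right C C2) (by positivity))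
        (by gcongr)
  have dg := HD.mulOp hΓd hg
  have main := hest (dRel E) _ ‖ξ‖ (norm_nonneg _) hb hdm lam _ u1 u2 _ _ _ du du1 dg
    (h.pr_wrem ξ _ _) ((hrem ξ _ _).trans ?_) hequ hre hbig
  · have m1 : ∀ f : LL E, ‖mulOp Γ f‖ ≤ N * ‖f‖ := norm_rscal_le hγN
    have m2 : ∀ f : LL E, ‖mulOp Δ f‖ ≤ N * ‖f‖ := norm_rscal_le hδN
    have m3 : ∀ f : LL E, ‖mulOp κ f‖ ≤ N * ‖f‖ := norm_rscal_le hφN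
    have e0 : ‖w‖ ≤ N * ‖mulOp Γ w‖ := by
      conv_lhs => rw [← hΔΓ w]
      exact m2 _
    have e1 : ‖w1‖ ≤ N * (‖u1‖ + N * ‖mulOp Γ w‖) := by
      have : w1 = mulOp Δ (u1 - mulOp κ (mulOp Γ w)) := by rw [hu1, add_sub_cancel_right, hΔΓ]
      rw [this]
      refine (m2 _).trans ?_
      gcongr
      exact (norm_sub_le _ _).trans (by gcongr; exact m3 _)
    have e2 : ‖mulOp (κ * Γ) g + mulOp Γ g1‖ ≤ N * (N * ‖g‖) + N * ‖g1‖ := by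
      refine (norm_add_le _ _).trans (add_le_add ?_ (m1 _))
      rw [mulOp_mul_apply]
      exact (m3 _).trans (by gcongr; exact m1 _)
    have e3 := m1 g
    set k := ‖ξ‖
    have hk : 0 ≤ k := norm_nonneg ξ
    have s1 : ‖mulOp (κ * Γ) g + mulOp Γ g1‖ + (1 + k) * ‖mulOp Γ g‖ ≤
        N * (1 + N) * (‖g1‖ + (1 + k) * ‖g‖) := by
      have : (1 + k) * ‖mulOp Γ g‖ ≤ (1 + k) * (N * ‖g‖) := by gcongr
      have q1 : 0 ≤ N * N * ‖g1‖ := by positivity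
      have q2 : 0 ≤ N * N * (k * ‖g‖) := by positivity
      linarith
    have s2 : ‖w1‖ + (1 + k) * ‖w‖ ≤ N * (1 + N) * (‖u1‖ + (1 + k) * ‖mulOp Γ w‖) := by
      have : (1 + k) * ‖w‖ ≤ (1 + k) * (N * ‖mulOp Γ w‖) := by gcongr
      have q1 : 0 ≤ N * N * ‖u1‖ := by positivity
      have q2 : 0 ≤ N * N * (k * ‖mulOp Γ w‖) := by positivity
      linarith
    calc ‖w1‖ + (1 + k) * ‖w‖ ≤ N * (1 + N) * (C' * (N * (1 + N) * (‖g1‖ + (1 + k) * ‖g‖))) :=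
          s2.trans (by gcongr; exact main.trans (by gcongr))
      _ ≤ (N * (1 + N) * C' * (N * (1 + N)) + 1) * (‖g1‖ + (1 + k) * ‖g‖) := by
          have : 0 ≤ ‖g1‖ + (1 + k) * ‖g‖ := by positivity
          linarith
  · change _ ≤ M * (_ + ‖mulOp (cst L.pr) u1‖ + ‖ξ‖ * ‖mulOp (cst L.pr) _‖)
    have : Mr ≤ M := by rw [hM]; linarith
    gcongr

end AprioriEstimate

section ContinuityMethod

variable {Y : Type*} [NormedAddCommGroup Y] [NormedSpace ℂ Y] [CompleteSpace Y]

/-- The method of continuity for linear relations. -/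
theorem continuity_method (G : Submodule ℂ (Y × Y)) (K : Y →L[ℂ] Y) {C : ℝ} (hC : 0 ≤ C)
    (hest : ∀ t : ℝ, 0 ≤ t → t ≤ 1 → ∀ w g, (w, g) ∈ G → ‖w‖ ≤ C * ‖g + (t : ℂ) • K w‖)
    (h0 : ∀ g, ∃ w, (w, g) ∈ G) (g : Y) : ∃ w, (w, g - K w) ∈ G := by
  obtain ⟨n, hn⟩ := exists_nat_gt (2 * (C * ‖K‖))
  have hn0 : (0 : ℝ) < n := lt_of_le_of_lt (by positivity) hn
  have step : ∀ i : ℕ, i ≤ n → ∀ g, ∃ w, (w, g - ((i / n : ℝ) : ℂ) • K w) ∈ G := by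
    intro i
    induction i with
    | zero =>
      intro _ g
      obtain ⟨w, hw⟩ := h0 g
      exact ⟨w, by simpa using hw⟩
    | succ i ih =>
      intro hi g
      choose S hS using ih (by omega)
      have hi1 : (i / n : ℝ) ≤ 1 := by
        rw [div_le_one hn0]
        exact_mod_cast (by omega : i ≤ n)
      have hdiff : ∀ a b, ‖S a - S b‖ ≤ C * ‖a - b‖ := fun a b => by
        have h1 := hest (i / n) (by positivity) hi1 _ _ (G.sub_mem (hS a) (hS b))
        refine h1.trans_eq ?_
        congr 2
        simp only [Prod.fst_sub, Prod.snd_sub, map_sub, smul_sub]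
        abel
      have hlip : LipschitzWith (1 / 2) fun w => S (g - ((1 / n : ℝ) : ℂ) • K w) := by
        refine LipschitzWith.of_dist_le_mul fun a b => ?_
        rw [dist_eq_norm, dist_eq_norm]
        refine (hdiff _ _).trans ?_
        rw [sub_sub_sub_cancel_left, ← smul_sub, ← map_sub, norm_smul, Complex.norm_real,
          Real.norm_of_nonneg (by positivity), norm_sub_rev a b]
        have h2 : C * (1 / n * (‖K‖ * ‖b - a‖)) ≤ 1 / 2 * ‖b - a‖ := by
          have : C * ‖K‖ * (1 / n) ≤ 1 / 2 := by
            rw [mul_one_div, div_le_iff₀ hn0]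
            linarith
          calc C * (1 / n * (‖K‖ * ‖b - a‖)) = C * ‖K‖ * (1 / n) * ‖b - a‖ := by ring
            _ ≤ _ := by gcongr
        refine le_trans ?_ (h2.trans_eq (by norm_num))
        gcongr
        exact K.le_opNorm _
      have hcon : ContractingWith (1 / 2) fun w => S (g - ((1 / n : ℝ) : ℂ) • K w) :=
        ⟨by rw [← NNReal.coe_lt_coe]; norm_num, hlip⟩
      refine ⟨ContractingWith.fixedPoint _ hcon, ?_⟩
      have hf := hcon.fixedPoint_isFixedPt
      set w := ContractingWith.fixedPoint _ hcon
      have h3 := hS (g - ((1 / n : ℝ) : ℂ) • K w)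
      rw [hf.eq] at h3
      convert h3 using 2
      push_cast
      rw [add_div, add_smul]
      abel
  obtain ⟨w, hw⟩ := step n le_rfl g
  refine ⟨w, ?_⟩
  rw [div_self hn0.ne'] at hw
  simpa using hw

end ContinuityMethod

section Upgrade

variable {E : Type*} [NormedAddCommGroup E] [InnerProductSpace ℂ E] [FiniteDimensional ℂ E]
variable {d : ℕ} {L : LinData E d} {s : ℝ}

/-- Uniformly accretive coefficients are invertible. -/
theorem exists_cf_inv {a a' : Cf E} (ha : CfDeriv a a') {θ : ℝ} (hθ : 0 < θ)
    (h : ∀ x v, θ * ‖v‖ ^ 2 ≤ rI v (a x v)) :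
    ∃ b b' : Cf E, CfDeriv b b' ∧ (∀ x v, b x (a x v) = v) ∧ ∀ x v, a x (b x v) = v := by
  have hlow : ∀ x v, θ * ‖v‖ ≤ ‖a x v‖ := fun x v => by
    rcases eq_or_ne v 0 with rfl | hv
    · simp
    have h1 := (h x v).trans (rI_le _ _)
    have h2 : 0 < ‖v‖ := norm_pos_iff.2 hv
    nlinarith
  have hu : ∀ x, IsUnit (a x) := fun x => by
    rw [ContinuousLinearMap.isUnit_iff_isUnit_toLinearMap, LinearMap.isUnit_iff_ker_eq_bot,
      LinearMap.ker_eq_bot']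
    intro v hv
    have h1 := hlow x v
    have h2 : a x v = 0 := hv
    rw [h2, norm_zero] at h1
    exact norm_eq_zero.1 (by nlinarith [norm_nonneg v])
  have h1 : ∀ x v, (Ring.inverse (a x)) (a x v) = v := fun x v => by
    have := Ring.inverse_mul_cancel _ (hu x)
    exact congrArg (fun T : E →L[ℂ] E => T v) this
  have h2 : ∀ x v, a x ((Ring.inverse (a x)) v) = v := fun x v => by
    have := Ring.mul_inverse_cancel _ (hu x)
    exact congrArg (fun T : E →L[ℂ] E => T v) this
  have hd : ∀ x, HasDerivAt (fun y => Ring.inverse (a y))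
      (-(Ring.inverse (a x) * a' x * Ring.inverse (a x))) x := fun x => by
    obtain ⟨u, hu⟩ := hu x
    have := (hasFDerivAt_ringInverse (𝕜 := ℝ) u)
    rw [hu] at this
    have h3 := this.comp_hasDerivAt x (ha x)
    refine h3.congr_deriv ?_
    rw [← hu, Ring.inverse_unit]
    rfl
  have hc : Continuous fun y => Ring.inverse (a y) :=
    continuous_iff_continuousAt.2 fun x => (hd x).continuousAt
  let b : Cf E := BoundedContinuousFunction.ofNormedAddCommGroup _ hc θ⁻¹ fun x => by
    refine ContinuousLinearMap.opNorm_le_bound _ (by positivity) fun v => ?_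
    have := hlow x (Ring.inverse (a x) v)
    rw [h2] at this
    rwa [inv_mul_eq_div, le_div_iff₀' hθ]
  refine ⟨b, -(b * a' * b), fun x => hd x, h1, h2⟩

/-- Solutions with data in `H¹` have second derivatives in `L²`. -/
theorem LinData.Good.upgrade (h : L.Good s) {lam : ℂ} {ξ : Fin d → ℝ} {w w1 v2 g g1 : LL E}
    (hw : HD w w1) (hv : HD (mulOp (cst L.pr) w1) v2) (hg : HD g g1)
    (heq : L.Eq lam ξ w w1 v2 g) : ∃ w2, HD w1 w2 ∧ L.Eq lam ξ w w1 w2 g := by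
  obtain ⟨θ, hθ, hdef⟩ := h.definite
  set P := mulOp (cst L.pr) with hP
  set c : Cf E := 1 - cst L.pr with hc
  set a : Cf E := (s : ℂ) • (c * L.A 0 * c) + cst L.pr with ha
  set a' : Cf E := (s : ℂ) • (c * L.A' 0 * c) with ha'
  have hcd : CfDeriv c 0 := fun x => hasDerivAt_const x (1 - L.pr)
  have hprd : CfDeriv (cst L.pr) 0 := fun x => hasDerivAt_const x L.pr
  have had : CfDeriv a a' := fun x => by
    refine ((((hcd.mul (h.A_d 0)).mul hcd).smul s x).add (hprd x)).congr_deriv ?_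
    ext v
    simp [ha', Cf.mul_apply']
  have hrI_s : ∀ (u v : E), rI u ((s : ℂ) • v) = s * rI u v := fun u v => by
    simp [rI, inner_smul_right]
  have hac : ∀ x v, min θ 1 / 2 * ‖v‖ ^ 2 ≤ rI v (a x v) := fun x v => by
    have e1 : a x v = (s : ℂ) • (L.A 0 x (v - L.pr v) - L.pr (L.A 0 x (v - L.pr v))) + L.pr v := rfl
    have e2 : ∀ u, rI v (u - L.pr u) = rI (v - L.pr v) u := fun u => by
      simp only [rI, inner_sub_right, inner_sub_left, h.pr_sa]
    have e3 : rI v (L.pr v) = ‖L.pr v‖ ^ 2 := by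
      rw [← rI_self]
      simp only [rI, h.pr_sa, h.pr_pr]
    rw [e1, rI_add_right, hrI_s, e2, e3]
    have e4 := hdef x (v - L.pr v) (by rw [map_sub, h.pr_pr, sub_self])
    have e5 : ‖v‖ ≤ ‖v - L.pr v‖ + ‖L.pr v‖ := by
      simpa using norm_add_le (v - L.pr v) (L.pr v)
    have e6 : ‖v‖ ^ 2 ≤ 2 * (‖v - L.pr v‖ ^ 2 + ‖L.pr v‖ ^ 2) := by
      nlinarith [norm_nonneg v, sq_nonneg (‖v - L.pr v‖ - ‖L.pr v‖)]
    have e7 : min θ 1 * ‖v - L.pr v‖ ^ 2 ≤ θ * ‖v - L.pr v‖ ^ 2 := by gcongr; exact min_le_left _ _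
    have e8 : min θ 1 * ‖L.pr v‖ ^ 2 ≤ 1 * ‖L.pr v‖ ^ 2 := by gcongr; exact min_le_right _ _
    have e9 : 0 < min θ 1 := by positivity
    nlinarith
  obtain ⟨b, b', hb, hba, -⟩ := exists_cf_inv had (by positivity : 0 < min θ 1 / 2) hac
  have hPP : ∀ f, P (P f) = P f :=
    fun f => mulOp_cst_apply_eq (a := cst L.pr) (fun _ v => h.pr_pr v) f
  have dP : ∀ {f f1}, HD f f1 → HD (f - P f) (f1 - P f1) := fun hf => hf.sub (hf.cst L.pr)
  have kB : ∀ j k f, P (mulOp (L.B j k) f) = mulOp (L.B j k) f :=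
    fun j k f => mulOp_cst_apply_eq (h.pr_B j k) f
  have hlow : ∃ z, (L.coefs ξ 0).par w w1 v2 + (L.coefs ξ 0).del w1 +
      Complex.I • (L.coefs ξ 0).delx w + L.rem ξ w w1 = P z := by
    refine ⟨(L.coefs ξ 0).par w w1 v2 + (L.coefs ξ 0).del w1 +
      Complex.I • (L.coefs ξ 0).delx w + L.rem ξ w w1, ?_⟩
    have kr : ∀ j f, P (mulOp (L.r j) f) = mulOp (L.r j) f :=
      fun j f => mulOp_cst_apply_eq (h.pr_r j) f
    have kr0 : ∀ f, P (mulOp L.r0 f) = mulOp L.r0 f := fun f => mulOp_cst_apply_eq h.pr_r0 f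
    have kd : ∀ j f, P (mulOp (L.del j) f) = mulOp (L.del j) f :=
      fun j f => mulOp_cst_apply_eq (h.pr_del j) f
    simp only [LinData.rem, LinData.coefs, Coefs.par, map_add, map_sub, map_neg, map_smul, map_sum,
      mulOp_lcomb, tang, kB, kr, kr0, kd]
  obtain ⟨z, hz⟩ := hlow
  have heq' : lam • mulOp L.a0 w + mulOp (L.A 0) w1 +
      Complex.I • mulOp (lcomb ξ (tang L.A)) w + mulOp L.e w + P z = g := by
    rw [← hz]
    exact heq
  obtain ⟨k1, dk⟩ : ∃ k1, HD (g - (lam • mulOp L.a0 w + Complex.I • mulOp (lcomb ξ (tang L.A)) w +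
      mulOp L.e w) - mulOp (L.A 0) (P w1)) k1 :=
    ⟨_, (hg.sub ((((HD.mulOp h.a0_d hw).smul lam).add ((HD.mulOp (CfDeriv.lcomb ξ
      (fun j => h.A_d j.succ)) hw).smul Complex.I)).add (HD.mulOp h.e_d hw))).sub
      (HD.mulOp (h.A_d 0) hv)⟩
  have e0 : g - (lam • mulOp L.a0 w + Complex.I • mulOp (lcomb ξ (tang L.A)) w +
      mulOp L.e w) - mulOp (L.A 0) (P w1) = mulOp (L.A 0) (w1 - P w1) + P z := by
    rw [← heq', map_sub]
    abel
  rw [e0] at dk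
  have dk2 := dP dk
  rw [map_add, hPP, add_sub_add_right_eq_sub] at dk2
  have e1 : mulOp a w1 = (s : ℂ) • (mulOp (L.A 0) (w1 - P w1) - P (mulOp (L.A 0) (w1 - P w1))) +
      P w1 := by
    rw [ha, mulOp_add_apply, mulOp_smul]
    simp only [_root_.smul_apply, mulOp_mul_apply, hc, mulOp_sub_apply, mulOp_one,
      one_apply_eq_self, hP]
  have d1 := (dk2.smul (s : ℂ)).add hv
  rw [← e1] at d1
  have d2 := HD.mulOp hb d1
  have e2 : mulOp b (mulOp a w1) = w1 := by
    rw [← mulOp_mul_apply]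
    have : b * a = 1 := Cf.ext' hba
    rw [this, mulOp_one]
    rfl
  rw [e2] at d2
  refine ⟨_, d2, ?_⟩
  generalize mulOp b' (mulOp a w1) + _ = w2 at d2 ⊢
  have e3 : v2 = P w2 := hv.unique (d2.cst L.pr)
  have e4 : mulOp (L.B 0 0) v2 = mulOp (L.B 0 0) w2 := by
    rw [e3, hP, ← mulOp_mul_apply]
    congr 2
    exact Cf.ext' fun x v => h.B_pr 0 0 x v
  unfold LinData.Eq Coefs.Eqn Coefs.par LinData.coefs at heq ⊢
  simp only at heq ⊢
  rw [← e4]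
  exact heq

end Upgrade

section LargeRealPart

theorem young_le {α : ℝ} (hα : 0 < α) (x y : ℝ) : x * y ≤ α * y ^ 2 + x ^ 2 / (4 * α) := by
  have : 0 ≤ (2 * α * y - x) ^ 2 / (4 * α) := by positivity
  have e : (2 * α * y - x) ^ 2 / (4 * α) = α * y ^ 2 + x ^ 2 / (4 * α) - x * y := by
    field_simp
    ring
  linarith

theorem absorb_two {M c D K μ Y a t p q P1 η : ℝ} (hM : 0 ≤ M) (hK : 1 ≤ K)
    (hμ : 0 < μ) (hμ1 : μ ≤ 1) (hc : 0 < c) (hc1 : c ≤ 1) (hμD : μ * D ^ 2 ≤ 1 / 4)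
    (hY : Y = 2 * M ^ 2 / (μ * c)) (ha : 1 ≤ a) (ht : 0 ≤ t) (ht1 : t ≤ 1)
    (htG : t * (2 * M + Y) ≤ μ * a / 4) (hp : 0 ≤ p) (hq : 0 ≤ q) (hη : 0 ≤ η)
    (h1 : a * p ^ 2 ≤ p * η + t * M * (p ^ 2 + p * q + p * P1))
    (h2 : a * q ^ 2 + c * P1 ^ 2 ≤ K * (q * η) + t * M * (q * (p + q + P1)) + D * a * (q * p)) :
    μ * c * (p ^ 2 + q ^ 2 + P1 ^ 2) ≤ 2 * K * ((p + q) * η) := by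
  have hY0 : 0 ≤ Y := by rw [hY]; positivity
  have htt : t ^ 2 ≤ t := by rw [sq]; exact mul_le_of_le_one_left ht ht1
  have y : ∀ x, t * M * (x * P1) ≤ μ * c / 8 * P1 ^ 2 + t * (Y * x ^ 2) := fun x => by
    have h3 := young_le (by positivity : 0 < μ * c / 8) (t * M * x) P1
    have e : (t * M * x) ^ 2 / (4 * (μ * c / 8)) = t ^ 2 * (Y * x ^ 2) := by
      rw [hY]; field_simp; ring
    have h4 : t ^ 2 * (Y * x ^ 2) ≤ t * (Y * x ^ 2) := by gcongr
    linarith only [h3, e, h4]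
  have y1 := y p
  have y2 : μ * (t * M * (q * P1)) ≤ μ * c / 8 * P1 ^ 2 + t * (Y * q ^ 2) := by
    have h3 : 0 ≤ μ * c / 8 * P1 ^ 2 + t * (Y * q ^ 2) := by positivity
    exact (mul_le_mul_of_nonneg_left (y q) hμ.le).trans (mul_le_of_le_one_left h3 hμ1)
  have k5 : μ * (D * a * (q * p)) ≤ a * (p ^ 2 / 4 + μ * q ^ 2 / 4) := by
    have h3 := young_le (by norm_num : (0 : ℝ) < 1 / 4) (D * μ * q) p
    have e3 : (D * μ * q) ^ 2 / (4 * (1 / 4)) = μ * D ^ 2 * (μ * q ^ 2) := by ring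
    have e4 : μ * D ^ 2 * (μ * q ^ 2) ≤ 1 / 4 * (μ * q ^ 2) := by gcongr
    calc μ * (D * a * (q * p)) = a * (D * μ * q * p) := by ring
      _ ≤ a * (p ^ 2 / 4 + μ * q ^ 2 / 4) := by
        gcongr
        linarith only [h3, e3, e4]
  have m1 : μ * (K * (q * η)) ≤ K * (q * η) := mul_le_of_le_one_left (by positivity) hμ1
  have m2 : μ * (t * M * (q * (p + q))) ≤ t * M * (q * (p + q)) :=
    mul_le_of_le_one_left (by positivity) hμ1
  have m3 := mul_le_mul_of_nonneg_left h2 hμ.le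
  have m4 : t * M * (2 * (p * q)) ≤ t * M * (p ^ 2 + q ^ 2) := by
    gcongr
    linarith only [sq_nonneg (p - q)]
  have m5 : t * (2 * M + Y) * (p ^ 2 + q ^ 2) ≤ μ * a / 4 * (p ^ 2 + q ^ 2) := by gcongr
  have m6 : μ * a / 4 * p ^ 2 ≤ a / 4 * p ^ 2 := by
    have : μ * a ≤ 1 * a := by gcongr
    gcongr
    linarith only [this]
  have m7 : μ * c * p ^ 2 ≤ a * p ^ 2 := by
    gcongr
    exact (mul_le_one₀ hμ1 hc.le hc1).trans ha
  have m8 : μ * c * q ^ 2 ≤ μ * a * q ^ 2 := by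
    gcongr
    exact hc1.trans ha
  have m9 : p * η ≤ K * (p * η) := le_mul_of_one_le_left (by positivity) hK
  have m10 : 0 ≤ μ * c * P1 ^ 2 := by positivity
  linarith only [h1, y1, y2, k5, m1, m2, m3, m4, m5, m6, m7, m8, m9, m10]

/-- Absorption of lower order terms for large real part, uniform in the homotopy parameter. -/
theorem absorb_large {N c θ : ℝ} (hN : 1 ≤ N) (hc : 0 < c) (hc1 : c ≤ 1) (hθ : 0 < θ) :
    ∃ Λ : ℝ, 1 ≤ Λ ∧ ∃ C : ℝ, 0 < C ∧ ∀ ρ t p q P1 p1 η : ℝ, Λ ≤ ρ → 0 ≤ t → t ≤ 1 → 0 ≤ p →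
      0 ≤ q → 0 ≤ P1 → 0 ≤ p1 → 0 ≤ η →
      (1 - t) * p ^ 2 + t * (ρ * c) * p ^ 2 ≤ p * η + t * N * (p ^ 2 + p * q + p * P1) →
      (1 - t) * (q ^ 2 + P1 ^ 2) + t * (ρ * c * q ^ 2 + c * P1 ^ 2) ≤
        q * η + t * N * (q * (p + q + P1 + p1)) →
      θ * p1 ≤ η + t * N * (ρ * p + p + q + P1) → p + q + P1 ≤ C * η := by
  obtain ⟨D, hD⟩ : ∃ D, D = N ^ 2 / (c * θ) := ⟨_, rfl⟩
  have hD0 : 0 < D := by rw [hD]; positivity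
  obtain ⟨μ, hμ⟩ : ∃ μ, μ = min 1 (1 / (4 * D ^ 2)) := ⟨_, rfl⟩
  have hμ0 : 0 < μ := by rw [hμ]; positivity
  have hμ1 : μ ≤ 1 := by rw [hμ]; exact min_le_left _ _
  have hμD : μ * D ^ 2 ≤ 1 / 4 := by
    have : μ ≤ 1 / (4 * D ^ 2) := by rw [hμ]; exact min_le_right _ _
    calc μ * D ^ 2 ≤ 1 / (4 * D ^ 2) * D ^ 2 := by gcongr
      _ = 1 / 4 := by field_simp
  obtain ⟨n, hn⟩ : ∃ n, n = N ^ 2 / θ := ⟨_, rfl⟩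
  obtain ⟨K, hK⟩ : ∃ K, K = N / θ := ⟨_, rfl⟩
  have hK0 : 0 ≤ K := by rw [hK]; positivity
  have hn0 : 0 ≤ n := by rw [hn]; positivity
  obtain ⟨Y, hY⟩ : ∃ Y, Y = 2 * (N + n) ^ 2 / (μ * c) := ⟨_, rfl⟩
  have hY0 : 0 ≤ Y := by rw [hY]; positivity
  refine ⟨max 1 (max (1 / c) (4 * (2 * (N + n) + Y) / (μ * c))), le_max_left _ _,
    6 * (1 + K) / (μ * c), by positivity, ?_⟩
  intro ρ t p q P1 p1 η hρ ht ht1 hp hq hP hp1 hη h1 h2 h3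
  have hρ1 : 1 ≤ ρ := (le_max_left _ _).trans hρ
  have hρc : 1 ≤ ρ * c := by
    have : 1 / c ≤ ρ := (le_max_left _ _).trans ((le_max_right _ _).trans hρ)
    rwa [div_le_iff₀ hc] at this
  have hρG : 4 * (2 * (N + n) + Y) ≤ ρ * (μ * c) := by
    have : 4 * (2 * (N + n) + Y) / (μ * c) ≤ ρ :=
      (le_max_right _ _).trans ((le_max_right _ _).trans hρ)
    rwa [div_le_iff₀ (by positivity)] at this
  obtain ⟨a, ha⟩ : ∃ a, a = (1 - t) + t * (ρ * c) := ⟨_, rfl⟩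
  have ha1 : 1 ≤ a := by
    have := mul_le_mul_of_nonneg_left hρc ht
    rw [ha]; linarith only [this]
  have htρ : t * (ρ * c) ≤ a := by rw [ha]; linarith only [ht1]
  have htG : t * (2 * (N + n) + Y) ≤ μ * a / 4 := by
    have e1 := mul_le_mul_of_nonneg_left hρG ht
    have e2 := mul_le_mul_of_nonneg_left htρ hμ0.le
    linarith only [e1, e2]
  have htt : t ^ 2 ≤ t := by rw [sq]; exact mul_le_of_le_one_left ht ht1
  have hNM : t * N ≤ t * (N + n) := by gcongr; linarith only [hn0]
  have k1 : a * p ^ 2 ≤ p * η + t * (N + n) * (p ^ 2 + p * q + p * P1) := by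
    have : t * N * (p ^ 2 + p * q + p * P1) ≤ t * (N + n) * (p ^ 2 + p * q + p * P1) := by gcongr
    rw [ha]
    linarith only [h1, this]
  have k3 : p1 ≤ (η + t * N * (ρ * p + p + q + P1)) / θ := by rwa [le_div_iff₀' hθ]
  have k4 : t * N * (q * p1) ≤ K * (q * η) + n * (t ^ 2 * ρ) * (q * p) +
      n * t ^ 2 * (q * (p + q + P1)) := by
    have e1 : t * N * (q * p1) ≤ t * N * (q * ((η + t * N * (ρ * p + p + q + P1)) / θ)) := by
      gcongr
    have e2 : t * (K * (q * η)) ≤ K * (q * η) := mul_le_of_le_one_left (by positivity) ht1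
    have e3 : t * N * (q * ((η + t * N * (ρ * p + p + q + P1)) / θ)) =
      t * (K * (q * η)) + n * (t ^ 2 * ρ) * (q * p) + n * t ^ 2 * (q * (p + q + P1)) := by
      rw [hK, hn]
      field_simp
      ring
    linarith only [e1, e2, e3]
  have k5 : n * (t ^ 2 * ρ) * (q * p) ≤ D * a * (q * p) := by
    have e1 : t ^ 2 * (ρ * c) ≤ a := (mul_le_mul_of_nonneg_right htt (by positivity)).trans htρ
    have e2 : n * (t ^ 2 * ρ) = D * (t ^ 2 * (ρ * c)) := by rw [hD, hn]; field_simp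
    rw [e2]
    gcongr
  have k6 : n * t ^ 2 * (q * (p + q + P1)) ≤ n * t * (q * (p + q + P1)) := by gcongr
  have k2 : a * q ^ 2 + c * P1 ^ 2 ≤ (1 + K) * (q * η) + t * (N + n) * (q * (p + q + P1)) +
      D * a * (q * p) := by
    have e1 : 0 ≤ (1 - t) * (1 - c) * P1 ^ 2 :=
      mul_nonneg (mul_nonneg (by linarith only [ht1]) (by linarith only [hc1])) (sq_nonneg _)
    rw [ha] at k5 ⊢
    linarith only [h2, e1, k4, k5, k6]
  have s5 := absorb_two (by positivity) (by linarith only [hK0] : 1 ≤ 1 + K) hμ0 hμ1 hc hc1 hμD hY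
    ha1 ht ht1 htG hp hq hη k1 k2
  by_cases hr : p + q + P1 = 0
  · rw [hr]; positivity
  have hr0 : 0 < p + q + P1 := lt_of_le_of_ne (by positivity) (Ne.symm hr)
  have s6 : (p + q + P1) * (μ * c * (p + q + P1)) ≤ (p + q + P1) * (6 * (1 + K) * η) := by
    have m1 : (p + q + P1) ^ 2 ≤ 3 * (p ^ 2 + q ^ 2 + P1 ^ 2) := by
      linarith only [sq_nonneg (p - q), sq_nonneg (p - P1), sq_nonneg (q - P1)]
    have m2 : μ * c * (p + q + P1) ^ 2 ≤ μ * c * (3 * (p ^ 2 + q ^ 2 + P1 ^ 2)) := by gcongr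
    have m3 : 0 ≤ 6 * (1 + K) * (P1 * η) := by positivity
    linarith only [s5, m2, m3]
  rw [div_mul_eq_mul_div, le_div_iff₀ (by positivity)]
  linarith only [le_of_mul_le_mul_left s6 hr0]

end LargeRealPart

section Homotopy

variable {H : Type*} [NormedAddCommGroup H] [InnerProductSpace ℂ H]
variable {Δ : SkewRel H} {q : Coefs H} {k c C M θ s : ℝ}

theorem rI_real_smul (a : ℝ) (f g : H) : rI f ((a : ℂ) • g) = a * rI f g := by
  simp only [rI, inner_smul_right, Complex.re_ofReal_mul]

set_option maxHeartbeats 1600000 in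
/-- Uniform estimate along the homotopy to a constant coefficient operator. -/
theorem Coefs.Bounds.homotopy (h : q.Bounds Δ k c C 0) (hk : 0 ≤ k) (hC : 1 ≤ C) (hc : 0 < c)
    (hM : 0 ≤ M) (hθ : 0 < θ) (hθ1 : θ ≤ 1) (hs : s * s = 1)
    (hpe : ∀ f, q.pr (q.e f) = 0) (he : ∀ f, ‖q.e f‖ ≤ M * ‖f‖)
    (hA : ∀ f, q.pr f = 0 → θ * ‖f‖ ^ 2 ≤ s * rI f (q.A f))
    (hb : ∀ f, θ * ‖q.pr f‖ ^ 2 ≤ rI f (q.b f)) :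
    ∃ Λ : ℝ, 1 ≤ Λ ∧ ∀ lam : ℂ, Λ ≤ lam.re → ‖lam‖ ≤ 2 * lam.re → ∃ C', 0 ≤ C' ∧
      ∀ t : ℝ, 0 ≤ t → t ≤ 1 → ∀ w w1 v2 r g : H, Δ.D w w1 → Δ.D (q.pr w1) v2 → q.pr v2 = v2 →
        q.pr r = r → ‖r‖ ≤ M * (‖w‖ + ‖q.pr w1‖) → q.Eqn lam w w1 v2 r g →
        ‖w‖ + ‖w1‖ + ‖v2‖ ≤
          C' * ‖((1 - t : ℝ) : ℂ) • (w + (s : ℂ) • (w1 - q.pr w1) - v2) + (t : ℂ) • g‖ := by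
  obtain ⟨N, hN⟩ : ∃ N, N = 10 * ((C + M) * (1 + k)) := ⟨_, rfl⟩
  have hCMk : C + M + C * k ≤ (C + M) * (1 + k) := by
    linarith only [mul_nonneg hM hk]
  have hCk : 0 ≤ C * k := by positivity
  have hN1 : 1 ≤ N := by rw [hN]; linarith only [hCMk, hC, hM, hCk]
  have hNb : 10 * C + 10 * M + 10 * (C * k) ≤ N := by rw [hN]; linarith only [hCMk]
  obtain ⟨Λ, hΛ, C1, hC1, habs⟩ := absorb_large hN1 (lt_min hc one_pos) (min_le_right c 1) hθ
  refine ⟨Λ, hΛ, fun lam hl1 hl2 => ?_⟩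
  set ρ := lam.re with hρ
  have hρ1 : 1 ≤ ρ := hΛ.trans hl1
  obtain ⟨C2, hC2⟩ : ∃ C2, C2 = (1 + N * (2 * ρ * C1)) / θ := ⟨_, rfl⟩
  have hC20 : 0 ≤ C2 := by rw [hC2]; positivity
  obtain ⟨C3, hC3⟩ : ∃ C3, C3 = (1 + (1 + 3 * N * (1 + ρ + k)) * (C1 + C2)) / θ := ⟨_, rfl⟩
  have hC30 : 0 ≤ C3 := by rw [hC3]; positivity
  refine ⟨2 * C1 + C2 + C3, by positivity, ?_⟩
  intro t ht ht1 w w1 v2 r g hw hv hpv hpr hr hE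
  obtain ⟨G, hG⟩ : ∃ G, G = ((1 - t : ℝ) : ℂ) • (w + (s : ℂ) • (w1 - q.pr w1) - v2) + (t : ℂ) • g :=
    ⟨_, rfl⟩
  rw [← hG]
  obtain ⟨y, hy⟩ : ∃ y, y = q.pr w := ⟨_, rfl⟩
  obtain ⟨y1, hy1⟩ : ∃ y1, y1 = q.pr w1 := ⟨_, rfl⟩
  obtain ⟨u, hu⟩ : ∃ u, u = w - y := ⟨_, rfl⟩
  obtain ⟨u1, hu1⟩ : ∃ u1, u1 = w1 - y1 := ⟨_, rfl⟩
  have ew : w = u + y := by rw [hu, sub_add_cancel]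
  have ew1 : w1 = u1 + y1 := by rw [hu1, sub_add_cancel]
  have py : q.pr y = y := by rw [hy, h.pr_pr]
  have py1 : q.pr y1 = y1 := by rw [hy1, h.pr_pr]
  have pu : q.pr u = 0 := by rw [hu, map_sub, py, hy, sub_self]
  have pu1 : q.pr u1 = 0 := by rw [hu1, map_sub, py1, hy1, sub_self]
  have orth : ∀ {f x}, q.pr f = 0 → q.pr x = x → rI f x = 0 := fun {f x} hf hx => by
    rw [h.rI_of_pr hx, hf]; simp [rI]
  have orth' : ∀ {f x}, q.pr f = 0 → q.pr x = x → rI x f = 0 := fun hf hx => by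
    rw [rI_comm]; exact orth hf hx
  have dy : Δ.D y y1 := by rw [hy, hy1]; exact h.pr_D w w1 hw
  have du : Δ.D u u1 := by rw [hu, hu1]; exact Δ.graph.sub_mem hw dy
  rw [← hy1] at hv hr hG
  rw [← hu1] at hG
  have rG : ∀ x, rI x G = (1 - t) * (rI x w + s * rI x u1 - rI x v2) + t * rI x g := fun x => by
    rw [hG, rI_add_right, rI_real_smul, rI_real_smul, rI_sub_right, rI_add_right, rI_real_smul]
  have kill : ∀ {f}, ∀ T : H →L[ℂ] H, ∀ {a : ℝ}, ‖T f‖ ≤ a * ‖q.pr f‖ → q.pr f = 0 → T f = 0 := by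
    intro f T a hT hf
    rw [hf, norm_zero, mul_zero] at hT
    exact norm_le_zero_iff.1 hT
  have sgw : ∀ f, 0 * ‖f‖ + C * ‖q.sg f‖ ≤ C * ‖f‖ := fun f => by
    rw [zero_mul, zero_add]; exact mul_le_mul_of_nonneg_left (h.sg_le f) (by linarith)
  have ppar := h.pr_par w w1 v2
  have plow := h.pr_low (w := w) (w1 := w1) hpr
  have pa0 : ∀ f, q.pr (q.a0 f) = q.a0 (q.pr f) := fun f => by
    have := h.pr_a0i (q.a0 f)
    rw [h.a0i_a0] at this
    rw [this, h.a0_a0i]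
  have a0w : q.a0 w = q.a0 u + q.a0 y := by rw [ew, map_add]
  have pa0u : q.pr (q.a0 u) = 0 := by rw [pa0, pu, map_zero]
  have pa0y : q.pr (q.a0 y) = q.a0 y := by rw [pa0, py]
  have rIl : ∀ z x : H, (⟪z, x⟫_ℂ).im = 0 → rI z (lam • x) = ρ * rI z x :=
    fun z x hz => rI_smul_of_im_zero lam hz
  have im0 : ∀ z : H, (⟪z, q.a0 z⟫_ℂ).im = 0 := fun z => by
    rw [← h.a0_sa]; exact h.a0_sa.inner_self_im z
  have skewA : rI u (q.A u1) = -(1 / 2) * rI u (q.A' u) := by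
    have := Δ.rI_skew du (h.A_comm u u1 du)
    rw [rI_add_right, ← h.A_sa.rI u u1, rI_comm (q.A u)] at this
    have h2 := h.A_sa.rI u u1
    rw [rI_comm (q.A u)] at h2
    linarith only [this, h2]
  have wI := norm_I_smul (H := H)
  obtain ⟨p, hp⟩ : ∃ p, p = ‖u‖ := ⟨_, rfl⟩
  obtain ⟨Q, hQ⟩ : ∃ Q, Q = ‖y‖ := ⟨_, rfl⟩
  obtain ⟨P1, hP1⟩ : ∃ P1, P1 = ‖y1‖ := ⟨_, rfl⟩
  obtain ⟨p1, hp1⟩ : ∃ p1, p1 = ‖u1‖ := ⟨_, rfl⟩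
  obtain ⟨η, hη⟩ : ∃ η, η = ‖G‖ := ⟨_, rfl⟩
  obtain ⟨z, hz⟩ : ∃ z, z = ‖v2‖ := ⟨_, rfl⟩
  have p0 : 0 ≤ p := hp ▸ norm_nonneg _
  have Q0 : 0 ≤ Q := hQ ▸ norm_nonneg _
  have P10 : 0 ≤ P1 := hP1 ▸ norm_nonneg _
  have p10 : 0 ≤ p1 := hp1 ▸ norm_nonneg _
  have η0 : 0 ≤ η := hη ▸ norm_nonneg _
  have z0 : 0 ≤ z := hz ▸ norm_nonneg _
  have nw : ‖w‖ ≤ p + Q := by rw [ew, hp, hQ]; exact norm_add_le _ _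
  have nw1 : ‖w1‖ ≤ p1 + P1 := by rw [ew1, hp1, hP1]; exact norm_add_le _ _
  have nAw1 : ‖q.A w1‖ ≤ C * (p1 + P1) := (h.A_le w1).trans (by gcongr)
  have nXw : ‖Complex.I • q.X w‖ ≤ C * k * (p + Q) := by
    rw [wI]; exact (h.X_le w).trans (by gcongr)
  have new : ‖q.e w‖ ≤ M * (p + Q) := (he w).trans (by gcongr)
  have nlow : ‖q.low w w1 r‖ ≤ 2 * C * (p1 + P1) + 2 * (C * k) * (p + Q) + M * (p + Q + P1) := by
    refine (h.norm_low_le w w1 r).trans ?_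
    have e1 := sgw w1
    have e2 := sgw w
    have e3 : C * ‖q.pr w1‖ ≤ C * ‖w1‖ := by gcongr; exact h.norm_pr_le _
    have e4 : C * ‖q.pr w‖ ≤ C * ‖w‖ := by gcongr; exact h.norm_pr_le _
    have e5 : k * (0 * ‖w‖ + C * ‖q.sg w‖ + C * ‖q.pr w‖) ≤ k * (2 * C * (p + Q)) := by
      gcongr
      have : C * ‖w‖ ≤ C * (p + Q) := by gcongr
      linarith only [e2, e4, this]
    have e6 : C * ‖w1‖ ≤ C * (p1 + P1) := by gcongr
    have e7 : ‖r‖ ≤ M * (p + Q + P1) := by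
      refine hr.trans ?_
      rw [← hP1]
      gcongr
    linarith only [e1, e3, e5, e6, e7]
  -- the hyperbolic test
  have T1 : (1 - t) * p ^ 2 + t * (ρ * min c 1) * p ^ 2 ≤
      p * η + t * N * (p ^ 2 + p * Q + p * P1) := by
    have e0 := rG u
    have e1 := hE.rI u
    have f1 : rI u w = p ^ 2 := by rw [ew, rI_add_right, orth pu py, rI_self, hp, add_zero]
    have f2 : rI u u1 = 0 := by
      have := Δ.rI_skew du du
      rw [rI_comm] at this
      linarith only [this]
    have f3 : rI u v2 = 0 := orth pu hpv
    have f4 : rI u (lam • q.a0 w) = ρ * rI u (q.a0 u) := by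
      rw [a0w, smul_add, rI_add_right, rIl _ _ (im0 u),
        orth pu (x := lam • q.a0 y) (by rw [map_smul, pa0y]), add_zero]
    have f5 : rI u (q.A w1) = -(1 / 2) * rI u (q.A' u) + rI u (q.A y1) := by
      rw [ew1, map_add, rI_add_right, skewA]
    have f6 : rI u (Complex.I • q.X w) = rI u (Complex.I • q.X y) := by
      rw [ew, map_add, smul_add, rI_add_right, h.X_sa.rI_I, zero_add]
    have f7 : rI u (q.par w w1 v2) = 0 := orth pu ppar
    have f8 : rI u (q.low w w1 r) = 0 := orth pu plow
    rw [f1, f2, f3] at e0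
    rw [f4, f5, f6, f7, f8] at e1
    have g1 : min c 1 * p ^ 2 ≤ rI u (q.a0 u) := by
      rw [hp]
      exact le_trans (by gcongr; exact min_le_left _ _) (h.a0_pos u)
    have g2 : rI u (q.A' u) ≤ C * p ^ 2 := by
      refine (rI_le _ _).trans ?_
      rw [hp, sq, ← mul_assoc, mul_comm C, mul_assoc]
      gcongr
      exact (h.A'_le u).trans (sgw u)
    have g3 : -(p * (C * P1)) ≤ rI u (q.A y1) := by
      refine le_trans (neg_le_neg ?_) (neg_le_rI _ _)
      rw [hp, hP1]; gcongr; exact h.A_le _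
    have g4 : -(p * (C * k * Q)) ≤ rI u (Complex.I • q.X y) := by
      refine le_trans (neg_le_neg ?_) (neg_le_rI _ _)
      rw [hp, hQ, wI]; gcongr; exact h.X_le _
    have g5 : -(p * (M * (p + Q))) ≤ rI u (q.e w) := by
      refine le_trans (neg_le_neg ?_) (neg_le_rI _ _)
      rw [← hp]; gcongr
    have g6 : rI u G ≤ p * η := by rw [hp, hη]; exact rI_le _ _
    have g7 : ρ * (min c 1 * p ^ 2) ≤ ρ * rI u (q.a0 u) := by gcongr
    have g8 : ρ * (min c 1 * p ^ 2) - N * (p ^ 2 + p * Q + p * P1) ≤ rI u g := by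
      have i1 : 0 ≤ (N - (C + M)) * p ^ 2 :=
        mul_nonneg (by linarith only [hNb, hC, hM, hCk]) (sq_nonneg p)
      have i2 : 0 ≤ (N - (C * k + M)) * (p * Q) :=
        mul_nonneg (by linarith only [hNb, hC, hM, hCk]) (by positivity)
      have i3 : 0 ≤ (N - C) * (p * P1) :=
        mul_nonneg (by linarith only [hNb, hC, hM, hCk]) (by positivity)
      have i4 : 0 ≤ C * p ^ 2 := by positivity
      linarith only [e1, g7, g2, g3, g4, g5, i1, i2, i3, i4]
    have g9 := mul_le_mul_of_nonneg_left g8 ht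
    linarith only [e0, g6, g9]
  -- the parabolic test
  have T2 : (1 - t) * (Q ^ 2 + P1 ^ 2) + t * (ρ * min c 1 * Q ^ 2 + min c 1 * P1 ^ 2) ≤
      Q * η + t * N * (Q * (p + Q + P1 + p1)) := by
    have e0 := rG y
    have e1 := hE.rI y
    have f1 : rI y w = Q ^ 2 := by rw [ew, rI_add_right, orth' pu py, rI_self, hQ, zero_add]
    have f2 : rI y u1 = 0 := orth' pu1 py
    have f3 : rI y v2 = -P1 ^ 2 := by
      have := Δ.rI_skew dy hv
      rw [rI_self, ← hP1] at this
      linarith only [this]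
    have f4 : rI y (lam • q.a0 w) = ρ * rI y (q.a0 y) := by
      rw [a0w, smul_add, rI_add_right, rIl _ _ (im0 y),
        orth' (f := lam • q.a0 u) (by rw [map_smul, pa0u, smul_zero]) py, zero_add]
    have f6 : rI y (Complex.I • q.X w) = rI y (Complex.I • q.X u) := by
      rw [ew, map_add, smul_add, rI_add_right, h.X_sa.rI_I, add_zero]
    have f7 : rI y (q.e w) = 0 := orth' (hpe w) py
    have ep : q.par w w1 v2 = q.par y y1 v2 := by
      unfold Coefs.par
      rw [ew, ew1, map_add, map_add, map_add, kill q.b1 (h.b1_le u1) pu1, kill q.b2 (h.b2_le u1) pu1,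
        kill q.b3 (h.b3_le u) pu, zero_add, zero_add, zero_add]
    have f8 : rI y (q.par w w1 v2) = (rI y1 (q.b y1) + rI y1 (Complex.I • q.b1 y) -
        rI y (Complex.I • q.b2 y1) + rI y (q.b3 y)) + rI y (q.b' y1) + rI y (Complex.I • q.b1' y) := by
      have s0 := Δ.rI_skew dy (h.b_comm y1 v2 hv)
      have s1 := Δ.rI_skew dy (Submodule.smul_mem _ Complex.I (h.b1_comm y y1 dy) :
        Δ.D (Complex.I • q.b1 y) (Complex.I • (q.b1' y + q.b1 y1)))
      rw [ep]
      simp only [Coefs.par, smul_add, rI_add_right, rI_sub_right, rI_neg_right] at s0 s1 ⊢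
      linarith only [s0, s1]
    rw [f1, f2, f3] at e0
    rw [f4, f6, f7, f8] at e1
    have gg := h.garding y y1 dy
    rw [py, py1, ← hQ, ← hP1] at gg
    have g1 : min c 1 * Q ^ 2 ≤ rI y (q.a0 y) := by
      rw [hQ]
      exact le_trans (by gcongr; exact min_le_left _ _) (h.a0_pos y)
    have lower : ∀ {x a}, ‖x‖ ≤ a → -(Q * a) ≤ rI y x := fun {x a} hx => by
      refine le_trans (neg_le_neg ?_) (neg_le_rI _ _)
      rw [← hQ]; gcongr
    have g2 := lower nAw1
    have g3 : -(Q * (C * k * p)) ≤ rI y (Complex.I • q.X u) := by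
      refine lower ?_
      rw [wI, hp]; exact h.X_le _
    have g4 := lower nlow
    have g5 : -(Q * (C * P1)) ≤ rI y (q.b' y1) := by
      refine lower ((h.b'_le y1).trans_eq ?_)
      rw [py1, hP1]
    have g6 : -(Q * (C * k * Q)) ≤ rI y (Complex.I • q.b1' y) := by
      refine lower ?_
      rw [wI]
      refine (h.b1'_le y).trans_eq ?_
      rw [py, hQ]
    have g7 : ρ * (min c 1 * Q ^ 2) ≤ ρ * rI y (q.a0 y) := by gcongr
    have g8 : rI y G ≤ Q * η := by rw [hQ, hη]; exact rI_le _ _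
    have g9 : min c 1 * P1 ^ 2 ≤ c * P1 ^ 2 := by gcongr; exact min_le_left _ _
    have g10 : ρ * (min c 1 * Q ^ 2) + min c 1 * P1 ^ 2 - N * (Q * (p + Q + P1 + p1)) ≤ rI y g := by
      have i0 : 0 ≤ (N - (10 * C + 10 * M + 10 * (C * k))) * (Q * (p + Q + P1 + p1)) :=
        mul_nonneg (by linarith only [hNb]) (by positivity)
      have i1 : 0 ≤ C * (Q * (p + Q + P1 + p1)) := by positivity
      have i2 : 0 ≤ M * (Q * (p + Q + P1 + p1)) := by positivity
      have i3 : 0 ≤ C * k * (Q * (p + Q + P1 + p1)) := by positivity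
      have j1 : 0 ≤ C * (Q * p) := by positivity
      have j2 : 0 ≤ C * (Q * p1) := by positivity
      have j3 : 0 ≤ C * (Q * P1) := by positivity
      have j4 : 0 ≤ C * (Q * Q) := by positivity
      have j5 : 0 ≤ C * k * (Q * p) := by positivity
      have j6 : 0 ≤ C * k * (Q * Q) := by positivity
      have j7 : 0 ≤ M * (Q * p1) := by positivity
      have j8 : 0 ≤ c * (k ^ 2 * Q ^ 2) := by positivity
      have j9 : 0 ≤ C * k * (Q * P1) := by positivity
      have j10 : 0 ≤ C * k * (Q * p1) := by positivity
      have j11 : 0 ≤ M * (Q * p) := by positivity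
      have j12 : 0 ≤ M * (Q * P1) := by positivity
      have j13 : 0 ≤ M * (Q * Q) := by positivity
      linarith only [e1, gg, g2, g3, g4, g5, g6, g7, g9, i0, j1, j2, j3, j4, j5, j6, j7, j8, j9,
        j10, j11, j12, j13]
    have g11 := mul_le_mul_of_nonneg_left g10 ht
    linarith only [e0, g8, g11]
  -- the derivative of the hyperbolic modes
  have T3 : θ * p1 ≤ η + t * N * (ρ * p + p + Q + P1) := by
    rcases eq_or_lt_of_le p10 with hz | hz
    · rw [← hz, mul_zero]; positivity
    have e0 := rG u1
    have e1 := hE.rI u1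
    have f1 : rI u1 w = 0 := by
      have := Δ.rI_skew du du
      rw [rI_comm u u1] at this
      rw [ew, rI_add_right, orth pu1 py]
      linarith only [this]
    have f2 : rI u1 u1 = p1 ^ 2 := by rw [rI_self, hp1]
    have f3 : rI u1 v2 = 0 := orth pu1 hpv
    have f5 : rI u1 (q.A w1) = rI u1 (q.A u1) + rI u1 (q.A y1) := by
      rw [ew1, map_add, rI_add_right]
    have f4 : rI u1 (lam • q.a0 w) = rI u1 (lam • q.a0 u) := by
      rw [a0w, smul_add, rI_add_right, orth pu1 (x := lam • q.a0 y) (by rw [map_smul, pa0y]),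
        add_zero]
    have f7 : rI u1 (q.par w w1 v2) = 0 := orth pu1 ppar
    have f8 : rI u1 (q.low w w1 r) = 0 := orth pu1 plow
    rw [f1, f2, f3] at e0
    rw [f4, f5, f7, f8] at e1
    have hs1 : |s| = 1 := by
      rcases mul_self_eq_one_iff.1 hs with h | h <;> rw [h] <;> norm_num
    have lower : ∀ {x a}, ‖x‖ ≤ a → -(p1 * a) ≤ s * rI u1 x := fun {x a} hx => by
      have h1 : |s * rI u1 x| ≤ p1 * a := by
        rw [abs_mul, hs1, one_mul]
        refine (abs_rI_le _ _).trans ?_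
        rw [← hp1]; gcongr
      exact (abs_le.1 h1).1
    have upper : s * rI u1 G ≤ p1 * η := by
      refine (le_abs_self _).trans ?_
      rw [abs_mul, hs1, one_mul, hp1, hη]
      exact abs_rI_le _ _
    have g1 : -(p1 * (2 * ρ * C * p)) ≤ s * rI u1 (lam • q.a0 u) := by
      refine lower ?_
      rw [norm_smul, hp, mul_assoc]
      exact mul_le_mul hl2 (h.a0_le u) (norm_nonneg _) (by linarith only [hρ1])
    have g2 : -(p1 * (C * P1)) ≤ s * rI u1 (q.A y1) := lower (by rw [hP1]; exact h.A_le _)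
    have g3 := lower nXw
    have g4 := lower new
    have g5 := hA u1 pu1
    rw [← hp1] at g5
    have g6 : θ * p1 ^ 2 - N * (p1 * (ρ * p + p + Q + P1)) ≤ s * rI u1 g := by
      have i0 : 0 ≤ (N - (10 * C + 10 * M + 10 * (C * k))) * (p1 * (ρ * p + p + Q + P1)) :=
        mul_nonneg (by linarith only [hNb]) (by positivity)
      have j1 : 0 ≤ C * (p1 * (ρ * p)) := by positivity
      have j2 : 0 ≤ C * (p1 * p) := by positivity
      have j3 : 0 ≤ C * (p1 * P1) := by positivity
      have j4 : 0 ≤ C * (p1 * Q) := by positivity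
      have j5 : 0 ≤ C * k * (p1 * p) := by positivity
      have j6 : 0 ≤ C * k * (p1 * Q) := by positivity
      have j7 : 0 ≤ C * k * (p1 * (ρ * p)) := by positivity
      have j8 : 0 ≤ C * k * (p1 * P1) := by positivity
      have j9 : 0 ≤ M * (p1 * (ρ * p)) := by positivity
      have j10 : 0 ≤ M * (p1 * P1) := by positivity
      have j11 : 0 ≤ M * (p1 * p) := by positivity
      have j12 : 0 ≤ M * (p1 * Q) := by positivity
      have e1' := congrArg (fun x => s * x) e1
      simp only [mul_add, add_zero] at e1'
      linarith only [e1', g1, g2, g3, g4, g5, i0, j1, j2, j3, j4, j5, j6, j7, j8, j9, j10, j11, j12]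
    have g7 := mul_le_mul_of_nonneg_left g6 ht
    have g8 : s * rI u1 G = (1 - t) * p1 ^ 2 + t * (s * rI u1 g) := by
      rw [e0]
      linear_combination (1 - t) * p1 ^ 2 * hs
    have g9 : θ * p1 ^ 2 ≤ (1 - t) * p1 ^ 2 + t * (θ * p1 ^ 2) := by
      have : 0 ≤ (1 - t) * (1 - θ) * p1 ^ 2 :=
        mul_nonneg (mul_nonneg (by linarith only [ht1]) (by linarith only [hθ1])) (sq_nonneg _)
      linarith only [this]
    refine le_of_mul_le_mul_left ?_ hz
    linarith only [g7, g8, g9, upper]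
  have S1 := habs ρ t p Q P1 p1 η hl1 ht ht1 p0 Q0 P10 p10 η0 T1 T2 T3
  have S2 : p1 ≤ C2 * η := by
    rw [hC2, div_mul_eq_mul_div, le_div_iff₀' hθ]
    have e1 : t * N * (ρ * p + p + Q + P1) ≤ 1 * N * (2 * ρ * (p + Q + P1)) := by
      gcongr
      have m : ∀ x, 0 ≤ x → x ≤ ρ * x := fun x hx => le_mul_of_one_le_left hx hρ1
      linarith only [m p p0, m Q Q0, m P1 P10, Q0, P10]
    have e2 : 1 * N * (2 * ρ * (p + Q + P1)) ≤ 1 * N * (2 * ρ * (C1 * η)) := by gcongr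
    linarith only [T3, e1, e2]
  -- the second derivative
  have S3 : z ≤ C3 * η := by
    rcases eq_or_lt_of_le z0 with hz0 | hz0
    · rw [← hz0]; positivity
    have e0 := rG v2
    have e1 := hE.rI v2
    have f1 : rI v2 w = rI v2 y := by rw [ew, rI_add_right, orth' pu hpv, zero_add]
    have f2 : rI v2 u1 = 0 := orth' pu1 hpv
    have f3 : rI v2 v2 = z ^ 2 := by rw [rI_self, hz]
    have f4 : rI v2 (lam • q.a0 w) = rI v2 (lam • q.a0 y) := by
      rw [a0w, smul_add, rI_add_right, orth' (f := lam • q.a0 u) (by rw [map_smul, pa0u, smul_zero])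
        hpv, zero_add]
    have f5 : rI v2 (q.e w) = 0 := orth' (hpe w) hpv
    have f6 : rI v2 (q.par w w1 v2) = -rI v2 (q.b v2) - rI v2 (Complex.I • (q.b1 w1 + q.b2 w1)) +
        rI v2 (q.b3 w) := by
      simp only [Coefs.par, rI_add_right, rI_sub_right, rI_neg_right]
    rw [f1, f2, f3] at e0
    rw [f4, f5, f6] at e1
    have up : ∀ {x a}, ‖x‖ ≤ a → rI v2 x ≤ z * a := fun {x a} hx => by
      refine (rI_le _ _).trans ?_
      rw [← hz]; gcongr
    have g0 := hb v2
    rw [hpv, ← hz] at g0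
    have g1 : rI v2 (lam • q.a0 y) ≤ z * (2 * ρ * (C * Q)) := by
      refine up ?_
      rw [norm_smul, hQ]
      exact mul_le_mul hl2 (h.a0_le y) (norm_nonneg _) (by linarith only [hρ1])
    have g2 := up nAw1
    have g3 := up nXw
    have g4 : -(z * (2 * (C * k * P1))) ≤ rI v2 (Complex.I • (q.b1 w1 + q.b2 w1)) := by
      refine le_trans (neg_le_neg ?_) (neg_le_rI _ _)
      rw [wI, ← hz]
      gcongr
      refine (norm_add_le _ _).trans ?_
      have i1 := h.b1_le w1
      have i2 := h.b2_le w1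
      rw [← hy1, ← hP1] at i1 i2
      linarith only [i1, i2]
    have g5 : rI v2 (q.b3 w) ≤ z * (C * k ^ 2 * Q) := by
      refine up ?_
      have i1 := h.b3_le w
      rwa [← hy, ← hQ] at i1
    have g6 := up nlow
    have g7 : -(z * η) ≤ rI v2 G := by
      refine le_trans (neg_le_neg ?_) (neg_le_rI _ _)
      rw [hz, hη]
    have g8 : rI v2 y ≤ z * Q := up hQ.symm.le
    have g8' : (1 - t) * rI v2 y ≤ z * Q := by
      refine (mul_le_mul_of_nonneg_left g8 (by linarith only [ht1])).trans ?_
      refine mul_le_of_le_one_left (by positivity) (by linarith only [ht])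
    obtain ⟨V, hV⟩ : ∃ V, V = p + Q + P1 + p1 := ⟨_, rfl⟩
    have hV0 : 0 ≤ V := by rw [hV]; positivity
    have g9 : rI v2 g ≤ z * (3 * N * (1 + ρ + k) * V) - θ * z ^ 2 := by
      have i1 : z * (2 * ρ * (C * Q)) ≤ z * (2 * ρ * (N * V)) := by
        gcongr
        · linarith only [hNb, hC, hM, hCk]
        · rw [hV]; linarith only [p0, P10, p10]
      have i2 : z * (C * k ^ 2 * Q) ≤ z * (N * k * V) := by
        have : C * k ^ 2 * Q = (C * k) * k * Q := by ring
        rw [this]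
        gcongr
        · linarith only [hNb, hC, hM, hCk]
        · rw [hV]; linarith only [p0, P10, p10]
      have i3 : z * (C * (p1 + P1)) + z * (C * k * (p + Q)) + z * (2 * (C * k * P1)) +
          z * (2 * C * (p1 + P1) + 2 * (C * k) * (p + Q) + M * (p + Q + P1)) ≤ z * (N * V) := by
        rw [← mul_add, ← mul_add, ← mul_add]
        gcongr
        have i0 : 0 ≤ (N - (10 * C + 10 * M + 10 * (C * k))) * V :=
          mul_nonneg (by linarith only [hNb]) (by positivity)
        have j1 : 0 ≤ C * V := by positivity
        have j2 : C * k * P1 ≤ C * k * V := by gcongr; rw [hV]; linarith only [p0, Q0, p10]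
        have j3 : C * (p1 + P1) ≤ C * V := by gcongr; rw [hV]; linarith only [p0, Q0]
        have j4 : C * k * (p + Q) ≤ C * k * V := by gcongr; rw [hV]; linarith only [P10, p10]
        have j5 : M * (p + Q + P1) ≤ M * V := by gcongr; rw [hV]; linarith only [p10]
        have j6 : 0 ≤ C * k * V := by positivity
        have j7 : 0 ≤ M * V := by positivity
        linarith only [i0, j1, j2, j3, j4, j5, j6, j7]
      have i4 : 0 ≤ z * (N * V) := by positivity
      have i5 : 0 ≤ z * (N * V) * ρ := by positivity
      have i6 : 0 ≤ z * (N * V) * k := by positivity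
      linarith only [e1, g0, g1, g2, g3, g4, g5, g6, i1, i2, i3, i4, i5, i6]
    have g10 := mul_le_mul_of_nonneg_left g9 ht
    have g11 : t * (z * (3 * N * (1 + ρ + k) * V)) ≤ z * (3 * N * (1 + ρ + k) * V) :=
      mul_le_of_le_one_left (by positivity) ht1
    have g12 : θ * z ^ 2 ≤ (1 - t) * z ^ 2 + t * (θ * z ^ 2) := by
      have : 0 ≤ (1 - t) * (1 - θ) * z ^ 2 :=
        mul_nonneg (mul_nonneg (by linarith only [ht1]) (by linarith only [hθ1])) (sq_nonneg _)
      linarith only [this]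
    have g13 : z * (θ * z) ≤ z * (η + Q + 3 * N * (1 + ρ + k) * V) := by
      linarith only [e0, g7, g8', g10, g11, g12]
    have g14 := le_of_mul_le_mul_left g13 hz0
    have g15 : V ≤ (C1 + C2) * η := by rw [hV]; linarith only [S1, S2]
    have g16 : Q ≤ V := by rw [hV]; linarith only [p0, P10, p10]
    have g17 : (1 + 3 * N * (1 + ρ + k)) * V ≤ (1 + 3 * N * (1 + ρ + k)) * ((C1 + C2) * η) := by
      gcongr
    rw [hC3, div_mul_eq_mul_div, le_div_iff₀' hθ]
    linarith only [g14, g16, g17]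
  rw [← hη, ← hz]
  linarith only [nw, nw1, S1, S2, S3, p0, Q0, P10]

end Homotopy

section Solvability

variable {E : Type*} [NormedAddCommGroup E] [InnerProductSpace ℂ E] [FiniteDimensional ℂ E]
variable {d : ℕ} {L : LinData E d} {s : ℝ}

/-- The resolvent operator acting on a function and its first two derivatives. -/
def LinData.op (L : LinData E d) (lam : ℂ) (ξ : Fin d → ℝ) : LL E × LL E × LL E →L[ℂ] LL E :=
  let q := L.coefs ξ 0
  let W := ContinuousLinearMap.fst ℂ (LL E) (LL E × LL E)
  let W1 := ContinuousLinearMap.fst ℂ (LL E) (LL E) ∘L ContinuousLinearMap.snd ℂ (LL E) (LL E × LL E)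
  let W2 := ContinuousLinearMap.snd ℂ (LL E) (LL E) ∘L ContinuousLinearMap.snd ℂ (LL E) (LL E × LL E)
  lam • (q.a0 ∘L W) + q.A ∘L W1 + Complex.I • (q.X ∘L W) + q.e ∘L W +
    ((-(q.b ∘L W2) - Complex.I • (q.b1 ∘L W1 + q.b2 ∘L W1) + q.b3 ∘L W) + q.del ∘L W1 +
      Complex.I • (q.delx ∘L W) + (mulOp (L.r 0) ∘L W1 +
        Complex.I • (mulOp (lcomb ξ (tang L.r)) ∘L W) + mulOp L.r0 ∘L W))

theorem LinData.eq_iff {lam : ℂ} {ξ : Fin d → ℝ} {w w1 w2 g : LL E} :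
    L.Eq lam ξ w w1 w2 g ↔ L.op lam ξ (w, w1, w2) = g := by
  unfold LinData.Eq LinData.rem
  rw [sum_grad]
  rfl

theorem LinData.eq_shift {lam mu : ℂ} {ξ : Fin d → ℝ} {w w1 w2 g : LL E}
    (h : L.Eq lam ξ w w1 w2 g) : L.Eq (lam + mu) ξ w w1 w2 (g + mu • mulOp L.a0 w) := by
  unfold LinData.Eq Coefs.Eqn at *
  rw [← h]
  simp only [LinData.coefs, add_smul]
  abel

/-- A parametrization of the domain of a constant coefficient model operator. -/
theorem exists_model_inverse {pr : E →L[ℂ] E} (hpp : ∀ v, pr (pr v) = pr v) (hs : s * s = 1) :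
    ∃ J0 J1 J2 : LL E →L[ℂ] LL E, ∀ y, HD (J0 y) (J1 y) ∧ HD (mulOp (cst pr) (J1 y)) (J2 y) ∧
      mulOp (cst pr) (J2 y) = J2 y ∧
      J0 y + (s : ℂ) • (J1 y - mulOp (cst pr) (J1 y)) - J2 y = y := by
  let m : ℝ → ℝ := fun η => 2 * Real.pi * η
  have hm : Continuous m := by fun_prop
  have hz : ∀ η, (1 : ℂ) + s * (m η * Complex.I) ≠ 0 := fun η h => by
    have := congrArg Complex.re h
    simp at this
  have hz1 : ∀ η, 1 ≤ ‖(1 : ℂ) + s * (m η * Complex.I)‖ := fun η => by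
    have := Complex.abs_re_le_norm ((1 : ℂ) + s * (m η * Complex.I))
    simpa using this
  have hsa : |s| = 1 := by rcases mul_self_eq_one_iff.1 hs with h | h <;> rw [h] <;> norm_num
  have hz2 : ∀ η, |m η| ≤ ‖(1 : ℂ) + s * (m η * Complex.I)‖ := fun η => by
    have := Complex.abs_im_le_norm ((1 : ℂ) + s * (m η * Complex.I))
    have e : ((1 : ℂ) + s * (m η * Complex.I)).im = s * m η := by simp
    rwa [e, abs_mul, hsa, one_mul] at this
  have hq : ∀ η, 0 < 1 + m η ^ 2 := fun η => by positivity
  have hcq : Continuous fun η => ((1 + m η ^ 2)⁻¹ : ℝ) :=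
    Continuous.inv₀ (by fun_prop) fun η => (hq η).ne'
  have hcz : Continuous fun η => ((1 : ℂ) + s * (m η * Complex.I))⁻¹ :=
    Continuous.inv₀ (by fun_prop) hz
  let f0 : Cf E := scal (fun η => ((1 : ℂ) + s * (m η * Complex.I))⁻¹) hcz 1 fun η => by
    rw [norm_inv]; exact inv_le_one_of_one_le₀ (hz1 η)
  let f1 : Cf E := scal (fun η => (m η * Complex.I) * ((1 : ℂ) + s * (m η * Complex.I))⁻¹)
    (by fun_prop) 1 fun η => by
      rw [norm_mul, norm_mul, norm_inv, Complex.norm_I, mul_one, Complex.norm_real,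
        ← div_eq_mul_inv, div_le_one (by linarith [hz1 η])]
      exact hz2 η
  let p0 : Cf E := scal (fun η => (((1 + m η ^ 2)⁻¹ : ℝ) : ℂ)) (by fun_prop) 1 fun η => by
    rw [Complex.norm_real, norm_inv, Real.norm_of_nonneg (hq η).le]
    exact inv_le_one_of_one_le₀ (by nlinarith [sq_nonneg (m η)])
  let p1 : Cf E := scal (fun η => m η * Complex.I * (((1 + m η ^ 2)⁻¹ : ℝ) : ℂ)) (by fun_prop) 1
    fun η => by
      rw [norm_mul, norm_mul, Complex.norm_I, mul_one, Complex.norm_real, Complex.norm_real,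
        norm_inv, Real.norm_of_nonneg (hq η).le, ← div_eq_mul_inv, div_le_one (hq η),
        Real.norm_eq_abs, ← sq_abs (m η)]
      nlinarith [sq_nonneg (|m η| - 1), abs_nonneg (m η)]
  let p2 : Cf E := scal (fun η => -(m η : ℂ) ^ 2 * (((1 + m η ^ 2)⁻¹ : ℝ) : ℂ)) (by fun_prop) 1
    fun η => by
      rw [norm_mul, norm_neg, norm_pow, Complex.norm_real, Complex.norm_real, norm_inv,
        Real.norm_of_nonneg (hq η).le, ← div_eq_mul_inv, div_le_one (hq η), Real.norm_eq_abs, sq_abs]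
      linarith
  let Fo : LL E →L[ℂ] LL E := (Lp.fourierTransformₗᵢ ℝ E : LL E →L[ℂ] LL E)
  let Fi : LL E →L[ℂ] LL E := ((Lp.fourierTransformₗᵢ ℝ E).symm : LL E →L[ℂ] LL E)
  have hFi : ∀ u : LL E, (𝓕 (Fi u) : LL E) = u :=
    fun u => (Lp.fourierTransformₗᵢ ℝ E).apply_symm_apply u
  have hFi' : ∀ u : LL E, Fi (𝓕 u : LL E) = u :=
    fun u => (Lp.fourierTransformₗᵢ ℝ E).symm_apply_apply u
  have hpc : ∀ u, mulOp (cst pr) (Fi u) = Fi (mulOp (cst pr) u) := fun u => by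
    rw [← hFi' (mulOp (cst pr) (Fi u)), fourier_cst, hFi]
  let j0 : Cf E := f0 * (1 - cst pr) + p0 * cst pr
  let j1 : Cf E := f1 * (1 - cst pr) + p1 * cst pr
  let j2 : Cf E := p2 * cst pr
  have a0 : ∀ x v, j0 x v = ((1 : ℂ) + s * (m x * Complex.I))⁻¹ • (v - pr v) +
    (((1 + m x ^ 2)⁻¹ : ℝ) : ℂ) • pr v := fun x v => rfl
  have a1 : ∀ x v, j1 x v = ((m x * Complex.I) * ((1 : ℂ) + s * (m x * Complex.I))⁻¹) • (v - pr v) +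
    (m x * Complex.I * (((1 + m x ^ 2)⁻¹ : ℝ) : ℂ)) • pr v := fun x v => rfl
  have a2 : ∀ x v, j2 x v = (-(m x : ℂ) ^ 2 * (((1 + m x ^ 2)⁻¹ : ℝ) : ℂ)) • pr v := fun x v => rfl
  refine ⟨Fi ∘L mulOp j0 ∘L Fo, Fi ∘L mulOp j1 ∘L Fo, Fi ∘L mulOp j2 ∘L Fo, fun y => ?_⟩
  set Y : LL E := (𝓕 y : LL E) with hY
  change HD (Fi (mulOp j0 Y)) (Fi (mulOp j1 Y)) ∧ HD (mulOp (cst pr) (Fi (mulOp j1 Y)))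
    (Fi (mulOp j2 Y)) ∧ mulOp (cst pr) (Fi (mulOp j2 Y)) = Fi (mulOp j2 Y) ∧
    Fi (mulOp j0 Y) + (s : ℂ) • (Fi (mulOp j1 Y) - mulOp (cst pr) (Fi (mulOp j1 Y))) -
      Fi (mulOp j2 Y) = y
  have hmx : ∀ x : ℝ, (2 * Real.pi * x * Complex.I : ℂ) = m x * Complex.I := fun x => by
    simp only [m]; push_cast; ring
  refine ⟨?_, ?_, ?_, ?_⟩
  · rw [hD_iff_fourier, hFi, hFi]
    filter_upwards [coeFn_mulOp j0 Y, coeFn_mulOp j1 Y] with x h1 h2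
    rw [h1, h2, a0, a1, hmx, smul_add, smul_smul, smul_smul]
  · rw [hpc, hD_iff_fourier, hFi, hFi, ← mulOp_mul_apply]
    filter_upwards [coeFn_mulOp (cst pr * j1) Y, coeFn_mulOp j2 Y] with x h1 h2
    rw [h1, h2, a2, hmx, show (cst pr * j1) x (Y x) = pr (j1 x (Y x)) from rfl, a1, map_add, map_smul, map_smul, map_sub, hpp,
      sub_self, smul_zero, zero_add, smul_smul]
    congr 1
    linear_combination (-(m x : ℂ) ^ 2 * (((1 + m x ^ 2)⁻¹ : ℝ) : ℂ)) * Complex.I_sq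
  · rw [hpc, ← mulOp_mul_apply]
    congr 3
    exact Cf.ext' fun x v => by rw [Cf.mul_apply', cst_apply, a2, map_smul, hpp]
  · rw [hpc, ← map_sub, ← map_smul, ← map_add, ← map_sub, ← mulOp_mul_apply, ← mulOp_sub_apply]
    have e : ∀ (c : ℂ) (a : Cf E) (f : LL E), c • mulOp a f = mulOp (c • a) f := fun c a f => by
      rw [mulOp_smul]; rfl
    rw [e, ← mulOp_add_apply, ← mulOp_sub_apply]
    have : j0 + (s : ℂ) • (j1 - cst pr * j1) - j2 = 1 := Cf.ext' fun x v => by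
      change j0 x v + (s : ℂ) • (j1 x v - pr (j1 x v)) - j2 x v = v
      rw [a0, a1, a2, map_add, map_smul, map_smul, map_sub, hpp, sub_self, smul_zero, zero_add,
        add_sub_cancel_right, smul_smul]
      have i1 : ((1 : ℂ) + s * (m x * Complex.I))⁻¹ + s * ((m x * Complex.I) *
          ((1 : ℂ) + s * (m x * Complex.I))⁻¹) = 1 := by
        have := mul_inv_cancel₀ (hz x)
        linear_combination this
      have i2 : (((1 + m x ^ 2)⁻¹ : ℝ) : ℂ) - -(m x : ℂ) ^ 2 * (((1 + m x ^ 2)⁻¹ : ℝ) : ℂ) = 1 := by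
        have := mul_inv_cancel₀ (hq x).ne'
        have h2 : ((1 : ℂ) + (m x : ℂ) ^ 2) * (((1 + m x ^ 2)⁻¹ : ℝ) : ℂ) = 1 := by
          exact_mod_cast this
        linear_combination h2
      calc _ = (((1 : ℂ) + s * (m x * Complex.I))⁻¹ + s * ((m x * Complex.I) *
          ((1 : ℂ) + s * (m x * Complex.I))⁻¹)) • (v - pr v) + ((((1 + m x ^ 2)⁻¹ : ℝ) : ℂ) -
            -(m x : ℂ) ^ 2 * (((1 + m x ^ 2)⁻¹ : ℝ) : ℂ)) • pr v := by
            rw [add_smul, sub_smul]; abel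
        _ = v := by rw [i1, i2]; simp
    rw [this, mulOp_one]
    exact hFi' y

theorem LinData.eqn_iff {lam : ℂ} {ξ : Fin d → ℝ} {sg : Cf E} {w w1 w2 rr g : LL E} :
    (L.coefs ξ sg).Eqn lam w w1 w2 rr g ↔
    lam • mulOp L.a0 w + mulOp (L.A 0) w1 + Complex.I • mulOp (lcomb ξ (tang L.A)) w +
    mulOp L.e w + ((-(mulOp (L.B 0 0) w2) - Complex.I • (mulOp (lcomb ξ fun k => L.B 0 k.succ) w1 +
      mulOp (lcomb ξ fun j => L.B j.succ 0) w1) +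
      mulOp (lcomb ξ fun j => lcomb ξ fun k => L.B j.succ k.succ) w) + mulOp (L.del 0) w1 +
      Complex.I • mulOp (lcomb ξ (tang L.del)) w + rr) = g := Iff.rfl

/-- Solvability in `L²` for large real part. -/
theorem LinData.Good.solvable_large (h : L.Good s) (ξ : EuclideanSpace ℝ (Fin d)) :
    ∃ Λ : ℝ, ∀ lam : ℂ, Λ ≤ lam.re → ‖lam‖ ≤ 2 * lam.re → ∀ g, ∃ w w1 v2,
      HD w w1 ∧ HD (mulOp (cst L.pr) w1) v2 ∧ L.Eq lam ξ w w1 v2 g := by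
  obtain ⟨C, c, hC, hc, hbd⟩ := h.bounds
  have hB := hbd C le_rfl 0 le_rfl (fun _ => 1) continuous_const (fun _ => by norm_num)
    (fun _ => Or.inl rfl) ξ
  have hs1 : s * s = 1 := by rcases h.s_sq with h | h <;> rw [h] <;> norm_num
  obtain ⟨θ1, hθ1, hell⟩ := h.ell
  obtain ⟨θ2, hθ2, hdef⟩ := h.definite
  obtain ⟨θ, hθ⟩ : ∃ θ, θ = min 1 (min θ1 θ2) := ⟨_, rfl⟩
  have hθ0 : 0 < θ := by rw [hθ]; positivity
  obtain ⟨M, hM⟩ : ∃ M, M = ‖L.e‖ + ‖L.r 0‖ + ‖mulOp (lcomb ξ (tang L.r))‖ + ‖L.r0‖ := ⟨_, rfl⟩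
  have n1 : 0 ≤ ‖L.e‖ := by positivity
  have n2 : 0 ≤ ‖L.r 0‖ := by positivity
  have n3 : 0 ≤ ‖L.r0‖ := by positivity
  have n4 : 0 ≤ ‖mulOp (lcomb ξ (tang L.r))‖ := norm_nonneg _
  obtain ⟨Λ, hΛ, hhom⟩ := hB.homotopy (M := M) (θ := θ) (norm_nonneg _) hC hc (by rw [hM]; positivity) hθ0
    (by rw [hθ]; exact min_le_left _ _) hs1
    (fun f => by
      change mulOp (cst L.pr) (mulOp L.e f) = 0
      rw [mulOp_cst_apply_eq (b := 0) h.pr_e f, show mulOp (0 : Cf E) = 0 from map_zero mulHom]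
      rfl)
    (fun f => (norm_mulOp_le _ _).trans (by gcongr; rw [hM]; linarith))
    (fun f hf => by
      have key := re_inner_mulOp_ge (a := (s : ℂ) • L.A 0) (b := 1) (c := 0) (f := f) (p := θ) (q := 0) ?_
      · rw [mulOp_one, mulOp_smul, zero_mul, sub_zero, _root_.smul_apply, inner_smul_right,
          Complex.re_ofReal_mul] at key
        exact key
      have h1 := coeFn_mulOp (cst L.pr) f
      rw [show mulOp (cst L.pr) f = 0 from hf] at h1
      filter_upwards [h1, Lp.coeFn_zero E 2 (volume : Measure ℝ)] with x hx hx0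
      rw [cst_apply, hx0] at hx
      have h2 := hdef x (f x) hx.symm
      have e1 : (⟪f x, ((s : ℂ) • L.A 0) x (f x)⟫_ℂ).re = s * rI (f x) (L.A 0 x (f x)) := by
        change (⟪f x, (s : ℂ) • L.A 0 x (f x)⟫_ℂ).re = _
        rw [inner_smul_right, Complex.re_ofReal_mul]
        rfl
      rw [e1, zero_mul, sub_zero]
      refine le_trans ?_ h2
      change θ * ‖f x‖ ^ 2 ≤ _
      gcongr
      rw [hθ]
      exact (min_le_right _ _).trans (min_le_right _ _))
    (fun f => by
      have key := re_inner_mulOp_ge (a := L.B 0 0) (b := cst L.pr) (c := 0) (f := f) (p := θ) (q := 0)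
        (Eventually.of_forall fun x => ?_)
      · rw [zero_mul, sub_zero] at key
        exact key
      have h2 := hell x (Pi.single 0 1) (f x)
      rw [Finset.sum_eq_single 0 (fun j _ hj => by simp [Pi.single_eq_of_ne hj]) (by simp),
        Finset.sum_eq_single 0 (fun j _ hj => by simp [Pi.single_eq_of_ne hj]) (by simp),
        Finset.sum_eq_single 0 (fun j _ hj => by simp [Pi.single_eq_of_ne hj]) (by simp)] at h2
      simp only [Pi.single_eq_same, one_pow, mul_one, one_mul] at h2
      rw [zero_mul, sub_zero]
      refine le_trans ?_ h2
      change θ * ‖L.pr (f x)‖ ^ 2 ≤ _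
      gcongr
      rw [hθ]
      exact (min_le_right _ _).trans (min_le_left _ _))
  refine ⟨Λ, fun lam hl1 hl2 g => ?_⟩
  obtain ⟨C', hC', hest⟩ := hhom lam hl1 hl2
  obtain ⟨J0, J1, J2, hJ⟩ := exists_model_inverse (pr := L.pr) (s := s) h.pr_pr hs1
  set T : LL E →L[ℂ] LL E := L.op lam ξ ∘L (J0.prod (J1.prod J2)) with hT
  have hTE : ∀ y, L.Eq lam ξ (J0 y) (J1 y) (J2 y) (T y) := fun y => LinData.eq_iff.2 rfl
  have hr0 : ∀ f, mulOp (L.r 0) f = mulOp (L.r 0) (mulOp (cst L.pr) f) := fun f => by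
    rw [← mulOp_mul_apply]
    congr 2
    exact Cf.ext' fun x v => (h.r_pr 0 x v).symm
  obtain ⟨y, hy⟩ := continuity_method (Y := LL E)
    { carrier := {p | p.1 = p.2}
      add_mem' := fun {a b} (ha : a.1 = a.2) (hb : b.1 = b.2) => by
        change a.1 + b.1 = a.2 + b.2
        rw [ha, hb]
      zero_mem' := rfl
      smul_mem' := fun c a (ha : a.1 = a.2) => by
        change c • a.1 = c • a.2
        rw [ha] } (T - 1) (C := 2 * C') (by positivity)
    (fun t ht ht1 w g' (hwg : w = g') => by
      subst hwg
      obtain ⟨d0, d1, d2, d3⟩ := hJ w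
      have hprr : mulOp (cst L.pr) (L.rem ξ (J0 w) (J1 w)) = L.rem ξ (J0 w) (J1 w) := by
        have kr : ∀ j f, mulOp (cst L.pr) (mulOp (L.r j) f) = mulOp (L.r j) f :=
          fun j f => mulOp_cst_apply_eq (h.pr_r j) f
        have kr0 : ∀ f, mulOp (cst L.pr) (mulOp L.r0 f) = mulOp L.r0 f :=
          fun f => mulOp_cst_apply_eq h.pr_r0 f
        simp only [LinData.rem, map_add, map_sum, kr, kr0]
      have hrn : ‖L.rem ξ (J0 w) (J1 w)‖ ≤ M * (‖J0 w‖ + ‖mulOp (cst L.pr) (J1 w)‖) := by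
        unfold LinData.rem
        rw [sum_grad, hr0]
        have i1 := norm_mulOp_le (L.r 0) (mulOp (cst L.pr) (J1 w))
        have i2 := (mulOp (lcomb ξ (tang L.r))).le_opNorm (J0 w)
        have i3 := norm_mulOp_le L.r0 (J0 w)
        have i4 := norm_add₃_le (a := mulOp (L.r 0) (mulOp (cst L.pr) (J1 w)))
          (b := Complex.I • mulOp (lcomb ξ (tang L.r)) (J0 w)) (c := mulOp L.r0 (J0 w))
        rw [norm_I_smul] at i4
        have a1 := norm_nonneg (J0 w)
        have a2 := norm_nonneg (mulOp (cst L.pr) (J1 w))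
        have q1 := mul_nonneg n1 (add_nonneg a1 a2)
        have q2 := mul_nonneg n2 a1
        have q3 := mul_nonneg n3 a2
        have q4 := mul_nonneg n4 a2
        rw [hM]
        linarith only [i1, i2, i3, i4, q1, q2, q3, q4]
      have e1 := hest t ht ht1 (J0 w) (J1 w) (J2 w) _ _ d0 d1 d2 hprr hrn
        (LinData.eqn_iff.2 (LinData.eqn_iff.1 (hTE w)))
      change _ ≤ C' * ‖((1 - t : ℝ) : ℂ) • (J0 w + (s : ℂ) • (J1 w - mulOp (cst L.pr) (J1 w)) - J2 w)
        + (t : ℂ) • T w‖ at e1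
      rw [d3] at e1
      have e2 : ((1 - t : ℝ) : ℂ) • w + (t : ℂ) • T w = w + (t : ℂ) • (T - 1) w := by
        rw [_root_.sub_apply, one_apply_eq_self]
        push_cast
        rw [sub_smul, smul_sub, one_smul]
        abel
      rw [e2] at e1
      have e3 : ‖w‖ ≤ ‖J0 w‖ + 2 * ‖J1 w‖ + ‖J2 w‖ := by
        have hsa : ‖(s : ℂ)‖ = 1 := by
          rw [Complex.norm_real]
          rcases h.s_sq with h | h <;> rw [h] <;> norm_num
        have i1 : ‖J1 w - mulOp (cst L.pr) (J1 w)‖ ≤ ‖J1 w‖ + ‖J1 w‖ :=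
          (norm_sub_le _ _).trans (by gcongr; exact hB.norm_pr_le (J1 w))
        have i2 := norm_sub_le_of_le (norm_add_le_of_le (le_refl ‖J0 w‖)
          ((norm_smul_le (s : ℂ) (J1 w - mulOp (cst L.pr) (J1 w))))) (le_refl ‖J2 w‖)
        rw [d3, hsa] at i2
        linarith
      have := norm_nonneg (J0 w)
      have := norm_nonneg (J2 w)
      linarith) (fun g => ⟨g, rfl⟩) g
  obtain ⟨d0, d1, -, -⟩ := hJ y
  refine ⟨J0 y, J1 y, J2 y, d0, d1, ?_⟩
  have hy' : y = g - (T - 1) y := hy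
  have : T y = g := by
    rw [_root_.sub_apply, one_apply_eq_self, sub_sub_eq_add_sub, eq_sub_iff_add_eq] at hy'
    exact add_left_cancel (hy'.trans (add_comm _ _))
  rw [← this]
  exact hTE y

end Solvability

section Continuation

variable {E : Type*} [NormedAddCommGroup E] [InnerProductSpace ℂ E] [FiniteDimensional ℂ E]
variable {d : ℕ} {L : LinData E d} {s : ℝ}

/-- Moving the spectral parameter along a segment on which the a priori estimate holds. -/
theorem LinData.Good.continuation (h : L.Good s) {ξ : Fin d → ℝ} {lam0 lam : ℂ} {k C : ℝ}
    (hk : 0 ≤ k) (hC : 0 ≤ C)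
    (hest : ∀ t : ℝ, 0 ≤ t → t ≤ 1 → ∀ w w1 w2 g g1 : LL E, HD w w1 → HD w1 w2 → HD g g1 →
      L.Eq (lam0 + t * (lam - lam0)) ξ w w1 w2 g →
      ‖w1‖ + (1 + k) * ‖w‖ ≤ C * (‖g1‖ + (1 + k) * ‖g‖))
    (h0 : ∀ g g1 : LL E, HD g g1 → ∃ w w1 w2, HD w w1 ∧ HD w1 w2 ∧ L.Eq lam0 ξ w w1 w2 g)
    {g g1 : LL E} (hg : HD g g1) : ∃ w w1 w2, HD w w1 ∧ HD w1 w2 ∧ L.Eq lam ξ w w1 w2 g := by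
  let X : Submodule ℂ (LL E × LL E) := hDGraph
  haveI : CompleteSpace X := (isClosed_HD (E := E)).completeSpace_coe
  let K0 : LL E × LL E →L[ℂ] LL E × LL E :=
    (mulOp L.a0 ∘L ContinuousLinearMap.fst ℂ _ _).prod
      (mulOp L.a0' ∘L ContinuousLinearMap.fst ℂ _ _ + mulOp L.a0 ∘L ContinuousLinearMap.snd ℂ _ _)
  have hK0 : ∀ x : X, K0 x.1 ∈ X := fun x => HD.mulOp h.a0_d x.2
  let K : X →L[ℂ] X := (lam - lam0) • (K0 ∘L X.subtypeL).codRestrict X hK0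
  let G : Submodule ℂ (X × X) :=
    { carrier := {p | ∃ w2, HD p.1.1.2 w2 ∧ L.Eq lam0 ξ p.1.1.1 p.1.1.2 w2 p.2.1.1}
      add_mem' := by
        rintro a b ⟨u, hu, hu'⟩ ⟨v, hv, hv'⟩
        refine ⟨u + v, hu.add hv, ?_⟩
        rw [LinData.eq_iff] at *
        have := congrArg₂ (· + ·) hu' hv'
        simp only [← map_add] at this
        exact this
      zero_mem' := ⟨0, hDGraph.zero_mem, LinData.eq_iff.2 (map_zero _)⟩
      smul_mem' := by
        rintro c a ⟨u, hu, hu'⟩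
        refine ⟨c • u, hu.smul c, ?_⟩
        rw [LinData.eq_iff] at *
        have := congrArg (c • ·) hu'
        simp only [← map_smul] at this
        exact this }
  obtain ⟨⟨⟨w, w1⟩, hw⟩, w2, hw2, heq⟩ := continuity_method G K (C := C * (2 + k)) (by positivity)
    (fun t ht ht1 w f ⟨w2, hw2, heq⟩ => by
      have e1 := LinData.eq_shift (mu := t * (lam - lam0)) heq
      have e2 := hest t ht ht1 _ _ _ _ _ w.2 hw2 (f + (t : ℂ) • K w).2 (by
        convert e1 using 1
        change f.1.1 + (t : ℂ) • ((lam - lam0) • mulOp L.a0 w.1.1) = _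
        rw [smul_smul])
      have n1 : ‖(f + (t : ℂ) • K w).1.2‖ ≤ ‖f + (t : ℂ) • K w‖ := norm_snd_le _
      have n2 : ‖(f + (t : ℂ) • K w).1.1‖ ≤ ‖f + (t : ℂ) • K w‖ := norm_fst_le _
      have n3 : C * (‖(f + (t : ℂ) • K w).1.2‖ + (1 + k) * ‖(f + (t : ℂ) • K w).1.1‖) ≤
          C * (‖f + (t : ℂ) • K w‖ + (1 + k) * ‖f + (t : ℂ) • K w‖) := by gcongr
      have n4 := norm_nonneg w.1.1
      have n5 := norm_nonneg w.1.2
      have n6 : 0 ≤ k * ‖w.1.1‖ := by positivity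
      have n7 : ‖w‖ = max ‖w.1.1‖ ‖w.1.2‖ := rfl
      rw [n7]
      refine max_le ?_ ?_ <;> linarith only [e2, n3, n4, n5, n6])
    (fun f => by
      obtain ⟨w, w1, w2, hw, hw1, heq⟩ := h0 f.1.1 f.1.2 f.2
      exact ⟨⟨(w, w1), hw⟩, w2, hw1, heq⟩) ⟨(g, g1), hg⟩
  refine ⟨w, w1, w2, hw, hw2, ?_⟩
  have e1 := LinData.eq_shift (mu := lam - lam0) heq
  convert e1 using 1
  · ring
  · change g = g - (lam - lam0) • mulOp L.a0 w + _
    rw [sub_add_cancel]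

/-- Solvability and bounds for the symmetrized resolvent equation at high frequencies. -/
theorem LinData.Good.resolvent (h : L.Good s) {αp αm : E →L[ℂ] E}
    {𝒜p 𝒜m : Fin (d + 1) → E →L[ℂ] E} (hp : L.AtEnd atTop αp 𝒜p) (hm : L.AtEnd atBot αm 𝒜m) :
    ∃ R C θ : ℝ, 0 < R ∧ 0 < C ∧ 0 < θ ∧ ∀ (ξ : EuclideanSpace ℝ (Fin d)) (lam : ℂ),
      R ≤ max ‖ξ‖ ‖lam‖ → -θ ≤ lam.re →
      (∀ g g1 : LL E, HD g g1 → ∃ w w1 w2, HD w w1 ∧ HD w1 w2 ∧ L.Eq lam ξ w w1 w2 g) ∧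
      ∀ w w1 v2 g g1 : LL E, HD w w1 → HD (mulOp (cst L.pr) w1) v2 → HD g g1 →
        L.Eq lam ξ w w1 v2 g → ‖w1‖ + (1 + ‖ξ‖) * ‖w‖ ≤ C * (‖g1‖ + (1 + ‖ξ‖) * ‖g‖) := by
  obtain ⟨R, C, θ, hR, hC, hθ, hest⟩ := h.apriori hp hm
  refine ⟨R + θ, C, θ, by positivity, hC, hθ, fun ξ lam hbig hre => ⟨fun g g1 hg => ?_,
    fun w w1 v2 g g1 hw hv hg heq => ?_⟩⟩
  · obtain ⟨Λ, hΛ⟩ := h.solvable_large ξ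
    obtain ⟨τ, hτ⟩ : ∃ τ, τ = |Λ| + 3 * ‖lam‖ := ⟨_, rfl⟩
    have hτ0 : 0 ≤ τ := by rw [hτ]; positivity
    have hrl := abs_le.1 (Complex.abs_re_le_norm lam)
    have hre0 : (lam + τ).re = lam.re + τ := by simp
    refine h.continuation (lam0 := lam + τ) (k := ‖ξ‖) (C := C) (norm_nonneg _) hC.le
      (fun t ht ht1 w w1 w2 g g1 hw hw1 hg heq => ?_) (fun g g1 hg => ?_) hg
    · have e1 : lam + τ + t * (lam - (lam + τ)) = lam + ((1 - t) * τ : ℝ) := by push_cast; ring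
      rw [e1] at heq
      have hx0 : 0 ≤ (1 - t) * τ := mul_nonneg (by linarith) hτ0
      generalize (1 - t) * τ = x at hx0 heq
      refine hest ξ _ w w1 w2 g g1 hw hw1 hg heq (by simp; linarith) ?_
      rcases le_max_iff.1 hbig with hb | hb
      · exact le_max_of_le_left (by linarith)
      refine le_max_of_le_right ?_
      rcases le_total 0 lam.re with h0 | h0
      · have : ‖lam‖ ≤ ‖lam + (x : ℂ)‖ := by
          rw [Complex.norm_def, Complex.norm_def]
          refine Real.sqrt_le_sqrt ?_
          rw [Complex.normSq_apply, Complex.normSq_apply]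
          simp only [Complex.add_re, Complex.ofReal_re, Complex.add_im, Complex.ofReal_im, add_zero]
          nlinarith
        linarith
      · have h1 : |lam.im| ≤ ‖lam + (x : ℂ)‖ := by
          simpa using Complex.abs_im_le_norm (lam + (x : ℂ))
        have h2 := Complex.norm_le_abs_re_add_abs_im lam
        rw [abs_of_nonpos h0] at h2
        linarith
    · obtain ⟨w, w1, v2, hw, hv, heq⟩ := hΛ (lam + τ) (by
        rw [hre0, hτ]
        linarith [le_abs_self Λ, norm_nonneg lam]) (by
        rw [hre0]
        refine (norm_add_le _ _).trans ?_
        rw [Complex.norm_real, Real.norm_of_nonneg hτ0]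
        rw [hτ]
        linarith [abs_nonneg Λ]) g
      obtain ⟨w2, hw2, heq2⟩ := h.upgrade hw hv hg heq
      exact ⟨w, w1, w2, hw, hw2, heq2⟩
  · obtain ⟨w2, hw2, heq2⟩ := h.upgrade hw hv hg heq
    exact hest ξ lam w w1 w2 g g1 hw hw2 hg heq2 hre ((by linarith : R ≤ R + θ).trans hbig)

end Continuation

section Complexification

variable {m r : ℕ}

attribute [local instance] Matrix.linftyOpNormedRing Matrix.linftyOpNormedAlgebra

/-- The operator on complex vectors given by a real matrix. -/
def cx : Mat m r →L[ℝ] (CState m r →L[ℂ] CState m r) :=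
  LinearMap.toContinuousLinearMap
    { toFun := fun M => Matrix.toEuclideanCLM (𝕜 := ℂ) (M.map (algebraMap ℝ ℂ))
      map_add' := fun M N => by
        rw [Matrix.map_add _ (fun a b => map_add (algebraMap ℝ ℂ) a b), map_add]
      map_smul' := fun c M => by
        rw [show (c • M).map (algebraMap ℝ ℂ) = (c : ℂ) • M.map (algebraMap ℝ ℂ) by
          ext; simp, map_smul]
        rfl }

theorem cx_mul (M N : Mat m r) : cx (M * N) = cx M * cx N := by
  change Matrix.toEuclideanCLM (𝕜 := ℂ) ((M * N).map (algebraMap ℝ ℂ)) = _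
  rw [Matrix.map_mul, map_mul]
  rfl

theorem cx_one : cx (1 : Mat m r) = 1 := by
  change Matrix.toEuclideanCLM (𝕜 := ℂ) ((1 : Mat m r).map (algebraMap ℝ ℂ)) = _
  rw [Matrix.map_one _ (map_zero _) (map_one _), map_one]

theorem cx_mul_apply (M N : Mat m r) (v : CState m r) : cx (M * N) v = cx M (cx N v) := by
  rw [cx_mul]; rfl

/-- Real part of a complex vector. -/
def reV (v : CState m r) : State m r := fun i => (v i).re

/-- Imaginary part of a complex vector. -/
def imV (v : CState m r) : State m r := fun i => (v i).im

theorem cx_apply_apply (M : Mat m r) (v : CState m r) (i : Idx m r) :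
    cx M v i = ∑ j, (M i j : ℂ) * v j := rfl

theorem reV_cx (M : Mat m r) (v : CState m r) : reV (cx M v) = M *ᵥ reV v := by
  funext i
  simp only [reV, cx_apply_apply, Complex.re_sum, Complex.re_ofReal_mul]
  rfl

theorem imV_cx (M : Mat m r) (v : CState m r) : imV (cx M v) = M *ᵥ imV v := by
  funext i
  simp only [imV, cx_apply_apply, Complex.im_sum, Complex.im_ofReal_mul]
  rfl

theorem inner_cx_of_symm {M : Mat m r} (hM : M.IsSymm) (v w : CState m r) :
    ⟪cx M v, w⟫_ℂ = ⟪v, cx M w⟫_ℂ := by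
  have h : star (cx M) = cx M := by
    change star (Matrix.toEuclideanCLM (𝕜 := ℂ) (M.map (algebraMap ℝ ℂ))) = _
    rw [← map_star]
    change Matrix.toEuclideanCLM (𝕜 := ℂ) (M.map (algebraMap ℝ ℂ))ᴴ =
      Matrix.toEuclideanCLM (𝕜 := ℂ) (M.map (algebraMap ℝ ℂ))
    congr 1
    ext i j
    have := congrFun (congrFun hM i) j
    simp only [Matrix.transpose_apply] at this
    simp [Matrix.conjTranspose_apply, this]
  conv_lhs => rw [← h]
  exact ContinuousLinearMap.adjoint_inner_left _ _ _

theorem rI_eq_dotProduct (v w : CState m r) : rI v w = reV v ⬝ᵥ reV w + imV v ⬝ᵥ imV w := by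
  simp only [rI, PiLp.inner_apply, Complex.re_sum, dotProduct, reV, imV, ← Finset.sum_add_distrib]
  refine Finset.sum_congr rfl fun i _ => ?_
  simp [Complex.mul_re]
  ring

theorem rI_cx (M : Mat m r) (v : CState m r) :
    rI v (cx M v) = reV v ⬝ᵥ (M *ᵥ reV v) + imV v ⬝ᵥ (M *ᵥ imV v) := by
  rw [rI_eq_dotProduct, reV_cx, imV_cx]

theorem norm_sq_eq_dotProduct (v : CState m r) :
    ‖v‖ ^ 2 = reV v ⬝ᵥ reV v + imV v ⬝ᵥ imV v := by
  rw [← rI_self, rI_eq_dotProduct]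

theorem eq_zero_of_reV_imV {v : CState m r} (h1 : reV v = 0) (h2 : imV v = 0) : v = 0 := by
  ext i
  exact Complex.ext (congrFun h1 i) (congrFun h2 i)

/-- Projection matrix onto the second block. -/
def D1 : Mat m r := Matrix.fromBlocks 0 0 0 1

/-- Projection matrix onto the first block. -/
def D0 : Mat m r := Matrix.fromBlocks 1 0 0 0

theorem D0_add_D1 : (D0 + D1 : Mat m r) = 1 := by
  rw [D0, D1, Matrix.fromBlocks_add, ← Matrix.fromBlocks_one]
  simp

theorem D1_mul (M : Mat m r) : D1 * M = Matrix.fromBlocks 0 0 M.toBlocks₂₁ M.toBlocks₂₂ := by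
  conv_lhs => rw [D1, ← Matrix.fromBlocks_toBlocks M, Matrix.fromBlocks_multiply]
  simp

theorem mul_D1 (M : Mat m r) : M * D1 = Matrix.fromBlocks 0 M.toBlocks₁₂ 0 M.toBlocks₂₂ := by
  conv_lhs => rw [D1, ← Matrix.fromBlocks_toBlocks M, Matrix.fromBlocks_multiply]
  simp

theorem D1_mul_D1 : (D1 * D1 : Mat m r) = D1 := by
  rw [D1_mul, D1]; simp

theorem D0_eq : (D0 : Mat m r) = 1 - D1 := eq_sub_of_add_eq D0_add_D1

theorem D1_mul_D0 : (D1 * D0 : Mat m r) = 0 := by rw [D0_eq, mul_sub, mul_one, D1_mul_D1, sub_self]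

theorem reV_eq (v : CState m r) (M : Mat m r) (h : cx M v = 0) : M *ᵥ reV v = 0 ∧ M *ᵥ imV v = 0 := by
  rw [← reV_cx, ← imV_cx, h]
  exact ⟨rfl, rfl⟩

variable {V : Type*} [NormedAddCommGroup V] [NormedSpace ℝ V]

theorem contDiffOn_of_entries {n : WithTop ℕ∞} {G : V → Mat m r} {Ω : Set V}
    (h : ∀ a b, ContDiffOn ℝ n (fun U => G U a b) Ω) : ContDiffOn ℝ n G Ω := by
  have e : G = fun U => ∑ a, ∑ b, G U a b • Matrix.single a b (1 : ℝ) := by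
    funext U
    conv_lhs => rw [Matrix.matrix_eq_sum_single (G U)]
    simp [Matrix.smul_single]
  rw [e]
  exact ContDiffOn.sum fun a _ => ContDiffOn.sum fun b _ => (h a b).smul contDiffOn_const

/-- Linear maps into or out of matrices are smooth. -/
theorem ContDiffOn.linearMap_comp {F F' : Type*} [NormedAddCommGroup F] [NormedSpace ℝ F]
    [FiniteDimensional ℝ F] [NormedAddCommGroup F'] [NormedSpace ℝ F'] (T : F →ₗ[ℝ] F')
    {n : WithTop ℕ∞} {G : V → F} {Ω : Set V} (h : ContDiffOn ℝ n G Ω) :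
    ContDiffOn ℝ n (fun U => T (G U)) Ω :=
  (LinearMap.toContinuousLinearMap T).contDiff.comp_contDiffOn h

theorem contDiffOn_inv {n : WithTop ℕ∞} {G : V → Mat m r} {Ω : Set V}
    (h : ContDiffOn ℝ n G Ω) (hu : ∀ U ∈ Ω, IsUnit (G U).det) :
    ContDiffOn ℝ n (fun U => (G U)⁻¹) Ω := fun U hU => by
  obtain ⟨u, hu⟩ := (Matrix.isUnit_iff_isUnit_det _).2 (hu U hU)
  have h1 := contDiffAt_ringInverse ℝ (n := n) u
  rw [hu] at h1
  have h2 := h1.comp_contDiffWithinAt U (h U hU)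
  refine h2.congr (fun y _ => Matrix.nonsing_inv_eq_ringInverse _)
    (Matrix.nonsing_inv_eq_ringInverse _)

theorem contDiffOn_det {n : WithTop ℕ∞} {G : V → Mat m r} {Ω : Set V}
    (h : ContDiffOn ℝ n G Ω) : ContDiffOn ℝ n (fun U => (G U).det) Ω := by
  simp only [Matrix.det_apply]
  refine ContDiffOn.sum fun σ _ => ContDiffOn.const_smul _ (contDiffOn_prod fun i _ => ?_)
  exact ContDiffOn.linearMap_comp (Matrix.entryLinearMap ℝ ℝ (σ i) i) h

theorem contDiffOn_mulVec {n : WithTop ℕ∞} {G : V → Mat m r} {p : V → State m r} {Ω : Set V}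
    (h : ContDiffOn ℝ n G Ω) (hp : ContDiffOn ℝ n p Ω) :
    ContDiffOn ℝ n (fun U => G U *ᵥ p U) Ω := by
  refine contDiffOn_pi.2 fun i => ?_
  simp only [Matrix.mulVec, dotProduct]
  exact ContDiffOn.sum fun j _ => (ContDiffOn.linearMap_comp (Matrix.entryLinearMap ℝ ℝ i j) h).mul
    (contDiffOn_pi.1 hp j)

theorem contDiffOn_jac {n k : ℕ} {G : State m r → State m r} {Ω : Set (State m r)} (hΩ : IsOpen Ω)
    (h : ContDiffOn ℝ n G Ω) (hk : k + 1 ≤ n) : ContDiffOn ℝ k (jac G) Ω := by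
  have h1 : ContDiffOn ℝ k (fderiv ℝ G) Ω := h.fderiv_of_isOpen hΩ (by exact_mod_cast hk)
  let T : (State m r →L[ℝ] State m r) →ₗ[ℝ] Mat m r :=
    LinearMap.toMatrix'.toLinearMap ∘ₗ ContinuousLinearMap.coeLM ℝ
  exact ContDiffOn.linearMap_comp T h1

end Complexification

section Profile

variable {d m r : ℕ}

attribute [local instance] Matrix.linftyOpNormedRing Matrix.linftyOpNormedAlgebra

open ViscousShock.System

/-- The hypotheses on the system, the symmetrizer and the profile. -/
structure ShockHyp (P : System d m r) (Ubar : ℝ → State m r) (Um Up : State m r)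
    (𝒰 : Set (State m r)) (W : State m r → State m r) (S : State m r → Mat m r) (q : ℕ) : Prop where
  isOpen : IsOpen 𝒰
  mem : ∀ x, Ubar x ∈ 𝒰
  mem_m : Um ∈ 𝒰
  mem_p : Up ∈ 𝒰
  struct : P.HasViscousStructure 𝒰
  profile : P.IsProfile Ubar Um Up
  symm : P.IsSymmHypParab 𝒰 W S
  stable_m : P.IsStableEndState W S Um
  stable_p : P.IsStableEndState W S Up
  reg : P.IsRegular 𝒰 W S q
  definite : P.IsUniformlyDefinite W S Ubar

/-- The matrix determining the derivative of the profile. -/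
def profileMat (P : System d m r) (W : State m r → State m r) (S : State m r → Mat m r)
    (U : State m r) : Mat m r := D0 * P.tA W S 0 U + P.tB W S 0 0 U

/-- The first order equation `Ubar' = H(Ubar)` for the profile. -/
def profileField (P : System d m r) (W : State m r → State m r) (S : State m r → Mat m r)
    (c U : State m r) : State m r :=
  dUdW W U *ᵥ ((profileMat P W S U)⁻¹ *ᵥ (D1 *ᵥ (S U *ᵥ (P.F 0 U - c))))

/-- The states at which the profile equation is regular. -/
def regSet (P : System d m r) (𝒰 : Set (State m r)) (W : State m r → State m r)
    (S : State m r → Mat m r) : Set (State m r) := {U ∈ 𝒰 | (profileMat P W S U).det ≠ 0}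

theorem D1_mulVec (v : State m r) : D1 *ᵥ v = Sum.elim (0 : Fin m → ℝ) (v ∘ Sum.inr) := by
  rw [D1, Matrix.fromBlocks_mulVec]; simp

theorem mulVec_D0_eq {v : State m r} (h : D1 *ᵥ v = 0) : D0 *ᵥ v = v := by
  rw [D0_eq, Matrix.sub_mulVec, h, Matrix.one_mulVec, sub_zero]

variable {P : System d m r} {Ubar : ℝ → State m r} {Um Up : State m r} {𝒰 : Set (State m r)}
variable {W : State m r → State m r} {S : State m r → Mat m r} {q : ℕ}

namespace ShockHyp

theorem hq (h : ShockHyp P Ubar Um Up 𝒰 W S q) : 2 ≤ q := by have := h.reg.q_ge; omega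

section Algebra

variable (h : ShockHyp P Ubar Um Up 𝒰 W S q) {U : State m r} (hU : U ∈ 𝒰)
include h hU

theorem M_mul : dUdW W U * jac W U = 1 := Matrix.nonsing_inv_mul _ (h.symm.W_deriv_invertible U hU)

theorem mul_M : jac W U * dUdW W U = 1 := Matrix.mul_nonsing_inv _ (h.symm.W_deriv_invertible U hU)

theorem S_eq : S U = tA0 W S U * jac W U := by
  rw [tA0, mul_assoc, h.M_mul hU, mul_one]

theorem D0_S : D0 * S U = D0 * S U * D0 := by
  conv_lhs => rw [← Matrix.fromBlocks_toBlocks (S U), h.symm.S_lower U hU]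
  conv_rhs => rw [← Matrix.fromBlocks_toBlocks (S U), h.symm.S_lower U hU]
  simp [D0, Matrix.fromBlocks_multiply]

theorem D0_B (j k : Fin (d + 1)) : D0 * P.B j k U = 0 := by
  rw [← Matrix.fromBlocks_toBlocks (P.B j k U), h.struct.upper_left U hU, h.struct.upper_right U hU]
  simp [D0, Matrix.fromBlocks_multiply]

theorem D1_tB (j k : Fin (d + 1)) : D1 * P.tB W S j k U = P.tB W S j k U := by
  rw [D1_mul, h.symm.tB_blockDiag U hU j k]; simp

theorem tB_D1 (j k : Fin (d + 1)) : P.tB W S j k U * D1 = P.tB W S j k U := by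
  rw [mul_D1, h.symm.tB_blockDiag U hU j k]; simp

theorem D1_tA0 : D1 * tA0 W S U = tA0 W S U * D1 := by
  rw [D1_mul, mul_D1, (h.symm.tA0_blockDiag U hU).1, (h.symm.tA0_blockDiag U hU).2]

end Algebra

theorem ell (h : ShockHyp P Ubar Um Up 𝒰 W S q) : ∃ θ, 0 < θ ∧ ∀ U ∈ 𝒰, ∀ (ξ : Fin (d + 1) → ℝ) (v : State m r),
    θ * (∑ j, ξ j ^ 2) * ((D1 *ᵥ v) ⬝ᵥ (D1 *ᵥ v)) ≤
      ∑ j, ∑ k, ξ j * ξ k * (v ⬝ᵥ (P.tB W S j k U *ᵥ v)) := by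
  obtain ⟨θ, hθ, hell⟩ := h.symm.tB_elliptic
  refine ⟨θ, hθ, fun U hU ξ v => ?_⟩
  have h1 := hell U hU ξ (v ∘ Sum.inr)
  rw [D1_mulVec, Matrix.dotProduct_block]
  simp only [Sum.elim_comp_inl, Sum.elim_comp_inr, zero_dotProduct, zero_add]
  refine h1.trans_eq ?_
  simp only [Matrix.sum_mulVec, Matrix.smul_mulVec, dotProduct_sum, dotProduct_smul, smul_eq_mul]
  refine Finset.sum_congr rfl fun j _ => Finset.sum_congr rfl fun k _ => ?_
  rw [h.symm.tB_blockDiag U hU j k, Matrix.fromBlocks_mulVec, Matrix.dotProduct_block]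
  simp

theorem D1_eq_zero (h : ShockHyp P Ubar Um Up 𝒰 W S q) {U : State m r} (hU : U ∈ 𝒰) {v : State m r}
    (e1 : P.tB W S 0 0 U *ᵥ v = 0) : D1 *ᵥ v = 0 := by
  obtain ⟨θ', hθ', hell⟩ := h.ell
  have e2 := hell U hU (Pi.single 0 1) v
  rw [Finset.sum_eq_single 0 (fun j _ hj => by simp [Pi.single_eq_of_ne hj]) (by simp),
    Finset.sum_eq_single 0 (fun j _ hj => by simp [Pi.single_eq_of_ne hj]) (by simp),
    Finset.sum_eq_single 0 (fun j _ hj => by simp [Pi.single_eq_of_ne hj]) (by simp), e1] at e2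
  simp only [Pi.single_eq_same, one_pow, mul_one, dotProduct_zero, mul_zero] at e2
  rw [← dotProduct_self_eq_zero]
  have : 0 ≤ (D1 *ᵥ v) ⬝ᵥ (D1 *ᵥ v) := Finset.sum_nonneg fun i _ => mul_self_nonneg _
  nlinarith

/-- Definiteness along the profile and at its end states. -/
def DefAt (P : System d m r) (W : State m r → State m r) (S : State m r → Mat m r) (s θ : ℝ)
    (U : State m r) : Prop :=
  ∀ v : State m r, D1 *ᵥ v = 0 → θ * (v ⬝ᵥ v) ≤ s * (v ⬝ᵥ (P.tA W S 0 U *ᵥ v))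

theorem defAt (h : ShockHyp P Ubar Um Up 𝒰 W S q) : ∃ s θ : ℝ, (s = 1 ∨ s = -1) ∧ 0 < θ ∧ ∀ x, DefAt P W S s θ (Ubar x) := by
  have key : ∀ x (v : State m r), D1 *ᵥ v = 0 → v ⬝ᵥ v = (v ∘ Sum.inl) ⬝ᵥ (v ∘ Sum.inl) ∧
      v ⬝ᵥ (P.tA W S 0 (Ubar x) *ᵥ v) =
        (v ∘ Sum.inl) ⬝ᵥ ((P.tA W S 0 (Ubar x)).toBlocks₁₁ *ᵥ (v ∘ Sum.inl)) := by
    intro x v hv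
    rw [D1_mulVec] at hv
    have h2 : v ∘ Sum.inr = 0 := funext fun i => congrFun hv (Sum.inr i)
    constructor
    · rw [Matrix.dotProduct_block, h2]; simp
    · conv_lhs => rw [← Matrix.fromBlocks_toBlocks (P.tA W S 0 (Ubar x)), Matrix.fromBlocks_mulVec,
        Matrix.dotProduct_block, h2]
      simp
  obtain ⟨θ, hθ, hd | hd⟩ := h.definite
  · refine ⟨1, θ, Or.inl rfl, hθ, fun x v hv => ?_⟩
    rw [(key x v hv).1, (key x v hv).2, one_mul]
    exact hd x _
  · refine ⟨-1, θ, Or.inr rfl, hθ, fun x v hv => ?_⟩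
    rw [(key x v hv).1, (key x v hv).2]
    linarith [hd x (v ∘ Sum.inl)]

theorem mem_regSet (h : ShockHyp P Ubar Um Up 𝒰 W S q) {U : State m r} (hU : U ∈ 𝒰) {s θ : ℝ} (hθ : 0 < θ) (hd : DefAt P W S s θ U) :
    U ∈ regSet P 𝒰 W S := by
  refine ⟨hU, fun hdet => ?_⟩
  obtain ⟨v, hv0, hv⟩ := Matrix.exists_mulVec_eq_zero_iff.2 hdet
  have e1 : P.tB W S 0 0 U *ᵥ v = 0 := by
    have : D1 * profileMat P W S U = P.tB W S 0 0 U := by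
      rw [profileMat, mul_add, ← mul_assoc, D1_mul_D0, zero_mul, zero_add, h.D1_tB hU]
    rw [← this, ← Matrix.mulVec_mulVec, hv, Matrix.mulVec_zero]
  have e3 := h.D1_eq_zero hU e1
  have e4 : D0 *ᵥ (P.tA W S 0 U *ᵥ v) = 0 := by
    rw [profileMat, Matrix.add_mulVec, e1, add_zero, ← Matrix.mulVec_mulVec] at hv
    exact hv
  have e5 : v ⬝ᵥ (P.tA W S 0 U *ᵥ v) = v ⬝ᵥ (D0 *ᵥ (P.tA W S 0 U *ᵥ v)) := by
    have hs : (D0 : Mat m r)ᵀ = D0 := by simp [D0, Matrix.fromBlocks_transpose]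
    rw [Matrix.dotProduct_mulVec v D0, ← Matrix.mulVec_transpose, hs, mulVec_D0_eq e3]
  have e6 := hd v e3
  rw [e5, e4, dotProduct_zero, mul_zero] at e6
  refine hv0 (dotProduct_self_eq_zero.1 ?_)
  have : 0 ≤ v ⬝ᵥ v := Finset.sum_nonneg fun i _ => mul_self_nonneg _
  nlinarith

section Smooth

variable (h : ShockHyp P Ubar Um Up 𝒰 W S q)
include h

theorem c_jacW : ContDiffOn ℝ 2 (jac W) 𝒰 :=
  contDiffOn_jac (k := 2) h.isOpen h.reg.W_smooth (by have := h.hq; omega)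

theorem c_jacF (j : Fin (d + 1)) : ContDiffOn ℝ 2 (jac (P.F j)) 𝒰 :=
  contDiffOn_jac (k := 2) h.isOpen (h.reg.F_smooth j) (by have := h.hq; omega)

theorem c_F (j : Fin (d + 1)) : ContDiffOn ℝ 2 (P.F j) 𝒰 :=
  (h.reg.F_smooth j).of_le (by exact_mod_cast (by have := h.hq; omega : 2 ≤ q + 1))

theorem c_B (j k : Fin (d + 1)) : ContDiffOn ℝ 2 (P.B j k) 𝒰 := contDiffOn_of_entries fun a b =>
  (h.reg.B_smooth j k a b).of_le (by exact_mod_cast (by have := h.hq; omega : 2 ≤ q + 1))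

theorem c_M : ContDiffOn ℝ 2 (dUdW W) 𝒰 := contDiffOn_inv h.c_jacW h.symm.W_deriv_invertible

theorem c_tA0 : ContDiffOn ℝ 2 (tA0 W S) 𝒰 := contDiffOn_of_entries fun a b =>
  (h.reg.tA0_smooth a b).of_le (by exact_mod_cast (by have := h.hq; omega : 2 ≤ q + 1))

theorem c_S : ContDiffOn ℝ 2 S 𝒰 := (h.c_tA0.mul h.c_jacW).congr fun _ hU => h.S_eq hU

theorem c_tA (j : Fin (d + 1)) : ContDiffOn ℝ 2 (P.tA W S j) 𝒰 := (h.c_S.mul (h.c_jacF j)).mul h.c_M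

theorem c_tB (j k : Fin (d + 1)) : ContDiffOn ℝ 2 (P.tB W S j k) 𝒰 :=
  (h.c_S.mul (h.c_B j k)).mul h.c_M

theorem c_Q : ContDiffOn ℝ 2 (profileMat P W S) 𝒰 := (contDiffOn_const.mul (h.c_tA 0)).add (h.c_tB 0 0)

theorem regSet_sub : regSet P 𝒰 W S ⊆ 𝒰 := fun _ hU => hU.1

theorem isOpen_regSet : IsOpen (regSet P 𝒰 W S) :=
  (contDiffOn_det h.c_Q).continuousOn.isOpen_inter_preimage h.isOpen isOpen_ne

theorem c_field (c : State m r) : ContDiffOn ℝ 2 (profileField P W S c) (regSet P 𝒰 W S) := by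
  have hs := h.regSet_sub
  have := contDiffOn_inv (h.c_Q.mono hs) fun U hU => isUnit_iff_ne_zero.2 hU.2
  exact contDiffOn_mulVec (h.c_M.mono hs) (contDiffOn_mulVec this (contDiffOn_mulVec contDiffOn_const
    (contDiffOn_mulVec (h.c_S.mono hs) (((h.c_F 0).mono hs).sub contDiffOn_const))))

theorem defAt_limit {s θ : ℝ} (hd : ∀ x, DefAt P W S s θ (Ubar x)) {l : Filter ℝ} [l.NeBot]
    {U : State m r} (hU : U ∈ 𝒰) (hl : Tendsto Ubar l (𝓝 U)) : DefAt P W S s θ U := fun v hv => by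
  have h1 : ContinuousOn (fun U => v ⬝ᵥ (P.tA W S 0 U *ᵥ v)) 𝒰 := by
    simp only [dotProduct]
    exact continuousOn_finsetSum _ fun i _ => continuousOn_const.mul (continuousOn_pi.1
      (contDiffOn_mulVec (h.c_tA 0) (contDiffOn_const (c := v))).continuousOn i)
  have h2 := (h1.continuousAt (h.isOpen.mem_nhds hU)).tendsto.comp hl
  exact ge_of_tendsto' (h2.const_mul s) fun x => hd x v hv

theorem differentiable : Differentiable ℝ Ubar := h.profile.smooth.differentiable one_ne_zero

theorem hasDerivAt_profile : ∃ c, ∀ x, HasDerivAt Ubar (profileField P W S c (Ubar x)) x := by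
  have hU' : ∀ x, HasDerivAt Ubar (deriv Ubar x) x := fun x => (h.differentiable x).hasDerivAt
  have hF : ∀ x, HasDerivAt (fun y => P.F 0 (Ubar y)) (jac (P.F 0) (Ubar x) *ᵥ deriv Ubar x) x :=
    fun x => by
      have h1 : DifferentiableAt ℝ (P.F 0) (Ubar x) :=
        ((h.c_F 0).differentiableOn two_ne_zero).differentiableAt (h.isOpen.mem_nhds (h.mem x))
      have h2 := h1.hasFDerivAt.comp_hasDerivAt x (hU' x)
      refine h2.congr_deriv ?_
      rw [jac, LinearMap.toMatrix'_mulVec]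
      rfl
  obtain ⟨c, hc⟩ : ∃ c, ∀ x, P.B 0 0 (Ubar x) *ᵥ deriv Ubar x = P.F 0 (Ubar x) - c := by
    have h1 : ∀ x, HasDerivAt (fun y => P.F 0 (Ubar y) - P.B 0 0 (Ubar y) *ᵥ deriv Ubar y) 0 x :=
      fun x => by
        have := (hF x).differentiableAt.hasDerivAt.sub (h.profile.ode x)
        rw [sub_self] at this
        exact this
    refine ⟨P.F 0 (Ubar 0) - P.B 0 0 (Ubar 0) *ᵥ deriv Ubar 0, fun x => ?_⟩
    have := is_const_of_deriv_eq_zero (fun x => (h1 x).differentiableAt) (fun x => (h1 x).deriv) x 0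
    rw [← this]
    simp
  have hSl : ∀ x v, D0 *ᵥ v = 0 → D0 *ᵥ (S (Ubar x) *ᵥ v) = 0 := fun x v hv => by
    rw [Matrix.mulVec_mulVec, h.D0_S (h.mem x), ← Matrix.mulVec_mulVec, hv, Matrix.mulVec_zero]
  have hB0 : ∀ x, D0 *ᵥ (P.F 0 (Ubar x) - c) = 0 := fun x => by
    rw [← hc, Matrix.mulVec_mulVec, h.D0_B (h.mem x), Matrix.zero_mulVec]
  have hF0 : ∀ x, D0 *ᵥ (jac (P.F 0) (Ubar x) *ᵥ deriv Ubar x) = 0 := fun x => by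
    have h1 := ((LinearMap.toContinuousLinearMap (Matrix.mulVecLin (D0 : Mat m r))).hasFDerivAt
      (x := P.F 0 (Ubar x) - c)).comp_hasDerivAt x ((hF x).sub_const c)
    have h2 : (⇑(LinearMap.toContinuousLinearMap (Matrix.mulVecLin (D0 : Mat m r))) ∘
        fun y => P.F 0 (Ubar y) - c) = fun _ => 0 := funext hB0
    rw [h2] at h1
    exact h1.unique (hasDerivAt_const x 0)
  obtain ⟨s, θ, -, hθ, hd⟩ := h.defAt
  refine ⟨c, fun x => ?_⟩
  convert hU' x using 1
  have hx := h.mem x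
  have hr := (h.mem_regSet hx hθ (hd x)).2
  have key : profileMat P W S (Ubar x) *ᵥ (jac W (Ubar x) *ᵥ deriv Ubar x) =
      D1 *ᵥ (S (Ubar x) *ᵥ (P.F 0 (Ubar x) - c)) := by
    have e1 : profileMat P W S (Ubar x) * jac W (Ubar x) =
        D0 * (S (Ubar x) * jac (P.F 0) (Ubar x)) + S (Ubar x) * P.B 0 0 (Ubar x) := by
      rw [profileMat, add_mul, tA, tB]
      simp only [mul_assoc, h.M_mul hx, mul_one]
    have e2 : D0 *ᵥ (S (Ubar x) *ᵥ (P.F 0 (Ubar x) - c)) = 0 := hSl x _ (hB0 x)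
    rw [Matrix.mulVec_mulVec, e1, Matrix.add_mulVec, ← Matrix.mulVec_mulVec, ← Matrix.mulVec_mulVec,
      ← Matrix.mulVec_mulVec, hSl x _ (hF0 x), hc, zero_add,
      ]
    conv_lhs => rw [← Matrix.one_mulVec (S (Ubar x) *ᵥ _), ← D0_add_D1, Matrix.add_mulVec, e2,
      zero_add]
  rw [profileField, ← key, Matrix.mulVec_mulVec _ (profileMat P W S (Ubar x))⁻¹,
    Matrix.nonsing_inv_mul _ (isUnit_iff_ne_zero.2 hr), Matrix.one_mulVec, Matrix.mulVec_mulVec,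
    h.M_mul hx, Matrix.one_mulVec]

end Smooth

end ShockHyp

end Profile

section Trace

variable {m r : ℕ}

attribute [local instance] Matrix.linftyOpNormedRing Matrix.linftyOpNormedAlgebra

open Classical in
/-- The coefficient with given values; zero if these are not continuous and bounded. -/
def cfOf {E : Type*} [NormedAddCommGroup E] [InnerProductSpace ℂ E] (a : ℝ → E →L[ℂ] E) : Cf E :=
  if h : Continuous a ∧ ∃ C, ∀ x, ‖a x‖ ≤ C then
    BoundedContinuousFunction.ofNormedAddCommGroup a h.1 h.2.choose h.2.choose_spec else 0

theorem cfOf_apply {E : Type*} [NormedAddCommGroup E] [InnerProductSpace ℂ E]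
    {a : ℝ → E →L[ℂ] E} (h : Continuous a) (h' : ∃ C, ∀ x, ‖a x‖ ≤ C) (x : ℝ) : cfOf a x = a x := by
  rw [cfOf, dif_pos ⟨h, h'⟩]; rfl

/-- The coefficient obtained from a matrix function along a curve. -/
def coef (Ubar : ℝ → State m r) (G : State m r → Mat m r) : Cf (CState m r) :=
  cfOf fun x => cx (G (Ubar x))

/-- The derivative along a vector field. -/
def cder {V : Type*} [NormedAddCommGroup V] [NormedSpace ℝ V] (H : State m r → State m r)
    (G : State m r → V) (U : State m r) : V := fderiv ℝ G U (H U)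

theorem eq_zero_of_tendsto_atTop {u : ℝ → State m r} {H : State m r → State m r} {Ω : Set (State m r)}
    {Up : State m r} (hΩ : IsOpen Ω) (hp : Up ∈ Ω) (hH : ContinuousOn H Ω)
    (hd : ∀ x, HasDerivAt u (H (u x)) x) (hl : Tendsto u atTop (𝓝 Up)) : H Up = 0 := by
  funext i
  have hi : ∀ x, HasDerivAt (fun y => u y i) (H (u x) i) x := fun x => (hasDerivAt_pi.1 (hd x)) i
  have hs : ∀ x : ℝ, ∃ c ∈ Set.Ioo x (x + 1), H (u c) i = u (x + 1) i - u x i := fun x => by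
    obtain ⟨c, hc, h⟩ := exists_hasDerivAt_eq_slope (fun y => u y i) (fun y => H (u y) i)
      (lt_add_one x) (fun y _ => (hi y).continuousAt.continuousWithinAt) fun y _ => hi y
    exact ⟨c, hc, by rw [h]; simp⟩
  choose c hc hcs using hs
  have hct : Tendsto c atTop atTop := tendsto_atTop_mono (fun x => (hc x).1.le) tendsto_id
  have h1 : Tendsto (fun x => H (u (c x)) i) atTop (𝓝 (H Up i)) :=
    (((continuous_apply i).tendsto _).comp ((hH.continuousAt (hΩ.mem_nhds hp)).tendsto)).comp
      (hl.comp hct)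
  have h2 : Tendsto (fun x => u (x + 1) i - u x i) atTop (𝓝 (Up i - Up i)) :=
    (((continuous_apply i).tendsto _).comp
      (hl.comp (tendsto_atTop_add_const_right _ 1 tendsto_id))).sub
      (((continuous_apply i).tendsto _).comp hl)
  simp only [hcs] at h1
  rw [sub_self] at h2
  exact tendsto_nhds_unique h1 h2

theorem eq_zero_of_tendsto_atBot {u : ℝ → State m r} {H : State m r → State m r} {Ω : Set (State m r)}
    {Um : State m r} (hΩ : IsOpen Ω) (hp : Um ∈ Ω) (hH : ContinuousOn H Ω)
    (hd : ∀ x, HasDerivAt u (H (u x)) x) (hl : Tendsto u atBot (𝓝 Um)) : H Um = 0 := by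
  have h := eq_zero_of_tendsto_atTop (u := fun x => u (-x)) (H := -H) hΩ hp hH.neg (fun x => by
    have := (hd (-x)).scomp x (hasDerivAt_neg x)
    rw [neg_one_smul] at this
    exact this) (hl.comp tendsto_neg_atTop_atBot)
  simpa using h

/-- A heteroclinic orbit of a vector field. -/
structure Orbit (Ubar : ℝ → State m r) (Um Up : State m r) (Ω : Set (State m r))
    (H : State m r → State m r) : Prop where
  isOpen : IsOpen Ω
  mem : ∀ x, Ubar x ∈ Ω
  mem_m : Um ∈ Ω
  mem_p : Up ∈ Ω
  smooth : ContDiffOn ℝ 2 H Ω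
  deriv : ∀ x, HasDerivAt Ubar (H (Ubar x)) x
  lim_m : Tendsto Ubar atBot (𝓝 Um)
  lim_p : Tendsto Ubar atTop (𝓝 Up)

variable {Ubar : ℝ → State m r} {Um Up : State m r} {Ω : Set (State m r)}
  {H : State m r → State m r}

namespace Orbit

theorem zero_m (h : Orbit Ubar Um Up Ω H) : H Um = 0 :=
  eq_zero_of_tendsto_atBot h.isOpen h.mem_m h.smooth.continuousOn h.deriv h.lim_m

theorem zero_p (h : Orbit Ubar Um Up Ω H) : H Up = 0 :=
  eq_zero_of_tendsto_atTop h.isOpen h.mem_p h.smooth.continuousOn h.deriv h.lim_p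

theorem continuous (h : Orbit Ubar Um Up Ω H) : Continuous Ubar :=
  continuous_iff_continuousAt.2 fun x => (h.deriv x).continuousAt

theorem exists_compact (h : Orbit Ubar Um Up Ω H) : ∃ K, IsCompact K ∧ K ⊆ Ω ∧ ∀ x, Ubar x ∈ K := by
  have hn : Tendsto (fun x : ℝ => ‖x‖) (cocompact ℝ) atTop := tendsto_norm_cocompact_atTop
  refine ⟨_, ((h.lim_p.comp hn).isCompact_insert_range_of_cocompact
      (h.continuous.comp continuous_norm)).union
    ((h.lim_m.comp (tendsto_neg_atTop_atBot.comp hn)).isCompact_insert_range_of_cocompact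
      (h.continuous.comp continuous_norm.neg)), ?_, fun x => ?_⟩
  · rintro _ ((rfl | ⟨x, rfl⟩) | (rfl | ⟨x, rfl⟩))
    exacts [h.mem_p, h.mem _, h.mem_m, h.mem _]
  · rcases le_total 0 x with hx | hx
    · exact Or.inl (Or.inr ⟨x, by simp [abs_of_nonneg hx]⟩)
    · exact Or.inr (Or.inr ⟨x, by simp [abs_of_nonpos hx]⟩)

variable {G G' : State m r → Mat m r}

theorem coef_apply (h : Orbit Ubar Um Up Ω H) (hG : ContinuousOn G Ω) (x : ℝ) :
    coef Ubar G x = cx (G (Ubar x)) := by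
  obtain ⟨K, hK, hKΩ, hx⟩ := h.exists_compact
  refine cfOf_apply (cx.continuous.comp (hG.comp_continuous h.continuous h.mem)) ?_ x
  obtain ⟨C, hC⟩ := hK.exists_bound_of_continuousOn (cx.continuous.comp_continuousOn (hG.mono hKΩ))
  exact ⟨C, fun x => hC _ (hx x)⟩

theorem coef_mul (h : Orbit Ubar Um Up Ω H) (hG : ContinuousOn G Ω) (hG' : ContinuousOn G' Ω) :
    coef Ubar (fun U => G U * G' U) = coef Ubar G * coef Ubar G' := by
  refine Cf.ext' fun x v => ?_
  rw [Cf.mul_apply', h.coef_apply hG, h.coef_apply hG', h.coef_apply (G := fun U => G U * G' U) (hG.mul hG'), cx_mul_apply]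

theorem coef_sub (h : Orbit Ubar Um Up Ω H) (hG : ContinuousOn G Ω) (hG' : ContinuousOn G' Ω) :
    coef Ubar (fun U => G U - G' U) = coef Ubar G - coef Ubar G' := by
  refine Cf.ext' fun x v => ?_
  rw [BoundedContinuousFunction.sub_apply, h.coef_apply hG, h.coef_apply hG',
    h.coef_apply (G := fun U => G U - G' U) (hG.sub hG'), map_sub]

theorem coef_add (h : Orbit Ubar Um Up Ω H) (hG : ContinuousOn G Ω) (hG' : ContinuousOn G' Ω) :
    coef Ubar (fun U => G U + G' U) = coef Ubar G + coef Ubar G' := by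
  refine Cf.ext' fun x v => ?_
  rw [BoundedContinuousFunction.add_apply, h.coef_apply hG, h.coef_apply hG',
    h.coef_apply (G := fun U => G U + G' U) (hG.add hG'), map_add]

theorem contDiffOn_cder (h : Orbit Ubar Um Up Ω H) {V : Type*} [NormedAddCommGroup V]
    [NormedSpace ℝ V] {G : State m r → V} (hG : ContDiffOn ℝ 2 G Ω) :
    ContDiffOn ℝ 1 (cder H G) Ω :=
  (hG.fderiv_of_isOpen h.isOpen (by norm_num)).clm_apply (h.smooth.of_le one_le_two)

theorem continuousOn_cder (h : Orbit Ubar Um Up Ω H) {V : Type*} [NormedAddCommGroup V]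
    [NormedSpace ℝ V] {G : State m r → V} (hG : ContDiffOn ℝ 1 G Ω) :
    ContinuousOn (cder H G) Ω :=
  (hG.continuousOn_fderiv_of_isOpen h.isOpen le_rfl).clm_apply h.smooth.continuousOn

theorem cfDeriv_coef (h : Orbit Ubar Um Up Ω H) (hG : ContDiffOn ℝ 1 G Ω) :
    CfDeriv (coef Ubar G) (coef Ubar (cder H G)) := fun x => by
  have e : (fun y => coef Ubar G y) = fun y => cx (G (Ubar y)) :=
    funext fun y => h.coef_apply hG.continuousOn y
  rw [e, h.coef_apply (h.continuousOn_cder hG)]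
  have h1 := (((hG.differentiableOn one_ne_zero).differentiableAt
    (h.isOpen.mem_nhds (h.mem x))).hasFDerivAt).comp_hasDerivAt x (h.deriv x)
  exact cx.hasFDerivAt.comp_hasDerivAt x h1

theorem tendsto_coef (h : Orbit Ubar Um Up Ω H) (hG : ContinuousOn G Ω) {l : Filter ℝ}
    {U : State m r} (hU : U ∈ Ω) (hl : Tendsto Ubar l (𝓝 U)) :
    Tendsto (fun x => coef Ubar G x) l (𝓝 (cx (G U))) := by
  simp only [h.coef_apply hG]
  exact (cx.continuous.tendsto _).comp ((hG.continuousAt (h.isOpen.mem_nhds hU)).tendsto.comp hl)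

end Orbit

theorem cder_eq_zero {V : Type*} [NormedAddCommGroup V] [NormedSpace ℝ V] {G : State m r → V}
    {U : State m r} (h : H U = 0) : cder H G U = 0 := by rw [cder, h, map_zero]

end Trace

section Symmetrized

variable {d m r : ℕ}

attribute [local instance] Matrix.linftyOpNormedRing Matrix.linftyOpNormedAlgebra

open ViscousShock.System

/-- The symmetric part of `Ã^j` that is relevant for the energy estimates. -/
def symA (P : System d m r) (W : State m r → State m r) (S : State m r → Mat m r)
    (j : Fin (d + 1)) (U : State m r) : Mat m r :=
  D0 * P.tA W S j U + D1 * (P.tA W S j U)ᵀ * D0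

/-- The contribution of the derivative of the viscosity to the linearized convection. -/
def viscA (P : System d m r) (H : State m r → State m r) (j : Fin (d + 1)) (U : State m r) :
    Mat m r :=
  Matrix.of fun a c => ∑ b, fderiv ℝ (fun U => P.B j 0 U a b) U (Pi.single c 1) * H U b

/-- `B^{jk} ∂U/∂W`. -/
def BM (P : System d m r) (W : State m r → State m r) (j k : Fin (d + 1)) (U : State m r) :
    Mat m r := P.B j k U * dUdW W U

/-- `dF^1 ∂U/∂W`. -/
def FM (P : System d m r) (W : State m r → State m r) (U : State m r) : Mat m r :=
  jac (P.F 0) U * dUdW W U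

/-- The terms of order zero in the viscous flux. -/
def EM (P : System d m r) (W : State m r → State m r) (H : State m r → State m r)
    (U : State m r) : Mat m r :=
  P.B 0 0 U * cder H (dUdW W) U + viscA P H 0 U * dUdW W U

/-- The symmetrized linearized equations. -/
def linData (P : System d m r) (Ubar : ℝ → State m r) (W : State m r → State m r)
    (S : State m r → Mat m r) (H : State m r → State m r) : LinData (CState m r) d where
  a0 := coef Ubar (tA0 W S)
  a0i := coef Ubar fun U => (tA0 W S U)⁻¹
  a0' := coef Ubar (cder H (tA0 W S))
  e := coef Ubar fun U => D0 * S U * cder H (FM P W) U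
  e' := coef Ubar (cder H fun U => D0 * S U * cder H (FM P W) U)
  r0 := coef Ubar fun U => D1 * S U * cder H (FM P W) U - S U * cder H (EM P W H) U
  A := fun j => coef Ubar (symA P W S j)
  A' := fun j => coef Ubar (cder H (symA P W S j))
  del := Fin.cons (coef Ubar fun U => P.tA W S 0 U - symA P W S 0 U - S U * EM P W H U)
    fun j => coef Ubar fun U => P.tA W S j.succ U - symA P W S j.succ U
      - S U * cder H (BM P W 0 j.succ) U - S U * viscA P H j.succ U * dUdW W U
      - S U * P.B j.succ 0 U * cder H (dUdW W) U
  r := Fin.cons (coef Ubar fun U => -(S U * cder H (BM P W 0 0) U)) fun _ => 0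
  B := fun j k => coef Ubar (P.tB W S j k)
  B' := fun j k => coef Ubar (cder H (P.tB W S j k))
  pr := cx D1

theorem cx_D1_of {X : Mat m r} (h : D0 * X = 0) (v : CState m r) : cx D1 (cx X v) = cx X v := by
  have : D1 * X = X := by
    conv_rhs => rw [← one_mul X, ← D0_add_D1, add_mul, h, zero_add]
  rw [← cx_mul_apply, this]

theorem isSymm_D1 : (D1 : Mat m r).IsSymm := by simp [D1, Matrix.IsSymm, Matrix.fromBlocks_transpose]

theorem isSymm_D0 : (D0 : Mat m r).IsSymm := by simp [D0, Matrix.IsSymm, Matrix.fromBlocks_transpose]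

theorem D0_mul_D1 : (D0 * D1 : Mat m r) = 0 := by rw [D0_eq, sub_mul, one_mul, D1_mul_D1, sub_self]

theorem D0_mul_D0 : (D0 * D0 : Mat m r) = D0 := by
  conv_lhs => rw [D0_eq, sub_mul, one_mul, ← D0_eq, D1_mul_D0, sub_zero]

/-- Linear relations on an open set pass to derivatives. -/
theorem cder_relation {V V' : Type*} [NormedAddCommGroup V] [NormedSpace ℝ V]
    [NormedAddCommGroup V'] [NormedSpace ℝ V'] [FiniteDimensional ℝ V] {G : State m r → V}
    {Ω : Set (State m r)} (hΩ : IsOpen Ω) (hG : ContDiffOn ℝ 1 G Ω) (T : V →ₗ[ℝ] V')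
    (h : ∀ U ∈ Ω, T (G U) = 0) {U : State m r} (hU : U ∈ Ω) (w : State m r) :
    T (fderiv ℝ G U w) = 0 := by
  have h0 : (fun U => LinearMap.toContinuousLinearMap T (G U)) =ᶠ[𝓝 U] fun _ => (0 : V') := by
    filter_upwards [hΩ.mem_nhds hU] with y hy using h y hy
  have h1 := ((LinearMap.toContinuousLinearMap T).hasFDerivAt).comp U
    ((hG.differentiableOn one_ne_zero).differentiableAt (hΩ.mem_nhds hU)).hasFDerivAt
  have h2 := h1.unique ((hasFDerivAt_const (0 : V') U).congr_of_eventuallyEq h0)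
  exact DFunLike.congr_fun h2 w

variable {P : System d m r} {Ubar : ℝ → State m r} {Um Up : State m r} {𝒰 : Set (State m r)}
variable {W : State m r → State m r} {S : State m r → Mat m r} {q : ℕ} {H : State m r → State m r}

theorem D0_symA (j : Fin (d + 1)) (U : State m r) : D0 * symA P W S j U = D0 * P.tA W S j U := by
  rw [symA, mul_add, ← mul_assoc, ← mul_assoc, ← mul_assoc, D0_mul_D0, D0_mul_D1]; simp

theorem symA_mulVec_dot (j : Fin (d + 1)) (U : State m r) {v : State m r} (hv : D1 *ᵥ v = 0) :
    v ⬝ᵥ (symA P W S j U *ᵥ v) = v ⬝ᵥ (P.tA W S j U *ᵥ v) := by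
  rw [symA, Matrix.add_mulVec, dotProduct_add, mul_assoc, ← Matrix.mulVec_mulVec,
    ← Matrix.mulVec_mulVec, Matrix.dotProduct_mulVec v D0, ← Matrix.mulVec_transpose, isSymm_D0,
    mulVec_D0_eq hv, Matrix.dotProduct_mulVec v D1, ← Matrix.mulVec_transpose, isSymm_D1, hv,
    zero_dotProduct, add_zero]

theorem symA_mul_D0 {j : Fin (d + 1)} {U : State m r} (h : (P.tA W S j U).IsSymm) :
    symA P W S j U * D0 = P.tA W S j U * D0 := by
  rw [symA, h, add_mul, mul_assoc (D1 * _), D0_mul_D0, mul_assoc D0, mul_assoc D1, ← add_mul,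
    D0_add_D1, one_mul]

namespace ShockHyp

section Pointwise

variable (h : ShockHyp P Ubar Um Up 𝒰 W S q) {U : State m r} (hU : U ∈ 𝒰)
include h hU

theorem isSymm_symA (j : Fin (d + 1)) : (symA P W S j U).IsSymm := by
  have h1 := h.symm.tA_symm U hU j
  rw [symA, ← Matrix.fromBlocks_toBlocks (P.tA W S j U)]
  rw [Matrix.IsSymm] at h1
  simp [D0, D1, Matrix.fromBlocks_multiply, Matrix.fromBlocks_transpose, Matrix.IsSymm,
    Matrix.fromBlocks_add, h1]

theorem D0_S_mul {X : Mat m r} (hX : D0 * X = 0) : D0 * (S U * X) = 0 := by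
  rw [← mul_assoc, h.D0_S hU, mul_assoc, hX, mul_zero]

theorem D0_viscA (j : Fin (d + 1)) : D0 * viscA P H j U = 0 := by
  have key : ∀ (a : Fin m) b, fderiv ℝ (fun U => P.B j 0 U (Sum.inl a) b) U = 0 := fun a b => by
    have e : (fun U => P.B j 0 U (Sum.inl a) b) =ᶠ[𝓝 U] fun _ => (0 : ℝ) := by
      filter_upwards [h.isOpen.mem_nhds hU] with y hy
      rcases b with b | b
      · exact congrFun (congrFun (h.struct.upper_left y hy j 0) a) b
      · exact congrFun (congrFun (h.struct.upper_right y hy j 0) a) b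
    rw [e.fderiv_eq]; simp
  have h1 : (viscA P H j U).toBlocks₁₁ = 0 := by
    ext a c; simp [viscA, Matrix.toBlocks₁₁, key]
  have h2 : (viscA P H j U).toBlocks₁₂ = 0 := by
    ext a c; simp [viscA, Matrix.toBlocks₁₂, key]
  rw [← Matrix.fromBlocks_toBlocks (viscA P H j U), h1, h2]
  simp [D0, Matrix.fromBlocks_multiply]

theorem D0_EM : D0 * EM P W H U = 0 := by
  rw [EM, mul_add, ← mul_assoc, ← mul_assoc, h.D0_B hU, h.D0_viscA hU]; simp

theorem coupling {τ : ℝ} {ζ : Fin (d + 1) → ℝ} (hst : P.IsStableEndState W S U) (hζ : ζ ≠ 0)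
    {v : State m r} (hv : D1 *ᵥ v = 0)
    (he : τ • (tA0 W S U *ᵥ v) + ∑ j, ζ j • (symA P W S j U *ᵥ v) = 0) : v = 0 := by
  have e1 : ∀ j, symA P W S j U *ᵥ v = P.tA W S j U *ᵥ v := fun j => by
    conv_lhs => rw [← mulVec_D0_eq hv, Matrix.mulVec_mulVec, symA_mul_D0 (hst.symm j),
      ← Matrix.mulVec_mulVec, mulVec_D0_eq hv]
  have e2 : S U *ᵥ (τ • (dUdW W U *ᵥ v) + (∑ j, ζ j • jac (P.F j) U) *ᵥ (dUdW W U *ᵥ v)) = 0 := by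
    rw [← he, Matrix.mulVec_add, Matrix.mulVec_smul, Matrix.mulVec_mulVec, Matrix.mulVec_mulVec,
      Matrix.mulVec_mulVec, Finset.mul_sum, Finset.sum_mul, Matrix.sum_mulVec]
    simp only [e1, tA, tA0, mul_smul_comm, smul_mul_assoc, Matrix.smul_mulVec]
  have e3 := Matrix.eq_zero_of_mulVec_eq_zero (h.symm.S_invertible U hU).ne_zero e2
  have e4 : dUdW W U *ᵥ v = 0 := by
    by_contra hne
    refine hst.genuine_coupling ζ hζ (-τ) _ hne ?_ ?_
    · rw [neg_smul]; exact eq_neg_of_add_eq_zero_right e3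
    · refine Matrix.eq_zero_of_mulVec_eq_zero (h.symm.S_invertible U hU).ne_zero ?_
      rw [Matrix.mulVec_mulVec, Matrix.mulVec_mulVec, Finset.mul_sum, Finset.sum_mul,
        Matrix.sum_mulVec]
      refine Finset.sum_eq_zero fun j _ => ?_
      rw [Finset.mul_sum, Finset.sum_mul, Matrix.sum_mulVec]
      refine Finset.sum_eq_zero fun k _ => ?_
      rw [mul_smul_comm, smul_mul_assoc, Matrix.smul_mulVec]
      change _ • (P.tB W S j k U *ᵥ v) = 0
      rw [← h.tB_D1 hU, ← Matrix.mulVec_mulVec, hv, Matrix.mulVec_zero, smul_zero]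
  rw [← Matrix.one_mulVec v, ← h.mul_M hU, ← Matrix.mulVec_mulVec, e4, Matrix.mulVec_zero]

theorem isUnit_tA0 : IsUnit (tA0 W S U).det := (h.symm.tA0_posDef U hU).det_pos.ne'.isUnit

end Pointwise

end ShockHyp

end Symmetrized

section Symmetrized

variable {d m r : ℕ}

attribute [local instance] Matrix.linftyOpNormedRing Matrix.linftyOpNormedAlgebra

open ViscousShock.System

variable (P : System d m r) (Ubar : ℝ → State m r) (Um Up : State m r) (𝒰 Ω : Set (State m r))
variable (W : State m r → State m r) (S : State m r → Mat m r) (q : ℕ) (H : State m r → State m r)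

/-- The hypotheses together with the equation of the profile. -/
structure Setup : Prop where
  hyp : ShockHyp P Ubar Um Up 𝒰 W S q
  orbit : Orbit Ubar Um Up Ω H
  sub : Ω ⊆ 𝒰

variable {P Ubar Um Up 𝒰 Ω W S q H}

theorem ShockHyp.exists_setup (h : ShockHyp P Ubar Um Up 𝒰 W S q) :
    ∃ Ω H, Setup P Ubar Um Up 𝒰 Ω W S q H := by
  obtain ⟨c, hc⟩ := h.hasDerivAt_profile
  obtain ⟨s, θ, -, hθ, hd⟩ := h.defAt
  exact ⟨regSet P 𝒰 W S, profileField P W S c, h,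
    { isOpen := h.isOpen_regSet
      mem := fun x => h.mem_regSet (h.mem x) hθ (hd x)
      mem_m := h.mem_regSet h.mem_m hθ (h.defAt_limit hd h.mem_m h.profile.lim_left)
      mem_p := h.mem_regSet h.mem_p hθ (h.defAt_limit hd h.mem_p h.profile.lim_right)
      smooth := h.c_field c
      deriv := hc
      lim_m := h.profile.lim_left
      lim_p := h.profile.lim_right }, h.regSet_sub⟩

namespace Setup

section Smooth

variable (h : Setup P Ubar Um Up 𝒰 Ω W S q H)
include h

theorem c_jacW : ContDiffOn ℝ 2 (jac W) Ω := h.hyp.c_jacW.mono h.sub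
theorem c_M : ContDiffOn ℝ 2 (dUdW W) Ω := h.hyp.c_M.mono h.sub
theorem c_S : ContDiffOn ℝ 2 S Ω := h.hyp.c_S.mono h.sub
theorem c_tA0 : ContDiffOn ℝ 2 (tA0 W S) Ω := h.hyp.c_tA0.mono h.sub
theorem c_F (j : Fin (d + 1)) : ContDiffOn ℝ 2 (jac (P.F j)) Ω := (h.hyp.c_jacF j).mono h.sub
theorem c_tA (j : Fin (d + 1)) : ContDiffOn ℝ 2 (P.tA W S j) Ω := (h.hyp.c_tA j).mono h.sub
theorem c_B (j k : Fin (d + 1)) : ContDiffOn ℝ 2 (P.B j k) Ω := (h.hyp.c_B j k).mono h.sub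
theorem c_tB (j k : Fin (d + 1)) : ContDiffOn ℝ 2 (P.tB W S j k) Ω := (h.hyp.c_tB j k).mono h.sub
theorem c_BM (j k : Fin (d + 1)) : ContDiffOn ℝ 2 (BM P W j k) Ω := (h.c_B j k).mul h.c_M
theorem c_FM : ContDiffOn ℝ 2 (FM P W) Ω := (h.c_F 0).mul h.c_M
theorem c_dM : ContDiffOn ℝ 1 (cder H (dUdW W)) Ω := h.orbit.contDiffOn_cder h.c_M
theorem c_dFM : ContDiffOn ℝ 1 (cder H (FM P W)) Ω := h.orbit.contDiffOn_cder h.c_FM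
theorem c_dBM (j k : Fin (d + 1)) : ContDiffOn ℝ 1 (cder H (BM P W j k)) Ω :=
  h.orbit.contDiffOn_cder (h.c_BM j k)

theorem c_tA0i : ContDiffOn ℝ 2 (fun U => (tA0 W S U)⁻¹) Ω :=
  contDiffOn_inv h.c_tA0 fun _ hU => h.hyp.isUnit_tA0 (h.sub hU)

theorem c_tA_transpose (j : Fin (d + 1)) : ContDiffOn ℝ 2 (fun U => (P.tA W S j U)ᵀ) Ω :=
  contDiffOn_of_entries fun a b =>
    ContDiffOn.linearMap_comp (Matrix.entryLinearMap ℝ ℝ b a) (h.c_tA j)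

theorem c_symA (j : Fin (d + 1)) : ContDiffOn ℝ 2 (symA P W S j) Ω :=
  (contDiffOn_const.mul (h.c_tA j)).add
    ((contDiffOn_const.mul (h.c_tA_transpose j)).mul contDiffOn_const)

theorem c_viscA (j : Fin (d + 1)) : ContDiffOn ℝ 1 (viscA P H j) Ω :=
  contDiffOn_of_entries fun a c => by
    simp only [viscA, Matrix.of_apply]
    refine ContDiffOn.sum fun b _ => ContDiffOn.mul ?_
      (contDiffOn_pi.1 (h.orbit.smooth.of_le one_le_two) b)
    exact (((h.hyp.reg.B_smooth j 0 a b).mono h.sub).fderiv_of_isOpen (m := 1) h.orbit.isOpen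
      (by exact_mod_cast (by have := h.hyp.hq; omega : 1 + 1 ≤ q + 1))).clm_apply contDiffOn_const

theorem c_EM : ContDiffOn ℝ 1 (EM P W H) Ω :=
  (((h.c_B 0 0).of_le one_le_two).mul h.c_dM).add
    ((h.c_viscA 0).mul (h.c_M.of_le one_le_two))

theorem c_e : ContDiffOn ℝ 1 (fun U => D0 * S U * cder H (FM P W) U) Ω :=
  (contDiffOn_const.mul (h.c_S.of_le one_le_two)).mul h.c_dFM

theorem c_r0 : ContinuousOn
    (fun U => D1 * S U * cder H (FM P W) U - S U * cder H (EM P W H) U) Ω :=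
  ((continuousOn_const.mul h.c_S.continuousOn).mul h.c_dFM.continuousOn).sub
    (h.c_S.continuousOn.mul (h.orbit.continuousOn_cder h.c_EM))

theorem c_del0 : ContinuousOn
    (fun U => P.tA W S 0 U - symA P W S 0 U - S U * EM P W H U) Ω :=
  ((h.c_tA 0).continuousOn.sub (h.c_symA 0).continuousOn).sub
    (h.c_S.continuousOn.mul h.c_EM.continuousOn)

theorem c_del (j : Fin d) : ContinuousOn (fun U => P.tA W S j.succ U - symA P W S j.succ U
      - S U * cder H (BM P W 0 j.succ) U - S U * viscA P H j.succ U * dUdW W U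
      - S U * P.B j.succ 0 U * cder H (dUdW W) U) Ω :=
  ((((h.c_tA _).continuousOn.sub (h.c_symA _).continuousOn).sub
    (h.c_S.continuousOn.mul (h.c_dBM 0 j.succ).continuousOn)).sub
    ((h.c_S.continuousOn.mul (h.c_viscA j.succ).continuousOn).mul h.c_M.continuousOn)).sub
    ((h.c_S.continuousOn.mul (h.c_B j.succ 0).continuousOn).mul h.c_dM.continuousOn)

theorem c_r : ContinuousOn (fun U => -(S U * cder H (BM P W 0 0) U)) Ω :=
  (h.c_S.continuousOn.mul (h.c_dBM 0 0).continuousOn).neg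

theorem D0_cder {G : State m r → Mat m r} (hG : ContDiffOn ℝ 1 G Ω) (h0 : ∀ U ∈ Ω, D0 * G U = 0)
    {U : State m r} (hU : U ∈ Ω) : D0 * cder H G U = 0 :=
  cder_relation h.orbit.isOpen hG (LinearMap.mulLeft ℝ D0) h0 hU _

theorem cder_D0 {G : State m r → Mat m r} (hG : ContDiffOn ℝ 1 G Ω) (h0 : ∀ U ∈ Ω, G U * D0 = 0)
    {U : State m r} (hU : U ∈ Ω) : cder H G U * D0 = 0 :=
  cder_relation h.orbit.isOpen hG (LinearMap.mulRight ℝ D0) h0 hU _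

theorem D0_BM (j k : Fin (d + 1)) {U : State m r} (hU : U ∈ Ω) : D0 * BM P W j k U = 0 := by
  rw [BM, ← mul_assoc, h.hyp.D0_B (h.sub hU), zero_mul]

theorem BM_D0 (j k : Fin (d + 1)) {U : State m r} (hU : U ∈ Ω) : BM P W j k U * D0 = 0 := by
  have h1 : S U * (BM P W j k U * D0) = 0 := by
    rw [BM, ← mul_assoc, ← mul_assoc]
    change P.tB W S j k U * D0 = 0
    rw [D0_eq, mul_sub, mul_one, h.hyp.tB_D1 (h.sub hU), sub_self]
  have h2 : (S U)⁻¹ * (S U * (BM P W j k U * D0)) = 0 := by rw [h1, mul_zero]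
  rwa [← mul_assoc, Matrix.nonsing_inv_mul _ (h.hyp.symm.S_invertible U (h.sub hU)), one_mul] at h2

theorem a0_pos : ∃ c, 0 < c ∧ ∀ x v, c * ‖v‖ ^ 2 ≤ rI v (cx (tA0 W S (Ubar x)) v) := by
  obtain ⟨K, hK, hKΩ, hx⟩ := h.orbit.exists_compact
  have hpos : ∀ U ∈ Ω, ∀ v : CState m r, v ≠ 0 → 0 < rI v (cx (tA0 W S U) v) := by
    intro U hU v hv
    have hp := (h.hyp.symm.tA0_posDef U (h.sub hU))
    have h0 : ∀ w : State m r, 0 ≤ w ⬝ᵥ (tA0 W S U *ᵥ w) := fun w => by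
      simpa using hp.posSemidef.dotProduct_mulVec_nonneg w
    have h1 : ∀ w : State m r, w ≠ 0 → 0 < w ⬝ᵥ (tA0 W S U *ᵥ w) := fun w hw => by
      simpa using hp.dotProduct_mulVec_pos hw
    rw [rI_cx]
    by_cases hr : reV v = 0
    · have hi : imV v ≠ 0 := fun hi => hv (eq_zero_of_reV_imV hr hi)
      linarith [h0 (reV v), h1 _ hi]
    · linarith [h0 (imV v), h1 _ hr]
  have hcont : ContinuousOn (fun p : State m r × CState m r => rI p.2 (cx (tA0 W S p.1) p.2))
      (K ×ˢ Metric.sphere 0 1) := by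
    have e1 : ContinuousOn (fun p : State m r × CState m r => cx (tA0 W S p.1) p.2)
        (K ×ˢ Metric.sphere 0 1) :=
      (cx.continuous.comp_continuousOn ((h.c_tA0.continuousOn.mono hKΩ).comp continuousOn_fst
        fun p hp => hp.1)).clm_apply continuousOn_snd
    exact Complex.continuous_re.comp_continuousOn (continuousOn_snd.inner e1)
  obtain ⟨c, hc, hcb⟩ := (hK.prod (isCompact_sphere (0 : CState m r) 1)).exists_forall_le'
    hcont (a := 0) fun p hp => hpos _ (hKΩ hp.1) _ (by
      intro h0; have := hp.2; simp [h0] at this)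
  refine ⟨c, hc, fun x v => ?_⟩
  by_cases hv : v = 0
  · simp [hv, rI]
  have hn : ‖v‖ ≠ 0 := norm_ne_zero_iff.2 hv
  have h1 := hcb (Ubar x, ((‖v‖⁻¹ : ℝ) : ℂ) • v) ⟨hx x, by
    rw [mem_sphere_zero_iff_norm, norm_smul, Complex.norm_real, norm_inv, norm_norm, inv_mul_cancel₀ hn]⟩
  have h2 : rI (((‖v‖⁻¹ : ℝ) : ℂ) • v) (cx (tA0 W S (Ubar x)) (((‖v‖⁻¹ : ℝ) : ℂ) • v)) =
      (‖v‖ ^ 2)⁻¹ * rI v (cx (tA0 W S (Ubar x)) v) := by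
    rw [map_smul, rI, rI, inner_smul_left, inner_smul_right, Complex.conj_ofReal, ← mul_assoc,
      ← Complex.ofReal_mul, Complex.re_ofReal_mul, sq, mul_inv]
  change c ≤ rI _ _ at h1
  rw [h2, inv_mul_eq_div, le_div_iff₀ (by positivity)] at h1
  exact h1

end Smooth

end Setup

end Symmetrized

section Symmetrized

variable {d m r : ℕ}

attribute [local instance] Matrix.linftyOpNormedRing Matrix.linftyOpNormedAlgebra

open ViscousShock.System

variable {P : System d m r} {Ubar : ℝ → State m r} {Um Up : State m r} {𝒰 Ω : Set (State m r)}
variable {W : State m r → State m r} {S : State m r → Mat m r} {q : ℕ} {H : State m r → State m r}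

theorem cx_D1_eq_zero {v : CState m r} (h : cx D1 v = 0) : D1 *ᵥ reV v = 0 ∧ D1 *ᵥ imV v = 0 :=
  reV_eq v D1 h

theorem norm_cx_D1_sq (v : CState m r) :
    ‖cx D1 v‖ ^ 2 = (D1 *ᵥ reV v) ⬝ᵥ (D1 *ᵥ reV v) + (D1 *ᵥ imV v) ⬝ᵥ (D1 *ᵥ imV v) := by
  rw [norm_sq_eq_dotProduct, reV_cx, imV_cx]

theorem linData_del_zero : (linData P Ubar W S H).del 0 =
    coef Ubar fun U => P.tA W S 0 U - symA P W S 0 U - S U * EM P W H U := rfl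

theorem linData_del_succ (j : Fin d) : (linData P Ubar W S H).del j.succ =
    coef Ubar fun U => P.tA W S j.succ U - symA P W S j.succ U
      - S U * cder H (BM P W 0 j.succ) U - S U * viscA P H j.succ U * dUdW W U
      - S U * P.B j.succ 0 U * cder H (dUdW W) U := rfl

theorem linData_r_zero : (linData P Ubar W S H).r 0 =
    coef Ubar fun U => -(S U * cder H (BM P W 0 0) U) := rfl

theorem linData_r_succ (j : Fin d) : (linData P Ubar W S H).r j.succ = 0 := rfl

theorem linData_r0 : (linData P Ubar W S H).r0 = coef Ubar fun U =>
    D1 * S U * cder H (FM P W) U - S U * cder H (EM P W H) U := rfl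

theorem linData_e : (linData P Ubar W S H).e =
    coef Ubar fun U => D0 * S U * cder H (FM P W) U := rfl

theorem linData_e' : (linData P Ubar W S H).e' =
    coef Ubar (cder H fun U => D0 * S U * cder H (FM P W) U) := rfl

theorem linData_pr : (linData P Ubar W S H).pr = cx D1 := rfl

theorem D0_tA_sub_symA (j : Fin (d + 1)) (U : State m r) :
    D0 * (P.tA W S j U - symA P W S j U) = 0 := by
  rw [mul_sub, D0_symA, sub_self]

namespace Setup

theorem pr_del (h : Setup P Ubar Um Up 𝒰 Ω W S q H) (j : Fin (d + 1)) (x : ℝ) (v : CState m r) :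
    (linData P Ubar W S H).pr ((linData P Ubar W S H).del j x v) =
      (linData P Ubar W S H).del j x v := by
  have hSX : ∀ X, D0 * X = 0 → D0 * (S (Ubar x) * X) = 0 := fun X hX =>
    h.hyp.D0_S_mul (h.hyp.mem x) hX
  refine Fin.cases ?_ (fun j => ?_) j
  · rw [linData_del_zero, linData_pr, h.orbit.coef_apply h.c_del0]
    refine cx_D1_of ?_ v
    rw [mul_sub, D0_tA_sub_symA, hSX _ (h.hyp.D0_EM (h.hyp.mem x)), sub_zero]
  · rw [linData_del_succ, linData_pr, h.orbit.coef_apply (h.c_del j)]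
    refine cx_D1_of ?_ v
    have e1 := hSX _ (h.D0_cder ((h.c_BM 0 j.succ).of_le one_le_two)
      (fun U hU => h.D0_BM _ _ hU) (h.orbit.mem x))
    have e2 := hSX (viscA P H j.succ (Ubar x)) (h.hyp.D0_viscA (h.hyp.mem x) _)
    have e3 := hSX (P.B j.succ 0 (Ubar x)) (h.hyp.D0_B (h.hyp.mem x) _ _)
    rw [mul_sub, mul_sub, mul_sub, D0_tA_sub_symA, e1, ← mul_assoc D0 (_ * _), e2,
      ← mul_assoc D0 (_ * _), e3]
    simp

theorem pr_r (h : Setup P Ubar Um Up 𝒰 Ω W S q H) (j : Fin (d + 1)) (x : ℝ) (v : CState m r) :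
    (linData P Ubar W S H).pr ((linData P Ubar W S H).r j x v) =
      (linData P Ubar W S H).r j x v := by
  refine Fin.cases ?_ (fun j => ?_) j
  · rw [linData_r_zero, linData_pr, h.orbit.coef_apply h.c_r]
    refine cx_D1_of ?_ v
    rw [mul_neg, h.hyp.D0_S_mul (h.hyp.mem x) (h.D0_cder ((h.c_BM _ _).of_le one_le_two)
      (fun U hU => h.D0_BM _ _ hU) (h.orbit.mem x)), neg_zero]
  · rw [linData_r_succ]
    simp

theorem cder_BM_D1 (h : Setup P Ubar Um Up 𝒰 Ω W S q H) (j k : Fin (d + 1)) {U : State m r}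
    (hU : U ∈ Ω) : cder H (BM P W j k) U * D1 = cder H (BM P W j k) U := by
  have e := h.cder_D0 ((h.c_BM j k).of_le one_le_two) (fun U hU => h.BM_D0 j k hU) hU
  conv_rhs => rw [← mul_one (cder H (BM P W j k) U), ← D0_add_D1, mul_add, e, zero_add]

theorem r_pr (h : Setup P Ubar Um Up 𝒰 Ω W S q H) (j : Fin (d + 1)) (x : ℝ) (v : CState m r) :
    (linData P Ubar W S H).r j x ((linData P Ubar W S H).pr v) =
      (linData P Ubar W S H).r j x v := by
  refine Fin.cases ?_ (fun j => ?_) j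
  · rw [linData_r_zero, linData_pr, h.orbit.coef_apply h.c_r, ← cx_mul_apply, neg_mul, mul_assoc,
      h.cder_BM_D1 _ _ (h.orbit.mem x)]
  · rw [linData_r_succ]
    rfl

theorem good (h : Setup P Ubar Um Up 𝒰 Ω W S q H) : ∃ s, (linData P Ubar W S H).Good s := by
  obtain ⟨s, θ, hs, hθ, hd⟩ := h.hyp.defAt
  have hm := h.orbit.mem
  have ha0 : ∀ x, (linData P Ubar W S H).a0 x = cx (tA0 W S (Ubar x)) := fun x =>
    h.orbit.coef_apply h.c_tA0.continuousOn x
  have ha0i : ∀ x, (linData P Ubar W S H).a0i x = cx (tA0 W S (Ubar x))⁻¹ := fun x =>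
    h.orbit.coef_apply h.c_tA0i.continuousOn x
  have hA : ∀ j x, (linData P Ubar W S H).A j x = cx (symA P W S j (Ubar x)) := fun j x =>
    h.orbit.coef_apply (h.c_symA j).continuousOn x
  have hB : ∀ j k x, (linData P Ubar W S H).B j k x = cx (P.tB W S j k (Ubar x)) := fun j k x =>
    h.orbit.coef_apply (h.c_tB j k).continuousOn x
  have hpr : (linData P Ubar W S H).pr = cx D1 := rfl
  have htt : ∀ x, tA0 W S (Ubar x) * (tA0 W S (Ubar x))⁻¹ = 1 := fun x =>
    Matrix.mul_nonsing_inv _ (h.hyp.isUnit_tA0 (h.hyp.mem x))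
  have htt' : ∀ x, (tA0 W S (Ubar x))⁻¹ * tA0 W S (Ubar x) = 1 := fun x =>
    Matrix.nonsing_inv_mul _ (h.hyp.isUnit_tA0 (h.hyp.mem x))
  have hDA : ∀ j U, D0 * (P.tA W S j U - symA P W S j U) = 0 := fun j U => by
    rw [mul_sub, D0_symA, sub_self]
  have hSX : ∀ x X, D0 * X = 0 → D0 * (S (Ubar x) * X) = 0 := fun x X hX =>
    h.hyp.D0_S_mul (h.hyp.mem x) hX
  refine ⟨s, ?_⟩
  constructor
  case pr_sa => exact fun v w => inner_cx_of_symm isSymm_D1 v w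
  case pr_pr => exact fun v => by rw [hpr, ← cx_mul_apply, D1_mul_D1]
  case a0_sa =>
    intro x v w
    rw [ha0]
    have h1 := (h.hyp.symm.tA0_posDef _ (h.hyp.mem x)).isHermitian
    rw [Matrix.IsHermitian, Matrix.conjTranspose_eq_transpose_of_trivial] at h1
    exact inner_cx_of_symm h1 v w
  case a0_pos => simpa only [ha0] using h.a0_pos
  case a0_a0i =>
    intro x v
    rw [ha0, ha0i, ← cx_mul_apply, htt, cx_one]; rfl
  case a0i_a0 =>
    intro x v
    rw [ha0, ha0i, ← cx_mul_apply, htt', cx_one]; rfl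
  case a0_d => exact h.orbit.cfDeriv_coef (h.c_tA0.of_le one_le_two)
  case a0_pr =>
    intro x v
    rw [ha0, hpr, ← cx_mul_apply, ← cx_mul_apply, h.hyp.D1_tA0 (h.hyp.mem x)]
  case A_sa =>
    intro j x v w
    rw [hA]
    exact inner_cx_of_symm (h.hyp.isSymm_symA (h.hyp.mem x) j) v w
  case A_d => exact fun j => h.orbit.cfDeriv_coef ((h.c_symA j).of_le one_le_two)
  case pr_B =>
    intro j k x v
    rw [hB, hpr, ← cx_mul_apply, h.hyp.D1_tB (h.hyp.mem x)]
  case B_pr =>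
    intro j k x v
    rw [hB, hpr, ← cx_mul_apply, h.hyp.tB_D1 (h.hyp.mem x)]
  case B_d => exact fun j k => h.orbit.cfDeriv_coef ((h.c_tB j k).of_le one_le_two)
  case ell =>
    obtain ⟨θ, hθ, hell⟩ := h.hyp.ell
    refine ⟨θ, hθ, fun x ξ v => ?_⟩
    have e1 := hell _ (h.hyp.mem x) ξ (reV v)
    have e2 := hell _ (h.hyp.mem x) ξ (imV v)
    rw [hpr, norm_cx_D1_sq, mul_add]
    refine (add_le_add e1 e2).trans_eq ?_
    simp only [hB, rI_cx, mul_add, Finset.sum_add_distrib]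
  case pr_del => exact h.pr_del
  case pr_r => exact h.pr_r
  case r_pr => exact h.r_pr
  case pr_r0 =>
    intro x v
    rw [linData_r0, linData_pr, h.orbit.coef_apply h.c_r0]
    refine cx_D1_of ?_ v
    rw [mul_sub, hSX x _ (h.D0_cder h.c_EM (fun U hU => h.hyp.D0_EM (h.sub hU)) (hm x)),
      ← mul_assoc, ← mul_assoc, D0_mul_D1]
    simp
  case pr_e =>
    intro x v
    rw [linData_e, linData_pr, h.orbit.coef_apply h.c_e.continuousOn, ← cx_mul_apply, ← mul_assoc, ← mul_assoc, D1_mul_D0]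
    simp
  case e_d => rw [linData_e, linData_e']; exact h.orbit.cfDeriv_coef h.c_e
  case s_sq => exact hs
  case definite =>
    refine ⟨θ, hθ, fun x v hv => ?_⟩
    obtain ⟨h1, h2⟩ := cx_D1_eq_zero hv
    rw [hA, rI_cx, norm_sq_eq_dotProduct, symA_mulVec_dot _ _ h1, symA_mulVec_dot _ _ h2, mul_add,
      mul_add]
    exact add_le_add (hd x _ h1) (hd x _ h2)

theorem atEnd (h : Setup P Ubar Um Up 𝒰 Ω W S q H) {l : Filter ℝ} {U : State m r} (hU : U ∈ Ω)
    (hl : Tendsto Ubar l (𝓝 U)) (hH : H U = 0) (hst : P.IsStableEndState W S U) :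
    (linData P Ubar W S H).AtEnd l (cx (tA0 W S U)) fun j => cx (symA P W S j U) := by
  have hz : ∀ {V : Type} [NormedAddCommGroup V] [NormedSpace ℝ V] (G : State m r → V),
      cder H G U = 0 := fun G => cder_eq_zero hH
  have hv : ∀ j, viscA P H j U = 0 := fun j => by
    ext a c; simp [viscA, hH]
  have hE : EM P W H U = 0 := by rw [EM, hz, hv]; simp
  have hpr : (1 - (linData P Ubar W S H).pr) = cx D0 := by
    change 1 - cx D1 = cx D0
    rw [D0_eq, map_sub, cx_one]
  constructor
  case a0 => exact h.orbit.tendsto_coef h.c_tA0.continuousOn hU hl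
  case A => exact fun j => h.orbit.tendsto_coef (h.c_symA j).continuousOn hU hl
  case a0' =>
    have := h.orbit.tendsto_coef (h.orbit.continuousOn_cder (h.c_tA0.of_le one_le_two)) hU hl
    rwa [hz, map_zero] at this
  case A' =>
    intro j
    have := h.orbit.tendsto_coef (h.orbit.continuousOn_cder ((h.c_symA j).of_le one_le_two)) hU hl
    rwa [hz, map_zero] at this
  case e =>
    have := h.orbit.tendsto_coef h.c_e.continuousOn hU hl
    rwa [hz, mul_zero, map_zero] at this
  case del =>
    intro j
    have hs : ∀ j, cx (P.tA W S j U - symA P W S j U) * cx D0 = 0 := fun j => by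
      rw [← cx_mul, sub_mul, symA_mul_D0 (hst.symm j), sub_self, map_zero]
    rw [hpr]
    refine Fin.cases ?_ (fun j => ?_) j
    · have := (h.orbit.tendsto_coef h.c_del0 hU hl).mul_const (cx D0)
      rwa [hE, mul_zero, sub_zero, hs] at this
    · have := (h.orbit.tendsto_coef (h.c_del j) hU hl).mul_const (cx D0)
      rwa [hz, hz, hv, mul_zero, mul_zero, zero_mul, sub_zero, sub_zero, sub_zero, hs]
        at this
  case inj =>
    intro v hv
    have hu := (h.hyp.isUnit_tA0 (h.sub hU)).ne_zero
    exact eq_zero_of_reV_imV (Matrix.eq_zero_of_mulVec_eq_zero hu (reV_eq v _ hv).1)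
      (Matrix.eq_zero_of_mulVec_eq_zero hu (reV_eq v _ hv).2)
  case coupling =>
    intro τ ζ hζ v he hv
    obtain ⟨h1, h2⟩ := cx_D1_eq_zero hv
    have e1 : cx (τ • tA0 W S U + ∑ j, ζ j • symA P W S j U) v = 0 := by
      rw [← he, map_add, map_sum, _root_.add_apply, ContinuousLinearMap.sum_apply, map_smul]
      simp only [map_smul]
      rfl
    have key : ∀ w : State m r, D1 *ᵥ w = 0 →
        (τ • tA0 W S U + ∑ j, ζ j • symA P W S j U) *ᵥ w = 0 → w = 0 := fun w hw h0 => by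
      refine h.hyp.coupling (h.sub hU) (τ := τ) (ζ := ζ) hst hζ hw ?_
      rw [← h0, Matrix.add_mulVec, Matrix.sum_mulVec]
      simp only [Matrix.smul_mulVec]
    exact eq_zero_of_reV_imV (key _ h1 (reV_eq v _ e1).1) (key _ h2 (reV_eq v _ e1).2)

end Setup

end Symmetrized

section Transformation

variable {d m r : ℕ}

attribute [local instance] Matrix.linftyOpNormedRing Matrix.linftyOpNormedAlgebra

open ViscousShock.System

theorem hasWeakDeriv_iff {F G : ℝ → CState m r} {f g : L2 m r} (hF : F =ᵐ[volume] f)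
    (hG : G =ᵐ[volume] g) : HasWeakDeriv F G ↔ HD f g := by
  refine forall₃_congr fun φ _ _ => ?_
  have e1 : ∫ x, deriv φ x • F x = ∫ x, ((deriv φ x : ℝ) : ℂ) • f x := integral_congr_ae (by
    filter_upwards [hF] with x hx
    rw [hx, Complex.coe_smul])
  have e2 : ∫ x, φ x • G x = ∫ x, ((φ x : ℝ) : ℂ) • g x := integral_congr_ae (by
    filter_upwards [hG] with x hx
    rw [hx, Complex.coe_smul])
  rw [e1, e2]

theorem lcomb_mul {E : Type*} [NormedAddCommGroup E] [InnerProductSpace ℂ E]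
    [FiniteDimensional ℂ E] {n : ℕ} (ξ : Fin n → ℝ)
    (F : Fin n → Cf E) (a : Cf E) : lcomb ξ F * a = lcomb ξ fun j => F j * a := by
  refine Cf.ext' fun x v => ?_
  rw [Cf.mul_apply', lcomb_apply, lcomb_apply]
  rfl

theorem mul_lcomb {E : Type*} [NormedAddCommGroup E] [InnerProductSpace ℂ E]
    [FiniteDimensional ℂ E] {n : ℕ} (ξ : Fin n → ℝ)
    (F : Fin n → Cf E) (a : Cf E) : a * lcomb ξ F = lcomb ξ fun j => a * F j := by
  refine Cf.ext' fun x v => ?_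
  rw [Cf.mul_apply', lcomb_apply, lcomb_apply, map_sum]
  exact Finset.sum_congr rfl fun j _ => map_smul _ _ _

theorem lcomb_add {E : Type*} [NormedAddCommGroup E] [InnerProductSpace ℂ E]
    [FiniteDimensional ℂ E] {n : ℕ} (ξ : Fin n → ℝ)
    (F G : Fin n → Cf E) : (lcomb ξ fun j => F j + G j) = lcomb ξ F + lcomb ξ G := by
  refine Cf.ext' fun x v => ?_
  change lcomb ξ _ x v = lcomb ξ F x v + lcomb ξ G x v
  simp only [lcomb_apply, ← Finset.sum_add_distrib]
  exact Finset.sum_congr rfl fun j _ => smul_add _ _ _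

theorem lcomb_sub {E : Type*} [NormedAddCommGroup E] [InnerProductSpace ℂ E]
    [FiniteDimensional ℂ E] {n : ℕ} (ξ : Fin n → ℝ)
    (F G : Fin n → Cf E) : (lcomb ξ fun j => F j - G j) = lcomb ξ F - lcomb ξ G := by
  refine Cf.ext' fun x v => ?_
  change lcomb ξ _ x v = lcomb ξ F x v - lcomb ξ G x v
  simp only [lcomb_apply, ← Finset.sum_sub_distrib]
  exact Finset.sum_congr rfl fun j _ => smul_sub _ _ _

variable {P : System d m r} {Ubar : ℝ → State m r} {Um Up : State m r} {𝒰 Ω : Set (State m r)}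
variable {W : State m r → State m r} {S : State m r → Mat m r} {q : ℕ} {H : State m r → State m r}

/-- The convection matrices of the linearized equations. -/
def convA (P : System d m r) (H : State m r → State m r) (j : Fin (d + 1)) (U : State m r) :
    Mat m r := jac (P.F j) U - viscA P H j U

/-- Coefficient of the unknown in the normal flux. -/
def fluxCf (P : System d m r) (Ubar : ℝ → State m r) (H : State m r → State m r) (ξ : Fin d → ℝ) :
    Cf (CState m r) :=
  Complex.I • (lcomb ξ fun k => coef Ubar (P.B 0 k.succ)) - coef Ubar (convA P H 0)

/-- Tangential terms of the linearized operator. -/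
def tangOp (P : System d m r) (Ubar : ℝ → State m r) (H : State m r → State m r) (ξ : Fin d → ℝ)
    (U U' : L2 m r) : L2 m r :=
  mulOp (Complex.I • lcomb ξ fun j => coef Ubar (P.B j.succ 0)) U' -
  mulOp (Complex.I • (lcomb ξ fun j => coef Ubar (convA P H j.succ)) +
    lcomb ξ fun j => lcomb ξ fun k => coef Ubar (P.B j.succ k.succ)) U

namespace Setup

variable (h : Setup P Ubar Um Up 𝒰 Ω W S q H)
include h

theorem c_convA (j : Fin (d + 1)) : ContDiffOn ℝ 1 (convA P H j) Ω :=
  ((h.c_F j).of_le one_le_two).sub (h.c_viscA j)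

theorem coef_linB (j k : Fin (d + 1)) (x : ℝ) (v : CState m r) :
    coef Ubar (P.B j k) x v = act (P.linB Ubar j k x) v := by
  rw [h.orbit.coef_apply (h.c_B j k).continuousOn]; rfl

theorem coef_convA (j : Fin (d + 1)) (x : ℝ) (v : CState m r) :
    coef Ubar (convA P H j) x v = act (P.linA Ubar j x) v := by
  rw [h.orbit.coef_apply (h.c_convA j).continuousOn, linA, (h.orbit.deriv x).deriv]; rfl

theorem leq_iff {ξ : EuclideanSpace ℝ (Fin d)} {U G : L2 m r} :
    P.LEq Ubar ξ U G ↔ ∃ U', HD U U' ∧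
      HD (mulOp (coef Ubar (P.B 0 0)) U' + mulOp (fluxCf P Ubar H ξ) U)
        (G - tangOp P Ubar H ξ U U') := by
  refine exists_congr fun U' => and_congr (hasWeakDeriv_iff (ae_eq_refl _) (ae_eq_refl _))
    (hasWeakDeriv_iff ?_ ?_)
  · filter_upwards [Lp.coeFn_add (mulOp (coef Ubar (P.B 0 0)) U') (mulOp (fluxCf P Ubar H ξ) U),
      coeFn_mulOp (coef Ubar (P.B 0 0)) U', coeFn_mulOp (fluxCf P Ubar H ξ) U] with x h1 h2 h3
    rw [h1, Pi.add_apply, h2, h3, fluxCf, BoundedContinuousFunction.sub_apply, _root_.sub_apply,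
      BoundedContinuousFunction.smul_apply, _root_.smul_apply, lcomb_apply]
    simp only [h.coef_linB, h.coef_convA, Complex.coe_smul]
    abel
  · rw [tangOp]
    filter_upwards [Lp.coeFn_sub G (tangOp P Ubar H ξ U U'),
      Lp.coeFn_sub (mulOp (Complex.I • lcomb ξ fun j => coef Ubar (P.B j.succ 0)) U')
        (mulOp (Complex.I • (lcomb ξ fun j => coef Ubar (convA P H j.succ)) +
          lcomb ξ fun j => lcomb ξ fun k => coef Ubar (P.B j.succ k.succ)) U),
      coeFn_mulOp (Complex.I • lcomb ξ fun j => coef Ubar (P.B j.succ 0)) U',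
      coeFn_mulOp (Complex.I • (lcomb ξ fun j => coef Ubar (convA P H j.succ)) +
          lcomb ξ fun j => lcomb ξ fun k => coef Ubar (P.B j.succ k.succ)) U] with x h1 h2 h3 h4
    rw [tangOp] at h1
    rw [h1, Pi.sub_apply, h2, Pi.sub_apply, h3, h4, BoundedContinuousFunction.smul_apply,
      BoundedContinuousFunction.add_apply, BoundedContinuousFunction.smul_apply, _root_.add_apply,
      _root_.smul_apply, _root_.smul_apply, lcomb_apply, lcomb_apply, lcomb_apply]
    simp only [lcomb_apply, h.coef_linB, h.coef_convA, Complex.coe_smul, Finset.smul_sum, smul_smul,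
      neg_smul, Finset.sum_neg_distrib]
    simp only [← Finset.smul_sum]
    abel

theorem κ_BM (j k : Fin (d + 1)) :
    coef Ubar (BM P W j k) = coef Ubar (P.B j k) * coef Ubar (dUdW W) :=
  h.orbit.coef_mul (h.c_B j k).continuousOn h.c_M.continuousOn

theorem κ_tA0 : coef Ubar (tA0 W S) = coef Ubar S * coef Ubar (dUdW W) :=
  h.orbit.coef_mul h.c_S.continuousOn h.c_M.continuousOn

theorem κ_tB (j k : Fin (d + 1)) :
    coef Ubar (P.tB W S j k) = coef Ubar S * (coef Ubar (P.B j k) * coef Ubar (dUdW W)) := by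
  rw [← mul_assoc, ← h.orbit.coef_mul h.c_S.continuousOn (h.c_B j k).continuousOn]
  exact h.orbit.coef_mul (G := fun U => S U * P.B j k U)
    (h.c_S.continuousOn.mul (h.c_B j k).continuousOn) h.c_M.continuousOn

theorem κ_FM : coef Ubar (FM P W) = coef Ubar (jac (P.F 0)) * coef Ubar (dUdW W) :=
  h.orbit.coef_mul (h.c_F 0).continuousOn h.c_M.continuousOn

theorem κ_convA (j : Fin (d + 1)) :
    coef Ubar (convA P H j) = coef Ubar (jac (P.F j)) - coef Ubar (viscA P H j) :=
  h.orbit.coef_sub (h.c_F j).continuousOn (h.c_viscA j).continuousOn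

theorem κ_EM : coef Ubar (EM P W H) = coef Ubar (P.B 0 0) * coef Ubar (cder H (dUdW W)) +
    coef Ubar (viscA P H 0) * coef Ubar (dUdW W) := by
  rw [← h.orbit.coef_mul (h.c_B 0 0).continuousOn h.c_dM.continuousOn,
    ← h.orbit.coef_mul (h.c_viscA 0).continuousOn h.c_M.continuousOn]
  exact h.orbit.coef_add (G := fun U => P.B 0 0 U * cder H (dUdW W) U)
    (G' := fun U => viscA P H 0 U * dUdW W U)
    ((h.c_B 0 0).continuousOn.mul h.c_dM.continuousOn)
    ((h.c_viscA 0).continuousOn.mul h.c_M.continuousOn)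

theorem κ_normal : (linData P Ubar W S H).A 0 + (linData P Ubar W S H).del 0 =
    coef Ubar S * (coef Ubar (FM P W) - coef Ubar (EM P W H)) := by
  rw [linData_del_zero]
  change coef Ubar (symA P W S 0) + _ = _
  rw [← h.orbit.coef_add (h.c_symA 0).continuousOn h.c_del0]
  refine Cf.ext' fun x v => ?_
  change coef Ubar _ x v = coef Ubar S x (coef Ubar (FM P W) x v -
    coef Ubar (EM P W H) x v)
  rw [h.orbit.coef_apply ((h.c_symA 0).continuousOn.fun_add h.c_del0),
    h.orbit.coef_apply h.c_S.continuousOn, h.orbit.coef_apply h.c_FM.continuousOn,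
    h.orbit.coef_apply h.c_EM.continuousOn, ← _root_.sub_apply, ← map_sub, ← cx_mul_apply]
  congr 2
  rw [tA, FM]
  noncomm_ring

theorem κ_tang (j : Fin d) : (linData P Ubar W S H).A j.succ + (linData P Ubar W S H).del j.succ =
    coef Ubar S * (coef Ubar (convA P H j.succ) * coef Ubar (dUdW W)
      - coef Ubar (P.B j.succ 0) * coef Ubar (cder H (dUdW W))
      - coef Ubar (cder H (BM P W 0 j.succ))) := by
  rw [linData_del_succ]
  change coef Ubar (symA P W S j.succ) + _ = _
  rw [← h.orbit.coef_add (h.c_symA j.succ).continuousOn (h.c_del j)]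
  refine Cf.ext' fun x v => ?_
  change coef Ubar _ x v = coef Ubar S x (coef Ubar (convA P H j.succ) x
    (coef Ubar (dUdW W) x v) - coef Ubar (P.B j.succ 0) x (coef Ubar (cder H (dUdW W)) x v) -
    coef Ubar (cder H (BM P W 0 j.succ)) x v)
  rw [h.orbit.coef_apply ((h.c_symA j.succ).continuousOn.fun_add (h.c_del j)),
    h.orbit.coef_apply h.c_S.continuousOn, h.orbit.coef_apply (h.c_convA _).continuousOn,
    h.orbit.coef_apply h.c_M.continuousOn, h.orbit.coef_apply (h.c_B _ _).continuousOn,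
    h.orbit.coef_apply h.c_dM.continuousOn, h.orbit.coef_apply (h.c_dBM _ _).continuousOn,
    ← cx_mul_apply, ← cx_mul_apply, ← _root_.sub_apply, ← map_sub, ← _root_.sub_apply,
    ← map_sub, ← cx_mul_apply]
  congr 2
  rw [tA, convA]
  noncomm_ring

theorem κ_zero : (linData P Ubar W S H).e + (linData P Ubar W S H).r0 =
    coef Ubar S * (coef Ubar (cder H (FM P W)) - coef Ubar (cder H (EM P W H))) := by
  rw [linData_e, linData_r0]
  refine Cf.ext' fun x v => ?_
  change coef Ubar _ x v + coef Ubar _ x v = coef Ubar S x (coef Ubar (cder H (FM P W)) x v -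
    coef Ubar (cder H (EM P W H)) x v)
  rw [h.orbit.coef_apply h.c_e.continuousOn, h.orbit.coef_apply h.c_r0,
    h.orbit.coef_apply h.c_S.continuousOn, h.orbit.coef_apply h.c_dFM.continuousOn,
    h.orbit.coef_apply (h.orbit.continuousOn_cder h.c_EM), ← _root_.add_apply, ← map_add,
    ← _root_.sub_apply, ← map_sub, ← cx_mul_apply]
  congr 2
  rw [D0_eq]
  noncomm_ring

theorem κ_r : (linData P Ubar W S H).r 0 = -(coef Ubar S * coef Ubar (cder H (BM P W 0 0))) := by
  rw [linData_r_zero]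
  refine Cf.ext' fun x v => ?_
  change coef Ubar _ x v = -(coef Ubar S x (coef Ubar (cder H (BM P W 0 0)) x v))
  rw [h.orbit.coef_apply h.c_r, h.orbit.coef_apply h.c_S.continuousOn,
    h.orbit.coef_apply (h.c_dBM _ _).continuousOn, ← cx_mul_apply, map_neg]
  rfl

end Setup

end Transformation

section Transformation

variable {d m r : ℕ}

attribute [local instance] Matrix.linftyOpNormedRing Matrix.linftyOpNormedAlgebra

open ViscousShock.System

variable {P : System d m r} {Ubar : ℝ → State m r} {Um Up : State m r} {𝒰 Ω : Set (State m r)}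
variable {W : State m r → State m r} {S : State m r → Mat m r} {q : ℕ} {H : State m r → State m r}

theorem mulOp_smul_apply {E : Type*} [NormedAddCommGroup E] [InnerProductSpace ℂ E]
    [FiniteDimensional ℂ E] (c : ℂ) (a : Cf E) (f : LL E) : mulOp (c • a) f = c • mulOp a f := by
  rw [mulOp_smul]; rfl

namespace Setup

section

variable (h : Setup P Ubar Um Up 𝒰 Ω W S q H)
include h

theorem flux_eq (ξ : Fin d → ℝ) (w w1 : L2 m r) :
    mulOp (coef Ubar (P.B 0 0)) (mulOp (coef Ubar (cder H (dUdW W))) w +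
        mulOp (coef Ubar (dUdW W)) w1) +
      mulOp (fluxCf P Ubar H ξ) (mulOp (coef Ubar (dUdW W)) w) =
    mulOp (coef Ubar (BM P W 0 0)) w1 + (mulOp (coef Ubar (EM P W H)) w -
      mulOp (coef Ubar (FM P W)) w +
      Complex.I • mulOp (lcomb ξ fun k => coef Ubar (BM P W 0 k.succ)) w) := by
  have e : mulOp (lcomb ξ fun k => coef Ubar (BM P W 0 k.succ)) w =
      mulOp (lcomb ξ fun k => coef Ubar (P.B 0 k.succ)) (mulOp (coef Ubar (dUdW W)) w) := by
    rw [← mulOp_mul_apply, lcomb_mul]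
    simp only [h.κ_BM]
  rw [e, h.κ_EM, h.κ_FM, h.κ_BM, fluxCf, h.κ_convA]
  simp only [mulOp_add_apply, mulOp_sub_apply, mulOp_mul_apply, mulOp_smul_apply, map_add]
  abel

/-- The derivative of the normal flux in the symmetrizing variables. -/
theorem hD_flux (ξ : Fin d → ℝ) {w w1 v2 : L2 m r} (hw : HD w w1)
    (hv : HD (mulOp (cst (cx D1)) w1) v2) :
    HD (mulOp (coef Ubar (BM P W 0 0)) w1 + (mulOp (coef Ubar (EM P W H)) w -
      mulOp (coef Ubar (FM P W)) w +
      Complex.I • mulOp (lcomb ξ fun k => coef Ubar (BM P W 0 k.succ)) w))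
    ((mulOp (coef Ubar (cder H (BM P W 0 0))) w1 + mulOp (coef Ubar (BM P W 0 0)) v2) +
      ((mulOp (coef Ubar (cder H (EM P W H))) w + mulOp (coef Ubar (EM P W H)) w1) -
      (mulOp (coef Ubar (cder H (FM P W))) w + mulOp (coef Ubar (FM P W)) w1) +
      Complex.I • (mulOp (lcomb ξ fun k => coef Ubar (cder H (BM P W 0 k.succ))) w +
        mulOp (lcomb ξ fun k => coef Ubar (BM P W 0 k.succ)) w1))) := by
  have c1 : ∀ j k, CfDeriv (coef Ubar (BM P W j k)) (coef Ubar (cder H (BM P W j k))) := fun j k =>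
    h.orbit.cfDeriv_coef ((h.c_BM j k).of_le one_le_two)
  refine HD.add ?_ (((HD.mulOp (h.orbit.cfDeriv_coef h.c_EM) hw).sub
    (HD.mulOp (h.orbit.cfDeriv_coef (h.c_FM.of_le one_le_two)) hw)).add
    ((HD.mulOp (CfDeriv.lcomb ξ fun k => c1 0 k.succ) hw).smul _))
  have e1 : coef Ubar (BM P W 0 0) * cst (cx D1) = coef Ubar (BM P W 0 0) := by
    refine Cf.ext' fun x v => ?_
    rw [Cf.mul_apply', h.orbit.coef_apply (h.c_BM 0 0).continuousOn, cst_apply, ← cx_mul_apply]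
    have := h.BM_D0 0 0 (h.orbit.mem x)
    rw [D0_eq, mul_sub, mul_one, sub_eq_zero] at this
    rw [← this]
  have e2 : coef Ubar (cder H (BM P W 0 0)) * cst (cx D1) = coef Ubar (cder H (BM P W 0 0)) := by
    refine Cf.ext' fun x v => ?_
    rw [Cf.mul_apply', h.orbit.coef_apply (h.c_dBM 0 0).continuousOn, cst_apply, ← cx_mul_apply,
      h.cder_BM_D1 0 0 (h.orbit.mem x)]
  have e3 := HD.mulOp (c1 0 0) hv
  rwa [← mulOp_mul_apply, ← mulOp_mul_apply, e1, e2] at e3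

theorem symmetrize (lam : ℂ) (ξ : Fin d → ℝ) (w w1 v2 f : L2 m r) :
    (linData P Ubar W S H).Eq lam ξ w w1 v2 (mulOp (coef Ubar S) f) ↔
    mulOp (coef Ubar S) (lam • mulOp (coef Ubar (dUdW W)) w - f -
      tangOp P Ubar H ξ (mulOp (coef Ubar (dUdW W)) w)
        (mulOp (coef Ubar (cder H (dUdW W))) w + mulOp (coef Ubar (dUdW W)) w1)) =
    mulOp (coef Ubar S)
     ((mulOp (coef Ubar (cder H (BM P W 0 0))) w1 + mulOp (coef Ubar (BM P W 0 0)) v2) +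
      ((mulOp (coef Ubar (cder H (EM P W H))) w + mulOp (coef Ubar (EM P W H)) w1) -
      (mulOp (coef Ubar (cder H (FM P W))) w + mulOp (coef Ubar (FM P W)) w1) +
      Complex.I • (mulOp (lcomb ξ fun k => coef Ubar (cder H (BM P W 0 k.succ))) w +
        mulOp (lcomb ξ fun k => coef Ubar (BM P W 0 k.succ)) w1))) := by
  obtain ⟨L, hL⟩ : ∃ L, L = linData P Ubar W S H := ⟨_, rfl⟩
  obtain ⟨σ, hσ⟩ : ∃ σ, σ = mulOp (coef Ubar S) := ⟨_, rfl⟩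
  have f1 : mulOp L.a0 w = σ (mulOp (coef Ubar (dUdW W)) w) := by
    rw [hσ, ← mulOp_mul_apply, ← h.κ_tA0, hL]; rfl
  have f2 : mulOp (L.A 0) w1 + mulOp (L.del 0) w1 =
      σ (mulOp (coef Ubar (FM P W)) w1) - σ (mulOp (coef Ubar (EM P W H)) w1) := by
    rw [hσ, ← map_sub, ← mulOp_sub_apply, ← mulOp_mul_apply, ← h.κ_normal, mulOp_add_apply, hL]
  have f3 : mulOp (lcomb ξ (tang L.A)) w + mulOp (lcomb ξ (tang L.del)) w =
      σ (mulOp (lcomb ξ fun j => coef Ubar (convA P H j.succ)) (mulOp (coef Ubar (dUdW W)) w)) -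
      σ (mulOp (lcomb ξ fun j => coef Ubar (P.B j.succ 0))
        (mulOp (coef Ubar (cder H (dUdW W))) w)) -
      σ (mulOp (lcomb ξ fun j => coef Ubar (cder H (BM P W 0 j.succ))) w) := by
    rw [hσ]
    simp only [← mulOp_mul_apply]
    rw [← mulOp_sub_apply, ← mulOp_sub_apply, ← mulOp_add_apply, lcomb_mul, lcomb_mul, mul_lcomb,
      mul_lcomb, mul_lcomb, ← lcomb_sub, ← lcomb_sub, ← lcomb_add]
    congr 3
    funext j
    rw [← mul_sub, ← mul_sub, ← h.κ_tang, hL]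
    rfl
  have f4 : mulOp L.e w + mulOp L.r0 w = σ (mulOp (coef Ubar (cder H (FM P W))) w) -
      σ (mulOp (coef Ubar (cder H (EM P W H))) w) := by
    rw [hσ, ← map_sub, ← mulOp_sub_apply, ← mulOp_mul_apply, ← h.κ_zero, mulOp_add_apply, hL]
  have f5 : L.rem ξ w w1 = -σ (mulOp (coef Ubar (cder H (BM P W 0 0))) w1) + mulOp L.r0 w := by
    rw [LinData.rem, Fin.sum_univ_succ, Finset.sum_eq_zero fun j _ => ?_, add_zero]
    · congr 1
      rw [hL, h.κ_r, mulOp_neg, hσ, ← mulOp_mul_apply]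
      rfl
    · rw [hL, linData_r_succ]
      exact DFunLike.congr_fun (map_zero mulHom) _
  have f6 : mulOp (L.B 0 0) v2 = σ (mulOp (coef Ubar (BM P W 0 0)) v2) := by
    rw [hσ, ← mulOp_mul_apply, h.κ_BM, ← h.κ_tB, hL]; rfl
  have f7 : mulOp (lcomb ξ fun k => L.B 0 k.succ) w1 =
      σ (mulOp (lcomb ξ fun k => coef Ubar (BM P W 0 k.succ)) w1) := by
    rw [hσ, ← mulOp_mul_apply, mul_lcomb]
    simp only [h.κ_BM, ← h.κ_tB, hL]; rfl
  have f8 : mulOp (lcomb ξ fun j => L.B j.succ 0) w1 =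
      σ (mulOp (lcomb ξ fun j => coef Ubar (P.B j.succ 0)) (mulOp (coef Ubar (dUdW W)) w1)) := by
    rw [hσ, ← mulOp_mul_apply, ← mulOp_mul_apply, mul_assoc, lcomb_mul, mul_lcomb]
    simp only [← h.κ_tB, hL]; rfl
  have f9 : mulOp (lcomb ξ fun j => lcomb ξ fun k => L.B j.succ k.succ) w =
      σ (mulOp (lcomb ξ fun j => lcomb ξ fun k => coef Ubar (P.B j.succ k.succ))
        (mulOp (coef Ubar (dUdW W)) w)) := by
    rw [hσ, ← mulOp_mul_apply, ← mulOp_mul_apply, mul_assoc, lcomb_mul, mul_lcomb]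
    simp only [lcomb_mul, mul_lcomb]
    simp only [← h.κ_tB, hL]; rfl
  rw [← hσ, ← hL]
  change lam • mulOp L.a0 w + mulOp (L.A 0) w1 + Complex.I • mulOp (lcomb ξ (tang L.A)) w +
    mulOp L.e w + ((-(mulOp (L.B 0 0) v2) - Complex.I • (mulOp (lcomb ξ fun k => L.B 0 k.succ) w1 +
      mulOp (lcomb ξ fun j => L.B j.succ 0) w1) +
      mulOp (lcomb ξ fun j => lcomb ξ fun k => L.B j.succ k.succ) w) + mulOp (L.del 0) w1 +
      Complex.I • mulOp (lcomb ξ (tang L.del)) w + L.rem ξ w w1) = σ f ↔ _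
  rw [← sub_eq_zero, ← sub_eq_zero (a := σ _)]
  refine Eq.congr_left ?_
  rw [tangOp]
  simp only [mulOp_add_apply, mulOp_smul_apply, map_add, map_sub, map_smul]
  rw [f1, f5, f6, f7, f8, f9]
  linear_combination (norm := module) f2 + Complex.I • f3 + f4

end

end Setup

end Transformation

section Transformation

variable {d m r : ℕ}

attribute [local instance] Matrix.linftyOpNormedRing Matrix.linftyOpNormedAlgebra

open ViscousShock.System

variable {P : System d m r} {Ubar : ℝ → State m r} {Um Up : State m r} {𝒰 Ω : Set (State m r)}
variable {W : State m r → State m r} {S : State m r → Mat m r} {q : ℕ} {H : State m r → State m r}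

namespace Setup

section

variable (h : Setup P Ubar Um Up 𝒰 Ω W S q H)
include h

theorem mulOp_M_jacW (f : L2 m r) :
    mulOp (coef Ubar (dUdW W)) (mulOp (coef Ubar (jac W)) f) = f := by
  rw [← mulOp_mul_apply, show coef Ubar (dUdW W) * coef Ubar (jac W) = 1 from
    Cf.ext' fun x v => ?_, mulOp_one]
  · rfl
  · rw [Cf.mul_apply', h.orbit.coef_apply h.c_M.continuousOn,
      h.orbit.coef_apply h.c_jacW.continuousOn, ← cx_mul_apply, h.hyp.M_mul (h.hyp.mem x), cx_one]
    rfl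

theorem mulOp_S_injective {f g : L2 m r}
    (e : mulOp (coef Ubar S) f = mulOp (coef Ubar S) g) : f = g := by
  have hc : ContinuousOn (fun U => (S U)⁻¹) Ω :=
    (contDiffOn_inv h.c_S fun U hU => h.hyp.symm.S_invertible U (h.sub hU)).continuousOn
  have h1 : ∀ f, mulOp (coef Ubar fun U => (S U)⁻¹) (mulOp (coef Ubar S) f) = f := fun f => by
    rw [← mulOp_mul_apply, show coef Ubar (fun U => (S U)⁻¹) * coef Ubar S = 1 from
      Cf.ext' fun x v => ?_, mulOp_one]
    · rfl
    · rw [Cf.mul_apply', h.orbit.coef_apply hc, h.orbit.coef_apply h.c_S.continuousOn,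
        ← cx_mul_apply, Matrix.nonsing_inv_mul _ (h.hyp.symm.S_invertible _ (h.hyp.mem x)), cx_one]
      rfl
  rw [← h1 f, e, h1]

theorem isUnit_par {U : State m r} (hU : U ∈ Ω) : IsUnit (P.tB W S 0 0 U + D0).det := by
  rw [isUnit_iff_ne_zero]
  intro hdet
  obtain ⟨v, hv0, hv⟩ := Matrix.exists_mulVec_eq_zero_iff.2 hdet
  have e1 : P.tB W S 0 0 U *ᵥ v = 0 := by
    have : D1 * (P.tB W S 0 0 U + D0) = P.tB W S 0 0 U := by
      rw [mul_add, h.hyp.D1_tB (h.sub hU), D1_mul_D0, add_zero]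
    rw [← this, ← Matrix.mulVec_mulVec, hv, Matrix.mulVec_zero]
  have e3 := h.hyp.D1_eq_zero (h.sub hU) e1
  rw [Matrix.add_mulVec, e1, zero_add, mulVec_D0_eq e3] at hv
  exact hv0 hv

theorem par_inv_mul {U : State m r} (hU : U ∈ Ω) :
    (P.tB W S 0 0 U + D0)⁻¹ * S U * BM P W 0 0 U = D1 := by
  have e : S U * BM P W 0 0 U = (P.tB W S 0 0 U + D0) * D1 := by
    rw [add_mul, D0_mul_D1, add_zero, h.hyp.tB_D1 (h.sub hU), BM, ← mul_assoc]
    rfl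
  rw [mul_assoc, e, ← mul_assoc, Matrix.nonsing_inv_mul _ (h.isUnit_par hU), one_mul]

/-- Regularity of the normal flux gives regularity of the parabolic part of the derivative. -/
theorem exists_hD_par {w1 g : L2 m r} (hg : HD (mulOp (coef Ubar (BM P W 0 0)) w1) g) :
    ∃ v2, HD (mulOp (cst (cx D1)) w1) v2 := by
  have hc : ContDiffOn ℝ 2 (fun U => (P.tB W S 0 0 U + D0)⁻¹ * S U) Ω :=
    (contDiffOn_inv ((h.c_tB 0 0).add contDiffOn_const) fun U hU => h.isUnit_par hU).mul h.c_S
  have e := HD.mulOp (h.orbit.cfDeriv_coef (hc.of_le one_le_two)) hg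
  rw [← mulOp_mul_apply, ← h.orbit.coef_mul hc.continuousOn (h.c_BM 0 0).continuousOn,
    show coef Ubar (fun U => (P.tB W S 0 0 U + D0)⁻¹ * S U * BM P W 0 0 U) = cst (cx D1) from
    Cf.ext' fun x v => ?_] at e
  · exact ⟨_, e⟩
  · rw [h.orbit.coef_apply (hc.continuousOn.fun_mul (h.c_BM 0 0).continuousOn),
      h.par_inv_mul (h.orbit.mem x)]
    rfl

theorem hD_M {w w1 : L2 m r} (hw : HD w w1) : HD (mulOp (coef Ubar (dUdW W)) w)
    (mulOp (coef Ubar (cder H (dUdW W))) w + mulOp (coef Ubar (dUdW W)) w1) :=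
  HD.mulOp (h.orbit.cfDeriv_coef (h.c_M.of_le one_le_two)) hw

/-- Solutions of the symmetrized equations solve the linearized equations. -/
theorem leq_of_eq {ξ : EuclideanSpace ℝ (Fin d)} {lam : ℂ} {w w1 v2 f : L2 m r} (hw : HD w w1)
    (hv : HD (mulOp (cst (cx D1)) w1) v2)
    (he : (linData P Ubar W S H).Eq lam ξ w w1 v2 (mulOp (coef Ubar S) f)) :
    P.LEq Ubar ξ (mulOp (coef Ubar (dUdW W)) w)
      (lam • mulOp (coef Ubar (dUdW W)) w - f) := by
  rw [h.leq_iff]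
  refine ⟨_, h.hD_M hw, ?_⟩
  rw [h.flux_eq, h.mulOp_S_injective ((h.symmetrize lam ξ w w1 v2 f).1 he)]
  exact h.hD_flux ξ hw hv

/-- Solutions of the linearized equations solve the symmetrized equations. -/
theorem eq_of_leq {ξ : EuclideanSpace ℝ (Fin d)} {lam : ℂ} {U U1 f : L2 m r} (hU : HD U U1)
    (he : P.LEq Ubar ξ U (lam • U - f)) :
    ∃ w w1 v2, U = mulOp (coef Ubar (dUdW W)) w ∧ HD w w1 ∧ HD (mulOp (cst (cx D1)) w1) v2 ∧
      (linData P Ubar W S H).Eq lam ξ w w1 v2 (mulOp (coef Ubar S) f) := by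
  obtain ⟨w, hw⟩ : ∃ w, w = mulOp (coef Ubar (jac W)) U := ⟨_, rfl⟩
  obtain ⟨w1, hw1⟩ : ∃ w1, HD w w1 :=
    ⟨_, hw ▸ HD.mulOp (h.orbit.cfDeriv_coef (h.c_jacW.of_le one_le_two)) hU⟩
  obtain rfl : U = mulOp (coef Ubar (dUdW W)) w := by rw [hw, h.mulOp_M_jacW]
  obtain ⟨U', hU', hΦ⟩ := h.leq_iff.1 he
  obtain rfl := hU'.unique (h.hD_M hw1)
  rw [h.flux_eq] at hΦ
  have c1 : ∀ j k, CfDeriv (coef Ubar (BM P W j k)) (coef Ubar (cder H (BM P W j k))) := fun j k =>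
    h.orbit.cfDeriv_coef ((h.c_BM j k).of_le one_le_two)
  have h2 := hΦ.sub (((HD.mulOp (h.orbit.cfDeriv_coef h.c_EM) hw1).sub
    (HD.mulOp (h.orbit.cfDeriv_coef (h.c_FM.of_le one_le_two)) hw1)).add
    ((HD.mulOp (CfDeriv.lcomb ξ fun k => c1 0 k.succ) hw1).smul Complex.I))
  rw [add_sub_cancel_right] at h2
  obtain ⟨v2, hv2⟩ := h.exists_hD_par h2
  refine ⟨w, w1, v2, rfl, hw1, hv2, (h.symmetrize lam ξ w w1 v2 f).2 ?_⟩
  rw [hΦ.unique (h.hD_flux ξ hw1 hv2)]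

end

end Setup

end Transformation

section Conclusion

variable {d m r : ℕ}

attribute [local instance] Matrix.linftyOpNormedRing Matrix.linftyOpNormedAlgebra

open ViscousShock.System

theorem ofReal_norm_fourier (f : L2 m r) :
    eLpNorm (𝓕 f : L2 m r) 2 volume = ENNReal.ofReal ‖f‖ := by
  rw [← (Lp.fourierTransformₗᵢ ℝ (CState m r)).norm_map f, Lp.norm_def, ENNReal.ofReal_toReal]
  · rfl
  · exact (Lp.eLpNorm_lt_top _).ne

theorem ofReal_norm_le_hatNorm (ξ : EuclideanSpace ℝ (Fin d)) {f f' : L2 m r} (h : HD f f') :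
    ENNReal.ofReal ‖f'‖ ≤ hatNorm ξ f := by
  rw [← ofReal_norm_fourier, hatNorm]
  refine eLpNorm_mono_ae ?_
  filter_upwards [hD_iff_fourier.1 h] with η hη
  rw [hη, norm_smul, norm_smul, Real.norm_of_nonneg (by positivity)]
  have : ‖(2 * (Real.pi : ℂ) * η * Complex.I)‖ = 2 * Real.pi * |η| := by
    simp [abs_of_pos Real.pi_pos]
  rw [this]
  gcongr
  linarith [norm_nonneg ξ]

theorem ofReal_mul_norm_le_hatNorm (ξ : EuclideanSpace ℝ (Fin d)) (f : L2 m r) :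
    ENNReal.ofReal ((1 + ‖ξ‖) * ‖f‖) ≤ hatNorm ξ f := by
  have h1 : ‖(1 + ‖ξ‖ : ℝ)‖ₑ = ENNReal.ofReal (1 + ‖ξ‖) := by
    rw [← ofReal_norm, Real.norm_of_nonneg (by positivity)]
  rw [ENNReal.ofReal_mul (by positivity), ← ofReal_norm_fourier, hatNorm, ← h1,
    ← eLpNorm_const_smul]
  refine eLpNorm_mono_ae (Eventually.of_forall fun η => ?_)
  rw [Pi.smul_apply, norm_smul, norm_smul, Real.norm_of_nonneg (by positivity),
    Real.norm_of_nonneg (by positivity)]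
  gcongr
  have : 0 ≤ 2 * Real.pi * |η| := by positivity
  linarith

theorem hatNorm_le (ξ : EuclideanSpace ℝ (Fin d)) {f f' : L2 m r} (h : HD f f') :
    hatNorm ξ f ≤ ENNReal.ofReal (‖f'‖ + (1 + ‖ξ‖) * ‖f‖) := by
  have h1 : ‖(1 + ‖ξ‖ : ℝ)‖ₑ = ENNReal.ofReal (1 + ‖ξ‖) := by
    rw [← ofReal_norm, Real.norm_of_nonneg (by positivity)]
  rw [ENNReal.ofReal_add (norm_nonneg _) (by positivity), ENNReal.ofReal_mul (by positivity),
    ← ofReal_norm_fourier, ← ofReal_norm_fourier, hatNorm, ← h1, ← eLpNorm_const_smul,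
    ← eLpNorm_norm (𝓕 f' : L2 m r), ← eLpNorm_norm ((1 + ‖ξ‖) • ((𝓕 f : L2 m r) : ℝ → CState m r))]
  refine le_trans (eLpNorm_mono_ae_real ?_) (eLpNorm_add_le (Lp.aestronglyMeasurable _).norm
    ((Lp.aestronglyMeasurable _).const_smul _).norm one_le_two)
  filter_upwards [hD_iff_fourier.1 h] with η hη
  have e : ‖(2 * (Real.pi : ℂ) * η * Complex.I)‖ = 2 * Real.pi * |η| := by
    simp [abs_of_pos Real.pi_pos]
  rw [Pi.add_apply, hη, Pi.smul_apply, norm_smul, norm_smul, norm_smul, e,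
    Real.norm_of_nonneg (by positivity), Real.norm_of_nonneg (by positivity)]
  apply le_of_eq
  ring

theorem exists_hD_of_hatNorm_lt_top {ξ : EuclideanSpace ℝ (Fin d)} {f : L2 m r}
    (h : hatNorm ξ f < ⊤) : ∃ f', HD f f' := by
  have hc : Continuous fun η : ℝ => 2 * (Real.pi : ℂ) * η * Complex.I := by fun_prop
  have hm : AEStronglyMeasurable (fun η : ℝ => (2 * (Real.pi : ℂ) * η * Complex.I) •
      (𝓕 f : L2 m r) η) volume :=
    hc.aestronglyMeasurable.smul (Lp.aestronglyMeasurable _)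
  have hL : MemLp (fun η : ℝ => (2 * (Real.pi : ℂ) * η * Complex.I) • (𝓕 f : L2 m r) η) 2 volume := by
    refine ⟨hm, lt_of_le_of_lt (eLpNorm_mono_ae (Eventually.of_forall fun η => ?_)) h⟩
    have e : ‖(2 * (Real.pi : ℂ) * η * Complex.I)‖ = 2 * Real.pi * |η| := by
      simp [abs_of_pos Real.pi_pos]
    rw [norm_smul, norm_smul, e, Real.norm_of_nonneg (by positivity)]
    gcongr
    linarith [norm_nonneg ξ]
  refine ⟨(Lp.fourierTransformₗᵢ ℝ (CState m r)).symm (hL.toLp _), hD_iff_fourier.2 ?_⟩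
  have : (𝓕 ((Lp.fourierTransformₗᵢ ℝ (CState m r)).symm (hL.toLp _)) : L2 m r) = hL.toLp _ :=
    (Lp.fourierTransformₗᵢ ℝ (CState m r)).apply_symm_apply _
  rw [this]
  exact hL.coeFn_toLp

theorem exists_norm_mulOp_weighted_le {E : Type*} [NormedAddCommGroup E] [InnerProductSpace ℂ E]
    [CompleteSpace E] (a a' : Cf E) : ∃ K, 0 ≤ K ∧ ∀ (k : ℝ) (f f' : LL E), 0 ≤ k →
      ‖mulOp a' f + mulOp a f'‖ + (1 + k) * ‖mulOp a f‖ ≤ K * (‖f'‖ + (1 + k) * ‖f‖) := by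
  refine ⟨‖a‖ + ‖a'‖, by positivity, fun k f f' hk => ?_⟩
  have h1 := norm_add_le (mulOp a' f) (mulOp a f')
  have h2 := norm_mulOp_le a' f
  have h3 := norm_mulOp_le a f'
  have h4 : (1 + k) * ‖mulOp a f‖ ≤ (1 + k) * (‖a‖ * ‖f‖) := by gcongr; exact norm_mulOp_le a f
  have h5 : 0 ≤ ‖a'‖ * ‖f'‖ := by positivity
  have h6 : 0 ≤ k * (‖a'‖ * ‖f‖) := by positivity
  linarith only [h1, h2, h3, h4, h5, h6]

variable {P : System d m r} {Ubar : ℝ → State m r} {Um Up : State m r} {𝒰 : Set (State m r)}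
variable {W : State m r → State m r} {S : State m r → Mat m r} {q : ℕ}

theorem LinData.Eq.sub {E : Type*} [NormedAddCommGroup E] [InnerProductSpace ℂ E]
    [FiniteDimensional ℂ E] {L : LinData E d} {lam : ℂ} {ξ : Fin d → ℝ}
    {w w1 w2 u u1 u2 g g' : LL E} (h : L.Eq lam ξ w w1 w2 g) (h' : L.Eq lam ξ u u1 u2 g') :
    L.Eq lam ξ (w - u) (w1 - u1) (w2 - u2) (g - g') := by
  rw [LinData.eq_iff] at *
  rw [← h, ← h', ← map_sub]
  rfl

theorem Setup.symm_resolvent {Ω : Set (State m r)} {H : State m r → State m r}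
    (h : Setup P Ubar Um Up 𝒰 Ω W S q H) :
    ∃ L, L = linData P Ubar W S H ∧ (∀ x v, L.B 0 0 x (cx D1 v) = L.B 0 0 x v) ∧
    ∃ R C θ : ℝ, 0 < R ∧ 0 < C ∧ 0 < θ ∧ ∀ (ξ : EuclideanSpace ℝ (Fin d)) (lam : ℂ),
      R ≤ max ‖ξ‖ ‖lam‖ → -θ ≤ lam.re →
      (∀ g g1 : L2 m r, HD g g1 → ∃ w w1 w2, HD w w1 ∧ HD w1 w2 ∧ L.Eq lam ξ w w1 w2 g) ∧
      ∀ w w1 v2 g g1 : L2 m r, HD w w1 → HD (mulOp (cst (cx D1)) w1) v2 → HD g g1 →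
        L.Eq lam ξ w w1 v2 g → ‖w1‖ + (1 + ‖ξ‖) * ‖w‖ ≤ C * (‖g1‖ + (1 + ‖ξ‖) * ‖g‖) := by
  obtain ⟨s, hg⟩ := h.good
  have hp := h.atEnd h.orbit.mem_p h.orbit.lim_p h.orbit.zero_p h.hyp.stable_p
  have hm := h.atEnd h.orbit.mem_m h.orbit.lim_m h.orbit.zero_m h.hyp.stable_m
  exact ⟨_, rfl, fun x v => hg.B_pr 0 0 x v, hg.resolvent hp hm⟩

theorem LinData.Eq.congr_second {E : Type*} [NormedAddCommGroup E] [InnerProductSpace ℂ E]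
    [FiniteDimensional ℂ E] {L : LinData E d} {lam : ℂ} {ξ : Fin d → ℝ}
    {w w1 w2 g : LL E} (h : L.Eq lam ξ w w1 w2 g) {T : E →L[ℂ] E}
    (hT : ∀ x v, L.B 0 0 x (T v) = L.B 0 0 x v) : L.Eq lam ξ w w1 (mulOp (cst T) w2) g := by
  have e1 : mulOp (L.B 0 0) (mulOp (cst T) w2) = mulOp (L.B 0 0) w2 := by
    rw [← mulOp_mul_apply]
    congr 2
    exact Cf.ext' hT
  rw [LinData.Eq, Coefs.Eqn, Coefs.par] at *
  rw [show (L.coefs ξ 0).b = mulOp (L.B 0 0) from rfl] at *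
  rw [e1]
  exact h

/-- Uniform resolvent bounds at high frequencies. -/
theorem ShockHyp.resolventBound (hyp : ShockHyp P Ubar Um Up 𝒰 W S q) :
    ∃ R C θ : ℝ, 0 < R ∧ 0 < C ∧ 0 < θ ∧
      ∀ (ξ : EuclideanSpace ℝ (Fin d)) (lam : ℂ),
        R ≤ Real.sqrt (‖ξ‖ ^ 2 + ‖lam‖ ^ 2) → -θ ≤ lam.re →
          P.ResolventBound Ubar ξ lam C := by
  obtain ⟨Ω, H, h⟩ := hyp.exists_setup
  obtain ⟨L, hL, hBpr, R, C, θ, hR, hC, hθ, hres⟩ := h.symm_resolvent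
  obtain ⟨a, ha0, ha⟩ := exists_norm_mulOp_weighted_le (coef Ubar (dUdW W))
    (coef Ubar (cder H (dUdW W)))
  obtain ⟨b, hb0, hb⟩ := exists_norm_mulOp_weighted_le (coef Ubar S) (coef Ubar (cder H S))
  refine ⟨2 * R, 2 * (a + 1) * (C * (b + 1)), θ, by positivity, by positivity, hθ,
    fun ξ lam hbig hre f hf => ?_⟩
  have hmax : R ≤ max ‖ξ‖ ‖lam‖ := by
    have h1 : Real.sqrt (‖ξ‖ ^ 2 + ‖lam‖ ^ 2) ≤ 2 * max ‖ξ‖ ‖lam‖ := by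
      rw [Real.sqrt_le_left (by positivity)]
      have e1 : ‖ξ‖ ^ 2 ≤ max ‖ξ‖ ‖lam‖ ^ 2 := by gcongr; exact le_max_left _ _
      have e2 : ‖lam‖ ^ 2 ≤ max ‖ξ‖ ‖lam‖ ^ 2 := by gcongr; exact le_max_right _ _
      linarith only [e1, e2, sq_nonneg (max ‖ξ‖ ‖lam‖), mul_pow 2 (max ‖ξ‖ ‖lam‖) 2]
    linarith only [h1, hbig]
  obtain ⟨hex, hest⟩ := hres ξ lam hmax hre
  obtain ⟨f1, hf1⟩ := exists_hD_of_hatNorm_lt_top hf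
  have hSf := HD.mulOp (h.orbit.cfDeriv_coef (h.c_S.of_le one_le_two)) hf1
  obtain ⟨w, w1, w2, hw, hw1, he⟩ := hex _ _ hSf
  have hv := hw1.cst (cx D1)
  have he' := he.congr_second hBpr
  have hU := h.hD_M hw
  refine ⟨_, (hatNorm_le ξ hU).trans_lt ENNReal.ofReal_lt_top, h.leq_of_eq hw hv (hL ▸ he'), ?_,
    fun V hV hVe => ?_⟩
  · have b1 := ha ‖ξ‖ w w1 (norm_nonneg ξ)
    have b2 := hest _ _ _ _ _ hw hv hSf he'
    have b3 := hb ‖ξ‖ f f1 (norm_nonneg ξ)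
    have b4 : ‖mulOp (coef Ubar (cder H (dUdW W))) w + mulOp (coef Ubar (dUdW W)) w1‖ +
        (1 + ‖ξ‖) * ‖mulOp (coef Ubar (dUdW W)) w‖ ≤
        (a + 1) * (C * (b + 1)) * (‖f1‖ + (1 + ‖ξ‖) * ‖f‖) :=
      calc _ ≤ a * (‖w1‖ + (1 + ‖ξ‖) * ‖w‖) := b1
        _ ≤ (a + 1) * (C * ((b + 1) * (‖f1‖ + (1 + ‖ξ‖) * ‖f‖))) := by
          refine mul_le_mul (by linarith) (b2.trans ?_) (by positivity) (by positivity)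
          gcongr
          refine b3.trans ?_
          gcongr
          linarith
        _ = _ := by ring
    refine (hatNorm_le ξ hU).trans ((ENNReal.ofReal_le_ofReal b4).trans ?_)
    rw [ENNReal.ofReal_mul (by positivity), ENNReal.ofReal_add (norm_nonneg _) (by positivity),
      mul_assoc 2, mul_comm 2, ENNReal.ofReal_mul (q := 2) (by positivity), mul_assoc]
    gcongr
    rw [ENNReal.ofReal_ofNat, two_mul]
    exact add_le_add (ofReal_norm_le_hatNorm ξ hf1) (ofReal_mul_norm_le_hatNorm ξ f)
  · obtain ⟨V1, hV1⟩ := exists_hD_of_hatNorm_lt_top hV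
    obtain ⟨u, u1, v2, rfl, hu, hu1, hue⟩ := h.eq_of_leq hV1 hVe
    rw [← hL] at hue
    have hd := hue.sub he'
    rw [sub_self] at hd
    have hz : HD (0 : L2 m r) 0 := by simpa using hf1.sub hf1
    have hdv := hu1.sub hv
    rw [← map_sub] at hdv
    have := hest _ _ _ _ _ (hu.sub hw) hdv hz hd
    rw [norm_zero, mul_zero, add_zero, mul_zero] at this
    have h0 : ‖u - w‖ ≤ 0 := by
      have e1 := norm_nonneg (u1 - w1)
      have e2 : 0 ≤ ‖ξ‖ * ‖u - w‖ := by positivity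
      linarith only [e1, e2, this]
    rw [sub_eq_zero.1 (norm_le_zero_iff.1 h0)]

end Conclusion

end ViscousShock

end

theorem mainTheorem7 {d m r : ℕ} (P : ViscousShock.System d m r)
    (Ubar : ℝ → ViscousShock.State m r) (Um Up : ViscousShock.State m r)
    (𝒰 : Set (ViscousShock.State m r)) (h𝒰 : IsOpen 𝒰)
    (hUbar : ∀ x, Ubar x ∈ 𝒰) (hUm : Um ∈ 𝒰) (hUp : Up ∈ 𝒰)
    (W : ViscousShock.State m r → ViscousShock.State m r)
    (S : ViscousShock.State m r → ViscousShock.Mat m r) (q : ℕ)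
    (hstruct : P.HasViscousStructure 𝒰)
    (hprofile : P.IsProfile Ubar Um Up)
    (hA1 : P.IsSymmHypParab 𝒰 W S)
    (hA2m : P.IsStableEndState W S Um) (hA2p : P.IsStableEndState W S Up)
    (hH0 : P.IsRegular 𝒰 W S q)
    (hH1 : P.IsUniformlyDefinite W S Ubar) :
    ∃ R C θ : ℝ, 0 < R ∧ 0 < C ∧ 0 < θ ∧
      ∀ (ξ : EuclideanSpace ℝ (Fin d)) (lam : ℂ),
        R ≤ Real.sqrt (‖ξ‖ ^ 2 + ‖lam‖ ^ 2) → -θ ≤ lam.re →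
          P.ResolventBound Ubar ξ lam C := by
  exact ViscousShock.ShockHyp.resolventBound
    ⟨h𝒰, hUbar, hUm, hUp, hstruct, hprofile, hA1, hA2m, hA2p, hH0, hH1⟩
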